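/- Let $\Omega\subset\{(r,z):r>0\}$ be a nonempty open set with $\Omega=\operatorname{int}\overline\Omega$ such that the set obtained by rotating $\overline\Omega$ about the $z$-axis is convex in $\mathbb R^3$, and let $k$ be an integer with $|k|\ge 1$. For $\alpha\in\{1,-1\}$ let $\|u\|_{L^2_{r^\alpha}(\Omega)}^2=\int_\Omega u^2 r^{\alpha}\,dr\,dz$. Let $H^1_r(\Omega)$ be the space of $u\in L^2_r(\Omega)$ with weak derivatives $\partial_ru,\partial_zu\in L^2_r(\Omega)$, put $|u|_{H^1_r}^2=\|\partial_ru\|_{L^2_r}^2+\|\partial_zu\|_{L^2_r}^2$, and on $\tilde H^1_r(\Omega)=H^1_r(\Omega)\cap L^2_{1/r}(\Omega)$ put $\|u\|_{\tilde H^1_r}^2=\|u\|_{L^2_r}^2+|u|_{H^1_r}^2+\|u\|_{L^2_{1/r}}^2$. For $\boldsymbol u=(u_r,u_\theta,u_z)$ let, in the sense of distributions, $$\mathbf{grad}^k u=\begin{pmatrix}\partial_r u\\-\tfrac kr u\\ \partial_z u\end{pmatrix},\quad \mathbf{curl}^k\boldsymbol u=\begin{pmatrix}-(\tfrac kr u_z+\partial_zu_\theta)\\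 \partial_zu_r-\partial_ru_z\\ \tfrac{ku_r+u_\theta}{r}+\partial_ru_\theta\end{pmatrix},\quad \mathrm{div}^k\boldsymbol u=\partial_ru_r+\tfrac{u_r-ku_\theta}{r}+\partial_zu_z .$$ For a finite conforming triangulation $\mathscr T_h$ of $\Omega$ with meshsize $h$ (the largest diameter $h_K$ of a triangle $K$), let $A_h,\boldsymbol B_h,\boldsymbol C_h,D_h$ be the spaces of $u\in L^2_r(\Omega)$ (respectively $\boldsymbol u\in L^2_r(\Omega)^3$) with $\mathbf{grad}^ku\in L^2_r$, $\mathbf{curl}^k\boldsymbol u\in L^2_r$, $\mathrm{div}^k\boldsymbol u\in L^2_r$, and no further condition, respectively, whose restriction to every $K\in\mathscr T_h$ has the form $$\alpha_1r+\alpha_2r^2+\alpha_3rz,\qquad \begin{pmatrix}\beta_1+\beta_4r+\beta_3z-\beta_6rz\\-k\beta_1+\beta_2r-k\beta_3z\\ \beta_5r+\beta_6r^2\end{pmatrix},\qquad \begin{pmatrix}k\gamma_1+\gamma_2r\\ \gamma_1+\gamma_3r\\ \gamma_4+\gamma_2z\end{pmatrix},\qquad \text{constant},$$ respectively. An $M$-bounded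 commuting projection for $\mathscr T_h$ is a quadruple $(\Pi_h^{g,k},\Pi_h^{c,k},\Pi_h^{d,k},\Pi_h^{o,k})$ of linear projections from $L^2_r(\Omega)$, $L^2_r(\Omega)^3$, $L^2_r(\Omega)^3$, $L^2_r(\Omega)$ onto $A_h,\boldsymbol B_h,\boldsymbol C_h,D_h$, all of $L^2_r$-operator norm at most $M$, such that $\mathbf{grad}^k\Pi_h^{g,k}=\Pi_h^{c,k}\mathbf{grad}^k$, $\mathbf{curl}^k\Pi_h^{c,k}=\Pi_h^{d,k}\mathbf{curl}^k$ and $\mathrm{div}^k\Pi_h^{d,k}=\Pi_h^{o,k}\mathrm{div}^k$ wherever the differential operator on the right has values in $L^2_r$. Fix $\sigma$ and consider the triangulations with $h_K^2\le\sigma|K|$ for every triangle $K$. Then: (i) there is a constant $M$, depending only on $\Omega,k,\sigma$, such that every such triangulation has an $M$-bounded commuting projection; (ii) for every $M$ there is a constant $C$, depending only on $\Omega,k,\sigma,M$, such that for every such triangulation, every $M$-bounded commuting projection for it, and every $\boldsymbol v=(v_r,v_\theta,v_z)\in H^1_r(\Omega)^3$ with $kv_z,\ kv_r+v_\theta\in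 L^2_{1/r}(\Omega)$, $$\|\boldsymbol v-\Pi_h^{c,k}\boldsymbol v\|_{L^2_r(\Omega)}\le C\,h\,\bigl(|v_\theta|_{H^1_r(\Omega)}+\|kv_z\|_{\tilde H^1_r(\Omega)}+\|kv_r+v_\theta\|_{\tilde H^1_r(\Omega)}\bigr).$$ -/

import Mathlib

open MeasureTheory
open scoped ContDiff

noncomputable section

namespace AxiFEM

/-! Points of the meridian half-plane are pairs `p = (r, z)`, so `p.1 = r` and `p.2 = z`.
Vector fields take values in `EuclideanSpace ℝ (Fin 3)`, with components
`0 = r`, `1 = θ`, `2 = z`. -/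

/-- Values of vector fields, in the order `(r, θ, z)`. -/
abbrev Vec : Type := EuclideanSpace ℝ (Fin 3)

/-! ### The meridian domain -/

/-- The subset of `ℝ³` obtained by rotating `S` around the `z`-axis. -/
def rotate (S : Set (ℝ × ℝ)) : Set (ℝ × ℝ × ℝ) :=
  {x | (Real.sqrt (x.1 ^ 2 + x.2.1 ^ 2), x.2.2) ∈ S}

/-- `Ω` is the (open) meridian section of a convex axisymmetric domain. Since `Ω` itself does not
contain the points of the axis, convexity is asked of the closed rotated set. The condition
`interior (closure Ω) = Ω` says that `Ω` is open and has no slits or punctures. -/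
structure IsMeridianDomain (Ω : Set (ℝ × ℝ)) : Prop where
  nonempty : Ω.Nonempty
  pos : ∀ p ∈ Ω, 0 < p.1
  regular : interior (closure Ω) = Ω
  convex : Convex ℝ (rotate (closure Ω))

/-! ### Weighted Lebesgue spaces and weak derivatives -/

/-- The measure `r ^ α dr dz` on `Ω`. -/
def wMeasure (Ω : Set (ℝ × ℝ)) (α : ℤ) : Measure (ℝ × ℝ) :=
  (volume.restrict Ω).withDensity fun p => ENNReal.ofReal (p.1 ^ α)

/-- The scalar space `L²_r(Ω)`. -/
abbrev L2r (Ω : Set (ℝ × ℝ)) : Type := Lp ℝ 2 (wMeasure Ω 1)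

/-- The space of vector fields with components in `L²_r(Ω)`. -/
abbrev L2rVec (Ω : Set (ℝ × ℝ)) : Type := Lp Vec 2 (wMeasure Ω 1)

/-- The norm `(∫_Ω f² r ^ α dr dz) ^ (1/2)`, for `f` in the weighted space. -/
def wNorm (Ω : Set (ℝ × ℝ)) (α : ℤ) (f : ℝ × ℝ → ℝ) : ℝ :=
  Real.sqrt (∫ p in Ω, f p ^ 2 * p.1 ^ α)

/-- Smooth functions with compact support in `Ω`. -/
def IsTest (Ω : Set (ℝ × ℝ)) (φ : ℝ × ℝ → ℝ) : Prop :=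
  ContDiff ℝ ∞ φ ∧ HasCompactSupport φ ∧ tsupport φ ⊆ Ω

/-- The classical derivative in `r`. -/
def dr (φ : ℝ × ℝ → ℝ) (p : ℝ × ℝ) : ℝ := fderiv ℝ φ p (1, 0)

/-- The classical derivative in `z`. -/
def dz (φ : ℝ × ℝ → ℝ) (p : ℝ × ℝ) : ℝ := fderiv ℝ φ p (0, 1)

/-- `g` is the weak derivative of `f` on `Ω` in the direction `e`. -/
def IsWeakDeriv (Ω : Set (ℝ × ℝ)) (e : ℝ × ℝ) (f g : ℝ × ℝ → ℝ) : Prop :=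
  LocallyIntegrableOn f Ω ∧ LocallyIntegrableOn g Ω ∧
    ∀ φ, IsTest Ω φ → ∫ p in Ω, g p * φ p = -∫ p in Ω, f p * fderiv ℝ φ p e

open Classical in
/-- The weak derivative of `f` in the direction `e` (unique almost everywhere), if there is one. -/
def weakDeriv (Ω : Set (ℝ × ℝ)) (e : ℝ × ℝ) (f : ℝ × ℝ → ℝ) : ℝ × ℝ → ℝ :=
  if h : ∃ g, IsWeakDeriv Ω e f g then h.choose else 0

/-- Membership in `H¹_r(Ω)`. -/
def MemH1 (Ω : Set (ℝ × ℝ)) (f : ℝ × ℝ → ℝ) : Prop :=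
  MemLp f 2 (wMeasure Ω 1) ∧
    (∃ g, IsWeakDeriv Ω (1, 0) f g ∧ MemLp g 2 (wMeasure Ω 1)) ∧
    ∃ g, IsWeakDeriv Ω (0, 1) f g ∧ MemLp g 2 (wMeasure Ω 1)

/-- The seminorm `|f|_{H¹_r(Ω)}`, for `f` in `H¹_r(Ω)`. -/
def h1Seminorm (Ω : Set (ℝ × ℝ)) (f : ℝ × ℝ → ℝ) : ℝ :=
  Real.sqrt (wNorm Ω 1 (weakDeriv Ω (1, 0) f) ^ 2 + wNorm Ω 1 (weakDeriv Ω (0, 1) f) ^ 2)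

/-- The norm of `H̃¹_r(Ω) = H¹_r(Ω) ∩ L²_{1/r}(Ω)`, for `f` in that space. -/
def h1TildeNorm (Ω : Set (ℝ × ℝ)) (f : ℝ × ℝ → ℝ) : ℝ :=
  Real.sqrt (wNorm Ω 1 f ^ 2 + h1Seminorm Ω f ^ 2 + wNorm Ω (-1) f ^ 2)

/-- The vector fields with all components in `H¹_r(Ω)` and with `k v_z` and `k v_r + v_θ`
in `L²_{1/r}(Ω)`. -/
def MemH1Diamond (Ω : Set (ℝ × ℝ)) (k : ℤ) (v : ℝ × ℝ → Vec) : Prop :=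
  (∀ i, MemH1 Ω fun p => v p i) ∧
    MemLp (fun p => (k : ℝ) * v p 2) 2 (wMeasure Ω (-1)) ∧
    MemLp (fun p => (k : ℝ) * v p 0 + v p 1) 2 (wMeasure Ω (-1))

/-! ### The operators `grad`, `curl`, `div` of the `k`-th Fourier mode, in the weak sense -/

/-- `G = (∂_r u, -(k/r) u, ∂_z u)` in the sense of distributions on `Ω`. -/
def IsGrad (Ω : Set (ℝ × ℝ)) (k : ℤ) (u : ℝ × ℝ → ℝ) (G : ℝ × ℝ → Vec) : Prop :=
  ∀ φ, IsTest Ω φ →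
    (∫ p in Ω, G p 0 * φ p) = (∫ p in Ω, -(u p * dr φ p)) ∧
    (∫ p in Ω, G p 1 * φ p) = (∫ p in Ω, -((k : ℝ) / p.1 * u p * φ p)) ∧
    (∫ p in Ω, G p 2 * φ p) = ∫ p in Ω, -(u p * dz φ p)

/-- `w = (-((k/r) u_z + ∂_z u_θ), ∂_z u_r - ∂_r u_z, (k u_r + u_θ)/r + ∂_r u_θ)` in the sense of
distributions on `Ω`. -/
def IsCurl (Ω : Set (ℝ × ℝ)) (k : ℤ) (u w : ℝ × ℝ → Vec) : Prop :=
  ∀ φ, IsTest Ω φ →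
    (∫ p in Ω, w p 0 * φ p) = (∫ p in Ω, (-((k : ℝ) / p.1 * u p 2 * φ p) + u p 1 * dz φ p)) ∧
    (∫ p in Ω, w p 1 * φ p) = (∫ p in Ω, (-(u p 0 * dz φ p) + u p 2 * dr φ p)) ∧
    (∫ p in Ω, w p 2 * φ p) =
      ∫ p in Ω, (((k : ℝ) * u p 0 + u p 1) / p.1 * φ p - u p 1 * dr φ p)

/-- `g = ∂_r u_r + (u_r - k u_θ)/r + ∂_z u_z` in the sense of distributions on `Ω`. -/
def IsDiv (Ω : Set (ℝ × ℝ)) (k : ℤ) (u : ℝ × ℝ → Vec) (g : ℝ × ℝ → ℝ) : Prop :=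
  ∀ φ, IsTest Ω φ →
    (∫ p in Ω, g p * φ p) =
      ∫ p in Ω, (-(u p 0 * dr φ p) + (u p 0 - (k : ℝ) * u p 1) / p.1 * φ p - u p 2 * dz φ p)

/-! ### Triangulations -/

/-- The Euclidean distance in the `(r, z)`-plane (the metric of `ℝ × ℝ` in Mathlib is the sup
metric). -/
def eDist (p q : ℝ × ℝ) : ℝ := Real.sqrt ((p.1 - q.1) ^ 2 + (p.2 - q.2) ^ 2)

/-- A conforming triangulation of `Ω`: a finite simplicial complex whose underlying space is
the closure of `Ω`. -/
structure Mesh (Ω : Set (ℝ × ℝ)) where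
  complex : Geometry.SimplicialComplex ℝ (ℝ × ℝ)
  finite : complex.faces.Finite
  space_eq : complex.space = closure Ω

/-- The triangles of a mesh, given by their sets of vertices. -/
def Mesh.triangles {Ω : Set (ℝ × ℝ)} (T : Mesh Ω) : Set (Finset (ℝ × ℝ)) :=
  {s | s ∈ T.complex.faces ∧ s.card = 3}

/-- The Euclidean diameter of the triangle with vertex set `s`, i.e. its longest side. -/
def triDiam (s : Finset (ℝ × ℝ)) : ℝ := sSup {d | ∃ p ∈ s, ∃ q ∈ s, d = eDist p q}

/-- The meshsize `h`: the largest diameter of a triangle. -/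
def Mesh.size {Ω : Set (ℝ × ℝ)} (T : Mesh Ω) : ℝ := sSup (triDiam '' T.triangles)

/-- Shape regularity with constant `σ`: `h_K² ≤ σ |K|` for all triangles `K`. -/
def Mesh.ShapeRegular {Ω : Set (ℝ × ℝ)} (T : Mesh Ω) (σ : ℝ) : Prop :=
  ∀ s ∈ T.triangles, triDiam s ^ 2 ≤ σ * volume.real (convexHull ℝ (s : Set (ℝ × ℝ)))

/-! ### The Fourier finite element spaces -/

/-- The elements of `A₁`. -/
def polyA (a : Fin 3 → ℝ) (p : ℝ × ℝ) : ℝ := a 0 * p.1 + a 1 * p.1 ^ 2 + a 2 * p.1 * p.2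

/-- The elements of `B₁`; `b i` is the coefficient `β_{i+1}`. -/
def polyB (k : ℤ) (b : Fin 6 → ℝ) (p : ℝ × ℝ) : Vec :=
  !₂[b 0 + b 3 * p.1 + b 2 * p.2 - b 5 * p.1 * p.2,
    -(k : ℝ) * b 0 + b 1 * p.1 - (k : ℝ) * b 2 * p.2,
    b 4 * p.1 + b 5 * p.1 ^ 2]

/-- The elements of `C₁`; `c i` is the coefficient `γ_{i+1}`. -/
def polyC (k : ℤ) (c : Fin 4 → ℝ) (p : ℝ × ℝ) : Vec :=
  !₂[(k : ℝ) * c 0 + c 1 * p.1, c 0 + c 2 * p.1, c 3 + c 1 * p.2]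

/-- `A_h`. -/
def spaceA {Ω : Set (ℝ × ℝ)} (k : ℤ) (T : Mesh Ω) : Set (L2r Ω) :=
  {u | (∃ G : L2rVec Ω, IsGrad Ω k u G) ∧
    ∀ s ∈ T.triangles, ∃ a : Fin 3 → ℝ,
      ∀ᵐ p ∂(wMeasure Ω 1), p ∈ convexHull ℝ (s : Set (ℝ × ℝ)) → u p = polyA a p}

/-- `B_h`. -/
def spaceB {Ω : Set (ℝ × ℝ)} (k : ℤ) (T : Mesh Ω) : Set (L2rVec Ω) :=
  {u | (∃ w : L2rVec Ω, IsCurl Ω k u w) ∧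
    ∀ s ∈ T.triangles, ∃ b : Fin 6 → ℝ,
      ∀ᵐ p ∂(wMeasure Ω 1), p ∈ convexHull ℝ (s : Set (ℝ × ℝ)) → u p = polyB k b p}

/-- `C_h`. -/
def spaceC {Ω : Set (ℝ × ℝ)} (k : ℤ) (T : Mesh Ω) : Set (L2rVec Ω) :=
  {u | (∃ g : L2r Ω, IsDiv Ω k u g) ∧
    ∀ s ∈ T.triangles, ∃ c : Fin 4 → ℝ,
      ∀ᵐ p ∂(wMeasure Ω 1), p ∈ convexHull ℝ (s : Set (ℝ × ℝ)) → u p = polyC k c p}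

/-- `D_h`. -/
def spaceD {Ω : Set (ℝ × ℝ)} (T : Mesh Ω) : Set (L2r Ω) :=
  {u | ∀ s ∈ T.triangles, ∃ d : ℝ,
      ∀ᵐ p ∂(wMeasure Ω 1), p ∈ convexHull ℝ (s : Set (ℝ × ℝ)) → u p = d}

/-! ### Commuting projections -/

/-- The linear map `P` is a projection onto the set `S`. -/
def IsProjOnto {E : Type*} [NormedAddCommGroup E] [NormedSpace ℝ E] (P : E →L[ℝ] E)
    (S : Set E) : Prop :=
  (∀ u, P u ∈ S) ∧ ∀ u ∈ S, P u = u

/-- `(Pg, Pc, Pd, Po)` are commuting projections of the weighted `L²_r`-complex of the `k`-th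
Fourier mode onto `A_h → B_h → C_h → D_h`, with operator norms on `L²_r` at most `M`. -/
structure IsCommutingProj {Ω : Set (ℝ × ℝ)} (k : ℤ) (T : Mesh Ω) (M : ℝ)
    (Pg : L2r Ω →L[ℝ] L2r Ω) (Pc Pd : L2rVec Ω →L[ℝ] L2rVec Ω)
    (Po : L2r Ω →L[ℝ] L2r Ω) : Prop where
  proj_g : IsProjOnto Pg (spaceA k T)
  proj_c : IsProjOnto Pc (spaceB k T)
  proj_d : IsProjOnto Pd (spaceC k T)
  proj_o : IsProjOnto Po (spaceD T)
  comm_grad : ∀ (u : L2r Ω) (G : L2rVec Ω), IsGrad Ω k u G → IsGrad Ω k (Pg u) (Pc G)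
  comm_curl : ∀ u w : L2rVec Ω, IsCurl Ω k u w → IsCurl Ω k (Pc u) (Pd w)
  comm_div : ∀ (u : L2rVec Ω) (g : L2r Ω), IsDiv Ω k u g → IsDiv Ω k (Pd u) (Po g)
  norm_g : ‖Pg‖ ≤ M
  norm_c : ‖Pc‖ ≤ M
  norm_d : ‖Pd‖ ≤ M
  norm_o : ‖Po‖ ≤ M

end AxiFEM

end

/-! Outline. With `ζ`, `η`, `ψ` formed from the components of a field and powers of `r`, the complex
`grad^k, curl^k, div^k` becomes the planar complex of weak gradients and rotations. Its Whitney
interpolants, with vertex values replaced by averages over probability measures near the vertices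
(supported in `Ω`, by convexity), commute with the derivatives and are bounded in the weighted
norms; for measures close to the vertices they are near the identity on the finite element spaces,
so that they can be corrected to projections. The error bound compares `v` with such an
interpolant, using a Poincaré inequality on patches. -/

noncomputable section
namespace AxiFEM
open MeasureTheory
open ENNReal (ofReal ofReal_mul ofReal_le_ofReal ofReal_ne_top ofReal_pow ofReal_add
  ofReal_ofNat)
open Finset (sum_congr mul_sum sum_add_distrib sum_sub_distrib smul_sum eventually_all)
open Set (Icc indicator_of_mem indicator_of_notMem mem_iUnion)
open Prod (smul_fst smul_snd norm_def fst_sum snd_sum fst_sub snd_sub)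
open Real (norm_eq_abs norm_of_nonneg)
open Bornology (IsBounded)
open Metric (closedBall)
open Filter (Eventually)
open scoped ContDiff

local notation "R2" => ℝ × ℝ
local notation "dK" => triDiam
local notation "lD" => lineDeriv ℝ
local notation "I01" => Icc (0 : ℝ) 1
local notation "wm" Ω:max => wMeasure Ω 1

variable {Ω U Z : Set R2} {s t : Finset R2} {Tr : Finset (Finset R2)} {φ : R2 → R2 → ℝ}
  {C A a ε : ℝ} {k : ℤ} {α : ℕ} {μ ν κ : Measure R2} {f g ψ χ : R2 → ℝ} {ζ G η : R2 → R2}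
  {p q v w : R2} {E : Type*} [NormedAddCommGroup E] [NormedSpace ℝ E]
  {F : Type*} [NormedAddCommGroup F] [NormedSpace ℝ F]
  {V W : Type*} [NormedAddCommGroup V] [NormedSpace ℝ V] [NormedAddCommGroup W] [NormedSpace ℝ W]

/-! ### Projections from near-identities of finite rank -/

lemma ex_proj_of_near_id (V : Submodule ℝ E) (M : E →ₗ[ℝ] E) (hfin : FiniteDimensional ℝ
    (LinearMap.range M)) (hMV : ∀ u, M u ∈ V) (hC : ∀ u, ‖M u‖ ≤ C * ‖u‖) (hnear : ∀ v ∈ V, ‖M v -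
    v‖ ≤ (1 / 2) * ‖v‖) : ∃ P : E →L[ℝ] E, IsProjOnto P (V : Set E) ∧ ‖P‖ ≤ 2 * max C 0 ∧ (∀ u, M (P
    u) = M u) ∧ (∀ v ∈ V, M v = 0 → v = 0) ∧ ∀ v ∈ V, ∃ v' ∈ V, M v' = v := by
  have hlow : ∀ v ∈ V, ‖v‖ ≤ 2 * ‖M v‖ := by
    intro v hv
    have h1 := hnear v hv
    have h2 : ‖v‖ ≤ ‖M v‖ + ‖M v - v‖ := by
      have := norm_sub_le (M v) (M v - v)
      simpa using this
    linarith
  have hinj0 : ∀ v ∈ V, M v = 0 → v = 0 := by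
    intro v hv h0
    have := hlow v hv
    rw [h0, norm_zero, mul_zero] at this
    exact norm_le_zero_iff.1 this
  let N : V →ₗ[ℝ] V := (M.comp V.subtype).codRestrict V fun v => hMV v
  have hNinj : Function.Injective N := by
    rw [injective_iff_map_eq_zero]
    intro v hv
    have : M (v : E) = 0 := congrArg Subtype.val hv
    exact Subtype.ext (hinj0 v v.2 this)
  have hVfin : FiniteDimensional ℝ V := by
    let N' : V →ₗ[ℝ] LinearMap.range M := M.rangeRestrict.comp V.subtype
    refine FiniteDimensional.of_injective N' ?_
    intro v w hvw
    have h := congrArg Subtype.val hvw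
    exact hNinj (Subtype.ext h)
  let e : V ≃ₗ[ℝ] V := LinearEquiv.ofInjectiveEndo N hNinj
  have he : ∀ v : V, M (e.symm v : E) = v := by
    intro v
    have h1 := e.apply_symm_apply v
    have h2 : N (e.symm v) = v := h1
    exact congrArg Subtype.val h2
  let M' : E →ₗ[ℝ] V := M.codRestrict V hMV
  let P₀ : E →ₗ[ℝ] E := V.subtype.comp (e.symm.toLinearMap.comp M')
  have hP₀ : ∀ u, M (P₀ u) = M u := fun u => he (M' u)
  have hP₀V : ∀ u, P₀ u ∈ V := fun u => (e.symm (M' u)).2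
  have hbound : ∀ u, ‖P₀ u‖ ≤ (2 * max C 0) * ‖u‖ := by
    intro u
    have h1 := hlow _ (hP₀V u)
    rw [hP₀ u] at h1
    have h2 : C * ‖u‖ ≤ max C 0 * ‖u‖ := by gcongr; exact le_max_left _ _
    linarith [hC u]
  refine ⟨P₀.mkContinuous _ hbound, ⟨fun u => hP₀V u, fun u hu => ?_⟩,
    LinearMap.mkContinuous_norm_le _ (by positivity) _, hP₀, hinj0,
    fun v hv => ⟨e.symm ⟨v, hv⟩, (e.symm ⟨v, hv⟩).2, he ⟨v, hv⟩⟩⟩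
  have : P₀ u - u = 0 := hinj0 _ (V.sub_mem (hP₀V u) hu) (by rw [map_sub, hP₀, sub_self])
  exact sub_eq_zero.1 this

/-! ### Convex combinations of random points -/

/-- The planar determinant. -/
def pdet (p q : R2) : ℝ := p.1 * q.2 - p.2 * q.1

/-- The planar inner product. -/
def pdot (p q : R2) : ℝ := p.1 * q.1 + p.2 * q.2

lemma lint_comp_smul_add_le {f : R2 → ENNReal} (hf : Measurable f) {t : ℝ} (ht : 1 / 3 ≤ t)
    (c : R2) : ∫⁻ x, f (t • x + c) ≤ 9 * ∫⁻ x, f x := by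
  have ht0 : t ≠ 0 := by linarith
  have h1 : ∫⁻ x, f (t • x + c) = ∫⁻ y, f (y + c) ∂(.map (fun x => t • x) volume) := by
    rw [lintegral_map (f := fun y => f (y + c)) (hf.comp (measurable_id.add_const c))
      (measurable_const_smul t)]
  rw [h1, Measure.map_addHaar_smul _ ht0, lintegral_smul_measure, lintegral_add_right_eq_self f c]
  simp [smul_eq_mul]
  gcongr
  rw [show (9 : ENNReal) = ofReal 9 by simp]
  apply ofReal_le_ofReal
  norm_num
  rw [inv_le_comm₀ (by positivity) (by norm_num)]
  nlinarith

lemma lint_comb_le {μ₁ μ₂ μ₃ : Measure R2} [IsFiniteMeasure μ₁] [IsFiniteMeasure μ₂]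
    [IsFiniteMeasure μ₃] {A m : ENNReal} (k₁ : μ₁ Set.univ ≤ m) (k₂ : μ₂ Set.univ ≤ m)
    (k₃ : μ₃ Set.univ ≤ m) (h₁ : μ₁ ≤ A • volume) (h₂ : μ₂ ≤ A • volume) (h₃ : μ₃ ≤ A • volume)
    {f : R2 → ENNReal} (hf : Measurable f) {t₁ t₂ t₃ : ℝ} (ht : t₁ + t₂ + t₃ = 1) : ∫⁻ q, f
    (t₁ • q.1 + t₂ • q.2.1 + t₃ • q.2.2) ∂(μ₁.prod (μ₂.prod μ₃)) ≤ 9 * A * m ^ 2 * ∫⁻ p, f p := by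
  have key : ∀ (μ : Measure R2), μ ≤ A • volume → ∀ (t : ℝ), 1 / 3 ≤ t → ∀ c,
      ∫⁻ x, f (t • x + c) ∂μ ≤ 9 * A * ∫⁻ p, f p := by
    intro μ hμ t ht c
    calc ∫⁻ x, f (t • x + c) ∂μ ≤ ∫⁻ x, f (t • x + c) ∂(A • volume) := lintegral_mono' hμ le_rfl
      _ = A * ∫⁻ x, f (t • x + c) := by rw [lintegral_smul_measure, smul_eq_mul]
      _ ≤ A * (9 * ∫⁻ x, f x) := by gcongr; exact lint_comp_smul_add_le hf ht c
      _ = _ := by ring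
  have hm : Measurable fun q : R2 × R2 × R2 =>
      f (t₁ • q.1 + t₂ • q.2.1 + t₃ • q.2.2) := hf.comp (by fun_prop)
  have hmx : ∀ x, Measurable fun y : R2 × R2 =>
      f (t₁ • x + t₂ • y.1 + t₃ • y.2) := fun x => hf.comp (by fun_prop)
  rcases (by by_contra! h; linarith : 1 / 3 ≤ t₁ ∨ 1 / 3 ≤ t₂ ∨ 1 / 3 ≤ t₃)
    with h | h | h
  · rw [lintegral_prod_symm _ hm.aemeasurable]
    calc _ ≤ ∫⁻ _y, (9 * A * ∫⁻ p, f p) ∂(μ₂.prod μ₃) := by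
          apply lintegral_mono
          intro y
          simp [add_assoc]
          exact key μ₁ h₁ t₁ h _
      _ = 9 * A * (∫⁻ p, f p) * (μ₂ .univ * μ₃ .univ) := by
          rw [lintegral_const, ← Set.univ_prod_univ, Measure.prod_prod]
      _ ≤ 9 * A * (∫⁻ p, f p) * (m * m) := by gcongr
      _ = _ := by ring
  · rw [lintegral_prod _ hm.aemeasurable]
    calc _ ≤ ∫⁻ _x, (9 * A * m * ∫⁻ p, f p) ∂μ₁ := by
          apply lintegral_mono
          intro x
          simp only
          rw [lintegral_prod_symm _ (hmx x).aemeasurable]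
          calc _ ≤ ∫⁻ _y, (9 * A * ∫⁻ p, f p) ∂μ₃ := by
                apply lintegral_mono
                intro y
                simp only
                have := key μ₂ h₂ t₂ h (t₁ • x + t₃ • y)
                exact le_trans (le_of_eq (by congr 1; ext z; congr 1; abel)) this
            _ ≤ 9 * A * (∫⁻ p, f p) * m := by rw [lintegral_const]; gcongr
            _ = _ := by ring
      _ ≤ (9 * A * m * ∫⁻ p, f p) * m := by rw [lintegral_const]; gcongr
      _ = _ := by ring
  · rw [lintegral_prod _ hm.aemeasurable]
    calc _ ≤ ∫⁻ _x, (9 * A * m * ∫⁻ p, f p) ∂μ₁ := by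
          apply lintegral_mono
          intro x
          simp only
          rw [lintegral_prod _ (hmx x).aemeasurable]
          calc _ ≤ ∫⁻ _y, (9 * A * ∫⁻ p, f p) ∂μ₂ := by
                apply lintegral_mono
                intro y
                simp only
                have := key μ₃ h₃ t₃ h (t₁ • x + t₂ • y)
                exact le_trans (le_of_eq (by congr 1; ext z; congr 1; abel)) this
            _ ≤ 9 * A * (∫⁻ p, f p) * m := by rw [lintegral_const]; gcongr
            _ = _ := by ring
      _ ≤ (9 * A * m * ∫⁻ p, f p) * m := by rw [lintegral_const]; gcongr
      _ = _ := by ring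

/-- The uniform probability measure on `S`. -/
def unif (S : Set R2) : Measure R2 := (volume S)⁻¹ • volume.restrict S

lemma prob_unif {S : Set R2} (h0 : volume S ≠ 0) (h1 : volume S ≠ ⊤) :
    IsProbabilityMeasure (unif S) :=
  ⟨by simp [unif, ENNReal.inv_mul_cancel h0 h1]⟩

lemma unif_le (S : Set R2) : unif S ≤ (volume S)⁻¹ • volume := by
  intro s
  simp [unif]
  gcongr
  exact Measure.restrict_le_self

lemma ae_mem_unif {S : Set R2} (hS : MeasurableSet S) : ∀ᵐ x ∂(unif S), x ∈ S :=
  Measure.ae_smul_measure (ae_restrict_mem hS) _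

lemma lint_comb_par_le {Θ : Type*} [MeasurableSpace Θ] {μ₁ μ₂ μ₃ : Measure R2} [IsFiniteMeasure μ₁]
    [IsFiniteMeasure μ₂] [IsFiniteMeasure μ₃] (ν : Measure Θ) [IsFiniteMeasure ν] {A m : ENNReal}
    (k₁ : μ₁ Set.univ ≤ m) (k₂ : μ₂ Set.univ ≤ m) (k₃ : μ₃ Set.univ ≤ m) (h₁ : μ₁ ≤ A • volume) (h₂
    : μ₂ ≤ A • volume) (h₃ : μ₃ ≤ A • volume) {f : R2 → ENNReal} (hf : Measurable f) {t₁ t₂ t₃ : Θ →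
    ℝ} (m₁ : Measurable t₁) (m₂ : Measurable t₂) (m₃ : Measurable t₃) (ht : ∀ θ, t₁ θ + t₂ θ + t₃ θ
    = 1) : ∫⁻ q, f (t₁ q.2 • q.1.1 + t₂ q.2 • q.1.2.1 + t₃ q.2 • q.1.2.2) ∂((μ₁.prod (μ₂.prod
    μ₃)).prod ν) ≤ 9 * A * m ^ 2 * (ν Set.univ) * ∫⁻ p, f p := by
  have hm : Measurable fun q : (R2 × R2 × R2) × Θ =>
      f (t₁ q.2 • q.1.1 + t₂ q.2 • q.1.2.1 + t₃ q.2 • q.1.2.2) := hf.comp (by fun_prop)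
  rw [lintegral_prod_symm _ hm.aemeasurable]
  calc _ ≤ ∫⁻ _θ, (9 * A * m ^ 2 * ∫⁻ p, f p) ∂ν := by
        apply lintegral_mono
        exact fun θ => lint_comb_le k₁ k₂ k₃ h₁ h₂ h₃ hf (ht θ)
    _ = _ := by simp only [lintegral_const]; ring

/-! ### Averages over moving simplices -/

/-- Triples of points of the plane. -/
abbrev Tri3 : Type := R2 × R2 × R2

/-- The point with affine parameters `t` in the triangle spanned by the triple `X`. -/
def bpt (t : R2) (X : Tri3) : R2 :=
  X.1 + t.1 • (X.2.1 - X.1) + t.2 • (X.2.2 - X.1)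

/-- The triple with edge vectors `z.2` for which `z.1` is the point with parameters `t`. -/
def trip (t : R2) (z : Tri3) : Tri3 :=
  (z.1 - t.1 • z.2.1 - t.2 • z.2.2, z.1 - t.1 • z.2.1 - t.2 • z.2.2 + z.2.1,
    z.1 - t.1 • z.2.1 - t.2 • z.2.2 + z.2.2)

lemma bpt_trip (t : R2) (z : Tri3) : bpt t (trip t z) = z.1 := by
  simp only [bpt, trip, add_sub_cancel_left]
  abel

lemma cont_trip : Continuous fun q : R2 × Tri3 => trip q.1 q.2 := by
  unfold trip; fun_prop

lemma mp_trip (t : R2) : MeasurePreserving (trip t) (volume : Measure Tri3) volume := by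
  have h1 : MeasurePreserving (Prod.swap : Tri3 → _) volume volume := Measure.measurePreserving_swap
  have h2 : MeasurePreserving
      (fun z : (R2 × R2) × R2 => (z.1, z.2 - (t.1 • z.1.1 + t.2 • z.1.2)))
      volume volume :=
    (MeasurePreserving.id volume).skew_product (g := fun (q : R2 × R2) p =>
      p - (t.1 • q.1 + t.2 • q.2))
      (by fun_prop) (.of_forall fun q => (measurePreserving_sub_right _ _).map_eq)
  have h3 : MeasurePreserving (Prod.swap : (R2 × R2) × R2 → _) volume volume :=
    Measure.measurePreserving_swap
  have h4 : MeasurePreserving (fun z : Tri3 => (z.1, z.2 + (z.1, z.1))) volume volume :=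
    (MeasurePreserving.id volume).skew_product (g := fun x q => q + (x, x))
      (by fun_prop) (.of_forall fun x =>
        ((measurePreserving_add_right (volume : Measure R2) x).prod
          (measurePreserving_add_right (volume : Measure R2) x)).map_eq)
  have := h4.comp (h3.comp (h2.comp h1))
  convert! this using 1
  ext z <;> simp [trip] <;> ring

/-- The integral of `Φ (X) g (bpt t X)` over all triples `X`, in the coordinates of `trip`. -/
def moving (g : R2 → ℝ) (Φ : Tri3 → ℝ) (t : R2) : ℝ :=
  ∫ z : Tri3, Φ (trip t z) * g z.1

lemma mov_eq (g : R2 → ℝ) (hg : Measurable g) (Φ : Tri3 → ℝ) (hΦ : Continuous Φ) (t : R2) :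
    moving g Φ t = ∫ X : Tri3, Φ X * g (bpt t X) := by
  have hm : Measurable fun X : Tri3 => Φ X * g (bpt t X) := by
    apply hΦ.measurable.mul (hg.comp _)
    unfold bpt; fun_prop
  rw [← (mp_trip t).map_eq, integral_map
    (mp_trip t).measurable.aemeasurable hm.aestronglyMeasurable]
  simp only [moving, bpt_trip]

lemma ex_mov_bd (hg : Integrable g) {Φ : Tri3 → ℝ} (hΦ : Continuous Φ) (hc : HasCompactSupport Φ) :
    ∃ B : Tri3 → ℝ, Integrable B ∧ ∀ t z, ‖Φ (trip t z) * g z.1‖ ≤ B z := by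
  obtain ⟨M, hM⟩ := hc.exists_bound_of_continuous hΦ
  obtain ⟨R, hR⟩ := hc.isCompact.isBounded.subset_closedBall (0 : Tri3)
  refine ⟨fun z => ‖g z.1‖ * (closedBall (0 : R2 × R2) (2 * R)).indicator (fun _ => M) z.2,
    hg.norm.mul_prod ((integrable_indicator_iff measurableSet_closedBall).2
      (integrableOn_const measure_closedBall_lt_top.ne)), fun t z => ?_⟩
  rw [norm_mul, mul_comm]
  refine mul_le_mul_of_nonneg_left ?_ (norm_nonneg _)
  by_cases h0 : Φ (trip t z) = 0
  · rw [h0, norm_zero]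
    exact Set.indicator_nonneg (fun _ _ => (norm_nonneg _).trans (hM 0)) _
  · have h1 := hR (subset_tsupport _ h0)
    rw [mem_closedBall_zero_iff] at h1
    have hx := (norm_fst_le _).trans h1
    have hy := ((norm_fst_le _).trans (norm_snd_le _)).trans h1
    have hw := ((norm_snd_le _).trans (norm_snd_le _)).trans h1
    rw [indicator_of_mem]
    · exact hM _
    · rw [mem_closedBall_zero_iff, norm_def]
      apply max_le
      · rw [show z.2.1 = (trip t z).2.1 - (trip t z).1 by simp [trip]]
        exact (norm_sub_le _ _).trans (by linarith)
      · rw [show z.2.2 = (trip t z).2.2 - (trip t z).1 by simp [trip]]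
        exact (norm_sub_le _ _).trans (by linarith)

lemma intble_mov (hg : Integrable g) {Φ : Tri3 → ℝ} (hΦ : Continuous Φ)
    (hc : HasCompactSupport Φ) (t : R2) : Integrable fun z : Tri3 => Φ (trip t z) * g z.1 := by
  obtain ⟨B, hB, h⟩ := ex_mov_bd hg hΦ hc
  exact hB.mono' (((by unfold trip; fun_prop : Continuous fun z => Φ (trip t z)).aestronglyMeasurable).mul
    hg.aestronglyMeasurable.comp_fst) (.of_forall (h t))

lemma cont_mov (hg : Integrable g) {Φ : Tri3 → ℝ} (hΦ : Continuous Φ)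
    (hc : HasCompactSupport Φ) : Continuous (moving g Φ) := by
  obtain ⟨B, hB, h⟩ := ex_mov_bd hg hΦ hc
  exact continuous_of_dominated (fun t => (intble_mov hg hΦ hc t).1) (fun t => .of_forall (h t)) hB
    (.of_forall fun z => by unfold trip; fun_prop)

lemma mov_add (hg : Integrable g) {Φ Ψ : Tri3 → ℝ} (hΦ : Continuous Φ) (hc : HasCompactSupport Φ)
    (hΨ : Continuous Ψ) (hd : HasCompactSupport Ψ) (t : R2) :
    moving g Φ t + moving g Ψ t = moving g (fun X => Φ X + Ψ X) t := by
  simp only [moving, add_mul, integral_add (intble_mov hg hΦ hc t) (intble_mov hg hΨ hd t)]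

/-- Minus the derivative of `φ` when the whole triple is translated by the vector `q X`. -/
def transD (q : Tri3 → R2) (φ : Tri3 → ℝ) (X : Tri3) : ℝ := -fderiv ℝ φ X (q X, q X, q X)

/-- The first edge vector of a triple. -/
def edge1 (X : Tri3) : R2 := X.2.1 - X.1

/-- The second edge vector of a triple. -/
def edge2 (X : Tri3) : R2 := X.2.2 - X.1

lemma cont_transD {q : Tri3 → R2} (hq : Continuous q) {φ : Tri3 → ℝ} (hφ : ContDiff ℝ 1 φ) :
    Continuous (transD q φ) := by
  unfold transD
  have := hφ.continuous_fderiv (by norm_num)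
  fun_prop

lemma hcs_transD {q : Tri3 → R2} {φ : Tri3 → ℝ} (hφ : HasCompactSupport φ) :
    HasCompactSupport (transD q φ) := by
  apply (hφ.fderiv ℝ).mono
  intro X hX h0
  apply hX
  simp [transD, h0]

lemma transD_mul_edge {e : Tri3 → R2} {φ c : Tri3 → ℝ} (hφ : ContDiff ℝ 1 φ)
    (hc : Differentiable ℝ c) (h : ∀ X q, c (X + (q, q, q)) = c X) :
    transD e (fun X => φ X * c X) = fun X => transD e φ X * c X := by
  ext X
  have h2 : fderiv ℝ c X (e X, e X, e X) = 0 := by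
    rw [← (hc X).lineDeriv_eq_fderiv]; simp [lineDeriv, h]
  unfold transD
  rw [show fderiv ℝ (fun X => φ X * c X) X = _ from
    ((hφ.differentiable (by norm_num) X).hasFDerivAt.mul (hc X).hasFDerivAt).fderiv]
  simp [h2, mul_comm]

lemma hd_mov_aux (hg : Integrable g) {φ : Tri3 → ℝ} (hφ : ContDiff ℝ 1 φ) (hc : HasCompactSupport φ)
    (q : Tri3 → R2) (hq : Continuous q) (γ : ℝ → R2) (τ : ℝ) (hd : ∀ z x, HasDerivAt (fun x => trip
    (γ x) z) (-(q (trip (γ x) z), q (trip (γ x) z), q (trip (γ x) z))) x) : HasDerivAt (fun x =>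
    moving g φ (γ x)) (moving g (transD q φ) (γ τ)) τ := by
  have hφc := hφ.continuous
  have hT := cont_transD hq hφ
  obtain ⟨B, hB, hBΦ⟩ := ex_mov_bd hg hT (hcs_transD hc)
  refine (hasDerivAt_integral_of_dominated_loc_of_deriv_le (s := Set.univ)
    (F' := fun x z => transD q φ (trip (γ x) z) * g z.1) Filter.univ_mem
    (.of_forall fun x => (intble_mov hg hφc hc _).1) (intble_mov hg hφc hc _)
    (intble_mov hg hT (hcs_transD hc) _).1 (.of_forall fun z x _ => hBΦ _ z) hB ?_).2
  filter_upwards with z x _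
  apply HasDerivAt.mul_const
  rw [transD, ← map_neg]
  exact (hφ.differentiable (by norm_num) _).hasFDerivAt.comp_hasDerivAt x (hd z x)

lemma hd_mov_fst (hg : Integrable g) {φ : Tri3 → ℝ} (hφ : ContDiff ℝ 1 φ)
    (hc : HasCompactSupport φ) (t₁ t₂ : ℝ) : HasDerivAt (fun x => moving g φ (x, t₂))
    (moving g (transD edge1 φ) (t₁, t₂)) t₁ := by
  refine hd_mov_aux hg hφ hc edge1 (by unfold edge1; fun_prop) (fun x => (x, t₂))
    t₁ fun z x => ?_
  have hx : HasDerivAt (fun x : ℝ => z.1 - x • z.2.1 - t₂ • z.2.2) (-z.2.1) x := by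
    have h := ((hasDerivAt_id x).smul_const z.2.1)
    simpa using (h.const_sub z.1).sub_const (t₂ • z.2.2)
  simpa [trip, edge1] using hx.prodMk ((hx.add_const z.2.1).prodMk (hx.add_const z.2.2))

lemma hd_mov_snd (hg : Integrable g) {φ : Tri3 → ℝ} (hφ : ContDiff ℝ 1 φ)
    (hc : HasCompactSupport φ) (t₁ t₂ : ℝ) : HasDerivAt (fun x => moving g φ (t₁, x))
    (moving g (transD edge2 φ) (t₁, t₂)) t₂ := by
  refine hd_mov_aux hg hφ hc edge2 (by unfold edge2; fun_prop) (fun x => (t₁, x))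
    t₂ fun z x => ?_
  have hx : HasDerivAt (fun x : ℝ => z.1 - t₁ • z.2.1 - x • z.2.2) (-z.2.2) x := by
    have h := ((hasDerivAt_id x).smul_const z.2.2)
    simpa using h.const_sub (z.1 - t₁ • z.2.1)
  simpa [trip, edge2] using hx.prodMk ((hx.add_const z.2.1).prodMk (hx.add_const z.2.2))

lemma intble_mov_prod (hg : Integrable g) {Φ : Tri3 → ℝ} (hΦ : Continuous Φ)
    (hc : HasCompactSupport Φ) (ν : Measure R2) [IsFiniteMeasure ν] : Integrable
    (fun q : R2 × Tri3 => Φ (trip q.1 q.2) * g q.2.1) (ν.prod volume) := by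
  obtain ⟨B, hB, h⟩ := ex_mov_bd hg hΦ hc
  exact (hB.comp_snd ν).mono' ((hΦ.comp cont_trip).aestronglyMeasurable.mul
    hg.aestronglyMeasurable.comp_fst.comp_snd) (.of_forall fun q => h _ _)

lemma intble_bpt_prod (hg : Integrable g) (hgm : Measurable g) {Φ : Tri3 → ℝ}
    (hΦ : Continuous Φ) (hc : HasCompactSupport Φ) (ν : Measure R2) [IsFiniteMeasure ν] : Integrable
    (fun q : R2 × Tri3 => Φ q.2 * g (bpt q.1 q.2)) (ν.prod volume) := by
  have hmp : MeasurePreserving (fun q : R2 × Tri3 => (q.1, trip q.1 q.2))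
      (ν.prod volume) (ν.prod volume) :=
    (MeasurePreserving.id ν).skew_product (g := trip) cont_trip.measurable
      (.of_forall fun t => (mp_trip t).map_eq)
  have hm : Measurable fun q : R2 × Tri3 => Φ q.2 * g (bpt q.1 q.2) := by
    refine (hΦ.measurable.comp measurable_snd).mul (hgm.comp ?_)
    unfold bpt; fun_prop
  rw [← hmp.integrable_comp hm.aestronglyMeasurable]
  convert! intble_mov_prod hg hΦ hc ν using 1
  ext q
  simp [Function.comp, bpt_trip]

/-- The parameter simplex. -/
def stdT : Set R2 := {t | 0 ≤ t.1 ∧ 0 ≤ t.2 ∧ t.1 + t.2 ≤ 1}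

lemma cpt_stdT : IsCompact stdT := by
  refine Metric.isCompact_of_isClosed_isBounded ?_ ?_
  · unfold stdT
    exact (isClosed_le continuous_const continuous_fst).inter
      ((isClosed_le continuous_const continuous_snd).inter
        (isClosed_le (continuous_fst.add continuous_snd) continuous_const))
  · refine (Metric.isBounded_Icc (0 : R2) (1, 1)).subset ?_
    rintro ⟨a, b⟩ ⟨h1, h2, h3⟩
    simp only at h1 h2 h3
    exact ⟨⟨h1, h2⟩, ⟨by simp only; linarith, by simp only; linarith⟩⟩

lemma bpt_eq (t : R2) (X : Tri3) : bpt t X = (1 - t.1 - t.2) • X.1 + t.1 • X.2.1 + t.2 • X.2.2 := by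
  ext <;> simp [bpt] <;> ring

lemma bpt_mem (cv : Convex ℝ Ω) {t : R2} (ht : t ∈ stdT) {X : Tri3} (h1 : X.1 ∈ Ω)
    (h2 : X.2.1 ∈ Ω) (h3 : X.2.2 ∈ Ω) : bpt t X ∈ Ω := by
  rw [bpt_eq]
  obtain ⟨a, b, c⟩ := ht
  have := cv.sum_mem (t := Finset.univ) (w := ![1 - t.1 - t.2, t.1, t.2])
    (z := ![X.1, X.2.1, X.2.2]) (by intro i _; fin_cases i <;> simp <;> linarith)
    (by simp [Fin.sum_univ_three]; ring) (by intro i _; fin_cases i <;> simp [h1, h2, h3])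
  simpa [Fin.sum_univ_three] using this

/-- The triples of points of `Ω`. -/
def cube3 (Ω : Set R2) : Set Tri3 := Ω ×ˢ Ω ×ˢ Ω

/-- The points of all triangles spanned by the triples in the support of `Φ`. -/
def sweep (Φ : Tri3 → ℝ) : Set R2 :=
  (fun q : R2 × Tri3 => bpt q.1 q.2) '' (stdT ×ˢ tsupport Φ)

lemma cpt_sweep {Φ : Tri3 → ℝ} (hc : HasCompactSupport Φ) : IsCompact (sweep Φ) :=
  (cpt_stdT.prod hc.isCompact).image (by unfold bpt; fun_prop)

lemma sweep_sub (cv : Convex ℝ Ω) {Φ : Tri3 → ℝ} (hs : tsupport Φ ⊆ cube3 Ω) : sweep Φ ⊆ Ω := by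
  rintro _ ⟨⟨t, X⟩, ⟨ht, hX⟩, rfl⟩
  obtain ⟨h1, h2, h3⟩ := hs hX
  exact bpt_mem cv ht h1 h2 h3

lemma bpt_mem_sweep {Φ : Tri3 → ℝ} {t : R2} (ht : t ∈ stdT) {X : Tri3} (hX : Φ X ≠ 0) : bpt t
    X ∈ sweep Φ := ⟨(t, X), ⟨ht, subset_tsupport _ hX⟩, rfl⟩

lemma sweep_mul_sub (φ c : Tri3 → ℝ) : sweep (fun X => φ X * c X) ⊆ sweep φ := by
  apply Set.image_mono
  exact Set.prod_mono_right (closure_mono (fun X hX h0 => hX (by simp [h0])))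

lemma intble_ind_of_cpt {C : Set R2} (hg : LocallyIntegrableOn g Ω)
    (hC : IsCompact C) (hCΩ : C ⊆ Ω) : Integrable (C.indicator g) := by
  rw [integrable_indicator_iff hC.measurableSet]
  exact hg.integrableOn_compact_subset hCΩ hC

lemma int_mul_avg (hg : LocallyIntegrableOn g Ω) (hgm : Measurable g) {Φ : Tri3 → ℝ}
    (hΦ : Continuous Φ) (hc : HasCompactSupport Φ) (ν : Measure R2) [IsFiniteMeasure ν]
    (hν : ∀ᵐ t ∂ν, t ∈ stdT) {C : Set R2} (hC : IsCompact C) (hCΩ : C ⊆ Ω) (hCs : sweep Φ ⊆ C) :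
    Integrable (fun X : Tri3 => Φ X * ∫ t, g (bpt t X) ∂ν) ∧ ∫ X : Tri3, Φ X * ∫ t, g (bpt t X) ∂ν =
    ∫ t, moving (C.indicator g) Φ t ∂ν := by
  have hgi := intble_ind_of_cpt hg hC hCΩ
  have hgim : Measurable (C.indicator g) := hgm.indicator hC.measurableSet
  have hI := intble_bpt_prod hgi hgim hΦ hc ν
  have hE : ∀ X : Tri3, ∫ t, Φ X * C.indicator g (bpt t X) ∂ν = Φ X * ∫ t, g (bpt t X) ∂ν := by
    intro X
    rw [← integral_const_mul]
    apply integral_congr_ae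
    filter_upwards [hν] with t ht
    by_cases h : Φ X = 0
    · simp [h]
    · rw [indicator_of_mem (hCs (bpt_mem_sweep ht h))]
  constructor
  · have := hI.integral_prod_right
    simpa only [hE] using this
  · simp only [← hE]
    rw [integral_integral_swap (f := fun X t => Φ X * C.indicator g (bpt t X)) hI.swap]
    apply integral_congr_ae
    filter_upwards with t
    exact (mov_eq _ hgim _ hΦ t).symm

/-! ### Weak gradients and rotations -/

/-- `G` is the gradient of `ψ` in the sense of distributions. -/
def WGrad (Ω : Set R2) (ψ : R2 → ℝ) (G : R2 → R2) : Prop :=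
  ∀ φ, IsTest Ω φ → (∫ p in Ω, (G p).1 * φ p) = (-∫ p in Ω, ψ p * dr φ p) ∧
    (∫ p in Ω, (G p).2 * φ p) = -∫ p in Ω, ψ p * dz φ p

/-- `s` is `∂_r ζ_z - ∂_z ζ_r` in the sense of distributions. -/
def WRot (Ω : Set R2) (ζ : R2 → R2) (s : R2 → ℝ) : Prop :=
  ∀ φ, IsTest Ω φ → (∫ p in Ω, s p * φ p) = ∫ p in Ω, ((ζ p).1 * dz φ p - (ζ p).2 * dr φ p)

/-- Measurable and locally integrable on `Ω`. -/
structure LocInt [MeasurableSpace F] (Ω : Set R2)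
    (f : R2 → F) : Prop where
  meas : Measurable f
  loc : LocallyIntegrableOn f Ω

lemma LocInt.fst (h : LocInt Ω G) : LocInt Ω fun p => (G p).1 :=
  ⟨h.meas.fst, h.loc.mono h.meas.fst.aestronglyMeasurable
    (.of_forall fun p => norm_fst_le (G p))⟩

lemma LocInt.snd (h : LocInt Ω G) : LocInt Ω fun p => (G p).2 :=
  ⟨h.meas.snd, h.loc.mono h.meas.snd.aestronglyMeasurable
    (.of_forall fun p => norm_snd_le (G p))⟩

/-- The slice of a test function on triples. -/
def slice (t : R2) (φ : Tri3 → ℝ) (q : R2 × R2) (p : R2) : ℝ :=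
  φ (trip t (p, q))

lemma hfd_trip (t : R2) (q : R2 × R2) (p : R2) : HasFDerivAt
    (fun p => trip t (p, q)) ((ContinuousLinearMap.id ℝ R2).prod ((ContinuousLinearMap.id ℝ
    R2).prod (ContinuousLinearMap.id ℝ R2))) p := by
  have h : HasFDerivAt (fun p : R2 => p - t.1 • q.1 - t.2 • q.2)
      (ContinuousLinearMap.id ℝ R2) p :=
    ((hasFDerivAt_id p).sub_const _).sub_const _
  exact h.prodMk ((h.add_const q.1).prodMk (h.add_const q.2))

lemma supp_slice_sub {t : R2} (ht : t ∈ stdT) (φ : Tri3 → ℝ) (q : R2 × R2) :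
    Function.support (slice t φ q) ⊆ sweep φ := by
  intro p hp
  have := bpt_mem_sweep ht (X := trip t (p, q)) hp
  rwa [bpt_trip] at this

lemma isTest_slice (cv : Convex ℝ Ω) {t : R2} (ht : t ∈ stdT) {φ : Tri3 → ℝ}
    (hφ : ContDiff ℝ ∞ φ) (hc : HasCompactSupport φ) (hs : tsupport φ ⊆ cube3 Ω) (q : R2 × R2) :
    IsTest Ω (slice t φ q) := by
  have hsub : tsupport (slice t φ q) ⊆ sweep φ :=
    closure_minimal (supp_slice_sub ht φ q) (cpt_sweep hc).isClosed
  refine ⟨?_, (cpt_sweep hc).of_isClosed_subset (isClosed_tsupport _) hsub,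
    hsub.trans (sweep_sub cv hs)⟩
  apply hφ.comp
  unfold trip
  fun_prop

lemma fd_slice {t : R2} {φ : Tri3 → ℝ} (hφ : ContDiff ℝ ∞ φ) (q : R2 × R2) (p e : R2) : fderiv
    ℝ (slice t φ q) p e = fderiv ℝ φ (trip t (p, q)) (e, e, e) := by
  have h1 : HasFDerivAt φ (fderiv ℝ φ (trip t (p, q))) (trip t (p, q)) :=
    (hφ.differentiable (by simp) _).hasFDerivAt
  have := (h1.comp p (hfd_trip t q p)).fderiv
  change fderiv ℝ (φ ∘ fun p => trip t (p, q)) p e = _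
  rw [this]
  rfl

lemma fd_apply_eq (χ : R2 → ℝ) (p e : R2) : fderiv ℝ χ p e = e.1 * dr χ p + e.2 * dz χ p := by
  have : e = e.1 • ((1, 0) : R2) + e.2 • ((0, 1) : R2) := by ext <;> simp
  conv_lhs => rw [this]
  rw [map_add, map_smul, map_smul]
  rfl

lemma int_mul_ind_eq {C : Set R2} (hCΩ : C ⊆ Ω) (hχ : Function.support χ ⊆ C)
    (g : R2 → ℝ) : ∫ p, χ p * C.indicator g p = ∫ p in Ω, g p * χ p := by
  rw [setIntegral_eq_integral_of_forall_compl_eq_zero]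
  · congr 1; ext p
    by_cases h : p ∈ C
    · rw [indicator_of_mem h, mul_comm]
    · have : χ p = 0 := by by_contra h'; exact h (hχ h')
      simp [this]
  · intro p hp
    have : χ p = 0 := by by_contra h'; exact hp (hCΩ (hχ h'))
    simp [this]

lemma mov_eq_it (hg : Integrable g) {Φ : Tri3 → ℝ} (hΦ : Continuous Φ)
    (hc : HasCompactSupport Φ) (t : R2) : moving g Φ t = ∫ q : R2 × R2, ∫ p, Φ (trip t (p, q)) *
    g p := integral_prod_symm _ (intble_mov hg hΦ hc t)

lemma mov_wk (cv : Convex ℝ Ω) {a b c : R2 → ℝ} (ha : LocInt Ω a) (hb : LocInt Ω b) (hc : LocInt Ω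
    c) {e e' : R2} (h : ∀ χ, IsTest Ω χ → ∫ p in Ω, a p * χ p = -∫ p in Ω, (b p * fderiv ℝ χ p e + c
    p * fderiv ℝ χ p e')) {φ m : Tri3 → ℝ} (hφ : ContDiff ℝ ∞ φ) (hφs : HasCompactSupport φ) (hs :
    tsupport φ ⊆ cube3 Ω) (hm : ContDiff ℝ ∞ m) (hm' : ∀ X q, m (X + (q, q, q)) = m X) {t : R2} (ht
    : t ∈ stdT) : moving ((sweep φ).indicator a) (fun X => φ X * m X) t = moving ((sweep
    φ).indicator b) (fun X => transD (fun _ => e) φ X * m X) t + moving ((sweep φ).indicator c) (fun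
    X => transD (fun _ => e') φ X * m X) t := by
  have hφ' : ContDiff ℝ ∞ fun X => φ X * m X := hφ.mul hm
  have hC := cpt_sweep hφs
  have hCΩ := sweep_sub cv hs
  have hc' : HasCompactSupport fun X => φ X * m X := hφs.mul_right
  have i : ∀ {f}, LocInt Ω f → Integrable ((sweep φ).indicator f) :=
    fun h => intble_ind_of_cpt h.loc hC hCΩ
  have cT : ∀ e : R2, Continuous (transD (fun _ => e) fun X => φ X * m X) :=
    fun e => cont_transD continuous_const (hφ'.of_le (by norm_cast))
  simp only [← transD_mul_edge (hφ.of_le (by norm_cast)) (hm.differentiable (by simp)) hm']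
  have I : ∀ {f e}, LocInt Ω f → _ := fun {f e} h => intble_mov (i h) (cT e) (hcs_transD hc') t
  rw [mov_eq_it (i ha) hφ'.continuous hc', mov_eq_it (i hb) (cT e) (hcs_transD hc'),
    mov_eq_it (i hc) (cT e') (hcs_transD hc'),
    ← integral_add (I hb).integral_prod_right (I hc).integral_prod_right]
  refine integral_congr_ae ?_
  filter_upwards [(I hb).prod_left_ae, (I hc).prod_left_ae] with q jb jc
  have hT := isTest_slice cv ht hφ' hc' ((tsupport_mul_subset_left).trans hs) q
  have hsup := (supp_slice_sub ht _ q).trans (sweep_mul_sub φ m)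
  have z : ∀ {p}, p ∉ sweep φ → fderiv ℝ (slice t (fun X => φ X * m X) q) p = 0 := fun {p} hp => by
    by_contra h'
    exact hp (closure_minimal hsup hC.isClosed (support_fderiv_subset ℝ h'))
  rw [← integral_add jb jc]
  refine (int_mul_ind_eq hCΩ hsup a).trans ((h _ hT).trans ?_)
  rw [setIntegral_eq_integral_of_forall_compl_eq_zero fun p hp => by simp [z fun h => hp (hCΩ h)],
    ← integral_neg]
  congr 1; ext p
  simp only [transD, ← fd_slice hφ']
  by_cases hp : p ∈ sweep φ
  · simp only [indicator_of_mem hp]; ring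
  · simp [z hp]

lemma transD_eq (e : Tri3 → R2) (φ : Tri3 → ℝ) (X : Tri3) : transD e φ X =
    transD (fun _ => (1, 0)) φ X * (e X).1 + transD (fun _ => (0, 1)) φ X * (e X).2 := by
  unfold transD
  rw [show (e X, e X, e X) = (e X).1 • (((1, 0), (1, 0), (1, 0)) : Tri3) +
    (e X).2 • (((0, 1), (0, 1), (0, 1)) : Tri3) by ext <;> simp, map_add, map_smul, map_smul]
  simp only [smul_eq_mul]; ring

lemma mov_wk_grad (cv : Convex ℝ Ω) (hψ : LocInt Ω ψ) (hG : LocInt Ω G) (h : WGrad Ω ψ G) {φ : Tri3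
    → ℝ} (hφ : ContDiff ℝ ∞ φ) (hc : HasCompactSupport φ) (hs : tsupport φ ⊆ cube3 Ω) {t : R2} (ht :
    t ∈ stdT) : moving ((sweep φ).indicator fun p => (G p).1) (fun X => φ X * (edge1 X).1) t +
    moving ((sweep φ).indicator fun p => (G p).2) (fun X => φ X * (edge1 X).2) t = moving ((sweep
    φ).indicator ψ) (transD edge1 φ) t := by
  have l0 : LocInt Ω fun _ => (0 : ℝ) := ⟨measurable_const, locallyIntegrableOn_const _⟩
  have he : ContDiff ℝ ∞ edge1 := by unfold edge1; fun_prop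
  have cT : ∀ e : R2, Continuous (transD (fun _ => e) φ) :=
    fun e => cont_transD continuous_const (hφ.of_le (by norm_cast))
  have hec := he.continuous
  rw [mov_wk cv hG.fst hψ l0 (e := (1, 0)) (e' := 0) (fun χ hχ => by simpa [dr] using (h χ hχ).1)
    hφ hc hs (by fun_prop) (by simp [edge1]) ht,
    mov_wk cv hG.snd hψ l0 (e := (0, 1)) (e' := 0) (fun χ hχ => by simpa [dz] using (h χ hχ).2)
    hφ hc hs (by fun_prop) (by simp [edge1]) ht, funext (transD_eq edge1 φ)]
  refine Eq.trans (by simp [moving]) (mov_add (intble_ind_of_cpt hψ.loc (cpt_sweep hc)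
    (sweep_sub cv hs)) (by fun_prop) (hcs_transD hc).mul_right (by fun_prop)
    (hcs_transD hc).mul_right t)

lemma mov_wk_rot (cv : Convex ℝ Ω) {s : R2 → ℝ} (hζ : LocInt Ω ζ) (hsl : LocInt Ω s) (h : WRot Ω ζ
    s) {φ : Tri3 → ℝ} (hφ : ContDiff ℝ ∞ φ) (hc : HasCompactSupport φ) (hs : tsupport φ ⊆ cube3 Ω)
    {t : R2} (ht : t ∈ stdT) : moving ((sweep φ).indicator s) (fun X => φ X * pdet (edge1 X) (edge2
    X)) t = (moving ((sweep φ).indicator fun p => (ζ p).1) (fun X => transD edge1 φ X * (edge2 X).1)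
    t + moving ((sweep φ).indicator fun p => (ζ p).2) (fun X => transD edge1 φ X * (edge2 X).2) t) -
    (moving ((sweep φ).indicator fun p => (ζ p).1) (fun X => transD edge2 φ X * (edge1 X).1) t +
    moving ((sweep φ).indicator fun p => (ζ p).2) (fun X => transD edge2 φ X * (edge1 X).2) t) := by
  have he : ContDiff ℝ ∞ edge1 := by unfold edge1; fun_prop
  have he' : ContDiff ℝ ∞ edge2 := by unfold edge2; fun_prop
  have cT : ∀ {e : Tri3 → R2}, ContDiff ℝ ∞ e → Continuous (transD e φ) :=
    fun h => cont_transD h.continuous (hφ.of_le (by norm_cast))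
  have hec := he.continuous
  have hec' := he'.continuous
  have c1 := cT he
  have c2 := cT he'
  have c3 := fun e : R2 => cT (contDiff_const (c := e))
  have hC := cpt_sweep hc
  have hCΩ := sweep_sub cv hs
  have S : ∀ (e : Tri3 → R2) (f : Tri3 → ℝ), HasCompactSupport fun X => transD e φ X * f X :=
    fun _ _ => (hcs_transD hc).mul_right
  have A := mov_add (intble_ind_of_cpt hζ.fst.loc hC hCΩ)
    (Φ := fun X => transD edge2 φ X * (edge1 X).1)
    (Ψ := fun X => transD (fun _ => (0, -1)) φ X * pdet (edge1 X) (edge2 X)) (by fun_prop) (S _ _)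
    (by unfold pdet; fun_prop) (S _ _) t
  have B := mov_add (intble_ind_of_cpt hζ.snd.loc hC hCΩ)
    (Φ := fun X => transD edge2 φ X * (edge1 X).2)
    (Ψ := fun X => transD (fun _ => (1, 0)) φ X * pdet (edge1 X) (edge2 X)) (by fun_prop) (S _ _)
    (by unfold pdet; fun_prop) (S _ _) t
  have key := mov_wk cv hsl hζ.fst hζ.snd (e := (0, -1)) (e' := (1, 0)) (fun χ hχ => by
      rw [h χ hχ, ← integral_neg]
      congr 1; ext p; rw [fd_apply_eq, fd_apply_eq]; ring) hφ hc hs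
    (m := fun X => pdet (edge1 X) (edge2 X)) (by unfold pdet; fun_prop)
    (by simp [pdet, edge1, edge2]) ht
  rw [key, eq_sub_iff_add_eq', add_add_add_comm, A, B]
  congr 2 <;> ext X <;>
    simp only [transD_eq edge1, transD_eq edge2, transD_eq fun _ => (0, -1), pdet] <;> ring

/-! ### The fundamental theorem of calculus and Stokes' theorem along almost all simplices -/

/-- The integral of the vector field `ζ` along the segment from `x` to `y`. -/
def seg (ζ : R2 → R2) (x y : R2) : ℝ :=
  (y - x).1 * (∫ τ in I01, (ζ (x + τ • (y - x))).1) +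
    (y - x).2 * ∫ τ in I01, (ζ (x + τ • (y - x))).2

/-- The signed integral of `s` over the triangle `x y w`. -/
def tri (s : R2 → ℝ) (x y w : R2) : ℝ :=
  pdet (y - x) (w - x) * ∫ t in stdT, s (bpt t (x, y, w))

/-- The uniform measure on the segment from `a` to `b` of the parameter plane. -/
def lineT (a b : R2) : Measure R2 :=
  Measure.map (fun τ : ℝ => a + τ • (b - a)) (volume.restrict I01)

instance (a b : R2) : IsFiniteMeasure (lineT a b) := by unfold lineT; infer_instance

lemma int_lineT (a b : R2) (hg : Measurable g) : ∫ t, g t ∂(lineT a b) = ∫ τ in Icc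
    (0 : ℝ) 1, g (a + τ • (b - a)) := by
  unfold lineT
  rw [integral_map (by fun_prop) hg.aestronglyMeasurable]

lemma cvx_stdT : Convex ℝ stdT := by
  rintro x ⟨a, b, c⟩ y ⟨d, e, f⟩ p q hp hq hpq
  refine ⟨?_, ?_, ?_⟩ <;> simp <;> nlinarith

lemma ae_lineT_mem {a b : R2} (ha : a ∈ stdT) (hb : b ∈ stdT) : ∀ᵐ t ∂(lineT a b), t ∈ stdT := by
  unfold lineT
  refine (ae_map_iff (p := (· ∈ stdT)) (by fun_prop) cpt_stdT.measurableSet).2 ?_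
  filter_upwards [ae_restrict_mem measurableSet_Icc] with τ hτ
  exact cvx_stdT.add_smul_sub_mem ha hb hτ

lemma bpt_line (a b : R2) (τ : ℝ) (X : Tri3) : bpt (a + τ • (b - a)) X = bpt a X + τ •
    (bpt b X - bpt a X) := by
  ext <;> simp [bpt] <;> ring

lemma meas_bpt (X : Tri3) : Measurable fun t => bpt t X := by
  unfold bpt; fun_prop

lemma seg_bpt (ζ : R2 → R2) (hζ : Measurable ζ) (a b : R2) (X : Tri3) : seg ζ (bpt a X)
    (bpt b X) = (bpt b X - bpt a X).1 * (∫ t, (ζ (bpt t X)).1 ∂(lineT a b)) +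
    (bpt b X - bpt a X).2 * ∫ t, (ζ (bpt t X)).2 ∂(lineT a b) := by
  have m := hζ.comp (meas_bpt X)
  rw [int_lineT a b (g := fun t => (ζ (bpt t X)).1) m.fst,
    int_lineT a b (g := fun t => (ζ (bpt t X)).2) m.snd]
  simp only [bpt_line]
  rfl

lemma ae_eq_zero_on_cube3 (hΩ : IsOpen Ω) {F : Tri3 → ℝ} (hi : ∀ φ : Tri3 → ℝ, ContDiff ℝ ∞ φ →
    HasCompactSupport φ → tsupport φ ⊆ cube3 Ω → Integrable (fun X => φ X * F X) ∧ ∫ X, φ X * F X =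
    0) : ∀ᵐ X : Tri3, X ∈ cube3 Ω → F X = 0 := by
  have hU : IsOpen (cube3 Ω) := hΩ.prod (hΩ.prod hΩ)
  apply hU.ae_eq_zero_of_integral_contDiff_smul_eq_zero
  · intro X hX
    obtain ⟨f, h1, h2, h3, h4, h5⟩ := exists_contDiff_tsupport_subset (n := ⊤) (hU.mem_nhds hX)
    have hopen : IsOpen {Y | 1 / 2 < f Y} := isOpen_lt continuous_const h3.continuous
    refine ⟨{Y | 1 / 2 < f Y}, mem_nhdsWithin_of_mem_nhds (hopen.mem_nhds
      (by simp only [Set.mem_ofPred_eq, h5]; norm_num)), ?_⟩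
    have hI := ((hi f h3 h2 h1).1.integrableOn (s := {Y | 1 / 2 < f Y}))
    have : IntegrableOn (fun Y => (f Y)⁻¹ * (f Y * F Y)) {Y | 1 / 2 < f Y} := by
      refine hI.bdd_mul (c := 2) h3.continuous.measurable.inv.aestronglyMeasurable ?_
      filter_upwards [ae_restrict_mem hopen.measurableSet] with Y hY
      have hY : 1 / 2 < f Y := hY
      rw [norm_inv, norm_of_nonneg (by linarith), inv_le_comm₀ (by linarith) (by norm_num)]
      linarith
    refine this.congr_fun (fun Y hY => ?_) hopen.measurableSet
    simp only [Set.mem_ofPred_eq] at hY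
    have : f Y ≠ 0 := by linarith
    field_simp
  · intro φ h1 h2 h3
    simpa only [smul_eq_mul] using (hi φ h1 h2 h3).2

lemma v00 : ((0, 0) : R2) ∈ stdT := by simp [stdT]
lemma v10 : ((1, 0) : R2) ∈ stdT := by simp [stdT]
lemma v01 : ((0, 1) : R2) ∈ stdT := by simp [stdT]

@[simp] theorem bpt_corner00 (X : Tri3) : bpt (0, 0) X = X.1 := by simp [bpt]
@[simp] theorem bpt_corner10 (X : Tri3) : bpt (1, 0) X = X.2.1 := by simp [bpt]
@[simp] theorem bpt_corner01 (X : Tri3) : bpt (0, 1) X = X.2.2 := by simp [bpt]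

lemma sint_Icc_d {f f' : ℝ → ℝ} {b : ℝ} (hab : a ≤ b) (hd : ∀ x, HasDerivAt f (f' x) x)
    (hc : Continuous f') : ∫ x in Icc a b, f' x = f b - f a := by
  rw [integral_Icc_eq_integral_Ioc, ← intervalIntegral.integral_of_le hab]
  exact intervalIntegral.integral_eq_sub_of_hasDerivAt (fun x _ => hd x)
    (hc.intervalIntegrable _ _)

lemma intble_mul_seg (cv : Convex ℝ Ω) (hζ : LocInt Ω ζ) {φ : Tri3 → ℝ} (hφ : Continuous φ)
    (hc : HasCompactSupport φ) (hs : tsupport φ ⊆ cube3 Ω) {a b : R2} (ha : a ∈ stdT)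
    (hb : b ∈ stdT) : Integrable (fun X => φ X * seg ζ (bpt a X) (bpt b X)) ∧ ∫ X, φ X * seg ζ
    (bpt a X) (bpt b X) = ∫ τ in I01, (moving ((sweep φ).indicator fun p => (ζ p).1)
    (fun X => φ X * (bpt b X - bpt a X).1) (a + τ • (b - a)) + moving ((sweep φ).indicator fun p =>
    (ζ p).2) (fun X => φ X * (bpt b X - bpt a X).2) (a + τ • (b - a))) := by
  have hC := cpt_sweep hc
  have hCΩ := sweep_sub cv hs
  have he : Continuous fun X => bpt b X - bpt a X := by unfold bpt; fun_prop
  have c1 : Continuous fun X => φ X * (bpt b X - bpt a X).1 := by fun_prop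
  have c2 : Continuous fun X => φ X * (bpt b X - bpt a X).2 := by fun_prop
  obtain ⟨p3, q3⟩ := int_mul_avg hζ.fst.loc hζ.fst.meas c1 hc.mul_right (lineT a b)
    (ae_lineT_mem ha hb) hC hCΩ (sweep_mul_sub _ _)
  obtain ⟨p4, q4⟩ := int_mul_avg hζ.snd.loc hζ.snd.meas c2 hc.mul_right (lineT a b)
    (ae_lineT_mem ha hb) hC hCΩ (sweep_mul_sub _ _)
  have i1 := intble_ind_of_cpt hζ.fst.loc hC hCΩ
  have i2 := intble_ind_of_cpt hζ.snd.loc hC hCΩ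
  have k1 := cont_mov i1 c1 hc.mul_right
  have k2 := cont_mov i2 c2 hc.mul_right
  rw [int_lineT _ _ k1.measurable] at q3
  rw [int_lineT _ _ k2.measurable] at q4
  have hF : ∀ X, φ X * seg ζ (bpt a X) (bpt b X) =
      φ X * (bpt b X - bpt a X).1 * (∫ t, (ζ (bpt t X)).1 ∂(lineT a b)) +
        φ X * (bpt b X - bpt a X).2 * ∫ t, (ζ (bpt t X)).2 ∂(lineT a b) := by
    intro X
    rw [seg_bpt ζ hζ.meas]; ring
  simp only [hF]
  refine ⟨p3.add p4, ?_⟩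
  rw [integral_add p3 p4, q3, q4, ← integral_add]
  · exact (by fun_prop : Continuous _).integrableOn_Icc
  · exact (by fun_prop : Continuous _).integrableOn_Icc

lemma ae_sub_eq_seg_triple (hΩ : IsOpen Ω) (cv : Convex ℝ Ω) (hψ : LocInt Ω ψ) (hG : LocInt Ω G) (h
    : WGrad Ω ψ G) : ∀ᵐ X : Tri3, X ∈ cube3 Ω → ψ X.2.1 - ψ X.1 - seg G X.1 X.2.1 = 0 := by
  apply ae_eq_zero_on_cube3 hΩ
  intro φ hφ hc hs
  have hφc := hφ.continuous
  have he : Continuous edge1 := by unfold edge1; fun_prop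
  have hC := cpt_sweep hc
  have hCΩ := sweep_sub cv hs
  have dm : ∀ (t : R2), t ∈ stdT → ∀ᵐ t' ∂(Measure.dirac t), t' ∈ stdT := by
    intro t ht
    exact (ae_dirac_iff (p := (· ∈ stdT)) cpt_stdT.measurableSet).2 ht
  obtain ⟨p1, q1⟩ := int_mul_avg hψ.loc hψ.meas hφc hc (Measure.dirac (1, 0))
    (dm _ v10) hC hCΩ subset_rfl
  obtain ⟨p2, q2⟩ := int_mul_avg hψ.loc hψ.meas hφc hc (Measure.dirac (0, 0))
    (dm _ v00) hC hCΩ subset_rfl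
  obtain ⟨p3, q3⟩ := intble_mul_seg cv hG hφc hc hs v00 v10
  simp only [integral_dirac, bpt_corner00, bpt_corner10] at p1 q1 p2 q2 p3 q3
  have i3 := intble_ind_of_cpt hψ.loc hC hCΩ
  have hφ1 : ContDiff ℝ 1 φ := hφ.of_le (by norm_cast)
  have k3 := cont_mov i3 (cont_transD he hφ1) (hcs_transD hc)
  have ftc := sint_Icc_d zero_le_one
    (fun x => hd_mov_fst i3 hφ1 hc x 0) (by fun_prop)
  have key : ∫ X, φ X * seg G X.1 X.2.1 =
      moving ((sweep φ).indicator ψ) φ (1, 0) - moving ((sweep φ).indicator ψ) φ (0, 0) := by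
    rw [← ftc, q3]
    refine setIntegral_congr_fun measurableSet_Icc fun τ hτ => ?_
    have ht : ((0, 0) + τ • ((1, 0) - (0, 0)) : R2) = (τ, 0) := by ext <;> simp
    have hmem : ((τ, 0) : R2) ∈ stdT := ⟨hτ.1, le_rfl, by simpa using hτ.2⟩
    simp only [ht]
    exact mov_wk_grad cv hψ hG h hφ hc hs hmem
  have p12 : Integrable fun X : Tri3 => φ X * ψ X.2.1 - φ X * ψ X.1 := p1.sub p2
  simp only [mul_sub]
  refine ⟨p12.sub p3, ?_⟩
  rw [integral_sub p12 p3, integral_sub p1 p2, q1, q2, key, sub_self]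

lemma int_stdT_fst {D : R2 → ℝ} (hD : Continuous D) : ∫ t in stdT, D t = ∫ x in
    I01, ∫ y in Icc (0 : ℝ) (1 - x), D (x, y) := by
  have hi : Integrable (stdT.indicator D) := by
    rw [integrable_indicator_iff cpt_stdT.measurableSet]
    exact hD.continuousOn.integrableOn_compact cpt_stdT
  rw [← integral_indicator cpt_stdT.measurableSet, Measure.volume_eq_prod,
    integral_prod _ hi, ← integral_indicator measurableSet_Icc]
  congr 1; ext x
  by_cases hx : x ∈ I01
  · rw [indicator_of_mem hx, ← integral_indicator measurableSet_Icc]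
    congr 1; ext y
    by_cases hy : y ∈ Icc (0 : ℝ) (1 - x)
    · rw [indicator_of_mem hy, indicator_of_mem]
      exact ⟨hx.1, hy.1, by simp only; linarith [hy.2]⟩
    · rw [indicator_of_notMem hy, indicator_of_notMem]
      rintro ⟨a, b, c⟩
      exact hy ⟨b, by simp only at c; linarith⟩
  · rw [indicator_of_notMem hx]
    have : ∀ y, stdT.indicator D (x, y) = 0 := by
      intro y
      rw [indicator_of_notMem]
      rintro ⟨a, b, c⟩
      simp only at a b c
      exact hx ⟨a, by linarith⟩
    simp [this]

lemma int_stdT_swap {D : R2 → ℝ} : ∫ t in stdT, D t = ∫ t in stdT, D t.swap := by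
  have hmp : MeasurePreserving (Prod.swap : R2 → R2) volume volume :=
    Measure.measurePreserving_swap
  have := hmp.setIntegral_preimage_emb MeasurableEquiv.prodComm.measurableEmbedding D stdT
  rw [← this]
  congr 2
  ext ⟨a, b⟩
  simp [stdT, add_comm]
  tauto

lemma green_stdT {K₁ K₂ D₁ D₂ : R2 → ℝ} (hK₁ : Continuous K₁) (hK₂ : Continuous K₂) (hD₁ :
    Continuous D₁) (hD₂ : Continuous D₂) (h₁ : ∀ a b, HasDerivAt (fun x => K₂ (x, b)) (D₁ (a, b)) a)
    (h₂ : ∀ a b, HasDerivAt (fun x => K₁ (a, x)) (D₂ (a, b)) b) : ∫ t in stdT, (D₁ t - D₂ t) = ((∫ τ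
    in I01, K₂ (1 - τ, τ)) - ∫ τ in I01, K₂ (0, τ)) - ((∫ τ in I01, K₁ (1 - τ, τ)) - ∫ τ in I01, K₁
    (τ, 0)) := by
  rw [integral_sub (hD₁.continuousOn.integrableOn_compact cpt_stdT)
    (hD₂.continuousOn.integrableOn_compact cpt_stdT)]
  have e1 : ∫ t in stdT, D₁ t =
      (∫ τ in I01, K₂ (1 - τ, τ)) - ∫ τ in I01, K₂ (0, τ) := by
    rw [int_stdT_swap, int_stdT_fst (by fun_prop), ← integral_sub]
    · refine setIntegral_congr_fun measurableSet_Icc fun τ hτ => ?_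
      exact sint_Icc_d (f := fun x => K₂ (x, τ)) (by linarith [hτ.2])
        (fun x => h₁ x τ) (by fun_prop)
    · exact (by fun_prop : Continuous _).integrableOn_Icc
    · exact (by fun_prop : Continuous _).integrableOn_Icc
  have e2 : ∫ t in stdT, D₂ t =
      (∫ τ in I01, K₁ (1 - τ, τ)) - ∫ τ in I01, K₁ (τ, 0) := by
    have hsub : ∫ τ in I01, K₁ (1 - τ, τ) = ∫ τ in I01, K₁ (τ, 1 - τ) := by
      rw [integral_Icc_eq_integral_Ioc, integral_Icc_eq_integral_Ioc,
        ← intervalIntegral.integral_of_le zero_le_one, ← intervalIntegral.integral_of_le zero_le_one]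
      have := intervalIntegral.integral_comp_sub_left (a := 0) (b := 1)
        (fun τ => K₁ (τ, 1 - τ)) (1 : ℝ)
      simpa using this
    rw [hsub, int_stdT_fst hD₂, ← integral_sub]
    · refine setIntegral_congr_fun measurableSet_Icc fun τ hτ => ?_
      exact sint_Icc_d (f := fun x => K₁ (τ, x)) (by linarith [hτ.2])
        (fun x => h₂ τ x) (by fun_prop)
    · exact (by fun_prop : Continuous _).integrableOn_Icc
    · exact (by fun_prop : Continuous _).integrableOn_Icc
  rw [e1, e2]

lemma ae_stokes (hΩ : IsOpen Ω) (cv : Convex ℝ Ω) {s : R2 → ℝ} (hζ : LocInt Ω ζ)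
    (hsl : LocInt Ω s) (h : WRot Ω ζ s) : ∀ᵐ X : Tri3, X ∈ cube3 Ω → seg ζ X.1 X.2.1 + seg ζ X.2.1
    X.2.2 - seg ζ X.1 X.2.2 - tri s X.1 X.2.1 X.2.2 = 0 := by
  apply ae_eq_zero_on_cube3 hΩ
  intro φ hφ hc hs
  have hφc := hφ.continuous
  have hφ1 : ContDiff ℝ 1 φ := hφ.of_le (by norm_cast)
  have he1 : Continuous edge1 := by unfold edge1; fun_prop
  have he2 : Continuous edge2 := by unfold edge2; fun_prop
  have hC := cpt_sweep hc
  have hCΩ := sweep_sub cv hs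
  obtain ⟨p1, q1⟩ := intble_mul_seg cv hζ hφc hc hs v00 v10
  obtain ⟨p2, q2⟩ := intble_mul_seg cv hζ hφc hc hs v10 v01
  obtain ⟨p3, q3⟩ := intble_mul_seg cv hζ hφc hc hs v00 v01
  have c0 : Continuous fun X => φ X * pdet (edge1 X) (edge2 X) := by unfold pdet; fun_prop
  have : IsFiniteMeasure ((volume : Measure R2).restrict stdT) :=
    isFiniteMeasure_restrict.2 cpt_stdT.measure_lt_top.ne
  obtain ⟨p4, q4⟩ := int_mul_avg hsl.loc hsl.meas c0 hc.mul_right (volume.restrict stdT)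
    (ae_restrict_mem cpt_stdT.measurableSet) hC hCΩ (sweep_mul_sub _ _)
  simp only [bpt_corner00, bpt_corner10, bpt_corner01] at p1 q1 p2 q2 p3 q3
  set ζ₁ := (sweep φ).indicator fun p => (ζ p).1 with hζ₁
  set ζ₂ := (sweep φ).indicator fun p => (ζ p).2 with hζ₂
  have i1 : Integrable ζ₁ := intble_ind_of_cpt hζ.fst.loc hC hCΩ
  have i2 : Integrable ζ₂ := intble_ind_of_cpt hζ.snd.loc hC hCΩ
  set K : (Tri3 → R2) → (Tri3 → ℝ) → R2 → ℝ := fun e φ t =>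
    moving ζ₁ (fun X => φ X * (e X).1) t + moving ζ₂ (fun X => φ X * (e X).2) t with hK
  have kc : ∀ {e φ}, Continuous e → Continuous φ → HasCompactSupport φ → Continuous (K e φ) :=
    fun _ _ hc => (cont_mov i1 (by fun_prop) hc.mul_right).add
      (cont_mov i2 (by fun_prop) hc.mul_right)
  have kc1 := kc he1 hφc hc
  have kc2 := kc he2 hφc hc
  have g := green_stdT kc1 kc2
    (kc he2 (cont_transD he1 hφ1) (hcs_transD hc))
    (kc he1 (cont_transD he2 hφ1) (hcs_transD hc))
    (fun a b => by
      have u1 := hd_mov_fst i1 (φ := fun X => φ X * (edge2 X).1)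
        (by unfold edge2; fun_prop) hc.mul_right a b
      have u2 := hd_mov_fst i2 (φ := fun X => φ X * (edge2 X).2)
        (by unfold edge2; fun_prop) hc.mul_right a b
      rw [transD_mul_edge hφ1 (by unfold edge2; fun_prop) (by simp [edge2])] at u1 u2
      exact u1.add u2)
    (fun a b => by
      have u1 := hd_mov_snd i1 (φ := fun X => φ X * (edge1 X).1)
        (by unfold edge1; fun_prop) hc.mul_right a b
      have u2 := hd_mov_snd i2 (φ := fun X => φ X * (edge1 X).2)
        (by unfold edge1; fun_prop) hc.mul_right a b
      rw [transD_mul_edge hφ1 (by unfold edge1; fun_prop) (by simp [edge1])] at u1 u2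
      exact u1.add u2)
  have e4 : (∫ X, φ X * tri s X.1 X.2.1 X.2.2) = ∫ t in stdT,
      (K edge2 (transD edge1 φ) t - K edge1 (transD edge2 φ) t) := by
    have : ∀ X : Tri3, φ X * tri s X.1 X.2.1 X.2.2 = φ X * pdet (edge1 X) (edge2 X) *
        ∫ t in stdT, s (bpt t X) := by
      intro X; simp only [tri, edge1, edge2]; ring
    simp only [this]
    rw [q4]
    refine setIntegral_congr_fun cpt_stdT.measurableSet fun t ht => ?_
    exact mov_wk_rot cv hζ hsl h hφ hc hs ht
  have e1 : (∫ X, φ X * seg ζ X.1 X.2.1) = ∫ τ in I01, K edge1 φ (τ, 0) := by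
    rw [q1]
    congr 1; ext τ
    rw [show ((0, 0) + τ • ((1, 0) - (0, 0)) : R2) = (τ, 0) by ext <;> simp]
    rfl
  have e3 : (∫ X, φ X * seg ζ X.1 X.2.2) = ∫ τ in I01, K edge2 φ (0, τ) := by
    rw [q3]
    congr 1; ext τ
    rw [show ((0, 0) + τ • ((0, 1) - (0, 0)) : R2) = (0, τ) by ext <;> simp]
    rfl
  have e2 : (∫ X, φ X * seg ζ X.2.1 X.2.2) = ∫ τ in I01, (K edge2 φ (1 - τ, τ) -
      K edge1 φ (1 - τ, τ)) := by
    rw [q2]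
    congr 1; ext τ
    rw [show ((1, 0) + τ • ((0, 1) - (1, 0)) : R2) = (1 - τ, τ) by ext <;> simp; ring]
    simp only [hK]
    have w : ∀ {g : R2 → ℝ} (_ : Integrable g) {a b : Tri3 → ℝ} (_ : Continuous a)
        (_ : Continuous b) (t : R2), moving g (fun X => φ X * (a X - b X)) t =
          moving g (fun X => φ X * a X) t - moving g (fun X => φ X * b X) t := by
      intro g hg a b ha hb t
      have := integral_sub (intble_mov hg (hφc.mul ha) hc.mul_right t)
        (intble_mov hg (hφc.mul hb) hc.mul_right t)
      refine Eq.trans ?_ this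
      unfold moving
      congr 1; ext z; simp only [Pi.mul_apply]; ring
    have r1 := w i1 (a := fun X => (edge2 X).1) (b := fun X => (edge1 X).1) (by fun_prop)
      (by fun_prop) (1 - τ, τ)
    have r2 := w i2 (a := fun X => (edge2 X).2) (b := fun X => (edge1 X).2) (by fun_prop)
      (by fun_prop) (1 - τ, τ)
    have r3 : ∀ X : Tri3, (X.2.2 - X.2.1).1 = (edge2 X).1 - (edge1 X).1 := by
      intro X; simp [edge1, edge2]
    have r4 : ∀ X : Tri3, (X.2.2 - X.2.1).2 = (edge2 X).2 - (edge1 X).2 := by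
      intro X; simp [edge1, edge2]
    simp only [r3, r4]
    rw [r1, r2]; ring
  have p4' : Integrable fun X : Tri3 => φ X * tri s X.1 X.2.1 X.2.2 := by
    refine p4.congr (.of_forall fun X => ?_)
    simp only [tri, edge1, edge2]; ring
  simp only [mul_sub, mul_add]
  have p12 : Integrable fun X : Tri3 => φ X * seg ζ X.1 X.2.1 + φ X * seg ζ X.2.1 X.2.2 :=
    p1.add p2
  have p123 : Integrable fun X : Tri3 => φ X * seg ζ X.1 X.2.1 + φ X * seg ζ X.2.1 X.2.2 -
    φ X * seg ζ X.1 X.2.2 := p12.sub p3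
  refine ⟨p123.sub p4', ?_⟩
  rw [integral_sub p123 p4', integral_sub p12 p3, integral_add p1 p2, e1, e2, e3, e4, g,
    integral_sub]
  · ring
  · exact (by fun_prop : Continuous _).integrableOn_Icc
  · exact (by fun_prop : Continuous _).integrableOn_Icc

/-! ### Weak derivatives of Lipschitz functions -/

/-- The gradient of a Lipschitz function, by line derivatives. -/
def lgrad (f : R2 → ℝ) (p : R2) : R2 := (lD f p (1, 0), lD f p (0, 1))

lemma meas_lgrad (hf : Continuous f) : Measurable (lgrad f) :=
  (measurable_lineDeriv hf).prodMk (measurable_lineDeriv hf)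

lemma norm_lgrad_le {C : NNReal} (hf : LipschitzWith C f) (p : R2) : ‖lgrad f p‖ ≤ C := by
  have h1 := norm_lineDeriv_le_of_lipschitz ℝ hf (x₀ := p) (v := (1, 0))
  have h2 := norm_lineDeriv_le_of_lipschitz ℝ hf (x₀ := p) (v := (0, 1))
  have n1 : ‖((1, 0) : R2)‖ = 1 := by simp [norm_def]
  have n2 : ‖((0, 1) : R2)‖ = 1 := by simp [norm_def]
  rw [n1, mul_one] at h1; rw [n2, mul_one] at h2
  exact max_le h1 h2

lemma IsTest.lipschitz {φ : R2 → ℝ} (h : IsTest Ω φ) : ∃ C, LipschitzWith C φ :=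
  ContDiff.lipschitzWith_of_hasCompactSupport h.2.1 (h.1) (by simp)

lemma int_Ω_eq (h : ∀ p, p ∉ Ω → χ p = 0) : ∫ p in Ω, g p * χ p = ∫ p, g p * χ p := by
  rw [setIntegral_eq_integral_of_forall_compl_eq_zero]
  intro p hp
  rw [h p hp, mul_zero]

lemma IsTest.eq_zero {φ : R2 → ℝ} (h : IsTest Ω φ) (hp : p ∉ Ω) : φ p = 0 := by
  by_contra h'; exact hp (h.2.2 (subset_tsupport _ h'))

lemma IsTest.fderiv_eq_zero {φ : R2 → ℝ} (h : IsTest Ω φ) (hp : p ∉ Ω) (e : R2) : fderiv ℝ φ p e =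
    0 := by
  by_contra h'
  apply hp
  apply h.2.2
  apply support_fderiv_subset ℝ
  intro h0
  apply h'
  simp [h0]

lemma IsTest.lineDeriv_eq {φ : R2 → ℝ} (h : IsTest Ω φ) (p e : R2) : lD φ p e = fderiv ℝ φ p e :=
  (h.1.differentiable (by simp) p).lineDeriv_eq_fderiv

lemma int_lD_mul_test {C : NNReal} (hf : LipschitzWith C f) (hχ : IsTest Ω χ)
    (e : R2) : ∫ p in Ω, lD f p e * χ p = -∫ p in Ω, f p * fderiv ℝ χ p e := by
  obtain ⟨D, hD⟩ := hχ.lipschitz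
  rw [int_Ω_eq fun p hp => hχ.eq_zero hp,
    int_Ω_eq (χ := fun p => fderiv ℝ χ p e) fun p hp => hχ.fderiv_eq_zero hp e,
    hf.integral_lineDeriv_mul_eq hD hχ.2.1 e, ← integral_neg]
  congr 1; ext p
  rw [lineDeriv_neg, hχ.lineDeriv_eq]; ring

lemma wGrad_lgrad {C : NNReal} (hf : LipschitzWith C f) : WGrad Ω f (lgrad f) := fun _χ hχ =>
  ⟨int_lD_mul_test hf hχ (1, 0), int_lD_mul_test hf hχ (0, 1)⟩

lemma lD_eq_zero_of_nmem_supp {F : R2 → ℝ} (hp : p ∉ tsupport F) (b : R2) : lineDeriv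
    ℝ F p b = 0 := by
  have : F =ᶠ[nhds p] 0 := notMem_tsupport_iff_eventuallyEq.1 hp
  rw [this.lineDeriv_eq]
  simp [lineDeriv]

lemma intble_lD_of_hcs {F : R2 → ℝ} {D : NNReal} (hF : LipschitzWith D F)
    (hc : HasCompactSupport F) (b : R2) : Integrable fun p => lD F p b := by
  rw [← integrableOn_iff_integrable_of_support_subset (s := tsupport F)]
  · exact (hF.locallyIntegrable_lineDeriv (μ := volume) b).integrableOn_isCompact hc.isCompact
  · intro p hp
    by_contra h
    exact hp (lD_eq_zero_of_nmem_supp h b)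

lemma int_lD_mul_lD {F : R2 → ℝ} {C D : NNReal} (hg : LipschitzWith C g)
    (hF : LipschitzWith D F) (hc : HasCompactSupport F) (a b : R2) : ∫ p, lD g p a *
    lD F p b = ∫ p, lD g p b * lD F p a := by
  have hFb := intble_lD_of_hcs hF hc b
  have l1 := LipschitzWith.integral_inv_smul_sub_mul_tendsto_integral_lineDeriv_mul
    (μ := (volume : Measure R2)) hg hFb a
  set K := Metric.cthickening ‖a‖ (tsupport F) with hK
  have hKc : IsCompact K := IsCompact.cthickening hc
  have hgb : Integrable (K.indicator fun p => lD g p b) := by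
    rw [integrable_indicator_iff hKc.measurableSet]
    exact (hg.locallyIntegrable_lineDeriv (μ := volume) b).integrableOn_isCompact hKc
  have l2 := LipschitzWith.integral_inv_smul_sub_mul_tendsto_integral_lineDeriv_mul
    (μ := (volume : Measure R2)) hF hgb (-a)
  have l2' := l2.neg
  have hlim : -∫ p, lD F p (-a) * K.indicator (fun p => lD g p b) p =
      ∫ p, lD g p b * lD F p a := by
    rw [← integral_neg]
    congr 1; ext p
    rw [lineDeriv_neg]
    by_cases hp : p ∈ K
    · rw [indicator_of_mem hp]; ring
    · have : p ∉ tsupport F := fun h => hp (Metric.self_subset_cthickening _ h)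
      rw [lD_eq_zero_of_nmem_supp this]; ring
  rw [hlim] at l2'
  have i : ∀ c, Integrable fun x => lD g x b * F (x - c) := fun c =>
    ((hF.continuous.comp (continuous_sub_right _)).integrable_of_hasCompactSupport
      (hc.comp_homeomorph (Homeomorph.subRight c))).bdd_mul (c := C * ‖b‖)
      (hg.memLp_lineDeriv (μ := (volume : Measure R2)) b).1
      (.of_forall fun x => norm_lineDeriv_le_of_lipschitz ℝ hg)
  have j : ∀ c, Integrable fun x => g (x + c) * lD F x b := fun c => by
    rw [← integrableOn_iff_integrable_of_support_subset (s := tsupport F)]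
    · exact hFb.integrableOn.continuousOn_mul
        (hg.continuous.comp (continuous_add_const c)).continuousOn hc.isCompact
    · intro p hp
      by_contra h
      exact hp (by simp [lD_eq_zero_of_nmem_supp h b])
  have k : ∀ c, ∫ x, g (x + c) * lD F x b = -∫ x, lD g x b * F (x - c) := by
    intro c
    have hgc : LipschitzWith C fun x => g (x + c) :=
      LipschitzWith.of_dist_le_mul fun x y => by simpa using hg.dist_le_mul (x + c) (y + c)
    have ibp := hgc.integral_lineDeriv_mul_eq (μ := (volume : Measure R2)) hF hc (-b)
    rw [neg_neg] at ibp
    rw [← integral_add_right_eq_self (fun x => lD g x b * F (x - c)) c, ← integral_neg]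
    simp only [mul_comm (g _), ← ibp, lineDeriv_neg, add_sub_cancel_right, neg_mul]
    simp only [lineDeriv, add_right_comm]
  refine tendsto_nhds_unique_of_eventuallyEq l1 l2' ?_
  filter_upwards [Ioc_mem_nhdsGT zero_lt_one] with t ht
  have e4 : ∫ x, t⁻¹ • (F (x + t • (-a)) - F x) * K.indicator (fun p => lD g p b) x =
      ∫ x, t⁻¹ * (lD g x b * F (x - t • a) - lD g x b * F (x - 0)) := by
    congr 1; ext x
    rw [smul_neg, ← sub_eq_add_neg, sub_zero]
    by_cases hx : x ∈ K
    · rw [indicator_of_mem hx, smul_eq_mul]; ring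
    · have h1 : F x = 0 := by
        by_contra h; exact hx (Metric.self_subset_cthickening _ (subset_tsupport _ h))
      have h2 : F (x - t • a) = 0 := by
        by_contra h
        refine hx (Metric.mem_cthickening_of_dist_le _ _ ‖a‖ _ (subset_tsupport _ h) ?_)
        simp only [dist_self_sub_right, norm_smul, norm_eq_abs, abs_of_pos ht.1]
        nlinarith [norm_nonneg a, ht.2]
      rw [h1, h2]; simp
  have e : ∫ x, t⁻¹ • (g (x + t • a) - g x) * lD F x b =
      ∫ x, t⁻¹ * (g (x + t • a) * lD F x b - g (x + 0) * lD F x b) := by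
    congr 1; ext x; rw [add_zero, smul_eq_mul]; ring
  rw [e, e4, integral_const_mul, integral_const_mul, integral_sub (j _) (j _),
    integral_sub (i _) (i _), k, k]
  ring

lemma wRot_smul_lgrad {C D : NNReal} (hf : LipschitzWith C f) (hg : LipschitzWith D g) : WRot Ω
    (fun p => f p • lgrad g p) (fun p => pdet (lgrad f p) (lgrad g p)) := by
  intro χ hχ
  obtain ⟨E, hE⟩ := hχ.lipschitz
  have hχc := hχ.1.continuous
  have hloc : ∀ e, MemLp (fun p => lD g p e) ⊤ (volume : Measure R2) :=
    fun e => hg.memLp_lineDeriv e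
  have hlocf : ∀ e, MemLp (fun p => lD f p e) ⊤ (volume : Measure R2) :=
    fun e => hf.memLp_lineDeriv e
  set F : R2 → ℝ := fun p => f p * χ p with hFdef
  have hFc : HasCompactSupport F := hχ.2.1.mul_left
  have hFL : ∃ K, LipschitzWith K F := by
    obtain ⟨M, hM⟩ := hFc.exists_bound_of_continuous (hf.continuous.mul hχc)
    obtain ⟨M₁, hM₁⟩ := hχ.2.1.exists_bound_of_continuous hχc
    obtain ⟨M₂, hM₂⟩ := hχ.2.1.isCompact.exists_bound_of_continuousOn hf.continuous.continuousOn
    have hM₁0 : 0 ≤ M₁ := (norm_nonneg _).trans (hM₁ 0)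
    refine ⟨⟨C * M₁ + |M₂| * E, by positivity⟩, ?_⟩
    have key : ∀ x y, x ∈ tsupport χ → dist (F x) (F y) ≤ (C * M₁ + |M₂| * E) * dist x y := by
      intro x y hx
      have h1 : F x - F y = f x * (χ x - χ y) + (f x - f y) * χ y := by simp only [hFdef]; ring
      rw [Real.dist_eq, h1]
      have a1 := hE.dist_le_mul x y
      have a2 := hf.dist_le_mul x y
      rw [Real.dist_eq] at a1 a2
      have a3 : |f x| ≤ |M₂| := (hM₂ x hx).trans (le_abs_self _)
      have a4 : |χ y| ≤ M₁ := hM₁ y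
      calc |f x * (χ x - χ y) + (f x - f y) * χ y| ≤ |f x| * |χ x - χ y| + |f x - f y| * |χ y| := by
            rw [← abs_mul, ← abs_mul]; exact abs_add_le _ _
        _ ≤ |M₂| * (E * dist x y) + (C * dist x y) * M₁ := by gcongr
        _ = _ := by ring
    refine LipschitzWith.of_dist_le_mul fun x y => ?_
    change dist (F x) (F y) ≤ (C * M₁ + |M₂| * E) * dist x y
    by_cases hx : x ∈ tsupport χ
    · exact key x y hx
    · by_cases hy : y ∈ tsupport χ
      · rw [dist_comm, dist_comm x y]; exact key y x hy
      · simp only [hFdef, image_eq_zero_of_notMem_tsupport hx, image_eq_zero_of_notMem_tsupport hy,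
          mul_zero, dist_self]
        positivity
  obtain ⟨K, hFK⟩ := hFL
  have main := int_lD_mul_lD hg hFK hFc (1, 0) (0, 1)
  have prod : ∀ e, ∀ᵐ p : R2, lD F p e =
      lD f p e * χ p + f p * fderiv ℝ χ p e := by
    intro e
    filter_upwards [hf.ae_lineDifferentiableAt (μ := (volume : Measure R2)) e] with p hp
    have h2 : HasLineDerivAt ℝ χ (fderiv ℝ χ p e) p e :=
      (hχ.1.differentiable (by simp) p).hasFDerivAt.hasLineDerivAt e
    have := HasDerivAt.mul hp.hasLineDerivAt h2
    have h3 : HasLineDerivAt ℝ F (lD f p e * χ p + f p * fderiv ℝ χ p e) p e := by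
      unfold HasLineDerivAt
      convert! this using 1
      simp
    exact h3.lineDeriv
  have hdc : ∀ e, Continuous fun p => fderiv ℝ χ p e := fun e =>
    (hχ.1.continuous_fderiv (by simp)).clm_apply continuous_const
  have I1 : ∀ e e', Integrable fun p => lD g p e * (lD f p e' * χ p) := by
    intro e e'
    refine Integrable.bdd_mul (c := D * ‖e‖) ?_ (hloc e).aestronglyMeasurable
      (.of_forall fun x => norm_lineDeriv_le_of_lipschitz ℝ hg)
    exact (hχc.integrable_of_hasCompactSupport hχ.2.1).bdd_mul (c := C * ‖e'‖)
      (hlocf e').aestronglyMeasurable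
      (.of_forall fun x => norm_lineDeriv_le_of_lipschitz ℝ hf)
  have I2 : ∀ e e', Integrable fun p => lD g p e * (f p * fderiv ℝ χ p e') := by
    intro e e'
    refine Integrable.bdd_mul (c := D * ‖e‖) ?_ (hloc e).aestronglyMeasurable
      (.of_forall fun x => norm_lineDeriv_le_of_lipschitz ℝ hg)
    exact (hf.continuous.mul (hdc e')).integrable_of_hasCompactSupport
      (hχ.2.1.fderiv_apply (𝕜 := ℝ) e').mul_left
  have ex : ∀ e e', ∫ p, lD g p e * lD F p e' =
      (∫ p, lD g p e * (lD f p e' * χ p)) +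
        ∫ p, lD g p e * (f p * fderiv ℝ χ p e') := by
    intro e e'
    rw [← integral_add (I1 e e') (I2 e e')]
    apply integral_congr_ae
    filter_upwards [prod e'] with p hp
    rw [hp]; ring
  rw [ex, ex] at main
  rw [int_Ω_eq fun p hp => hχ.eq_zero hp,
    setIntegral_eq_integral_of_forall_compl_eq_zero]
  · have l : ∫ p, pdet (lgrad f p) (lgrad g p) * χ p =
        (∫ p, lD g p (0, 1) * (lD f p (1, 0) * χ p)) -
          ∫ p, lD g p (1, 0) * (lD f p (0, 1) * χ p) := by
      rw [← integral_sub (I1 _ _) (I1 _ _)]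
      congr 1; ext p; simp only [pdet, lgrad]; ring
    have r : ∫ p, ((f p • lgrad g p).1 * dz χ p - (f p • lgrad g p).2 * dr χ p) =
        (∫ p, lD g p (1, 0) * (f p * fderiv ℝ χ p (0, 1))) -
          ∫ p, lD g p (0, 1) * (f p * fderiv ℝ χ p (1, 0)) := by
      rw [← integral_sub (I2 _ _) (I2 _ _)]
      congr 1; ext p; simp only [lgrad, dr, dz, Prod.smul_mk, smul_eq_mul]; ring
    rw [l, r]; linarith
  · intro p hp
    simp [dr, dz, hχ.fderiv_eq_zero hp]

/-! ### Triangles and barycentric coordinates -/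

/-- The closed triangle with vertex set `s`. -/
abbrev hull (s : Finset R2) : Set R2 := convexHull ℝ (s : Set R2)

/-- `s` is the vertex set of a nondegenerate triangle. -/
def IsTri (s : Finset R2) : Prop :=
  s.card = 3 ∧ AffineIndependent ℝ ((↑) : s → R2)

lemma sub_hull (hp : p ∈ s) : p ∈ hull s := subset_convexHull ℝ _ hp

lemma IsTri.nonempty (hs : IsTri s) : s.Nonempty := Finset.card_pos.1 (by rw [hs.1]; norm_num)

lemma rank_pl : Module.finrank ℝ R2 = 2 := by
  simp [Module.finrank_prod]

/-- The data `(g, b)` of the barycentric coordinates `p ↦ g v · p + b v` of a triangle. -/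
structure IsBary (s : Finset R2) (g : R2 → R2) (b : R2 → ℝ) : Prop where
  grad_zero : ∀ v, v ∉ s → g v = 0
  off_zero : ∀ v, v ∉ s → b v = 0
  sum_one : ∀ p, ∑ v ∈ s, (pdot (g v) p + b v) = 1
  sum_smul : ∀ p, ∑ v ∈ s, (pdot (g v) p + b v) • v = p
  delta : ∀ v ∈ s, ∀ w ∈ s, pdot (g v) w + b v = if v = w then 1 else 0

lemma affine_eq_pdot (f : R2 →ᵃ[ℝ] ℝ) (p : R2) : f p = pdot (f.linear (1, 0), f.linear (0, 1)) p +
    f 0 := by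
  have h1 : f p = f.linear p + f 0 := by
    have := f.linearMap_vsub p 0
    simp only [vsub_eq_sub, sub_zero] at this
    rw [this]; ring
  have h2 : p = p.1 • ((1 : ℝ), (0 : ℝ)) + p.2 • ((0 : ℝ), (1 : ℝ)) := by ext <;> simp
  rw [h1]
  conv_lhs => rw [h2]
  rw [map_add, map_smul, map_smul]
  simp only [pdot, smul_eq_mul]; ring

lemma IsTri.ex_bary (hs : IsTri s) : ∃ g b, IsBary s g b := by
  classical
  have htop : affineSpan ℝ (Set.range ((↑) : s → R2)) = ⊤ := by
    rw [hs.2.affineSpan_eq_top_iff_card_eq_finrank_add_one, rank_pl]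
    simp [hs.1]
  let B : AffineBasis s ℝ R2 := ⟨_, hs.2, htop⟩
  have hB : ∀ w : s, B w = (w : R2) := fun w => rfl
  let g : R2 → R2 := fun v => if h : v ∈ s then
    ((B.coord ⟨v, h⟩).linear (1, 0), (B.coord ⟨v, h⟩).linear (0, 1)) else 0
  let b : R2 → ℝ := fun v => if h : v ∈ s then B.coord ⟨v, h⟩ 0 else 0
  have key : ∀ (v : s) p, pdot (g v) p + b v = B.coord v p := by
    intro v p
    have hv := v.2
    simp only [g, b, hv, dif_pos]
    exact (affine_eq_pdot _ p).symm
  refine ⟨g, b, fun v hv => by simp [g, hv], fun v hv => by simp [b, hv], fun p => ?_, fun p => ?_,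
    fun v hv w hw => ?_⟩
  · rw [← Finset.sum_coe_sort s]
    simp only [key]
    exact B.sum_coord_apply_eq_one p
  · rw [← Finset.sum_coe_sort s]
    simp only [key]
    exact B.linear_combination_coord_eq_self p
  · rw [key ⟨v, hv⟩]
    have := B.coord_apply ⟨v, hv⟩ ⟨w, hw⟩
    rw [hB] at this
    simpa using this

open Classical in
/-- The gradients of the barycentric coordinates of `s`. -/
def lamG (s : Finset R2) : R2 → R2 := if h : IsTri s then h.ex_bary.choose else 0

open Classical in
/-- The constant terms of the barycentric coordinates of `s`. -/
def lamB (s : Finset R2) : R2 → ℝ :=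
  if h : IsTri s then h.ex_bary.choose_spec.choose else 0

lemma IsTri.isBary (hs : IsTri s) : IsBary s (lamG s) (lamB s) := by
  unfold lamG lamB
  rw [dif_pos hs, dif_pos hs]
  exact hs.ex_bary.choose_spec.choose_spec

/-- The barycentric coordinates, extended to the plane. -/
def lam (s : Finset R2) (v p : R2) : ℝ := pdot (lamG s v) p + lamB s v

lemma lam_sub (s : Finset R2) (v p q : R2) : lam s v p - lam s v q = pdot (lamG s v) (p - q) := by
  simp only [lam, pdot, fst_sub, snd_sub]; ring

lemma lam_combo (s : Finset R2) (v p q : R2) {b : ℝ} (h : a + b = 1) : lam s v (a • p + b • q) =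
    a * lam s v p + b * lam s v q := by
  obtain rfl : b = 1 - a := by linarith
  simp only [lam, pdot, Prod.fst_add, Prod.snd_add, smul_fst, smul_snd, smul_eq_mul]
  ring

lemma abs_pdot_le (p q : R2) : |pdot p q| ≤ 2 * ‖p‖ * ‖q‖ := by
  have h1 : |p.1 * q.1| ≤ ‖p‖ * ‖q‖ := by
    rw [abs_mul]; exact mul_le_mul (norm_fst_le p) (norm_fst_le q) (abs_nonneg _) (norm_nonneg _)
  have h2 : |p.2 * q.2| ≤ ‖p‖ * ‖q‖ := by
    rw [abs_mul]; exact mul_le_mul (norm_snd_le p) (norm_snd_le q) (abs_nonneg _) (norm_nonneg _)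
  have h3 := abs_add_le (p.1 * q.1) (p.2 * q.2)
  unfold pdot; linarith

lemma abs_pdet_le (p q : R2) : |pdet p q| ≤ 2 * ‖p‖ * ‖q‖ := by
  simpa [pdet, pdot, norm_def, max_comm, sub_eq_add_neg] using abs_pdot_le p (q.2, -q.1)

lemma cvx_lam_nn (s : Finset R2) : Convex ℝ {p | ∀ v ∈ s, 0 ≤ lam s v p} := by
  intro p hp q hq a b ha hb hab v hv
  rw [lam_combo s v p q hab]
  have := hp v hv; have := hq v hv
  positivity

lemma IsTri.mem_hull_iff (hs : IsTri s) : p ∈ hull s ↔ ∀ v ∈ s, 0 ≤ lam s v p := by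
  constructor
  · intro hp
    refine convexHull_min (t := {p | ∀ v ∈ s, 0 ≤ lam s v p}) ?_ (cvx_lam_nn s) hp
    intro w hw v hv
    unfold lam
    rw [hs.isBary.delta v hv w hw]
    split_ifs <;> norm_num
  · intro h
    rw [← hs.isBary.sum_smul p]
    exact (convex_convexHull ℝ _).sum_mem h (hs.isBary.sum_one p)
      fun v hv => sub_hull hv

lemma IsTri.lam_nn (hs : IsTri s) (hp : p ∈ hull s) (v : R2) : 0 ≤ lam s v p := by
  by_cases hv : v ∈ s
  · exact hs.mem_hull_iff.1 hp v hv
  · simp [lam, hs.isBary.grad_zero v hv, hs.isBary.off_zero v hv, pdot]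

lemma IsTri.lam_le_one (hs : IsTri s) (hp : p ∈ hull s) (v : R2) : lam s v p ≤ 1 := by
  by_cases hv : v ∈ s
  · rw [← hs.isBary.sum_one p]
    exact Finset.single_le_sum (f := fun v => lam s v p) (fun w _ => hs.lam_nn hp w) hv
  · simp [lam, hs.isBary.grad_zero v hv, hs.isBary.off_zero v hv, pdot]

lemma cpt_hull (s : Finset R2) : IsCompact (hull s) :=
  s.finite_toSet.isCompact_convexHull (𝕜 := ℝ)

lemma mset_hull (s : Finset R2) : MeasurableSet (hull s) :=
  (cpt_hull s).isClosed.measurableSet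

lemma vol_hull_lt_top (s : Finset R2) : volume (hull s) < ⊤ :=
  (cpt_hull s).measure_lt_top

lemma vol_hull_eq_zero (hs : AffineIndependent ℝ ((↑) : s → R2)) (hcard : s.card ≠ 3) : volume
    (hull s) = 0 := by
  have h : affineSpan ℝ (s : Set R2) ≠ ⊤ := by
    intro h
    have := (hs.affineSpan_eq_top_iff_card_eq_finrank_add_one).1 (by simpa using h)
    rw [rank_pl] at this
    simp at this; omega
  refine measure_mono_null ?_ (Measure.addHaar_affineSubspace volume _ h)
  exact convexHull_subset_affineSpan _

/-! ### Sizes -/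

lemma dist_le_eDist (p q : R2) : ‖p - q‖ ≤ eDist p q := by
  rw [norm_def, max_le_iff]
  unfold eDist
  constructor <;> apply Real.abs_le_sqrt <;> simp only [fst_sub, snd_sub]
  · nlinarith [sq_nonneg (p.2 - q.2)]
  · nlinarith [sq_nonneg (p.1 - q.1)]

lemma fin_eDist (s : Finset R2) : {d | ∃ p ∈ s, ∃ q ∈ s, d = eDist p q}.Finite := by
  refine ((s.product s).image fun x => eDist x.1 x.2).finite_toSet.subset ?_
  rintro d ⟨p, hp, q, hq, rfl⟩
  simp only [Finset.coe_image, Set.mem_image]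
  exact ⟨(p, q), Finset.mem_coe.2 (Finset.mem_product.2 ⟨hp, hq⟩), rfl⟩

lemma eDist_le_diam (hp : p ∈ s) (hq : q ∈ s) : eDist p q ≤ dK s :=
  le_csSup (fin_eDist s).bddAbove ⟨p, hp, q, hq, rfl⟩

lemma norm_sub_le_diam (hp : p ∈ hull s) (hq : q ∈ hull s) : ‖p - q‖ ≤ dK s := by
  obtain ⟨v, hv, w, hw, h⟩ := convexHull_exists_dist_ge2 hp hq
  rw [← dist_eq_norm]
  exact h.trans (by rw [dist_eq_norm]; exact (dist_le_eDist v w).trans (eDist_le_diam hv hw))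

lemma diam_nn (s : Finset R2) : 0 ≤ dK s :=
  Real.sSup_nonneg (by rintro d ⟨p, _, q, _, rfl⟩; exact Real.sqrt_nonneg _)

lemma IsTri.dpos (hs : IsTri s) : 0 < dK s := by
  obtain ⟨p, hp, q, hq, hpq⟩ := Finset.one_lt_card.1 (by rw [hs.1]; norm_num : 1 < s.card)
  have h1 : 0 < ‖p - q‖ := norm_pos_iff.2 (sub_ne_zero.2 hpq)
  exact h1.trans_le (norm_sub_le_diam (sub_hull hp) (sub_hull hq))

lemma IsTri.vol_pos (hs : IsTri s) {σ : ℝ}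
    (hσ : dK s ^ 2 ≤ σ * volume.real (hull s)) : 0 < σ ∧ 0 < volume.real (hull s) := by
  have h := (sq_pos_of_pos hs.dpos).trans_le hσ
  have h3 := measureReal_nonneg.lt_of_ne' (right_ne_zero_of_mul h.ne')
  exact ⟨pos_of_mul_pos_left h h3.le, h3⟩

lemma vol_le_of_strip {K : Set R2} (hK : MeasurableSet K) {c h ℓ : ℝ} (hh : 0 ≤ h)
    (hℓ : 0 ≤ ℓ) (h2 : ∀ p ∈ K, p.2 ∈ Icc (c - h) (c + h))
    (h1 : ∀ z, ∃ a, ∀ x, (x, z) ∈ K → x ∈ Icc a (a + ℓ)) : volume.real K ≤ 2 * h * ℓ := by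
  have : volume K ≤ ofReal (2 * h * ℓ) := by
    rw [Measure.volume_eq_prod, Measure.prod_apply_symm hK]
    calc _ ≤ ∫⁻ z, (Icc (c - h) (c + h)).indicator (fun _ => ofReal ℓ) z := by
          apply lintegral_mono
          intro z
          by_cases hz : z ∈ Icc (c - h) (c + h)
          · rw [indicator_of_mem hz]
            obtain ⟨a, ha⟩ := h1 z
            calc _ ≤ volume (Icc a (a + ℓ)) := measure_mono fun x hx => ha x hx
              _ = _ := by rw [Real.volume_Icc]; congr 1; ring
          · rw [indicator_of_notMem hz]
            have : (fun x => (x, z)) ⁻¹' K = ∅ := by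
              ext x; simp only [Set.mem_preimage, Set.mem_empty_iff_false, iff_false]
              exact fun hx => hz (h2 _ hx)
            simp [this]
      _ = _ := by
          rw [lintegral_indicator measurableSet_Icc, setLIntegral_const, Real.volume_Icc,
            ← ofReal_mul hℓ]
          congr 1; ring
  exact ENNReal.toReal_le_of_le_ofReal (by positivity) this

lemma strip_slope {g c : ℝ} (hg : g ≠ 0) : ∃ a, ∀ x, 0 ≤ g * x + c → g * x + c ≤ 1 → x ∈ Icc a
    (a + 1 / |g|) := by
  rcases lt_or_gt_of_ne hg with h | h
  · refine ⟨(1 - c) / g, fun x h1 h2 => ⟨?_, ?_⟩⟩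
    · rw [div_le_iff_of_neg h]; linarith
    · rw [abs_of_neg h, show (1 - c) / g + 1 / -g = (-c) / g by field_simp; ring,
        le_div_iff_of_neg h]; linarith
  · refine ⟨-c / g, fun x h1 h2 => ⟨?_, ?_⟩⟩
    · rw [div_le_iff₀ h]; linarith
    · rw [abs_of_pos h, ← add_div, le_div_iff₀ h]; linarith

lemma vol_swap (K : Set R2) : volume.real (Prod.swap ⁻¹' K) = volume.real K := by
  have := (Measure.measurePreserving_swap (μ := (volume : Measure ℝ)) (ν := (volume : Measure ℝ)))
  unfold Measure.real
  rw [Measure.volume_eq_prod]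
  exact congrArg _ (MeasurePreserving.measure_preimage_equiv (f := MeasurableEquiv.prodComm) this K)

lemma IsTri.norm_lamG_le (hs : IsTri s) {σ : ℝ} (hσ : dK s ^ 2 ≤ σ * volume.real (hull s))
    (v : R2) : ‖lamG s v‖ ≤ 2 * σ / dK s := by
  have hd := hs.dpos
  have hσ0 := (hs.vol_pos hσ).1.le
  obtain ⟨q, hq⟩ := hs.nonempty
  have hqh : q ∈ hull s := sub_hull hq
  have h0 : ∀ p ∈ hull s, 0 ≤ lam s v p ∧ lam s v p ≤ 1 :=
    fun p hp => ⟨hs.lam_nn hp v, hs.lam_le_one hp v⟩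
  have hnear : ∀ p ∈ hull s, |p.1 - q.1| ≤ dK s ∧ |p.2 - q.2| ≤ dK s := fun p hp =>
    ⟨(norm_fst_le (p - q)).trans (norm_sub_le_diam hp hqh),
      (norm_snd_le (p - q)).trans (norm_sub_le_diam hp hqh)⟩
  have fin : ∀ g : ℝ, (g ≠ 0 → volume.real (hull s) ≤ 2 * dK s * (1 / |g|)) →
      |g| ≤ 2 * σ / dK s := by
    intro g hg
    rcases eq_or_ne g 0 with rfl | h
    · simp; positivity
    · have h1 := hg h
      have h2 : dK s ^ 2 ≤ σ * (2 * dK s * (1 / |g|)) :=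
        hσ.trans (mul_le_mul_of_nonneg_left h1 hσ0)
      have hgp := abs_pos.2 h
      rw [le_div_iff₀ hd]
      have h3 : dK s ^ 2 * |g| ≤ 2 * σ * dK s := by
        calc _ ≤ σ * (2 * dK s * (1 / |g|)) * |g| := by gcongr
          _ = _ := by field_simp
      nlinarith
  rw [norm_def, max_le_iff]
  constructor
  · refine fin _ fun hg => vol_le_of_strip (mset_hull s) (c := q.2) hd.le
      (by positivity) (fun p hp => ?_) fun z => ?_
    · have := abs_le.1 (hnear p hp).2
      constructor <;> linarith
    · obtain ⟨a, ha⟩ := strip_slope (c := (lamG s v).2 * z + lamB s v) hg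
      refine ⟨a, fun x hx => ?_⟩
      have := h0 _ hx
      simp only [lam, pdot] at this
      exact ha x (by linarith) (by linarith)
  · refine fin _ fun hg => ?_
    rw [← vol_swap]
    refine vol_le_of_strip (measurable_swap (mset_hull s)) (c := q.1) hd.le
      (by positivity) (fun p hp => ?_) fun z => ?_
    · have := abs_le.1 (hnear p.swap hp).1
      simp only [Prod.fst_swap] at this
      constructor <;> linarith
    · obtain ⟨a, ha⟩ := strip_slope (c := (lamG s v).1 * z + lamB s v) hg
      refine ⟨a, fun x hx => ?_⟩
      have := h0 _ hx
      simp only [lam, pdot, Prod.swap_prod_mk] at this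
      exact ha x (by linarith) (by linarith)

lemma IsTri.diam_le_of_fst_le (hs : IsTri s) {σ ρ : ℝ} (hσ : dK s ^ 2 ≤ σ * volume.real (hull s))
    (h0 : ∀ v ∈ s, 0 ≤ v.1) (hρ : ∀ v ∈ s, v.1 ≤ ρ) : dK s ≤ 2 * σ * ρ := by
  have hd := hs.dpos
  have hσ0 := (hs.vol_pos hσ).1.le
  obtain ⟨q, hq⟩ := hs.nonempty
  have hqh : q ∈ hull s := sub_hull hq
  have hsub : hull s ⊆ {p | p.1 ∈ Icc 0 ρ} :=
    convexHull_min (fun v hv => ⟨h0 v hv, hρ v hv⟩)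
      ((convex_Icc 0 ρ).linear_preimage (LinearMap.fst ℝ ℝ ℝ))
  have : volume.real (hull s) ≤ 2 * dK s * ρ := by
    refine vol_le_of_strip (mset_hull s) (c := q.2) hd.le
      ((h0 q hq).trans (hρ q hq)) (fun p hp => ?_) fun z => ⟨0, fun x hx => ?_⟩
    · have := abs_le.1 ((norm_snd_le (p - q)).trans (norm_sub_le_diam hp hqh))
      simp only [snd_sub] at this
      constructor <;> linarith
    · simpa using hsub hx
  nlinarith [mul_le_mul_of_nonneg_left this hσ0]

/-! ### The meridian domain -/

lemma IsMeridianDomain.isOpen (h : IsMeridianDomain Ω) : IsOpen Ω := by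
  rw [← h.regular]; exact isOpen_interior

lemma IsMeridianDomain.cl_fst (h : IsMeridianDomain Ω) (hp : p ∈ closure Ω) : 0 ≤ p.1 := by
  have hc : IsClosed {p : R2 | 0 ≤ p.1} := isClosed_le continuous_const continuous_fst
  exact closure_minimal (fun q hq => (h.pos q hq).le) hc hp

lemma IsMeridianDomain.cvx_cl (h : IsMeridianDomain Ω) : Convex ℝ (closure Ω) := by
  have mem : ∀ p : R2, 0 ≤ p.1 → (((p.1, 0, p.2) : ℝ × ℝ × ℝ) ∈ rotate (closure Ω) ↔
      p ∈ closure Ω) := by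
    intro p hp
    simp [rotate, Real.sqrt_sq hp]
  intro p hp q hq a b ha hb hab
  have h1 := h.cl_fst hp
  have h2 := h.cl_fst hq
  have h3 := h.convex ((mem p h1).2 hp) ((mem q h2).2 hq) ha hb hab
  rw [← mem _ (by simp; positivity)]
  simpa using h3

lemma IsMeridianDomain.cvx (h : IsMeridianDomain Ω) : Convex ℝ Ω := by
  rw [← h.regular]; exact h.cvx_cl.interior

/-! ### Conforming triangulations -/

/-- The triangles of a mesh as a finite set. -/
def Mesh.tris {Ω : Set R2} (T : Mesh Ω) : Finset (Finset R2) :=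
  (T.finite.subset (fun _ hs => hs.1 : T.triangles ⊆ T.complex.faces)).toFinset

lemma mem_tris {T : Mesh Ω} : s ∈ T.tris ↔ s ∈ T.triangles := by simp [Mesh.tris]

lemma mTri {T : Mesh Ω} (hs : s ∈ T.tris) : IsTri s := by
  rw [mem_tris] at hs
  exact ⟨hs.2, T.complex.indep hs.1⟩

lemma mface {T : Mesh Ω} (hs : s ∈ T.tris) : s ∈ T.complex.faces := (mem_tris.1 hs).1

lemma hull_sub {T : Mesh Ω} (hs : s ∈ T.tris) : hull s ⊆ closure Ω := by
  rw [← T.space_eq]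
  exact T.complex.convexHull_subset_space (mface hs)

lemma Mesh.isBounded (T : Mesh Ω) : IsBounded Ω := by
  have : IsCompact (closure Ω) := by
    rw [← T.space_eq]
    exact T.finite.isCompact_biUnion fun s _ => cpt_hull s
  exact this.isBounded.subset subset_closure

lemma closed_iU (F : Finset (Finset R2)) : IsClosed (⋃ s ∈ F, hull s) :=
  F.finite_toSet.isClosed_biUnion fun s _ => (cpt_hull s).isClosed

lemma Mesh.cover (hΩ : IsOpen Ω) (T : Mesh Ω) (hp : p ∈ closure Ω) : ∃ s ∈ T.tris, p ∈ hull s := by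
  have hcl := closed_iU T.tris
  suffices h : Ω ⊆ ⋃ s ∈ T.tris, hull s by
    have := closure_minimal h hcl hp
    simpa using this
  rw [← Set.sdiff_eq_empty]
  have hopen : IsOpen (Ω \ ⋃ s ∈ T.tris, hull s) := hΩ.sdiff hcl
  rw [← hopen.measure_eq_zero_iff (volume : Measure R2)]
  have hnull : volume (⋃ s ∈ {s | s ∈ T.complex.faces ∧ s.card ≠ 3}, hull s) = 0 := by
    rw [measure_biUnion_null_iff (T.finite.subset fun s hs => hs.1).countable]
    exact fun s hs => vol_hull_eq_zero (T.complex.indep hs.1) hs.2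
  refine measure_mono_null ?_ hnull
  rintro q ⟨hq, hn⟩
  have : q ∈ T.complex.space := T.space_eq ▸ subset_closure hq
  rw [Geometry.SimplicialComplex.mem_space_iff] at this
  obtain ⟨s, hs, hqs⟩ := this
  simp only [mem_iUnion, not_exists] at hn
  simp only [mem_iUnion]
  refine ⟨s, ⟨hs, fun hc => hn s (mem_tris.2 ⟨hs, hc⟩) hqs⟩, hqs⟩

lemma inter_sub {T : Mesh Ω} (hs : s ∈ T.tris) (ht : t ∈ T.tris) : hull s ∩ hull t ⊆
    convexHull ℝ (s ∩ t : Set R2) :=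
  T.complex.inter_subset_convexHull (mface hs) (mface ht)

lemma vol_inter {T : Mesh Ω} (hs : s ∈ T.tris) (ht : t ∈ T.tris) (hst : s ≠ t) : volume
    (hull s ∩ hull t) = 0 := by
  classical
  have h1 : (s ∩ t).card ≠ 3 := by
    intro h
    have e1 : s ∩ t = s := Finset.eq_of_subset_of_card_le Finset.inter_subset_left
      (by rw [h, (mTri hs).1])
    have e2 : s ∩ t = t := Finset.eq_of_subset_of_card_le Finset.inter_subset_right
      (by rw [h, (mTri ht).1])
    exact hst (e1.symm.trans e2)
  have hind : AffineIndependent ℝ ((↑) : (s ∩ t : Finset R2) → R2) :=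
    (mTri hs).2.mono (by simp)
  refine measure_mono_null (inter_sub hs ht) ?_
  have := vol_hull_eq_zero hind h1
  simpa [hull] using this

lemma vtx_mem {T : Mesh Ω} (hs : s ∈ T.tris) (ht : t ∈ T.tris) (hv : v ∈ t)
    (h : v ∈ hull s) : v ∈ s := by
  have hf : ({v} : Finset R2) ∈ T.complex.faces :=
    T.complex.down_closed (mface ht) (by simpa using hv) (by simp)
  have := T.complex.inter_subset_convexHull (mface hs) hf ⟨h, by simp⟩
  by_contra hn
  have he : ((s : Set R2) ∩ (({v} : Finset R2) : Set R2)) = ∅ := by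
    ext x
    simp only [Set.mem_inter_iff, Finset.mem_coe, Finset.mem_singleton, Set.mem_empty_iff_false,
      iff_false, not_and]
    rintro hx rfl; exact hn hx
  rw [he] at this
  simp at this

lemma lam_eq {T : Mesh Ω} (hs : s ∈ T.tris) (ht : t ∈ T.tris) (v : R2) (hps : p ∈ hull s)
    (hpt : p ∈ hull t) : lam s v p = lam t v p := by
  have hdel : ∀ u ∈ T.tris, ∀ w ∈ u, lam u v w = if v = w then 1 else 0 := by
    intro u hu w hw
    by_cases hv : v ∈ u
    · exact (mTri hu).isBary.delta v hv w hw
    · rw [if_neg (by rintro rfl; exact hv hw)]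
      simp [lam, (mTri hu).isBary.grad_zero v hv, (mTri hu).isBary.off_zero v hv, pdot]
  refine convexHull_min (t := {p | lam s v p = lam t v p}) ?_ ?_ (inter_sub hs ht ⟨hps, hpt⟩)
  · rintro w ⟨hw1, hw2⟩
    exact (hdel s hs w hw1).trans (hdel t ht w hw2).symm
  · intro p hp q hq a b _ _ hab
    have h1 : lam s v p = lam t v p := hp
    have h2 : lam s v q = lam t v q := hq
    change lam s v _ = lam t v _
    rw [lam_combo _ _ _ _ hab, lam_combo _ _ _ _ hab, h1, h2]

/-! ### The star of a vertex -/

lemma IsTri.interior_nonempty (hs : IsTri s) : (interior (hull s)).Nonempty := by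
  rw [(convex_convexHull ℝ _).interior_nonempty_iff_affineSpan_eq_top, affineSpan_convexHull]
  have := (hs.2.affineSpan_eq_top_iff_card_eq_finrank_add_one).2 (by rw [rank_pl]; simp [hs.1])
  simpa using this

lemma intr_sub (hΩ : IsMeridianDomain Ω) {T : Mesh Ω} (hs : s ∈ T.tris) : interior
    (hull s) ⊆ Ω := by
  conv_rhs => rw [← hΩ.regular]
  exact interior_mono (hull_sub hs)

open Classical in
/-- The triangles with vertex `v`. -/
def Mesh.star {Ω : Set R2} (T : Mesh Ω) (v : R2) : Finset (Finset R2) :=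
  T.tris.filter (v ∈ ·)

lemma mem_star {T : Mesh Ω} : s ∈ T.star v ↔ s ∈ T.tris ∧ v ∈ s := by
  classical
  simp [Mesh.star]

lemma ex_ball {T : Mesh Ω} (hv : (T.star v).Nonempty) : ∃ δ > 0, ∀ s ∈ T.tris, ∀ p ∈ hull
    s, ‖p - v‖ < δ → s ∈ T.star v := by
  obtain ⟨t, ht⟩ := hv
  rw [mem_star] at ht
  classical
  have hcl := closed_iU (T.tris.filter (v ∉ ·))
  have hmem : v ∈ (⋃ s ∈ T.tris.filter (v ∉ ·), hull s)ᶜ := by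
    simp only [Set.mem_compl_iff, mem_iUnion, not_exists, Finset.mem_filter]
    rintro s ⟨hs, hvs⟩ h
    exact hvs (vtx_mem hs ht.1 ht.2 h)
  obtain ⟨δ, hδ, hb⟩ := Metric.isOpen_iff.1 hcl.isOpen_compl v hmem
  refine ⟨δ, hδ, fun s hs p hp hpv => ?_⟩
  rw [mem_star]
  refine ⟨hs, ?_⟩
  by_contra hn
  have := hb (by rwa [Metric.mem_ball, dist_eq_norm] : p ∈ Metric.ball v δ)
  simp only [Set.mem_compl_iff, mem_iUnion, not_exists, Finset.mem_filter] at this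
  exact this s ⟨hs, hn⟩ hp

lemma ex_near_intr {x : R2} (hv : v ∈ s) (hx : x ∈ interior (hull s)) {δ : ℝ} (hδ : 0 < δ) : ∃ g :
    ℝ, 0 < g ∧ v + g • (x - v) ∈ interior (hull s) ∧ ‖v + g • (x - v) - v‖ < δ := by
  have hpos : 0 < ‖x - v‖ + 1 := by positivity
  refine ⟨min 1 (δ / (‖x - v‖ + 1)), by positivity, ?_, ?_⟩
  · exact (convex_convexHull ℝ _).add_smul_sub_mem_interior (sub_hull hv) hx
      ⟨by positivity, min_le_left _ _⟩
  · rw [add_sub_cancel_left, norm_smul, norm_eq_abs, abs_of_pos (by positivity)]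
    calc _ ≤ δ / (‖x - v‖ + 1) * ‖x - v‖ := by gcongr; exact min_le_right _ _
      _ < δ / (‖x - v‖ + 1) * (‖x - v‖ + 1) := by gcongr; linarith
      _ = δ := by field_simp

lemma ex_mem_pdet_ne_zero (hU : IsOpen U) (hne : U.Nonempty) (v : R2) {d : R2} (hd : d ≠ 0) :
    ∃ x ∈ U, pdet (x - v) d ≠ 0 := by
  obtain ⟨x, hx⟩ := hne
  by_cases h : pdet (x - v) d = 0
  · have hc : Filter.Tendsto (fun t : ℝ => x + t • ((-d.2, d.1) : R2)) (nhds 0)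
        (nhds (x + (0 : ℝ) • ((-d.2, d.1) : R2))) :=
      Continuous.tendsto (by fun_prop) 0
    rw [zero_smul, add_zero] at hc
    have h1 := hc.eventually (hU.mem_nhds hx)
    obtain ⟨t, ht, ht0⟩ := ((h1.filter_mono nhdsWithin_le_nhds).and
      (self_mem_nhdsWithin (s := Set.Ioi (0 : ℝ)))).exists
    refine ⟨_, ht, ?_⟩
    have e : pdet (x + t • ((-d.2, d.1) : R2) - v) d =
        pdet (x - v) d - t * (d.1 ^ 2 + d.2 ^ 2) := by
      simp [pdet]; ring
    rw [e, h, zero_sub, neg_ne_zero]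
    have : d.1 ^ 2 + d.2 ^ 2 ≠ 0 := by
      intro h0
      apply hd
      ext
      · simp; nlinarith [sq_nonneg d.1, sq_nonneg d.2]
      · simp; nlinarith [sq_nonneg d.1, sq_nonneg d.2]
    exact mul_ne_zero (ne_of_gt ht0) this
  · exact ⟨x, hx, h⟩

lemma nmem_seg_of_pdet (h : pdet (q - v) (p - v) ≠ 0) : v ∉ segment ℝ p q := by
  rintro ⟨a, b, ha, hb, hab, hv⟩
  have h1 := congrArg Prod.fst hv
  have h2 := congrArg Prod.snd hv
  simp at h1 h2
  obtain rfl : a = 1 - b := by linarith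
  have e1 : b * (q.1 - v.1) = -(1 - b) * (p.1 - v.1) := by linarith
  have e2 : b * (q.2 - v.2) = -(1 - b) * (p.2 - v.2) := by linarith
  apply h
  simp only [pdet, fst_sub, snd_sub]
  have f1 : b * ((q.1 - v.1) * (p.2 - v.2) - (q.2 - v.2) * (p.1 - v.1)) = 0 := by
    linear_combination (p.2 - v.2) * e1 - (p.1 - v.1) * e2
  have f2 : (1 - b) * ((q.1 - v.1) * (p.2 - v.2) - (q.2 - v.2) * (p.1 - v.1)) = 0 := by
    linear_combination (q.1 - v.1) * e2 - (q.2 - v.2) * e1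
  linear_combination f1 + f2

lemma star_conn (hΩ : IsMeridianDomain Ω) {T : Mesh Ω} {A : Finset (Finset R2)}
    (hA : A ⊆ T.star v) (hne : A.Nonempty) (hpr : A ≠ T.star v) : ∃ a ∈ A, ∃ b ∈ T.star v, b ∉ A ∧ ∃
    w, w ≠ v ∧ w ∈ a ∧ w ∈ b := by
  classical
  obtain ⟨a₀, ha₀⟩ := hne
  obtain ⟨b₀, hb₀, hb₀A⟩ : ∃ b ∈ T.star v, b ∉ A := by
    by_contra! h
    exact hpr (hA.antisymm h)
  have ha₀' := mem_star.1 (hA ha₀)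
  have hb₀' := mem_star.1 hb₀
  obtain ⟨δ, hδ, hball⟩ := ex_ball (T := T) (v := v) ⟨a₀, hA ha₀⟩
  obtain ⟨x, hx⟩ := (mTri ha₀'.1).interior_nonempty
  have hxv : ∃ x ∈ interior (hull a₀), x ≠ v := by
    obtain ⟨x, hx, h⟩ := ex_mem_pdet_ne_zero isOpen_interior ⟨x, hx⟩ v
      (d := ((1, 0) : R2)) (by simp [Prod.ext_iff])
    exact ⟨x, hx, by rintro rfl; simp [pdet] at h⟩
  obtain ⟨x, hx, hxv⟩ := hxv
  obtain ⟨g, hg, hp1, hp2⟩ := ex_near_intr ha₀'.2 hx hδ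
  set p := v + g • (x - v) with hp
  have hpv : p - v ≠ 0 := by
    rw [hp, add_sub_cancel_left]
    exact smul_ne_zero hg.ne' (sub_ne_zero.2 hxv)
  obtain ⟨y, hy, hyd⟩ := ex_mem_pdet_ne_zero isOpen_interior
    (mTri hb₀'.1).interior_nonempty v hpv
  obtain ⟨g', hg', hq1, hq2⟩ := ex_near_intr hb₀'.2 hy hδ
  set q := v + g' • (y - v) with hq
  have hqd : pdet (q - v) (p - v) ≠ 0 := by
    have : pdet (q - v) (p - v) = g' * pdet (y - v) (p - v) := by
      rw [hq, add_sub_cancel_left]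
      simp [pdet]; ring
    rw [this]; exact mul_ne_zero hg'.ne' hyd
  have hv := nmem_seg_of_pdet hqd
  have hsegΩ : segment ℝ p q ⊆ Ω := hΩ.cvx.segment_subset
    (intr_sub hΩ ha₀'.1 hp1) (intr_sub hΩ hb₀'.1 hq1)
  have hsegB : segment ℝ p q ⊆ Metric.ball v δ := (convex_ball v δ).segment_subset
    (by rwa [Metric.mem_ball, dist_eq_norm]) (by rwa [Metric.mem_ball, dist_eq_norm])
  have hpre : IsPreconnected (segment ℝ p q) := (convex_segment p q).isPreconnected
  obtain ⟨z, hz, hzA, hzB⟩ := isPreconnected_closed_iff.1 hpre (⋃ s ∈ A, hull s)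
    (⋃ s ∈ T.star v \ A, hull s) (closed_iU _) (closed_iU _)
    (by
      intro z hz
      obtain ⟨s, hs, hzs⟩ := T.cover hΩ.isOpen (subset_closure (hsegΩ hz))
      have hst := hball s hs z hzs (by simpa [dist_eq_norm] using hsegB hz)
      by_cases h : s ∈ A
      · left; simp only [mem_iUnion]; exact ⟨s, h, hzs⟩
      · right; simp only [mem_iUnion]; exact ⟨s, Finset.mem_sdiff.2 ⟨hst, h⟩, hzs⟩)
    ⟨p, left_mem_segment ℝ p q, by
      simp only [mem_iUnion]; exact ⟨a₀, ha₀, interior_subset hp1⟩⟩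
    ⟨q, right_mem_segment ℝ p q, by
      simp only [mem_iUnion]
      exact ⟨b₀, Finset.mem_sdiff.2 ⟨hb₀, hb₀A⟩, interior_subset hq1⟩⟩
  simp only [mem_iUnion] at hzA hzB
  obtain ⟨a, ha, hza⟩ := hzA
  obtain ⟨b, hb, hzb⟩ := hzB
  rw [Finset.mem_sdiff] at hb
  refine ⟨a, ha, b, hb.1, hb.2, ?_⟩
  have hz2 := inter_sub (mem_star.1 (hA ha)).1 (mem_star.1 hb.1).1 ⟨hza, hzb⟩
  by_contra! hcon
  have hsub : (a ∩ b : Set R2) ⊆ {v} := by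
    rintro w ⟨h1, h2⟩
    by_contra hw
    exact hcon w hw h1 h2
  have := convexHull_mono (𝕜 := ℝ) hsub hz2
  rw [convexHull_singleton] at this
  exact hv (this ▸ hz)

lemma le_pow_mul_of_conn {ι : Type*} (S : Finset ι) (h : ι → ℝ) {K : ℝ} (hK : 1 ≤ K)
    (hpos : ∀ i ∈ S, 0 < h i) (hc : ∀ A ⊆ S, A.Nonempty → A ≠ S → ∃ a ∈ A, ∃ b ∈ S, b ∉ A ∧ h b ≤ K
    * h a) {a b : ι} (ha : a ∈ S) (hb : b ∈ S) : h b ≤ K ^ S.card * h a := by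
  classical
  have key : ∀ n : ℕ, ∃ A ⊆ S, a ∈ A ∧ (A = S ∨ n + 1 ≤ A.card) ∧ ∀ i ∈ A, h i ≤ K ^ n * h a := by
    intro n
    induction n with
    | zero => exact ⟨{a}, by simpa using ha, by simp, by simp, by simp⟩
    | succ n ih =>
      obtain ⟨A, hAS, haA, hcard, hA⟩ := ih
      have hmono : K ^ n * h a ≤ K ^ (n + 1) * h a := by
        have := hpos a ha
        gcongr
        · exact n.le_succ
      by_cases hS : A = S
      · exact ⟨A, hAS, haA, Or.inl hS, fun i hi => (hA i hi).trans hmono⟩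
      · obtain ⟨c, hc1, d, hd, hdA, hle⟩ := hc A hAS ⟨a, haA⟩ hS
        refine ⟨insert d A, Finset.insert_subset hd hAS, Finset.mem_insert_of_mem haA, Or.inr ?_, ?_⟩
        · rw [Finset.card_insert_of_notMem hdA]
          rcases hcard with h | h
          · exact absurd h hS
          · omega
        · intro i hi
          rcases Finset.mem_insert.1 hi with rfl | hi
          · calc h i ≤ K * h c := hle
              _ ≤ K * (K ^ n * h a) := by gcongr; exact hA c hc1
              _ = _ := by ring
          · exact (hA i hi).trans hmono
  obtain ⟨A, hAS, _, hcard, hA⟩ := key S.card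
  have : A = S := by
    rcases hcard with h | h
    · exact h
    · exact absurd (Finset.card_le_card hAS) (by omega)
  exact hA b (this ▸ hb)

lemma edge_le {T : Mesh Ω} {σ : ℝ} (hσ : T.ShapeRegular σ) (hs : s ∈ T.tris) (hvw : w ≠ v)
    (hvs : v ∈ s) (hws : w ∈ s) (hvt : v ∈ t) (hwt : w ∈ t) : dK s ≤ 4 * σ * dK t := by
  have hS := mTri hs
  have hreg := hσ s (mem_tris.1 hs)
  have h1 := hS.norm_lamG_le hreg v
  have h2 : lam s v v - lam s v w = 1 := by
    unfold lam
    rw [hS.isBary.delta v hvs v hvs, hS.isBary.delta v hvs w hws, if_pos rfl, if_neg hvw.symm]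
    ring
  rw [lam_sub] at h2
  have h3 := abs_pdot_le (lamG s v) (v - w)
  rw [h2, abs_one] at h3
  have h4 := norm_sub_le_diam (sub_hull hvt : v ∈ hull t) (sub_hull hwt)
  have hσ0 := (hS.vol_pos hreg).1
  have hd := hS.dpos
  have : 1 ≤ 2 * (2 * σ / dK s) * dK t := h3.trans (by gcongr)
  calc dK s = dK s * 1 := by ring
    _ ≤ dK s * (2 * (2 * σ / dK s) * dK t) := by gcongr
    _ = _ := by field_simp; ring

lemma card_star_le {T : Mesh Ω} {σ : ℝ} (hσ : T.ShapeRegular σ) (v : R2) :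
    ((T.star v).card : ℝ) ≤ 4 * σ ∨ T.star v = ∅ := by
  classical
  rcases (T.star v).eq_empty_or_nonempty with h | hne
  · exact Or.inr h
  left
  obtain ⟨t₀, ht₀, hmin⟩ := (T.star v).exists_min_image dK hne
  set δ := dK t₀
  have hδ : 0 < δ := (mTri (mem_star.1 ht₀).1).dpos
  let E : Finset R2 → Set R2 := fun s => AffineMap.homothety v (δ / dK s) '' hull s
  have hE : ∀ s ∈ T.star v, E s ⊆ hull s ∩ closedBall v δ := by
    rintro s hs _ ⟨x, hx, rfl⟩
    have hs' := mem_star.1 hs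
    have hd := (mTri hs'.1).dpos
    have hvs : v ∈ hull s := sub_hull hs'.2
    have hle : δ / dK s ≤ 1 := (div_le_one hd).2 (hmin s hs)
    rw [AffineMap.homothety_apply, vsub_eq_sub, vadd_eq_add, add_comm]
    refine ⟨(convex_convexHull ℝ _).add_smul_sub_mem hvs hx ⟨by positivity, hle⟩, ?_⟩
    rw [Metric.mem_closedBall, dist_eq_norm, add_sub_cancel_left, norm_smul, norm_eq_abs,
      abs_of_pos (by positivity)]
    calc _ ≤ δ / dK s * dK s := by gcongr; exact norm_sub_le_diam hx hvs
      _ = δ := by field_simp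
  have hvol : ∀ s ∈ T.star v, ofReal (δ ^ 2 / σ) ≤ volume (E s) := by
    intro s hs
    have hs' := mem_star.1 hs
    have hd := (mTri hs'.1).dpos
    have hreg := hσ s (mem_tris.1 hs'.1)
    have hσ0 := ((mTri hs'.1).vol_pos hreg).1
    rw [Measure.addHaar_image_homothety, rank_pl,
      ← ENNReal.ofReal_toReal (vol_hull_lt_top s).ne, ← ofReal_mul (abs_nonneg _),
      abs_of_pos (by positivity)]
    apply ofReal_le_ofReal
    rw [div_le_iff₀ hσ0]
    calc δ ^ 2 = (δ / dK s) ^ 2 * dK s ^ 2 := by field_simp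
      _ ≤ (δ / dK s) ^ 2 * (σ * volume.real (hull s)) := by gcongr
      _ = _ := by unfold Measure.real; ring
  have hmeas : ∀ s ∈ T.star v, NullMeasurableSet (E s) volume := by
    intro s _
    have : IsCompact (E s) := (cpt_hull s).image (by
      have : Continuous fun x : R2 => (δ / dK s) • (x - v) + v := by fun_prop
      convert! this using 2)
    exact this.isClosed.measurableSet.nullMeasurableSet
  have hdisj : (T.star v : Set (Finset R2)).Pairwise (Function.onFun (AEDisjoint volume) E) := by
    intro s hs t ht hst
    refine measure_mono_null ?_ (vol_inter (mem_star.1 hs).1 (mem_star.1 ht).1 hst)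
    exact Set.inter_subset_inter (fun x hx => (hE s hs hx).1) fun x hx => (hE t ht hx).1
  have hsum := measure_biUnion_finset₀ hdisj hmeas
  have hub : volume (⋃ s ∈ T.star v, E s) ≤ ofReal (4 * δ ^ 2) := by
    refine (measure_mono (t := closedBall v δ) ?_).trans ?_
    · simp only [Set.iUnion_subset_iff]
      exact fun s hs x hx => (hE s hs hx).2
    · rw [show v = (v.1, v.2) from rfl, ← closedBall_prod_same, Measure.volume_eq_prod,
        Measure.prod_prod, Real.volume_closedBall, Real.volume_closedBall,
        ← ofReal_mul (by positivity)]
      apply ofReal_le_ofReal; nlinarith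
  rw [hsum] at hub
  have hreg := hσ t₀ (mem_tris.1 (mem_star.1 ht₀).1)
  have hσ0 := ((mTri (mem_star.1 ht₀).1).vol_pos hreg).1
  have h1 : ((T.star v).card : ENNReal) * ofReal (δ ^ 2 / σ) ≤ ofReal (4 * δ ^ 2) := by
    calc _ = ∑ s ∈ T.star v, ofReal (δ ^ 2 / σ) := by simp
      _ ≤ _ := Finset.sum_le_sum hvol
      _ ≤ _ := hub
  rw [← ENNReal.ofReal_natCast, ← ofReal_mul (by positivity),
    ENNReal.ofReal_le_ofReal_iff (by positivity)] at h1
  have h2 : ((T.star v).card : ℝ) / σ * δ ^ 2 ≤ 4 * δ ^ 2 := by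
    calc _ = ((T.star v).card : ℝ) * (δ ^ 2 / σ) := by ring
      _ ≤ _ := h1
  have h3 := le_of_mul_le_mul_right h2 (by positivity)
  rwa [div_le_iff₀ hσ0] at h3

/-! ### Hat functions -/

lemma abs_sub_le_of_closed_cov {ι : Type*} (I : Finset ι) {E : ι → Set ℝ} (hE : ∀ i, IsClosed (E i))
    {f : ℝ → ℝ} {L : ℝ} (h : ∀ i, ∀ x ∈ E i, ∀ y ∈ E i, |f x - f y| ≤ L * |x - y|) {b : ℝ} : ∀ {a :
    ℝ}, a ≤ b → Icc a b ⊆ ⋃ i ∈ I, E i → |f b - f a| ≤ L * (b - a) := by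
  classical
  induction I using Finset.strongInduction with
  | H I ih =>
    intro a hab hcov
    obtain ⟨i, hi, hai⟩ : ∃ i ∈ I, a ∈ E i := by
      simpa using hcov (Set.left_mem_Icc.2 hab)
    have hcomp : IsCompact (Icc a b ∩ E i) := isCompact_Icc.inter_right (hE i)
    obtain ⟨t, ht, hmax⟩ := hcomp.exists_isMaxOn ⟨a, Set.left_mem_Icc.2 hab, hai⟩ continuousOn_id
    have h1 : |f t - f a| ≤ L * (t - a) := by
      have := h i t ht.2 a hai
      rwa [abs_of_nonneg (sub_nonneg.2 ht.1.1)] at this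
    rcases ht.1.2.eq_or_lt with rfl | htb
    · exact h1
    · have hcov' : Set.Ioc t b ⊆ ⋃ j ∈ I.erase i, E j := by
        intro x hx
        have := hcov ⟨ht.1.1.trans hx.1.le, hx.2⟩
        simp only [mem_iUnion] at this
        obtain ⟨j, hj, hxj⟩ := this
        simp only [mem_iUnion]
        refine ⟨j, Finset.mem_erase.2 ⟨?_, hj⟩, hxj⟩
        rintro rfl
        exact absurd (hmax ⟨⟨ht.1.1.trans hx.1.le, hx.2⟩, hxj⟩) (not_le.2 hx.1)
      have hcl : IsClosed (⋃ j ∈ I.erase i, E j) :=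
        (I.erase i).finite_toSet.isClosed_biUnion fun j _ => hE j
      have hcov'' : Icc t b ⊆ ⋃ j ∈ I.erase i, E j := by
        rw [← closure_Ioc htb.ne]
        exact closure_minimal hcov' hcl
      have h2 := ih (I.erase i) (Finset.erase_ssubset hi) htb.le hcov''
      calc |f b - f a| ≤ |f b - f t| + |f t - f a| := abs_sub_le _ _ _
        _ ≤ L * (b - t) + L * (t - a) := add_le_add h2 h1
        _ = _ := by ring

lemma lip_of_closed_cov {ι : Type*} (I : Finset ι) {F : ι → Set R2} (hF : ∀ i, IsClosed (F i)) {S :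
    Set R2} (hS : Convex ℝ S) (hcov : S ⊆ ⋃ i ∈ I, F i) {L : ℝ} (h : ∀ i, ∀ x ∈ F i, ∀ y ∈ F i, |f x
    - f y| ≤ L * ‖x - y‖) (hp : p ∈ S) (hq : q ∈ S) : |f p - f q| ≤ L * ‖p - q‖ := by
  have hc : Continuous fun t : ℝ => q + t • (p - q) := by fun_prop
  have := abs_sub_le_of_closed_cov I (E := fun i => (fun t : ℝ => q + t • (p - q)) ⁻¹' F i)
    (fun i => (hF i).preimage hc) (f := fun t => f (q + t • (p - q))) (L := L * ‖p - q‖)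
    (fun i x hx y hy => by
      refine (h i _ hx _ hy).trans (le_of_eq ?_)
      rw [add_sub_add_left_eq_sub, ← sub_smul, norm_smul, norm_eq_abs]
      ring) zero_le_one (by
      intro t ht
      have := hcov (hS.add_smul_sub_mem hq hp ht)
      simpa using this)
  simpa using this

open Classical in
/-- The piecewise linear function with value `1` at the vertex `v` and `0` at the other vertices. -/
def Mesh.hat {Ω : Set R2} (T : Mesh Ω) (v p : R2) : ℝ :=
  if h : ∃ s ∈ T.tris, p ∈ hull s then lam h.choose v p else 0

lemma hat_eq {T : Mesh Ω} (hs : s ∈ T.tris) (v : R2) (hp : p ∈ hull s) : T.hat v p = lam s v p := by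
  have h : ∃ s ∈ T.tris, p ∈ hull s := ⟨s, hs, hp⟩
  unfold Mesh.hat
  rw [dif_pos h]
  exact lam_eq h.choose_spec.1 hs v h.choose_spec.2 hp

lemma lam_of_nmem (hs : IsTri s) (hv : v ∉ s) (p : R2) : lam s v p = 0 := by
  simp [lam, hs.isBary.grad_zero v hv, hs.isBary.off_zero v hv, pdot]

lemma hat_lip (hΩ : IsMeridianDomain Ω) {T : Mesh Ω} {L : ℝ} (hL : 0 ≤ L)
    (h : ∀ s ∈ T.tris, v ∈ s → 2 * ‖lamG s v‖ ≤ L) (hp : p ∈ closure Ω) (hq : q ∈ closure Ω) :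
    |T.hat v p - T.hat v q| ≤ L * ‖p - q‖ := by
  classical
  refine lip_of_closed_cov T.tris.attach (F := fun s => hull s.1)
    (fun s => (cpt_hull _).isClosed) hΩ.cvx_cl ?_ ?_ hp hq
  · intro x hx
    obtain ⟨s, hs, hxs⟩ := T.cover hΩ.isOpen hx
    simp only [mem_iUnion]
    exact ⟨⟨s, hs⟩, by simp, hxs⟩
  · rintro ⟨s, hs⟩ x hx y hy
    rw [hat_eq hs v hx, hat_eq hs v hy, lam_sub]
    refine (abs_pdot_le _ _).trans ?_
    gcongr
    by_cases hv : v ∈ s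
    · exact h s hs hv
    · rw [(mTri hs).isBary.grad_zero v hv]; simpa using hL

/-- The sum of the abscissae of the vertices. -/
def rho (s : Finset R2) : ℝ := ∑ v ∈ s, v.1

/-- The geometric facts about a triangulation with triangles `Tr` and Lipschitz extensions `φ` of
its hat functions, with a single constant `C`. -/
structure Geom (Ω : Set R2) (Tr : Finset (Finset R2)) (φ : R2 → R2 → ℝ)
    (C : ℝ) : Prop where
  one_le : 1 ≤ C
  isTri : ∀ s ∈ Tr, IsTri s
  int_sub : ∀ s ∈ Tr, interior (hull s) ⊆ Ω
  cover : ∀ p ∈ Ω, ∃ s ∈ Tr, p ∈ hull s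
  inter_null : ∀ s ∈ Tr, ∀ t ∈ Tr, s ≠ t → volume (hull s ∩ hull t) = 0
  fst_nonneg : ∀ s ∈ Tr, ∀ v ∈ s, 0 ≤ v.1
  sub : ∀ s ∈ Tr, hull s ⊆ closure Ω
  vol : ∀ s ∈ Tr, dK s ^ 2 ≤ C * volume.real (hull s)
  grad : ∀ s ∈ Tr, ∀ v, ‖lamG s v‖ ≤ C / dK s
  comp : ∀ s ∈ Tr, ∀ t ∈ Tr, ∀ v ∈ s, v ∈ t → dK t ≤ C * dK s
  count : ∀ v, ∀ F ⊆ Tr, (∀ s ∈ F, v ∈ s) → (F.card : ℝ) ≤ C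
  size_le_rho : ∀ s ∈ Tr, dK s ≤ C * rho s
  lip : ∀ v, ∃ L, LipschitzWith L (φ v)
  hat : ∀ s ∈ Tr, ∀ v, ∀ p ∈ hull s, φ v p = lam s v p
  nbhd : ∀ s ∈ Tr, ∀ p ∈ Ω, ∀ q ∈ hull s, C * ‖p - q‖ ≤ dK s →
    ∃ t ∈ Tr, p ∈ hull t ∧ ∃ v ∈ s, v ∈ t

lemma ex_geom (hΩ : IsMeridianDomain Ω) (σ : ℝ) : ∃ C, ∀ T : Mesh Ω, T.ShapeRegular σ → ∃
    φ, Geom Ω T.tris φ C := by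
  classical
  set K : ℝ := max 1 (4 * σ) with hK
  set N : ℕ := ⌈4 * σ⌉₊ with hN
  set B : ℝ := K ^ N with hB
  have hK1 : 1 ≤ K := le_max_left _ _
  have hB1 : 1 ≤ B := one_le_pow₀ hK1
  have h4σ : 4 * σ ≤ K := le_max_right _ _
  refine ⟨4 * K * B, fun T hT => ?_⟩
  have hKB : K ≤ K * B := le_mul_of_one_le_right (by linarith) hB1
  have hC1 : 1 ≤ 4 * K * B := by nlinarith
  have hreg : ∀ s ∈ T.tris, dK s ^ 2 ≤ σ * volume.real (hull s) :=
    fun s hs => hT s (mem_tris.1 hs)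
  have hσ0 : ∀ s ∈ T.tris, 0 < σ := fun s hs => ((mTri hs).vol_pos (hreg s hs)).1
  have hcount : ∀ v, ((T.star v).card : ℝ) ≤ K := by
    intro v
    rcases card_star_le hT v with h | h
    · exact h.trans h4σ
    · simp [h]; linarith
  have hcomp : ∀ s ∈ T.tris, ∀ t ∈ T.tris, ∀ v ∈ s, v ∈ t → dK t ≤ B * dK s := by
    intro s hs t ht v hvs hvt
    have := le_pow_mul_of_conn (T.star v) dK hK1
      (fun i hi => (mTri (mem_star.1 hi).1).dpos)
      (fun A hA hne hpr => by
        obtain ⟨a, ha, b, hb, hbA, w, hwv, hwa, hwb⟩ := star_conn hΩ hA hne hpr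
        have hb' := mem_star.1 hb
        have ha' := mem_star.1 (hA ha)
        refine ⟨a, ha, b, hb, hbA, ?_⟩
        refine (edge_le hT hb'.1 hwv hb'.2 hwb ha'.2 hwa).trans ?_
        gcongr
        exact diam_nn a)
      (mem_star.2 ⟨hs, hvs⟩) (mem_star.2 ⟨ht, hvt⟩)
    refine this.trans ?_
    gcongr
    · exact diam_nn s
    · have h1 : ((T.star v).card : ℝ) ≤ 4 * σ := by
        rcases card_star_le hT v with h | h
        · exact h
        · have := hσ0 s hs
          simp [h]; linarith
      exact pow_le_pow_right₀ hK1 (by exact_mod_cast h1.trans (Nat.le_ceil _))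
  have hgrad : ∀ s ∈ T.tris, ∀ v, 2 * ‖lamG s v‖ ≤ K / dK s := by
    intro s hs v
    have h1 := (mTri hs).norm_lamG_le (hreg s hs) v
    have hd := (mTri hs).dpos
    calc 2 * ‖lamG s v‖ ≤ 2 * (2 * σ / dK s) := by gcongr
      _ = 4 * σ / dK s := by ring
      _ ≤ _ := by gcongr
  have hlip : ∀ s ∈ T.tris, ∀ v ∈ s, ∀ p ∈ closure Ω, ∀ q ∈ closure Ω,
      |T.hat v p - T.hat v q| ≤ K * B / dK s * ‖p - q‖ := by
    intro s hs v hv p hp q hq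
    have hd := (mTri hs).dpos
    refine hat_lip hΩ (by positivity) ?_ hp hq
    intro t ht hvt
    refine (hgrad t ht v).trans ?_
    have hdt := (mTri ht).dpos
    have := hcomp t ht s hs v hvt hv
    rw [div_le_div_iff₀ hdt hd, mul_assoc]
    gcongr
  have hext : ∀ v, ∃ f : R2 → ℝ, (∃ L, LipschitzWith L f) ∧
      Set.EqOn (T.hat v) f (closure Ω) := by
    intro v
    have : ∃ L : NNReal, LipschitzOnWith L (T.hat v) (closure Ω) := by
      by_cases h : ∃ s ∈ T.tris, v ∈ s
      · obtain ⟨s, hs, hv⟩ := h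
        have hd := (mTri hs).dpos
        refine ⟨⟨K * B / dK s, by positivity⟩, LipschitzOnWith.of_dist_le_mul fun p hp q hq => ?_⟩
        rw [dist_eq_norm, dist_eq_norm]
        exact hlip s hs v hv p hp q hq
      · push Not at h
        refine ⟨0, LipschitzOnWith.of_dist_le_mul fun p hp q hq => ?_⟩
        rw [dist_eq_norm]
        have := hat_lip hΩ (T := T) (v := v) le_rfl
          (fun s hs hv => absurd hv (h s hs)) hp hq
        simpa using this
    obtain ⟨L, hL⟩ := this
    obtain ⟨f, hf, he⟩ := hL.extend_real
    exact ⟨f, ⟨L, hf⟩, he⟩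
  choose φ hφ1 hφ2 using hext
  have hφ : ∀ s ∈ T.tris, ∀ v, ∀ p ∈ hull s, φ v p = lam s v p := by
    intro s hs v p hp
    rw [← hφ2 v (hull_sub hs hp), hat_eq hs v hp]
  refine ⟨φ, hC1, fun s hs => mTri hs, fun s hs => intr_sub hΩ hs,
    fun p hp => T.cover hΩ.isOpen (subset_closure hp), fun s hs t ht h => vol_inter hs ht h,
    fun s hs v hv => hΩ.cl_fst (hull_sub hs (sub_hull hv)),
    fun s hs => hull_sub hs, fun s hs => (hreg s hs).trans ?_, fun s hs v => ?_,
    fun s hs t ht v hvs hvt => (hcomp s hs t ht v hvs hvt).trans ?_, fun v F hF hv => ?_,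
    fun s hs => ?_, hφ1, hφ, ?_⟩
  · have := measureReal_nonneg (μ := volume) (s := hull s)
    have := hσ0 s hs
    gcongr
    nlinarith
  · have hd := (mTri hs).dpos
    have h1 := hgrad s hs v
    have h2 : K / dK s ≤ 4 * K * B / dK s := by gcongr; nlinarith
    linarith [norm_nonneg (lamG s v)]
  · have := diam_nn s
    gcongr
    nlinarith
  · have : F ⊆ T.star v := fun s hs => mem_star.2 ⟨hF hs, hv s hs⟩
    have h2 : (F.card : ℝ) ≤ (T.star v).card := by exact_mod_cast Finset.card_le_card this
    have := hcount v
    nlinarith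
  · have h0 : ∀ v ∈ s, 0 ≤ v.1 := fun v hv =>
      hΩ.cl_fst (hull_sub hs (sub_hull hv))
    have := (mTri hs).diam_le_of_fst_le (ρ := rho s) (hreg s hs) h0
      fun v hv => Finset.single_le_sum (f := fun v : R2 => v.1) h0 hv
    refine this.trans ?_
    have h3 : 0 ≤ rho s := Finset.sum_nonneg h0
    have := hσ0 s hs
    exact mul_le_mul_of_nonneg_right (by nlinarith) h3
  · intro s hs p hp q hq hpq
    have hd := (mTri hs).dpos
    obtain ⟨t, ht, hpt⟩ := T.cover hΩ.isOpen (subset_closure hp)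
    refine ⟨t, ht, hpt, ?_⟩
    by_contra! hcon
    have h1 : ∑ v ∈ s, T.hat v q = 1 := by
      rw [← (mTri hs).isBary.sum_one q]
      exact sum_congr rfl fun v _ => hat_eq hs v hq
    have h2 : ∑ v ∈ s, T.hat v p = 0 := Finset.sum_eq_zero fun v hv => by
      rw [hat_eq ht v hpt, lam_of_nmem (mTri ht) (hcon v hv)]
    have h3 : |∑ v ∈ s, T.hat v p - ∑ v ∈ s, T.hat v q| ≤ 3 * (K * B / dK s * ‖p - q‖) := by
      rw [← sum_sub_distrib]
      refine (Finset.abs_sum_le_sum_abs _ _).trans ?_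
      refine (Finset.sum_le_card_nsmul _ _ _ fun v hv => hlip s hs v hv p (subset_closure hp) q
        (hull_sub hs hq)).trans ?_
      rw [(mTri hs).1, nsmul_eq_mul]; norm_num
    rw [h1, h2] at h3
    norm_num at h3
    have h4 : 4 * (K * B / dK s * ‖p - q‖) ≤ 1 := by
      calc _ = 4 * K * B * ‖p - q‖ / dK s := by ring
        _ ≤ dK s / dK s := by gcongr
        _ = 1 := div_self hd.ne'
    have h5 : 0 ≤ K * B / dK s * ‖p - q‖ := by positivity
    linarith

/-! ### Patches of triangles -/

open Classical in
/-- The triangles sharing a vertex with `s`. -/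
def nbs (Tr : Finset (Finset R2)) (s : Finset R2) : Finset (Finset R2) :=
  Tr.filter fun t => ∃ v ∈ s, v ∈ t

lemma mem_nbs : t ∈ nbs Tr s ↔ t ∈ Tr ∧ ∃ v ∈ s, v ∈ t := by
  classical
  simp [nbs]

/-- The union of the triangles sharing a vertex with `s`. -/
def patch (Tr : Finset (Finset R2)) (s : Finset R2) : Set R2 :=
  ⋃ t ∈ nbs Tr s, hull t

lemma mem_patch : p ∈ patch Tr s ↔ ∃ t ∈ nbs Tr s, p ∈ hull t := by simp [patch]

lemma mset_patch (Tr : Finset (Finset R2)) (s : Finset R2) : MeasurableSet (patch Tr s) :=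
  Finset.measurableSet_biUnion _ fun t _ => mset_hull t

/-- The points of `Ω` close to the triangle `s`. -/
def zone (Ω : Set R2) (C : ℝ) (s : Finset R2) : Set R2 :=
  {p | p ∈ Ω ∧ ∃ q ∈ hull s, C * ‖p - q‖ ≤ dK s}

lemma cvx_zone (hΩ : Convex ℝ Ω) (hC : 0 ≤ C) (s : Finset R2) : Convex ℝ (zone Ω C s) := by
  rintro p ⟨hp, q, hq, h⟩ p' ⟨hp', q', hq', h'⟩ a b ha hb hab
  refine ⟨hΩ hp hp' ha hb hab, a • q + b • q', convex_convexHull ℝ _ hq hq' ha hb hab, ?_⟩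
  have e : a • p + b • p' - (a • q + b • q') = a • (p - q) + b • (p' - q') := by
    simp only [smul_sub]; abel
  have h1 : ‖a • (p - q) + b • (p' - q')‖ ≤ a * ‖p - q‖ + b * ‖p' - q'‖ := by
    refine (norm_add_le _ _).trans (le_of_eq ?_)
    rw [norm_smul, norm_smul, norm_eq_abs, norm_eq_abs, abs_of_nonneg ha, abs_of_nonneg hb]
  rw [e]
  calc C * _ ≤ C * (a * ‖p - q‖ + b * ‖p' - q'‖) := by gcongr
    _ = a * (C * ‖p - q‖) + b * (C * ‖p' - q'‖) := by ring
    _ ≤ a * dK s + b * dK s := by gcongr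
    _ = dK s := by rw [← add_mul, hab, one_mul]

namespace Geom

lemma pos (g : Geom Ω Tr φ C) : 0 < C := lt_of_lt_of_le one_pos g.one_le

lemma spos (g : Geom Ω Tr φ C) (hs : s ∈ Tr) : 0 < dK s :=
  (g.isTri s hs).dpos

lemma rho_pos (g : Geom Ω Tr φ C) (hs : s ∈ Tr) : 0 < rho s := by
  have h1 := g.size_le_rho s hs
  have h2 := g.spos hs
  have h3 := g.pos
  exact pos_of_mul_pos_right (h2.trans_le h1) h3.le

lemma zone_sub (g : Geom Ω Tr φ C) (hs : s ∈ Tr) : zone Ω C s ⊆ patch Tr s := by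
  rintro p ⟨hp, q, hq, h⟩
  obtain ⟨t, ht, hpt, hv⟩ := g.nbhd s hs p hp q hq h
  exact mem_patch.2 ⟨t, mem_nbs.2 ⟨ht, hv⟩, hpt⟩

lemma card_nbs_le (g : Geom Ω Tr φ C) (hs : s ∈ Tr) : ((nbs Tr s).card : ℝ) ≤ 3 * C := by
  classical
  have : nbs Tr s ⊆ s.biUnion fun v => Tr.filter (v ∈ ·) := by
    intro t ht
    obtain ⟨h1, v, hv, hvt⟩ := mem_nbs.1 ht
    exact Finset.mem_biUnion.2 ⟨v, hv, Finset.mem_filter.2 ⟨h1, hvt⟩⟩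
  have h1 : ((nbs Tr s).card : ℝ) ≤ ∑ v ∈ s, ((Tr.filter (v ∈ ·)).card : ℝ) := by
    exact_mod_cast (Finset.card_le_card this).trans Finset.card_biUnion_le
  refine h1.trans ((Finset.sum_le_card_nsmul _ _ C fun v _ => ?_).trans ?_)
  · exact g.count v _ (Finset.filter_subset _ _) fun s hs => (Finset.mem_filter.1 hs).2
  · rw [(g.isTri s hs).1, nsmul_eq_mul]; norm_num

lemma nbs_symm (hs : s ∈ Tr) (h : t ∈ nbs Tr s) : s ∈ nbs Tr t := by
  obtain ⟨_, v, hv, hvt⟩ := mem_nbs.1 h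
  exact mem_nbs.2 ⟨hs, v, hvt, hv⟩

lemma self_mem_nbs (g : Geom Ω Tr φ C) (hs : s ∈ Tr) : s ∈ nbs Tr s := by
  obtain ⟨v, hv⟩ := (g.isTri s hs).nonempty
  exact mem_nbs.2 ⟨hs, v, hv, hv⟩

lemma size_le_of_nbs (g : Geom Ω Tr φ C) (hs : s ∈ Tr) (h : t ∈ nbs Tr s) : dK t ≤ C * dK s := by
  obtain ⟨ht, v, hv, hvt⟩ := mem_nbs.1 h
  exact g.comp s hs t ht v hv hvt

lemma fst_le_rho (g : Geom Ω Tr φ C) (hs : s ∈ Tr) (hv : v ∈ s) : v.1 ≤ rho s :=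
  Finset.single_le_sum (f := fun v : R2 => v.1) (g.fst_nonneg s hs) hv

lemma _root_.AxiFEM.fst_le_add_diam (hp : p ∈ hull s) (hq : q ∈ hull s) : p.1 ≤ q.1 + triDiam
    s := by
  have h := (norm_fst_le (p - q)).trans (norm_sub_le_diam hp hq)
  have := (abs_le.1 h).2
  simp only [fst_sub] at this
  linarith

lemma rho_le_add (g : Geom Ω Tr φ C) (hs : s ∈ Tr) (hv : v ∈ s) : rho s ≤ 3 * (v.1 + dK s) := by
  have := Finset.sum_le_card_nsmul s (fun w : R2 => w.1) (v.1 + dK s)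
    fun w hw => fst_le_add_diam (sub_hull hw) (sub_hull hv)
  rw [(g.isTri s hs).1, nsmul_eq_mul] at this
  simpa [rho] using this

lemma hull_fst (g : Geom Ω Tr φ C) (hs : s ∈ Tr) (hp : p ∈ hull s) : 0 ≤ p.1 ∧ p.1 ≤ rho s :=
  convexHull_min (t := {p : R2 | p.1 ∈ Icc 0 (rho s)})
    (fun _ hv => ⟨g.fst_nonneg s hs _ hv, g.fst_le_rho hs hv⟩)
    ((convex_Icc 0 (rho s)).linear_preimage (LinearMap.fst ℝ ℝ ℝ)) hp

lemma rho_le_of_nbs (g : Geom Ω Tr φ C) (hs : s ∈ Tr) (h : t ∈ nbs Tr s) : rho t ≤ 6 * C ^ 2 *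
    rho s := by
  have h1 := g.size_le_of_nbs hs h
  obtain ⟨ht, v, hv, hvt⟩ := mem_nbs.1 h
  have h2 := g.rho_le_add ht hvt
  have h3 := g.fst_le_rho hs hv
  have h4 := g.size_le_rho s hs
  have h5 := g.rho_pos hs
  have hC := g.one_le
  calc rho t ≤ 3 * (v.1 + dK t) := h2
    _ ≤ 3 * (rho s + C * (C * rho s)) := by
        have : C * dK s ≤ C * (C * rho s) := by gcongr
        linarith
    _ ≤ _ := by
        have : 1 * rho s ≤ C ^ 2 * rho s := by gcongr; nlinarith
        nlinarith

lemma ae_tri (g : Geom Ω Tr φ C) : ∀ᵐ p, p ∈ Ω → ∃ s ∈ Tr, p ∈ interior (hull s) ∧ ∀ t ∈ Tr,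
    p ∈ hull t → t = s := by
  have h1 : ∀ᵐ p : R2, ∀ s ∈ Tr, p ∉ frontier (hull s) := by
    rw [eventually_all]
    intro s _
    exact measure_eq_zero_iff_ae_notMem.1
      ((convex_convexHull ℝ (s : Set R2)).addHaar_frontier volume)
  have h2 : ∀ᵐ p : R2, ∀ s ∈ Tr, ∀ t ∈ Tr, s ≠ t → p ∉ hull s ∩ hull t := by
    rw [eventually_all]
    intro s hs
    rw [eventually_all]
    intro t ht
    by_cases hst : s = t
    · simp [hst]
    · filter_upwards [measure_eq_zero_iff_ae_notMem.1 (g.inter_null s hs t ht hst)] with p hp _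
      exact hp
  filter_upwards [h1, h2] with p h1 h2 hp
  obtain ⟨s, hs, hps⟩ := g.cover p hp
  refine ⟨s, hs, ?_, fun t ht hpt => ?_⟩
  · by_contra h
    exact h1 s hs ⟨subset_closure hps, h⟩
  · by_contra h
    exact h2 t ht s hs h ⟨hpt, hps⟩

lemma ae_hull (g : Geom Ω Tr φ C) (hs : s ∈ Tr) : ∀ᵐ p : R2, p ∈ hull s → p ∈ interior
    (hull s) ∧ p ∈ Ω := by
  filter_upwards [measure_eq_zero_iff_ae_notMem.1
      ((convex_convexHull ℝ (s : Set R2)).addHaar_frontier volume)] with p hp hps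
  have : p ∈ interior (hull s) := by
    by_contra h
    exact hp ⟨subset_closure hps, h⟩
  exact ⟨this, g.int_sub s hs this⟩

lemma lint_eq_sum (g : Geom Ω Tr φ C) (F : R2 → ENNReal) : ∫⁻ p in Ω, F p = ∑ s ∈ Tr, ∫⁻
    p in hull s, F p := by
  have h1 : Ω =ᵐ[volume] ⋃ s ∈ Tr, hull s := by
    have : ∀ᵐ p : R2, ∀ s ∈ Tr, p ∈ hull s → p ∈ interior (hull s) ∧ p ∈ Ω := by
      rw [eventually_all]
      exact fun s hs => g.ae_hull hs
    rw [Filter.eventuallyEq_set]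
    filter_upwards [this] with p hp
    constructor
    · intro h
      obtain ⟨s, hs, hps⟩ := g.cover p h
      simp only [mem_iUnion]
      exact ⟨s, hs, hps⟩
    · intro h
      simp only [mem_iUnion] at h
      obtain ⟨s, hs, hps⟩ := h
      exact (hp s hs hps).2
  rw [setLIntegral_congr h1, lintegral_biUnion_finset₀]
  · intro s hs t ht hst
    exact g.inter_null s hs t ht hst
  · exact fun s _ => (mset_hull s).nullMeasurableSet

lemma sum_patch_le (g : Geom Ω Tr φ C) (F : R2 → ENNReal) : ∑ s ∈ Tr, ∫⁻ p in patch Tr s, F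
    p ≤ ofReal (3 * C) * ∫⁻ p in Ω, F p := by
  classical
  calc ∑ s ∈ Tr, ∫⁻ p in patch Tr s, F p ≤ ∑ s ∈ Tr, ∑ t ∈ nbs Tr s, ∫⁻ p in hull t, F p := by
        gcongr with s hs
        refine (lintegral_biUnion_finset₀ (fun a ha b hb hab => ?_)
          (fun t _ => (mset_hull t).nullMeasurableSet) F).le
        exact g.inter_null a (mem_nbs.1 ha).1 b (mem_nbs.1 hb).1 hab
    _ = ∑ s ∈ Tr, ∑ t ∈ Tr, if t ∈ nbs Tr s then ∫⁻ p in hull t, F p else 0 := by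
        refine sum_congr rfl fun s _ => ?_
        rw [← Finset.sum_filter]
        congr 1
        ext t
        simp only [Finset.mem_filter]
        exact ⟨fun h => ⟨(mem_nbs.1 h).1, h⟩, fun h => h.2⟩
    _ = ∑ t ∈ Tr, ∑ s ∈ Tr, if t ∈ nbs Tr s then ∫⁻ p in hull t, F p else 0 := Finset.sum_comm
    _ ≤ ∑ t ∈ Tr, ofReal (3 * C) * ∫⁻ p in hull t, F p := by
        gcongr with t ht
        rw [← Finset.sum_filter, Finset.sum_const, nsmul_eq_mul]
        gcongr
        rw [← ENNReal.ofReal_natCast]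
        apply ofReal_le_ofReal
        refine le_trans ?_ (g.card_nbs_le ht)
        exact_mod_cast Finset.card_le_card fun s hs => by
          rw [Finset.mem_filter] at hs
          exact nbs_symm hs.1 hs.2
    _ = _ := by rw [← mul_sum, g.lint_eq_sum]

end Geom

/-- The squared norm of `f` in the space with weight `r ^ α` on `A`. -/
def wE (α : ℕ) (f : R2 → F) (A : Set R2) : ENNReal :=
  ∫⁻ p in A, ‖f p‖ₑ ^ 2 * ofReal (p.1 ^ α)

namespace Geom

variable {G : Type*} [NormedAddCommGroup G]

lemma wE_le_of_patch (g : Geom Ω Tr φ C) {f : R2 → F} {f' : R2 → G} {B : ENNReal} (h : ∀ s ∈ Tr, wE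
    α f' (hull s) ≤ B * wE α f (patch Tr s)) : wE α f' Ω ≤ ofReal (3 * C) * B * wE α f Ω := by
  unfold wE at *
  rw [g.lint_eq_sum]
  calc _ ≤ ∑ s ∈ Tr, B * ∫⁻ p in patch Tr s, ‖f p‖ₑ ^ 2 * ofReal (p.1 ^ α) :=
        Finset.sum_le_sum h
    _ = B * ∑ s ∈ Tr, ∫⁻ p in patch Tr s, ‖f p‖ₑ ^ 2 * ofReal (p.1 ^ α) := by
        rw [mul_sum]
    _ ≤ B * (ofReal (3 * C) * ∫⁻ p in Ω, ‖f p‖ₑ ^ 2 * ofReal (p.1 ^ α)) := by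
        gcongr; exact g.sum_patch_le _
    _ = _ := by ring

lemma vol_hull_le (g : Geom Ω Tr φ C) (hs : s ∈ Tr) : volume (hull s) ≤ ofReal (4 * dK s ^ 2) := by
  obtain ⟨v, hv⟩ := (g.isTri s hs).nonempty
  have hd := g.spos hs
  refine (measure_mono (t := closedBall v (dK s)) ?_).trans ?_
  · intro p hp
    rw [Metric.mem_closedBall, dist_eq_norm]
    exact norm_sub_le_diam hp (sub_hull hv)
  · rw [show v = (v.1, v.2) from rfl, ← closedBall_prod_same, Measure.volume_eq_prod,
      Measure.prod_prod, Real.volume_closedBall, Real.volume_closedBall,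
      ← ofReal_mul (by positivity)]
    apply ofReal_le_ofReal; nlinarith

lemma wE_hull_le (g : Geom Ω Tr φ C) {f' : R2 → G} (hs : s ∈ Tr) {m : ENNReal} (h : ∀ᵐ p, p ∈ hull s
    → ‖f' p‖ₑ ^ 2 ≤ m) : wE α f' (hull s) ≤ m * ofReal (4 * dK s ^ 2 * rho s ^ α) := by
  have hd := g.spos hs
  have hρ := g.rho_pos hs
  unfold wE
  calc _ ≤ ∫⁻ p in hull s, m * ofReal (rho s ^ α) := by
        apply lintegral_mono_ae
        rw [ae_restrict_iff' (mset_hull s)]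
        filter_upwards [h] with p h hp
        have h1 := g.hull_fst hs hp
        gcongr
        · exact h hp
        · exact h1.1
        · exact h1.2
    _ = m * ofReal (rho s ^ α) * volume (hull s) := by rw [setLIntegral_const]
    _ ≤ m * ofReal (rho s ^ α) * ofReal (4 * dK s ^ 2) := by
        gcongr; exact g.vol_hull_le hs
    _ = _ := by
        rw [mul_assoc, ← ofReal_mul (by positivity)]; congr 2; ring

lemma lgrad_hat (g : Geom Ω Tr φ C) (hs : s ∈ Tr) (v : R2) (hp : p ∈ interior (hull s)) :
    lgrad (φ v) p = lamG s v := by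
  have he : φ v =ᶠ[nhds p] lam s v := by
    filter_upwards [isOpen_interior.mem_nhds hp] with q hq
    exact g.hat s hs v q (interior_subset hq)
  have key : ∀ e, lD (φ v) p e = pdot (lamG s v) e := by
    intro e
    rw [he.lineDeriv_eq]
    have : HasLineDerivAt ℝ (lam s v) (pdot (lamG s v) e) p e := by
      unfold HasLineDerivAt
      have h1 : (fun t : ℝ => lam s v (p + t • e)) = fun t => lam s v p + t * pdot (lamG s v) e := by
        ext t
        have := lam_sub s v (p + t • e) p
        rw [add_sub_cancel_left] at this
        have h2 : pdot (lamG s v) (t • e) = t * pdot (lamG s v) e := by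
          simp [pdot]; ring
        linarith
      rw [h1]
      simpa using ((hasDerivAt_id (0 : ℝ)).mul_const (pdot (lamG s v) e)).const_add (lam s v p)
    exact this.lineDeriv
  unfold lgrad
  rw [key, key]
  ext <;> simp [pdot]

end Geom

/-! ### Averages over random points, segments and triangles -/

lemma mp_int {X Y : Type*} [MeasurableSpace X] [MeasurableSpace Y] {μ : Measure X} {ν : Measure Y}
    {f : X → Y} (h : MeasurePreserving f μ ν) {g : Y → ℝ} (hg : Measurable g) (hi : Integrable g ν) :
    Integrable (fun x => g (f x)) μ ∧ ∫ y, g y ∂ν = ∫ x, g (f x) ∂μ :=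
  ⟨(h.integrable_comp hg.aestronglyMeasurable).2 hi, by
    rw [← h.map_eq, integral_map h.measurable.aemeasurable hg.aestronglyMeasurable]⟩

/-- A probability measure with bounded density and compact support in `Ω`. -/
structure Probe (Ω : Set R2) (μ : Measure R2) : Prop where
  prob : IsProbabilityMeasure μ
  dens : ∃ A : ENNReal, A ≠ ⊤ ∧ μ ≤ A • volume
  supp : ∃ S, IsCompact S ∧ S ⊆ Ω ∧ ∀ᵐ x ∂μ, x ∈ S

/-- The joint law of three independent points. -/
abbrev tm (μ ν κ : Measure R2) : Measure Tri3 := μ.prod (ν.prod κ)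

/-- The parameters of the first side of a triangle. -/
abbrev side : Measure R2 := lineT (0, 0) (1, 0)

/-- The parameters of a triangle. -/
abbrev full : Measure R2 := volume.restrict stdT

lemma ae_side : ∀ᵐ t ∂side, t ∈ stdT := ae_lineT_mem v00 v10

lemma ae_full : ∀ᵐ t ∂full, t ∈ stdT := ae_restrict_mem cpt_stdT.measurableSet

instance : IsFiniteMeasure full := isFiniteMeasure_restrict.2 cpt_stdT.measure_lt_top.ne

instance : IsProbabilityMeasure side := by
  unfold side lineT
  have : IsProbabilityMeasure (volume.restrict I01) := ⟨by simp⟩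
  exact Measure.isProbabilityMeasure_map (by fun_prop)

lemma full_univ_le : full Set.univ ≤ 1 := by
  rw [Measure.restrict_apply_univ]
  calc volume stdT ≤ volume (I01 ×ˢ I01) := by
        apply measure_mono
        rintro t ⟨h1, h2, h3⟩
        exact ⟨⟨h1, by linarith⟩, ⟨h2, by linarith⟩⟩
    _ = 1 := by rw [Measure.volume_eq_prod, Measure.prod_prod]; simp

lemma meas_bpt_prod : Measurable fun q : Tri3 × R2 => bpt q.2 q.1 := by
  unfold bpt; fun_prop

lemma lint_bpt_le [IsProbabilityMeasure μ] [IsProbabilityMeasure ν] [IsProbabilityMeasure κ]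
    {A : ENNReal} (h₁ : μ ≤ A • volume) (h₂ : ν ≤ A • volume) (h₃ : κ ≤ A • volume) (θ : Measure R2)
    [IsFiniteMeasure θ] {f : R2 → ENNReal} (hf : Measurable f) : ∫⁻ q, f (bpt q.2 q.1)
    ∂((tm μ ν κ).prod θ) ≤ 9 * A * θ Set.univ * ∫⁻ p, f p := by
  have := lint_comb_par_le θ (m := 1) (by simp) (by simp) (by simp) h₁ h₂ h₃ hf
    (t₁ := fun t : R2 => 1 - t.1 - t.2) (t₂ := fun t => t.1) (t₃ := fun t => t.2) (by fun_prop)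
    (by fun_prop) (by fun_prop) (fun t => by ring)
  simpa only [bpt_eq, one_pow, mul_one] using this

lemma ae_bpt [IsProbabilityMeasure μ] [IsProbabilityMeasure ν] [IsProbabilityMeasure κ]
    {A : ENNReal} (h₁ : μ ≤ A • volume) (h₂ : ν ≤ A • volume) (h₃ : κ ≤ A • volume) (θ : Measure R2)
    [IsFiniteMeasure θ] {P : R2 → Prop} (hP : ∀ᵐ p : R2, P p) : ∀ᵐ q ∂((tm μ ν κ).prod θ), P
    (bpt q.2 q.1) := by
  obtain ⟨N, hN, hNm, hN0⟩ := exists_measurable_superset_of_null (ae_iff.1 hP)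
  have h := lint_bpt_le h₁ h₂ h₃ θ (f := N.indicator 1) (measurable_one.indicator hNm)
  rw [lintegral_indicator_one hNm, hN0, mul_zero] at h
  have h0 := le_antisymm h zero_le
  have hm : Measurable fun q : Tri3 × R2 => N.indicator (1 : R2 → ENNReal) (bpt q.2 q.1) :=
    (measurable_one.indicator hNm).comp meas_bpt_prod
  rw [lintegral_eq_zero_iff hm] at h0
  filter_upwards [h0] with q hq
  by_contra hc
  have : bpt q.2 q.1 ∈ N := hN hc
  simp [this] at hq

lemma ae_tm [IsProbabilityMeasure μ] [IsProbabilityMeasure ν] [IsProbabilityMeasure κ]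
    {P Q R : R2 → Prop} (hP : ∀ᵐ x ∂μ, P x) (hQ : ∀ᵐ x ∂ν, Q x) (hR : ∀ᵐ x ∂κ, R x) : ∀ᵐ X
    ∂(tm μ ν κ), P X.1 ∧ Q X.2.1 ∧ R X.2.2 := by
  have h1 : ∀ᵐ X ∂(tm μ ν κ), P X.1 := Measure.quasiMeasurePreserving_fst.ae hP
  have h2 : ∀ᵐ X ∂(tm μ ν κ), Q X.2.1 :=
    (Measure.quasiMeasurePreserving_fst.comp Measure.quasiMeasurePreserving_snd).ae hQ
  have h3 : ∀ᵐ X ∂(tm μ ν κ), R X.2.2 :=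
    (Measure.quasiMeasurePreserving_snd.comp Measure.quasiMeasurePreserving_snd).ae hR
  filter_upwards [h1, h2, h3] with X a b c using ⟨a, b, c⟩

lemma Probe.ex_dens (hμ : Probe Ω μ) (hν : Probe Ω ν) (hκ : Probe Ω κ) : ∃ A : ENNReal, A ≠
    ⊤ ∧ μ ≤ A • volume ∧ ν ≤ A • volume ∧ κ ≤ A • volume := by
  obtain ⟨A, hA, h1⟩ := hμ.dens
  obtain ⟨B, hB, h2⟩ := hν.dens
  obtain ⟨D, hD, h3⟩ := hκ.dens
  have key : ∀ (E : ENNReal) (ρ : Measure R2), E ≤ A + B + D → ρ ≤ E • volume →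
      ρ ≤ (A + B + D) • volume := by
    intro E ρ hE hρ S
    refine (hρ S).trans ?_
    simp only [Measure.smul_apply, smul_eq_mul]
    gcongr
  exact ⟨A + B + D, by simp [hA, hB, hD], key A _ (le_add_right le_self_add) h1,
    key B _ (le_add_right le_add_self) h2, key D _ le_add_self h3⟩

lemma Probe.ae_mem (hμ : Probe Ω μ) : ∀ᵐ x ∂μ, x ∈ Ω := by
  obtain ⟨S, _, hS, h⟩ := hμ.supp
  filter_upwards [h] with x hx using hS hx

lemma Probe.exists_bound (hμ : Probe Ω μ) (hν : Probe Ω ν) (hκ : Probe Ω κ) : ∃ H B, IsCompact H ∧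
    (Convex ℝ Ω → H ⊆ Ω) ∧ ∀ᵐ X ∂(tm μ ν κ), (∀ t ∈ stdT, bpt t X ∈ H) ∧ ‖X.2.1 - X.1‖ ≤ B ∧
    ‖X.2.2 - X.1‖ ≤ B := by
  have := hμ.prob; have := hν.prob; have := hκ.prob
  obtain ⟨S₁, c₁, hS₁, h₁⟩ := hμ.supp
  obtain ⟨S₂, c₂, hS₂, h₂⟩ := hν.supp
  obtain ⟨S₃, c₃, hS₃, h₃⟩ := hκ.supp
  have hK : IsCompact (S₁ ×ˢ S₂ ×ˢ S₃) := c₁.prod (c₂.prod c₃)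
  have hc : Continuous fun q : Tri3 × R2 => bpt q.2 q.1 := by unfold bpt; fun_prop
  obtain ⟨B₁, hB₁⟩ := hK.exists_bound_of_continuousOn
    (f := fun X : Tri3 => X.2.1 - X.1) (by fun_prop)
  obtain ⟨B₂, hB₂⟩ := hK.exists_bound_of_continuousOn
    (f := fun X : Tri3 => X.2.2 - X.1) (by fun_prop)
  refine ⟨(fun q : Tri3 × R2 => bpt q.2 q.1) '' ((S₁ ×ˢ S₂ ×ˢ S₃) ×ˢ stdT), max B₁ B₂,
    (hK.prod cpt_stdT).image hc, fun cv => ?_, ?_⟩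
  · rintro _ ⟨⟨X, t⟩, ⟨⟨hX1, hX2, hX3⟩, ht⟩, rfl⟩
    exact bpt_mem cv ht (X := X) (hS₁ hX1) (hS₂ hX2) (hS₃ hX3)
  · filter_upwards [ae_tm h₁ h₂ h₃] with X ⟨a, b, c⟩
    exact ⟨fun t ht => ⟨(X, t), ⟨⟨a, b, c⟩, ht⟩, rfl⟩, (hB₁ X ⟨a, b, c⟩).trans (le_max_left _ _),
      (hB₂ X ⟨a, b, c⟩).trans (le_max_right _ _)⟩

lemma ae_pl {α β : Type*} [MeasurableSpace α] [MeasurableSpace β] {μ : Measure α}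
    {ν : Measure β} [SFinite ν] {P : α → Prop} (h : ∀ᵐ x ∂μ, P x) : ∀ᵐ q ∂(μ.prod ν), P q.1 :=
  Measure.quasiMeasurePreserving_fst.ae h

lemma ae_pr {α β : Type*} [MeasurableSpace α] [MeasurableSpace β] {μ : Measure α}
    {ν : Measure β} [SFinite ν] {P : β → Prop} (h : ∀ᵐ x ∂ν, P x) : ∀ᵐ q ∂(μ.prod ν), P q.2 :=
  Measure.quasiMeasurePreserving_snd.ae h

lemma Probe.intble_bpt (cv : Convex ℝ Ω) (hμ : Probe Ω μ) (hν : Probe Ω ν) (hκ : Probe Ω κ)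
    {θ : Measure R2} [IsFiniteMeasure θ] (hθ : ∀ᵐ t ∂θ, t ∈ stdT) (hf : LocInt Ω f) : Integrable
    (fun q : Tri3 × R2 => f (bpt q.2 q.1)) ((tm μ ν κ).prod θ) := by
  have := hμ.prob; have := hν.prob; have := hκ.prob
  obtain ⟨A, hA, h1, h2, h3⟩ := Probe.ex_dens hμ hν hκ
  obtain ⟨H, B, hH, hHΩ, hX⟩ := Probe.exists_bound hμ hν hκ
  have hi := intble_ind_of_cpt hf.loc hH (hHΩ cv)
  have hm : Measurable (H.indicator f) := hf.meas.indicator hH.measurableSet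
  have hI : Integrable (fun q : Tri3 × R2 => H.indicator f (bpt q.2 q.1))
      ((tm μ ν κ).prod θ) := by
    refine ⟨(hm.comp meas_bpt_prod).aestronglyMeasurable, ?_⟩
    have := lint_bpt_le h1 h2 h3 θ hm.enorm
    refine lt_of_le_of_lt this ?_
    refine ENNReal.mul_lt_top (ENNReal.mul_lt_top (ENNReal.mul_lt_top (by norm_num) hA.lt_top)
      (measure_lt_top _ _)) hi.2
  refine hI.congr ?_
  filter_upwards [ae_pl (ν := θ) hX, ae_pr (μ := tm μ ν κ) hθ] with q h1 h2
  rw [indicator_of_mem (h1.1 _ h2)]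

/-- The average of `u`. -/
def avg0 (μ : Measure R2) (u : R2 → ℝ) : ℝ := ∫ x, u x ∂μ

/-- The average of the integrals of `ζ` along the segments between random points. -/
def avg1 (μ ν : Measure R2) (ζ : R2 → R2) : ℝ :=
  ∫ q, pdot (ζ (bpt q.2 q.1)) (q.1.2.1 - q.1.1) ∂((tm μ ν ν).prod side)

/-- The average of the integrals of `s` over random triangles. -/
def avg2 (μ ν κ : Measure R2) (s : R2 → ℝ) : ℝ :=
  ∫ q, s (bpt q.2 q.1) * pdet (q.1.2.1 - q.1.1) (q.1.2.2 - q.1.1) ∂((tm μ ν κ).prod full)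

lemma Probe.integrable (cv : Convex ℝ Ω) (hμ : Probe Ω μ) (hf : LocInt Ω f) : Integrable f μ := by
  have := hμ.prob
  have h := hμ.intble_bpt cv hμ hμ (θ := Measure.dirac (0, 0))
    ((ae_dirac_iff (p := (· ∈ stdT)) cpt_stdT.measurableSet).2 v00) hf
  have h1 : Integrable (fun X : Tri3 => f X.1) (tm μ μ μ) := by
    have := h.integral_prod_left
    refine this.congr (.of_forall fun X => ?_)
    simp only
    rw [integral_dirac' (fun t => f (bpt t X)) _ (hf.meas.comp (meas_bpt X)).stronglyMeasurable]
    simp [bpt]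
  have mp : MeasurePreserving Prod.fst (tm μ μ μ) μ := measurePreserving_fst
  exact (mp.integrable_comp hf.meas.aestronglyMeasurable).1 h1

lemma Probe.intble_avg1 (cv : Convex ℝ Ω) (hμ : Probe Ω μ) (hν : Probe Ω ν)
    (hκ : Probe Ω κ) (hζ : LocInt Ω ζ) : Integrable
    (fun q : Tri3 × R2 => pdot (ζ (bpt q.2 q.1)) (q.1.2.1 - q.1.1)) ((tm μ ν κ).prod side) := by
  have := hμ.prob; have := hν.prob; have := hκ.prob
  obtain ⟨H, B, _, _, hX⟩ := Probe.exists_bound hμ hν hκ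
  have hX' := ae_pl (ν := side) hX
  have i1 := hμ.intble_bpt cv hν hκ ae_side hζ.fst
  have i2 := hμ.intble_bpt cv hν hκ ae_side hζ.snd
  unfold pdot
  refine (i1.mul_bdd (c := B) (g := fun q : Tri3 × R2 => (q.1.2.1 - q.1.1).1)
    (by fun_prop) ?_).add
    (i2.mul_bdd (c := B) (g := fun q : Tri3 × R2 => (q.1.2.1 - q.1.1).2) (by fun_prop) ?_)
  · filter_upwards [hX'] with q hq using (norm_fst_le _).trans hq.2.1
  · filter_upwards [hX'] with q hq using (norm_snd_le _).trans hq.2.1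

lemma Probe.intble_avg2 (cv : Convex ℝ Ω) (hμ : Probe Ω μ) (hν : Probe Ω ν)
    (hκ : Probe Ω κ) {s : R2 → ℝ} (hs : LocInt Ω s) : Integrable (fun q : Tri3 × R2 => s (bpt q.2
    q.1) * pdet (q.1.2.1 - q.1.1) (q.1.2.2 - q.1.1)) ((tm μ ν κ).prod full) := by
  have := hμ.prob; have := hν.prob; have := hκ.prob
  obtain ⟨H, B, _, _, hX⟩ := Probe.exists_bound hμ hν hκ
  have hX' := ae_pl (ν := full) hX
  refine (hμ.intble_bpt cv hν hκ ae_full hs).mul_bdd (c := 2 * B * B)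
    (by unfold pdet; fun_prop) ?_
  filter_upwards [hX'] with q hq
  refine (abs_pdet_le _ _).trans ?_
  have h1 := (norm_nonneg _).trans hq.2.1
  have h2 := hq.2.1
  have h3 := hq.2.2
  gcongr

lemma meas_seg (hζ : Measurable ζ) : Measurable fun z : R2 × R2 => seg ζ z.1 z.2 := by
  have hm : Measurable fun q : (R2 × R2) × ℝ => ζ (q.1.1 + q.2 • (q.1.2 - q.1.1)) :=
    hζ.comp (by fun_prop)
  have h1 := (hm.fst.stronglyMeasurable.integral_prod_right' (ν := volume.restrict I01)).measurable
  have h2 := (hm.snd.stronglyMeasurable.integral_prod_right' (ν := volume.restrict I01)).measurable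
  unfold seg
  fun_prop

lemma Probe.avg1_tm (cv : Convex ℝ Ω) (hμ : Probe Ω μ) (hν : Probe Ω ν) (hκ : Probe Ω κ) (hζ :
    LocInt Ω ζ) : Integrable (fun X : Tri3 => seg ζ X.1 X.2.1) (tm μ ν κ) ∧ ∫ q, pdot (ζ (bpt q.2
    q.1)) (q.1.2.1 - q.1.1) ∂((tm μ ν κ).prod side) = ∫ z, seg ζ z.1 z.2 ∂(μ.prod ν) := by
  have := hμ.prob; have := hν.prob; have := hκ.prob
  have hI := hμ.intble_avg1 cv hν hκ hζ
  have i1 := hμ.intble_bpt cv hν hκ ae_side hζ.fst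
  have i2 := hμ.intble_bpt cv hν hκ ae_side hζ.snd
  have hin : (fun X : Tri3 => ∫ t, pdot (ζ (bpt t X)) (X.2.1 - X.1) ∂side) =ᵐ[tm μ ν κ]
      fun X => seg ζ X.1 X.2.1 := by
    filter_upwards [i1.prod_right_ae, i2.prod_right_ae] with X j1 j2
    have := seg_bpt ζ hζ.meas (0, 0) (1, 0) X
    rw [bpt_corner00, bpt_corner10] at this
    rw [this]
    unfold pdot
    rw [integral_add (j1.mul_const _) (j2.mul_const _), integral_mul_const, integral_mul_const]
    ring
  have mp : MeasurePreserving (fun X : Tri3 => (X.1, X.2.1)) (tm μ ν κ) (μ.prod ν) :=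
    (MeasurePreserving.id μ).prod measurePreserving_fst
  constructor
  · exact hI.integral_prod_left.congr hin
  · rw [integral_prod _ hI, integral_congr_ae hin, ← mp.map_eq,
      integral_map mp.measurable.aemeasurable
        (meas_seg hζ.meas).aestronglyMeasurable]

lemma Probe.int_seg (cv : Convex ℝ Ω) (hμ : Probe Ω μ) (hν : Probe Ω ν)
    (hζ : LocInt Ω ζ) : Integrable (fun z => seg ζ z.1 z.2) (μ.prod ν) ∧ ∫ z, seg ζ z.1 z.2
    ∂(μ.prod ν) = avg1 μ ν ζ := by
  have := hμ.prob; have := hν.prob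
  obtain ⟨h1, h2⟩ := hμ.avg1_tm cv hν hν hζ
  have mp : MeasurePreserving (fun X : Tri3 => (X.1, X.2.1)) (tm μ ν ν) (μ.prod ν) :=
    (MeasurePreserving.id μ).prod measurePreserving_fst
  exact ⟨(mp.integrable_comp (meas_seg hζ.meas).aestronglyMeasurable).1 h1, h2.symm⟩

lemma Probe.int_tri (cv : Convex ℝ Ω) (hμ : Probe Ω μ) (hν : Probe Ω ν) (hκ : Probe Ω κ)
    {s : R2 → ℝ} (hs : LocInt Ω s) : Integrable (fun X : Tri3 => tri s X.1 X.2.1 X.2.2) (tm μ ν κ) ∧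
    ∫ X, tri s X.1 X.2.1 X.2.2 ∂(tm μ ν κ) = avg2 μ ν κ s := by
  have := hμ.prob; have := hν.prob; have := hκ.prob
  have hI := hμ.intble_avg2 cv hν hκ hs
  have hin : ∀ X : Tri3, ∫ t, s (bpt t X) * pdet (X.2.1 - X.1) (X.2.2 - X.1) ∂full =
      tri s X.1 X.2.1 X.2.2 := by
    intro X
    rw [integral_mul_const, mul_comm]; rfl
  constructor
  · have := hI.integral_prod_left
    simpa only [hin] using this
  · unfold avg2
    rw [integral_prod _ hI]
    simp only [hin]

lemma Probe.ac (hμ : Probe Ω μ) : μ ≪ volume := by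
  obtain ⟨A, _, h⟩ := hμ.dens
  exact (Measure.absolutelyContinuous_of_le h).trans Measure.smul_absolutelyContinuous

lemma Probe.tm_ac (hμ : Probe Ω μ) (hν : Probe Ω ν) (hκ : Probe Ω κ) : tm μ ν κ ≪
    (volume : Measure Tri3) := by
  have := hμ.prob; have := hν.prob; have := hκ.prob
  exact hμ.ac.prod (hν.ac.prod hκ.ac)

lemma Probe.avg0_sub (hΩ : IsOpen Ω) (cv : Convex ℝ Ω) (hμ : Probe Ω μ) (hν : Probe Ω ν)
    (hψ : LocInt Ω ψ) (hG : LocInt Ω G) (h : WGrad Ω ψ G) : avg0 ν ψ - avg0 μ ψ = avg1 μ ν G := by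
  have := hμ.prob; have := hν.prob
  have hae := (hμ.tm_ac hν hν).ae_le (ae_sub_eq_seg_triple hΩ cv hψ hG h)
  have mp1 : MeasurePreserving (fun X : Tri3 => X.1) (tm μ ν ν) μ := measurePreserving_fst
  have mp2 : MeasurePreserving (fun X : Tri3 => X.2.1) (tm μ ν ν) ν :=
    (measurePreserving_fst (μ := ν) (ν := ν)).comp measurePreserving_snd
  obtain ⟨i1, e1⟩ := mp_int mp1 hψ.meas (hμ.integrable cv hψ)
  obtain ⟨i2, e2⟩ := mp_int mp2 hψ.meas (hν.integrable cv hψ)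
  have mp : MeasurePreserving (fun X : Tri3 => (X.1, X.2.1)) (tm μ ν ν) (μ.prod ν) :=
    (MeasurePreserving.id μ).prod measurePreserving_fst
  obtain ⟨i, e⟩ := hμ.int_seg cv hν hG
  unfold avg0
  rw [e1, e2, ← integral_sub i2 i1, ← e, (mp_int mp (meas_seg hG.meas) i).2]
  apply integral_congr_ae
  filter_upwards [hae, ae_tm hμ.ae_mem hν.ae_mem hν.ae_mem] with X h1 h2
  have := h1 h2
  linarith

lemma Probe.avg1_coc (hΩ : IsOpen Ω) (cv : Convex ℝ Ω) (hμ : Probe Ω μ) (hν : Probe Ω ν)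
    (hκ : Probe Ω κ) {s : R2 → ℝ} (hζ : LocInt Ω ζ) (hs : LocInt Ω s) (h : WRot Ω ζ s) : avg1 μ ν
    ζ + avg1 ν κ ζ - avg1 μ κ ζ = avg2 μ ν κ s := by
  have := hμ.prob; have := hν.prob; have := hκ.prob
  have hae := (hμ.tm_ac hν hκ).ae_le (ae_stokes hΩ cv hζ hs h)
  have hm := (meas_seg hζ.meas)
  have mp1 : MeasurePreserving (fun X : Tri3 => (X.1, X.2.1)) (tm μ ν κ) (μ.prod ν) :=
    (MeasurePreserving.id μ).prod measurePreserving_fst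
  have mp2 : MeasurePreserving (fun X : Tri3 => X.2) (tm μ ν κ) (ν.prod κ) := measurePreserving_snd
  have mp3 : MeasurePreserving (fun X : Tri3 => (X.1, X.2.2)) (tm μ ν κ) (μ.prod κ) :=
    (MeasurePreserving.id μ).prod measurePreserving_snd
  have key : ∀ {ρ π : Measure R2} (_ : Probe Ω ρ) (_ : Probe Ω π)
      {f : Tri3 → R2 × R2} (_ : MeasurePreserving f (tm μ ν κ) (ρ.prod π)),
      Integrable (fun X => seg ζ (f X).1 (f X).2) (tm μ ν κ) ∧
        avg1 ρ π ζ = ∫ X, seg ζ (f X).1 (f X).2 ∂(tm μ ν κ) := by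
    intro ρ π hρ hπ f hf
    obtain ⟨i, e⟩ := hρ.int_seg cv hπ hζ
    exact e ▸ mp_int hf hm i
  obtain ⟨i1, e1⟩ := key hμ hν mp1
  obtain ⟨i2, e2⟩ := key hν hκ mp2
  obtain ⟨i3, e3⟩ := key hμ hκ mp3
  have i12 : Integrable (fun X : Tri3 => seg ζ X.1 X.2.1 + seg ζ X.2.1 X.2.2) (tm μ ν κ) := i1.add i2
  rw [e1, e2, e3, ← integral_add i1 i2, ← integral_sub i12 i3, ← (hμ.int_tri cv hν hκ hs).2]
  apply integral_congr_ae
  filter_upwards [hae, ae_tm hμ.ae_mem hν.ae_mem hκ.ae_mem] with X h1 h2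
  have := h1 h2
  linarith

/-! ### Linearity and bounds of the averages -/

lemma LocInt.add [MeasurableSpace F] [MeasurableAdd₂ F]
    {f g : R2 → F} (hf : LocInt Ω f) (hg : LocInt Ω g) : LocInt Ω fun p => f p + g p :=
  ⟨hf.meas.add hg.meas, hf.loc.add hg.loc⟩

lemma LocInt.const_smul [MeasurableSpace F] [BorelSpace F] [SecondCountableTopology F] {f : R2 → F}
    (hf : LocInt Ω f) (c : ℝ) : LocInt Ω fun p => c • f p :=
  ⟨hf.meas.const_smul c, hf.loc.smul c⟩

lemma Probe.ae_bpt_mem_of_cvx (hμ : Probe Ω μ) (hZ : Convex ℝ Z) (hν : Probe Ω ν)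
    (hκ : Probe Ω κ) (h₁ : ∀ᵐ x ∂μ, x ∈ Z) (h₂ : ∀ᵐ x ∂ν, x ∈ Z) (h₃ : ∀ᵐ x ∂κ, x ∈ Z)
    {θ : Measure R2} [IsFiniteMeasure θ] (hθ : ∀ᵐ t ∂θ, t ∈ stdT) {P : R2 → Prop}
    (hP : ∀ᵐ p, p ∈ Z → P p) : ∀ᵐ q ∂((tm μ ν κ).prod θ), P (bpt q.2 q.1) := by
  have := hμ.prob; have := hν.prob; have := hκ.prob
  obtain ⟨A, _, a1, a2, a3⟩ := Probe.ex_dens hμ hν hκ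
  filter_upwards [ae_bpt a1 a2 a3 θ hP, ae_pl (ν := θ) (ae_tm h₁ h₂ h₃),
    ae_pr (μ := tm μ ν κ) hθ] with q a b c
  exact a (bpt_mem hZ c b.1 b.2.1 b.2.2)

lemma Probe.ae_bpt_mem (cv : Convex ℝ Ω) (hμ : Probe Ω μ) (hν : Probe Ω ν) (hκ : Probe Ω κ)
    {θ : Measure R2} [IsFiniteMeasure θ] (hθ : ∀ᵐ t ∂θ, t ∈ stdT) {P : R2 → Prop}
    (hP : ∀ᵐ p, p ∈ Ω → P p) : ∀ᵐ q ∂((tm μ ν κ).prod θ), P (bpt q.2 q.1) :=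
  hμ.ae_bpt_mem_of_cvx cv hν hκ hμ.ae_mem hν.ae_mem hκ.ae_mem hθ hP

section linear

lemma Probe.avg0_congr (hμ : Probe Ω μ) (h : ∀ᵐ p, p ∈ Ω → f p = g p) : avg0 μ f = avg0 μ g := by
  apply integral_congr_ae
  filter_upwards [hμ.ac.ae_le h, hμ.ae_mem] with x h1 h2 using h1 h2

lemma Probe.avg1_congr (cv : Convex ℝ Ω) (hμ : Probe Ω μ) (hν : Probe Ω ν) {f g : R2 → R2}
    (h : ∀ᵐ p, p ∈ Ω → f p = g p) : avg1 μ ν f = avg1 μ ν g := by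
  apply integral_congr_ae
  filter_upwards [hμ.ae_bpt_mem cv hν hν ae_side h] with q hq
  rw [hq]

lemma Probe.avg2_congr (cv : Convex ℝ Ω) (hμ : Probe Ω μ) (hν : Probe Ω ν) (hκ : Probe Ω κ)
    (h : ∀ᵐ p, p ∈ Ω → f p = g p) : avg2 μ ν κ f = avg2 μ ν κ g := by
  apply integral_congr_ae
  filter_upwards [hμ.ae_bpt_mem cv hν hκ ae_full h] with q hq
  rw [hq]

lemma Probe.avg0_add (cv : Convex ℝ Ω) (hμ : Probe Ω μ) (hf : LocInt Ω f) (hg : LocInt Ω g) :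
    avg0 μ (fun p => f p + g p) = avg0 μ f + avg0 μ g :=
  integral_add (hμ.integrable cv hf) (hμ.integrable cv hg)

lemma Probe.avg1_add (cv : Convex ℝ Ω) (hμ : Probe Ω μ) (hν : Probe Ω ν) {f g : R2 → R2} (hf :
    LocInt Ω f) (hg : LocInt Ω g) : avg1 μ ν (fun p => f p + g p) = avg1 μ ν f + avg1 μ ν g := by
  unfold avg1
  rw [← integral_add (hμ.intble_avg1 cv hν hν hf) (hμ.intble_avg1 cv hν hν hg)]
  congr 1; ext q
  simp [pdot]; ring

lemma Probe.avg2_add (cv : Convex ℝ Ω) (hμ : Probe Ω μ) (hν : Probe Ω ν) (hκ : Probe Ω κ)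
    (hf : LocInt Ω f) (hg : LocInt Ω g) : avg2 μ ν κ (fun p => f p + g p) = avg2 μ ν κ f + avg2 μ ν
    κ g := by
  unfold avg2
  rw [← integral_add (hμ.intble_avg2 cv hν hκ hf) (hμ.intble_avg2 cv hν hκ hg)]
  congr 1; ext q; ring

lemma avg0_smul (c : ℝ) (f : R2 → ℝ) : avg0 μ (fun p => c • f p) = c * avg0 μ f :=
  integral_const_mul c f

lemma avg1_smul (c : ℝ) (f : R2 → R2) : avg1 μ ν (fun p => c • f p) = c * avg1 μ ν f := by
  unfold avg1
  rw [← integral_const_mul]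
  congr 1; ext q
  simp [pdot]; ring

lemma avg2_smul (c : ℝ) (f : R2 → ℝ) : avg2 μ ν κ (fun p => c • f p) = c * avg2 μ ν κ f := by
  unfold avg2
  rw [← integral_const_mul]
  congr 1; ext q
  simp; ring

end linear

lemma lint_sq_le {α : Type*} [MeasurableSpace α] {P : Measure α} (hP : P Set.univ ≤ 1)
    {f : α → ENNReal} (hf : AEMeasurable f P) : (∫⁻ x, f x ∂P) ^ 2 ≤ ∫⁻ x, f x ^ 2 ∂P := by
  have h := ENNReal.lintegral_mul_le_Lp_mul_Lq P Real.HolderConjugate.two_two hf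
    (aemeasurable_const (b := (1 : ENNReal)))
  simp only [Pi.mul_apply, mul_one, ENNReal.one_rpow, lintegral_const, one_mul] at h
  have h2 : ∫⁻ x, f x ∂P ≤ (∫⁻ x, f x ^ (2 : ℝ) ∂P) ^ (1 / 2 : ℝ) := by
    refine h.trans ?_
    calc _ ≤ (∫⁻ x, f x ^ (2 : ℝ) ∂P) ^ (1 / 2 : ℝ) * 1 := by
          gcongr
          exact ENNReal.rpow_le_one hP (by norm_num)
      _ = _ := mul_one _
  calc (∫⁻ x, f x ∂P) ^ 2 ≤ ((∫⁻ x, f x ^ (2 : ℝ) ∂P) ^ (1 / 2 : ℝ)) ^ 2 := by gcongr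
    _ = ∫⁻ x, f x ^ (2 : ℝ) ∂P := by
        rw [← ENNReal.rpow_natCast, ← ENNReal.rpow_mul]; norm_num
    _ = _ := by simp

lemma enorm_pdot_le (a b : R2) {ℓ : ℝ} (h : ‖b‖ ≤ ℓ) : ‖pdot a b‖ₑ ≤ ofReal (2 * ℓ) * ‖a‖ₑ := by
  have h1 := abs_pdot_le a b
  rw [← ofReal_norm, ← ofReal_norm,
    ← ofReal_mul (by linarith [norm_nonneg b])]
  apply ofReal_le_ofReal
  rw [norm_eq_abs]
  nlinarith [norm_nonneg a]

lemma enorm_avg1_le [IsProbabilityMeasure μ] [IsProbabilityMeasure ν] {ℓ : ℝ}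
    (hℓ : ∀ᵐ X ∂(tm μ ν ν), ‖X.2.1 - X.1‖ ≤ ℓ) (ζ : R2 → R2) : ‖avg1 μ ν ζ‖ₑ ≤ ofReal (2 * ℓ) * ∫⁻
    q, ‖ζ (bpt q.2 q.1)‖ₑ ∂((tm μ ν ν).prod side) := by
  unfold avg1
  refine (enorm_integral_le_lintegral_enorm _).trans ?_
  rw [← lintegral_const_mul' _ _ ofReal_ne_top]
  apply lintegral_mono_ae
  filter_upwards [ae_pl (ν := side) hℓ] with q hq
  exact enorm_pdot_le _ _ hq

lemma enorm_avg2_le [IsProbabilityMeasure μ] [IsProbabilityMeasure ν] [IsProbabilityMeasure κ]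
    {ℓ ℓ' : ℝ} (hℓ : ∀ᵐ X ∂(tm μ ν κ), ‖X.2.1 - X.1‖ ≤ ℓ)
    (hℓ' : ∀ᵐ X ∂(tm μ ν κ), ‖X.2.2 - X.1‖ ≤ ℓ') (s : R2 → ℝ) : ‖avg2 μ ν κ s‖ₑ ≤ ofReal
    (2 * ℓ * ℓ') * ∫⁻ q, ‖s (bpt q.2 q.1)‖ₑ ∂((tm μ ν κ).prod full) := by
  unfold avg2
  refine (enorm_integral_le_lintegral_enorm _).trans ?_
  rw [← lintegral_const_mul' _ _ ofReal_ne_top]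
  apply lintegral_mono_ae
  filter_upwards [ae_pl (ν := full) hℓ, ae_pl (ν := full) hℓ'] with q h1 h2
  rw [enorm_mul, mul_comm]
  gcongr
  rw [← ofReal_norm]
  apply ofReal_le_ofReal
  refine (abs_pdet_le _ _).trans ?_
  have := (norm_nonneg _).trans h1
  gcongr

/-! ### Probes near a triangle -/

/-- The probability measure `μ` has density `O(h⁻²)` and lives on the points of `Ω` close to the
triangle `s`, at a distance at least `a ρ` from the axis. -/
structure Near (Ω : Set R2) (C A a : ℝ) (s : Finset R2) (μ : Measure R2) : Prop where
  prob : IsProbabilityMeasure μ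
  dens : μ ≤ ofReal (A / dK s ^ 2) • volume
  zone : ∀ᵐ x ∂μ, x ∈ zone Ω C s
  rad : ∀ᵐ x ∂μ, a * rho s ≤ x.1

lemma dist_le_of_zone (hC : 1 ≤ C) {x y : R2} (hx : x ∈ zone Ω C s) (hy : y ∈ zone Ω C s) : ‖y -
    x‖ ≤ 3 * dK s := by
  obtain ⟨_, q, hq, h1⟩ := hx
  obtain ⟨_, q', hq', h2⟩ := hy
  have h3 := norm_sub_le_diam hq' hq
  have h4 : ‖x - q‖ ≤ dK s := by nlinarith [norm_nonneg (x - q)]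
  have h5 : ‖y - q'‖ ≤ dK s := by nlinarith [norm_nonneg (y - q')]
  have e : y - x = (y - q') + (q' - q) - (x - q) := by abel
  rw [e]
  have := norm_sub_le ((y - q') + (q' - q)) (x - q)
  have := norm_add_le (y - q') (q' - q)
  linarith

section near

lemma Near.lint_le (cv : Convex ℝ Ω) (g : Geom Ω Tr φ C) (hs : s ∈ Tr) (ha : 0 < a) (n₁ : Near Ω C A
    a s μ) (n₂ : Near Ω C A a s ν) (n₃ : Near Ω C A a s κ) {θ : Measure R2} [IsFiniteMeasure θ] (hθ1
    : θ Set.univ ≤ 1) (hθ : ∀ᵐ t ∂θ, t ∈ stdT) (α : ℕ) {f : R2 → ENNReal} (hf : Measurable f) : (∫⁻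
    q, f (bpt q.2 q.1) ∂((tm μ ν κ).prod θ)) * ofReal (dK s ^ 2 * rho s ^ α) ≤ ofReal (9 * A / a ^
    α) * ∫⁻ p in patch Tr s, f p * ofReal (p.1 ^ α) := by
  have := n₁.prob; have := n₂.prob; have := n₃.prob
  have hd := g.spos hs
  have hρ := g.rho_pos hs
  set f' : R2 → ENNReal := (patch Tr s).indicator fun p => f p * ofReal (p.1 ^ α) with hf'
  have hm : Measurable f' := Measurable.indicator (by fun_prop) (mset_patch Tr s)
  have h1 : (∫⁻ q, f (bpt q.2 q.1) ∂((tm μ ν κ).prod θ)) * ofReal ((a * rho s) ^ α) ≤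
      ∫⁻ q, f' (bpt q.2 q.1) ∂((tm μ ν κ).prod θ) := by
    rw [← lintegral_mul_const' _ _ ofReal_ne_top]
    apply lintegral_mono_ae
    filter_upwards [ae_pl (ν := θ) (ae_tm n₁.zone n₂.zone n₃.zone),
      ae_pl (ν := θ) (ae_tm n₁.rad n₂.rad n₃.rad),
      ae_pr (μ := tm μ ν κ) hθ] with q b c d
    have hz := bpt_mem (cvx_zone cv g.pos.le s) d b.1 b.2.1 b.2.2
    have hr : a * rho s ≤ (bpt q.2 q.1).1 :=
      bpt_mem (Ω := {p : R2 | a * rho s ≤ p.1})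
        ((convex_Ici (a * rho s)).linear_preimage (LinearMap.fst ℝ ℝ ℝ)) d c.1 c.2.1 c.2.2
    rw [hf', indicator_of_mem (g.zone_sub hs hz)]
    gcongr
  have h2 := lint_bpt_le n₁.dens n₂.dens n₃.dens θ hm
  have h3 : ∫⁻ p, f' p = ∫⁻ p in patch Tr s, f p * ofReal (p.1 ^ α) :=
    lintegral_indicator (mset_patch Tr s) _
  rw [h3] at h2
  have e1 : ofReal (dK s ^ 2 * rho s ^ α) =
      ofReal ((a * rho s) ^ α) * ofReal (dK s ^ 2 / a ^ α) := by
    rw [← ofReal_mul (by positivity)]; congr 1; rw [mul_pow]; field_simp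
  rw [e1, ← mul_assoc]
  calc _ ≤ (9 * ofReal (A / dK s ^ 2) * 1 *
        ∫⁻ p in patch Tr s, f p * ofReal (p.1 ^ α)) * ofReal (dK s ^ 2 / a ^ α) := by
        refine mul_le_mul' (h1.trans (h2.trans ?_)) le_rfl
        gcongr
    _ = (9 * (ofReal (A / dK s ^ 2) * ofReal (dK s ^ 2 / a ^ α))) *
        ∫⁻ p in patch Tr s, f p * ofReal (p.1 ^ α) := by ring
    _ = _ := by
        rw [← ENNReal.ofReal_mul' (by positivity), show (9 : ENNReal) = ofReal 9 by simp,
          ← ofReal_mul (by norm_num)]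
        congr 2; field_simp

lemma Near.enorm_avg0_sq (cv : Convex ℝ Ω) (g : Geom Ω Tr φ C) (hs : s ∈ Tr) (ha : 0 < a)
    (n₁ : Near Ω C A a s μ) (α : ℕ) (hf : Measurable f) : ‖avg0 μ f‖ₑ ^ 2 * ofReal
    (dK s ^ 2 * rho s ^ α) ≤ ofReal (9 * A / a ^ α) * wE α f (patch Tr s) := by
  have := n₁.prob
  have h1 := Near.lint_le cv g hs ha n₁ n₁ n₁ (θ := Measure.dirac (0, 0)) (by simp)
    ((ae_dirac_iff (p := (· ∈ stdT)) cpt_stdT.measurableSet).2 v00) α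
    (hf.enorm.pow_const 2)
  refine le_trans ?_ h1
  gcongr
  have hm : Measurable fun q : Tri3 × R2 => ‖f (bpt q.2 q.1)‖ₑ ^ 2 :=
    (hf.enorm.pow_const 2).comp meas_bpt_prod
  rw [lintegral_prod _ hm.aemeasurable]
  have e1 : ∀ X : Tri3, ∫⁻ t, ‖f (bpt t X)‖ₑ ^ 2 ∂(Measure.dirac ((0, 0) : R2)) =
      ‖f X.1‖ₑ ^ 2 := by
    intro X
    rw [lintegral_dirac' (f := fun t => ‖f (bpt t X)‖ₑ ^ 2) _
      ((hf.enorm.pow_const 2).comp (meas_bpt X))]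
    simp [bpt]
  simp only [e1]
  have mp : MeasurePreserving (fun X : Tri3 => X.1) (tm μ μ μ) μ := measurePreserving_fst
  rw [mp.lintegral_comp (hf.enorm.pow_const 2)]
  refine le_trans ?_ (lint_sq_le (by simp) hf.enorm.aemeasurable)
  gcongr
  exact enorm_integral_le_lintegral_enorm _

lemma Near.dist (g : Geom Ω Tr φ C) (n₁ : Near Ω C A a s μ) (n₂ : Near Ω C A a s ν) (n₃ : Near Ω C A
    a s κ) : ∀ᵐ X ∂(tm μ ν κ), ‖X.2.1 - X.1‖ ≤ 3 * dK s ∧ ‖X.2.2 - X.1‖ ≤ 3 * dK s := by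
  have := n₁.prob; have := n₂.prob; have := n₃.prob
  filter_upwards [ae_tm n₁.zone n₂.zone n₃.zone] with X h
  exact ⟨dist_le_of_zone g.one_le h.1 h.2.1, dist_le_of_zone g.one_le h.1 h.2.2⟩

lemma Near.enorm_sq_le (cv : Convex ℝ Ω) (g : Geom Ω Tr φ C) (hs : s ∈ Tr) (ha : 0 < a) (n₁ : Near Ω
    C A a s μ) (n₂ : Near Ω C A a s ν) (n₃ : Near Ω C A a s κ) {θ : Measure R2} [IsFiniteMeasure θ]
    (hθ1 : θ Set.univ ≤ 1) (hθ : ∀ᵐ t ∂θ, t ∈ stdT) (α : ℕ) [MeasurableSpace E]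
    [OpensMeasurableSpace E] {f : R2 → E} (hf : Measurable f) {I L : ℝ} (hL : 0 ≤ L) (h : ‖I‖ₑ ≤
    ofReal L * ∫⁻ q, ‖f (bpt q.2 q.1)‖ₑ ∂((tm μ ν κ).prod θ)) : ‖I‖ₑ ^ 2 * ofReal (dK s ^ 2 * rho s
    ^ α) ≤ ofReal (L ^ 2) * (ofReal (9 * A / a ^ α) * wE α f (patch Tr s)) := by
  have := n₁.prob; have := n₂.prob; have := n₃.prob
  have h1 := Near.lint_le cv g hs ha n₁ n₂ n₃ hθ1 hθ α (hf.enorm.pow_const 2)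
  have h3 := lint_sq_le (P := (tm μ ν κ).prod θ)
    (by rw [← Set.univ_prod_univ, Measure.prod_prod]; simpa using hθ1)
    (f := fun q => ‖f (bpt q.2 q.1)‖ₑ) (hf.enorm.comp meas_bpt_prod).aemeasurable
  calc _ ≤ _ := mul_le_mul' (pow_le_pow_left' h 2) le_rfl
    _ ≤ _ := by
      rw [mul_pow, ← ofReal_pow hL, mul_assoc]
      exact mul_le_mul' le_rfl ((mul_le_mul' h3 le_rfl).trans h1)

lemma Near.enorm_avg1_sq (cv : Convex ℝ Ω) (g : Geom Ω Tr φ C) (hs : s ∈ Tr) (ha : 0 < a)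
    (n₁ : Near Ω C A a s μ) (n₂ : Near Ω C A a s ν) (α : ℕ) {f : R2 → R2} (hf : Measurable f) :
    ‖avg1 μ ν f‖ₑ ^ 2 * ofReal (dK s ^ 2 * rho s ^ α) ≤ ofReal (36 * dK s ^ 2) *
    (ofReal (9 * A / a ^ α) * wE α f (patch Tr s)) := by
  have := n₁.prob; have := n₂.prob
  have h := Near.enorm_sq_le cv g hs ha n₁ n₂ n₂ (by simp) ae_side α hf
    (by have := diam_nn s; positivity)
    (enorm_avg1_le ((Near.dist g n₁ n₂ n₂).mono fun _ h => h.1) f)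
  rwa [show (2 * (3 * dK s)) ^ 2 = 36 * dK s ^ 2 by ring] at h

lemma Near.enorm_avg2_sq (cv : Convex ℝ Ω) (g : Geom Ω Tr φ C) (hs : s ∈ Tr) (ha : 0 < a)
    (n₁ : Near Ω C A a s μ) (n₂ : Near Ω C A a s ν) (n₃ : Near Ω C A a s κ) (α : ℕ)
    (hf : Measurable f) : ‖avg2 μ ν κ f‖ₑ ^ 2 * ofReal (dK s ^ 2 * rho s ^ α) ≤ ofReal
    (324 * dK s ^ 4) * (ofReal (9 * A / a ^ α) * wE α f (patch Tr s)) := by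
  have := n₁.prob; have := n₂.prob; have := n₃.prob
  have d := Near.dist g n₁ n₂ n₃
  have h := Near.enorm_sq_le cv g hs ha n₁ n₂ n₃ full_univ_le ae_full α hf
    (by have := diam_nn s; positivity)
    (enorm_avg2_le (d.mono fun _ h => h.1) (d.mono fun _ h => h.2) f)
  rwa [show (2 * (3 * dK s) * (3 * dK s)) ^ 2 = 324 * dK s ^ 4 by ring] at h

end near

/-! ### Averages of bounded functions -/

section bounded

lemma Probe.abs_avg1_le (hZ : Convex ℝ Z) (hμ : Probe Ω μ) (hν : Probe Ω ν) (h₁ : ∀ᵐ x ∂μ, x ∈ Z)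
    (h₂ : ∀ᵐ x ∂ν, x ∈ Z) {m ℓ : ℝ} (hm : ∀ᵐ p, p ∈ Z → ‖ζ p‖ ≤ m)
    (hℓ : ∀ᵐ X ∂(tm μ ν ν), ‖X.2.1 - X.1‖ ≤ ℓ) : |avg1 μ ν ζ| ≤ 2 * m * ℓ := by
  have := hμ.prob; have := hν.prob
  unfold avg1
  have := norm_integral_le_of_norm_le_const (μ := (tm μ ν ν).prod side) (C := 2 * m * ℓ)
    (f := fun q => pdot (ζ (bpt q.2 q.1)) (q.1.2.1 - q.1.1)) ?_
  · simpa using this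
  · filter_upwards [hμ.ae_bpt_mem_of_cvx hZ hν hν h₁ h₂ h₂ ae_side hm,
      ae_pl (ν := side) hℓ] with q a b
    refine (abs_pdot_le _ _).trans ?_
    have := (norm_nonneg _).trans a
    gcongr

lemma Probe.abs_avg2_le (hZ : Convex ℝ Z) (hμ : Probe Ω μ) (hν : Probe Ω ν) (hκ : Probe Ω κ)
    (h₁ : ∀ᵐ x ∂μ, x ∈ Z) (h₂ : ∀ᵐ x ∂ν, x ∈ Z) (h₃ : ∀ᵐ x ∂κ, x ∈ Z) {s : R2 → ℝ} {m D : ℝ}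
    (hm : ∀ᵐ p, p ∈ Z → |s p| ≤ m) (hD : ∀ᵐ X ∂(tm μ ν κ), |pdet (X.2.1 - X.1) (X.2.2 - X.1)| ≤ D)
    (hm0 : 0 ≤ m) (hD0 : 0 ≤ D) : |avg2 μ ν κ s| ≤ m * D := by
  have := hμ.prob; have := hν.prob; have := hκ.prob
  unfold avg2
  have := norm_integral_le_of_norm_le_const (μ := (tm μ ν κ).prod full) (C := m * D)
    (f := fun q => s (bpt q.2 q.1) * pdet (q.1.2.1 - q.1.1) (q.1.2.2 - q.1.1)) ?_
  · refine this.trans ?_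
    have h1 : ((tm μ ν κ).prod full).real Set.univ ≤ 1 := by
      refine ENNReal.toReal_le_of_le_ofReal zero_le_one ?_
      rw [← Set.univ_prod_univ, Measure.prod_prod]; simpa using full_univ_le
    exact mul_le_of_le_one_right (by positivity) h1
  · filter_upwards [hμ.ae_bpt_mem_of_cvx hZ hν hκ h₁ h₂ h₃ ae_full hm,
      ae_pl (ν := full) hD] with q a b
    rw [norm_eq_abs, abs_mul]
    exact mul_le_mul a b (abs_nonneg _) hm0

end bounded

/-! ### Samp measures -/

/-- The uniform measure on the image of the ball `B(c, R)` under the homothety of ratio `g` with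
center `v`. -/
def samp (g : ℝ) (v c : R2) (R : ℝ) : Measure R2 :=
  unif (closedBall (v + g • (c - v)) (g * R))

lemma ex_of_mem_samp_ball {g : ℝ} (hg : 0 < g) {c x : R2} {R : ℝ} (hx : x ∈ closedBall (v + g • (c -
    v)) (g * R)) : ∃ y ∈ closedBall c R, x = v + g • (y - v) := by
  refine ⟨v + g⁻¹ • (x - v), ?_, ?_⟩
  · rw [Metric.mem_closedBall, dist_eq_norm] at hx ⊢
    have e : v + g⁻¹ • (x - v) - c = g⁻¹ • (x - (v + g • (c - v))) := by
      rw [← sub_sub, smul_sub g⁻¹ (x - v), smul_smul, inv_mul_cancel₀ hg.ne', one_smul]; abel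
    rw [e, norm_smul, norm_eq_abs, abs_of_pos (by positivity), inv_mul_le_iff₀ hg]
    exact hx
  · rw [add_sub_cancel_left, smul_smul, mul_inv_cancel₀ hg.ne', one_smul]; abel

lemma vol_ball_pl (c : R2) {R : ℝ} (hR : 0 ≤ R) : volume (closedBall c R) = ofReal (4 * R ^ 2) := by
  rw [show c = (c.1, c.2) from rfl, ← closedBall_prod_same, Measure.volume_eq_prod,
    Measure.prod_prod, Real.volume_closedBall, Real.volume_closedBall,
    ← ofReal_mul (by positivity)]
  congr 1; ring

lemma samp_prob {g : ℝ} (hg : 0 < g) (v c : R2) {R : ℝ} (hR : 0 < R) : IsProbabilityMeasure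
    (samp g v c R) := by
  have h := vol_ball_pl (v + g • (c - v)) (R := g * R) (by positivity)
  apply prob_unif
  · rw [h, Ne, ENNReal.ofReal_eq_zero, not_le]; positivity
  · rw [h]; exact ofReal_ne_top

lemma samp_le {g : ℝ} (hg : 0 < g) (v c : R2) {R : ℝ} (hR : 0 < R) : samp g v c R ≤ ofReal
    (1 / (4 * (g * R) ^ 2)) • volume := by
  refine (unif_le _).trans (le_of_eq ?_)
  rw [vol_ball_pl _ (by positivity), ← ENNReal.ofReal_inv_of_pos (by positivity), one_div]

lemma ae_samp {g : ℝ} (hg : 0 < g) (v c : R2) (R : ℝ) : ∀ᵐ x ∂(samp g v c R), ∃ y ∈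
    closedBall c R, x = v + g • (y - v) := by
  filter_upwards [ae_mem_unif (S := closedBall (v + g • (c - v)) (g * R))
    Metric.isClosed_closedBall.measurableSet] with x hx
  exact ex_of_mem_samp_ball hg hx

lemma samp_probe (hΩ : IsOpen Ω) (cv : Convex ℝ Ω) {g : ℝ} (hg : 0 < g) (hg1 : g ≤ 1) {c : R2} (hv :
    v ∈ closure Ω) {R : ℝ} (hR : 0 < R) (hB : closedBall c R ⊆ Ω) : Probe Ω (samp g v c R) := by
  refine ⟨samp_prob hg v c hR, ⟨_, ofReal_ne_top, samp_le hg v c hR⟩,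
    closedBall (v + g • (c - v)) (g * R), isCompact_closedBall _ _, fun x hx => ?_,
    ae_mem_unif Metric.isClosed_closedBall.measurableSet⟩
  obtain ⟨y, hy, rfl⟩ := ex_of_mem_samp_ball hg hx
  rw [← hΩ.interior_eq]
  exact cv.add_smul_sub_mem_interior' hv (by rw [hΩ.interior_eq]; exact hB hy) ⟨hg, hg1⟩

/-- A family of sampling measures attached to the vertices, within a distance `ε h` of them. -/
structure Samp (Ω : Set R2) (Tr : Finset (Finset R2)) (C A a ε : ℝ)
    (μ : R2 → Measure R2) : Prop where
  probe : ∀ s ∈ Tr, ∀ v ∈ s, Probe Ω (μ v)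
  near : ∀ s ∈ Tr, ∀ v ∈ s, Near Ω C A a s (μ v)
  close : ∀ s ∈ Tr, ∀ v ∈ s, ∀ᵐ x ∂(μ v), ‖x - v‖ ≤ ε * dK s

lemma eDist_le (p q : R2) : eDist p q ≤ 2 * ‖p - q‖ := by
  unfold eDist
  rw [Real.sqrt_le_left (by positivity)]
  have h1 := norm_fst_le (p - q)
  have h2 := norm_snd_le (p - q)
  simp only [fst_sub, snd_sub, norm_eq_abs] at h1 h2
  have := sq_le_sq' (by linarith [abs_nonneg (p.1 - q.1), norm_nonneg (p - q)]) h1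
  have := sq_le_sq' (by linarith [abs_nonneg (p.2 - q.2), norm_nonneg (p - q)]) h2
  rw [sq_abs] at *
  nlinarith [sq_nonneg ‖p - q‖]

lemma ex_samp (hΩ : IsMeridianDomain Ω) (hb : IsBounded Ω) (C : ℝ) (hε : 0 < ε)
    (hε1 : ε ≤ 1) : ∃ A a : ℝ, 0 < a ∧ ∀ (Tr : Finset (Finset R2)) (φ : R2 → R2 → ℝ), Geom Ω Tr
    φ C → ∃ μ, Samp Ω Tr C A a ε μ := by
  classical
  obtain ⟨c, hc⟩ := hΩ.nonempty
  obtain ⟨R, hR, hB⟩ := Metric.nhds_basis_closedBall.mem_iff.1 (hΩ.isOpen.mem_nhds hc)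
  obtain ⟨b, hb0, hbB⟩ : ∃ b > 0, ∀ y ∈ closedBall c R, b ≤ y.1 := by
    obtain ⟨y, hy, hmin⟩ := (isCompact_closedBall c R).exists_isMinOn
      ⟨c, Metric.mem_closedBall_self hR.le⟩ continuous_fst.continuousOn
    exact ⟨y.1, hΩ.pos y (hB hy), fun z hz => hmin hz⟩
  obtain ⟨D, hD0, hD⟩ : ∃ D > 0, ∀ v ∈ closure Ω, ∀ y ∈ closure Ω, 2 * ‖y - v‖ ≤ D := by
    obtain ⟨D, hD⟩ := hb.closure.exists_norm_le
    refine ⟨4 * (|D| + 1), by positivity, fun v hv y hy => ?_⟩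
    have := norm_sub_le y v
    have := hD v hv; have := hD y hy
    have := le_abs_self D
    linarith
  have hBc : closedBall c R ⊆ closure Ω := hB.trans subset_closure
  by_cases hC : 1 ≤ C
  swap
  · exact ⟨0, 1, one_pos, fun Tr φ g => absurd g.one_le hC⟩
  have hC0 : 0 < C := by linarith
  set m : ℝ := min (1 / 2) (ε * b / (2 * C ^ 3 * D)) with hm
  have hm0 : 0 < m := by positivity
  refine ⟨C ^ 6 * D ^ 2 / (ε ^ 2 * R ^ 2), m / 3, by positivity, fun Tr φ g => ?_⟩
  have hex : ∀ v : R2, ∃ μ : Measure R2, ∀ s ∈ Tr, v ∈ s → Probe Ω μ ∧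
      Near Ω C (C ^ 6 * D ^ 2 / (ε ^ 2 * R ^ 2)) (m / 3) s μ ∧ ∀ᵐ x ∂μ, ‖x - v‖ ≤ ε * dK s := by
    intro v
    by_cases hv : ∃ t ∈ Tr, v ∈ t
    swap
    · push Not at hv
      exact ⟨0, fun s hs hvs => absurd hvs (hv s hs)⟩
    obtain ⟨t, ht, hvt⟩ := hv
    have hdt := g.spos ht
    have htD : dK t ≤ D := by
      refine csSup_le ⟨eDist v v, v, hvt, v, hvt, rfl⟩ ?_
      rintro d ⟨p, hp, q, hq, rfl⟩
      exact (eDist_le p q).trans (hD q (g.sub t ht (sub_hull hq)) p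
        (g.sub t ht (sub_hull hp)))
    have hvΩ : v ∈ closure Ω := g.sub t ht (sub_hull hvt)
    set γ : ℝ := ε * dK t / (2 * C ^ 2 * D) with hγ
    have hγ0 : 0 < γ := by positivity
    have hγ1 : γ ≤ 1 / 2 := by
      rw [hγ, div_le_iff₀ (by positivity)]
      have h1 : ε * dK t ≤ 1 * D := mul_le_mul hε1 htD hdt.le zero_le_one
      have h2 : 1 * D ≤ C ^ 2 * D := by gcongr; nlinarith
      linarith
    have hprobe := samp_probe hΩ.isOpen hΩ.cvx hγ0 (by linarith) hvΩ hR hB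
    refine ⟨samp γ v c R, fun s hs hvs => ?_⟩
    have hds := g.spos hs
    have hts := g.comp s hs t ht v hvs hvt
    have hst := g.comp t ht s hs v hvt hvs
    have hclose : ∀ᵐ x ∂(samp γ v c R), C * ‖x - v‖ ≤ ε * dK s := by
      filter_upwards [ae_samp hγ0 v c R] with x hx
      obtain ⟨y, hy, rfl⟩ := hx
      rw [add_sub_cancel_left, norm_smul, norm_eq_abs, abs_of_pos hγ0]
      have h1 : ‖y - v‖ ≤ D := by
        have := hD v hvΩ y (hBc hy); linarith [norm_nonneg (y - v)]
      calc C * (γ * ‖y - v‖) ≤ C * (γ * D) := by gcongr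
        _ = ε * (dK t / C) / 2 := by rw [hγ]; field_simp
        _ ≤ ε * dK s / 2 := by
            gcongr; rw [div_le_iff₀ hC0]; linarith
        _ ≤ ε * dK s := by linarith [mul_pos hε hds]
    refine ⟨hprobe, ⟨hprobe.prob, ?_, ?_, ?_⟩, ?_⟩
    · refine (samp_le hγ0 v c hR).trans fun S => ?_
      simp only [Measure.smul_apply, smul_eq_mul]
      refine mul_le_mul' (ofReal_le_ofReal ?_) le_rfl
      rw [hγ, div_div, div_le_div_iff₀ (by positivity) (by positivity)]
      have h1 : dK s ^ 2 ≤ (C * dK t) ^ 2 := by gcongr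
      calc 1 * (ε ^ 2 * R ^ 2 * dK s ^ 2) ≤ ε ^ 2 * R ^ 2 * (C * dK t) ^ 2 := by
            rw [one_mul]; gcongr
        _ = _ := by field_simp; ring
    · filter_upwards [hclose, hprobe.ae_mem] with x h1 h2
      refine ⟨h2, v, sub_hull hvs, h1.trans ?_⟩
      exact mul_le_of_le_one_left hds.le hε1
    · filter_upwards [ae_samp hγ0 v c R] with x hx
      obtain ⟨y, hy, rfl⟩ := hx
      have h1 := hbB y hy
      have h2 := g.rho_le_add hs hvs
      have h3 := g.fst_nonneg s hs v hvs
      have h4 : ε * b / (2 * C ^ 3 * D) * dK s ≤ γ * b := by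
        rw [hγ, div_mul_eq_mul_div, div_mul_eq_mul_div, div_le_div_iff₀ (by positivity) (by positivity)]
        calc ε * b * dK s * (2 * C ^ 2 * D) ≤ ε * b * (C * dK t) * (2 * C ^ 2 * D) := by
              gcongr
          _ = _ := by ring
      simp only [Prod.fst_add, smul_fst, fst_sub, smul_eq_mul]
      calc m / 3 * rho s ≤ m / 3 * (3 * (v.1 + dK s)) := by gcongr
        _ = m * v.1 + m * dK s := by ring
        _ ≤ 1 / 2 * v.1 + ε * b / (2 * C ^ 3 * D) * dK s := by
            gcongr
            · exact min_le_left _ _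
            · exact min_le_right _ _
        _ ≤ (1 - γ) * v.1 + γ * b := by
            have : 1 / 2 * v.1 ≤ (1 - γ) * v.1 := by gcongr; linarith
            linarith
        _ ≤ (1 - γ) * v.1 + γ * y.1 := by gcongr
        _ = _ := by ring
    · filter_upwards [hclose] with x h1
      have : 1 * ‖x - v‖ ≤ C * ‖x - v‖ := by gcongr
      linarith
  choose μ hμ using hex
  exact ⟨μ, fun s hs v hv => (hμ v s hs hv).1, fun s hs v hv => (hμ v s hs hv).2.1,
    fun s hs v hv => (hμ v s hs hv).2.2⟩

/-! ### Linearity of weak derivatives -/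

lemma intOn_mul_test (hf : LocallyIntegrableOn f Ω) (hχ : Continuous χ)
    (hc : HasCompactSupport χ) (hs : tsupport χ ⊆ Ω) : IntegrableOn (fun p => f p * χ p) Ω := by
  have h1 : IntegrableOn f (tsupport χ) := hf.integrableOn_compact_subset hs hc
  have h2 : IntegrableOn (fun p => f p * χ p) (tsupport χ) :=
    h1.mul_continuousOn hχ.continuousOn hc
  have : Integrable (fun p => f p * χ p) := by
    rw [← integrableOn_iff_integrable_of_support_subset (s := tsupport χ)]
    · exact h2
    · intro p hp
      apply subset_tsupport
      intro h0
      simp [h0] at hp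
  exact this.integrableOn

lemma IsTest.intOn_mul (hf : LocallyIntegrableOn f Ω) (hχ : IsTest Ω χ) : IntegrableOn
    (fun p => f p * χ p) Ω :=
  intOn_mul_test hf hχ.1.continuous hχ.2.1 hχ.2.2

lemma IsTest.fd_test (hχ : IsTest Ω χ) (e : R2) : IsTest Ω fun p => fderiv ℝ χ p e := by
  refine ⟨?_, hχ.2.1.fderiv_apply ℝ e, (tsupport_fderiv_apply_subset ℝ e).trans hχ.2.2⟩
  exact (hχ.1.fderiv_right (m := ∞) (by norm_cast)).clm_apply contDiff_const

lemma WGrad.congr (hΩ : MeasurableSet Ω) {ψ' : R2 → ℝ} {G' : R2 → R2} (h : WGrad Ω ψ G)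
    (h1 : ∀ᵐ p, p ∈ Ω → ψ p = ψ' p) (h2 : ∀ᵐ p, p ∈ Ω → G p = G' p) : WGrad Ω ψ' G' := by
  intro χ hχ
  have e1 := setIntegral_congr_ae (f := fun p => (G' p).1 * χ p) (g := fun p => (G p).1 * χ p) hΩ
    (by filter_upwards [h2] with p h hp; rw [h hp])
  have e2 := setIntegral_congr_ae (f := fun p => (G' p).2 * χ p) (g := fun p => (G p).2 * χ p) hΩ
    (by filter_upwards [h2] with p h hp; rw [h hp])
  have e3 := setIntegral_congr_ae (f := fun p => ψ' p * dr χ p) (g := fun p => ψ p * dr χ p) hΩ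
    (by filter_upwards [h1] with p h hp; rw [h hp])
  have e4 := setIntegral_congr_ae (f := fun p => ψ' p * dz χ p) (g := fun p => ψ p * dz χ p) hΩ
    (by filter_upwards [h1] with p h hp; rw [h hp])
  rw [e1, e2, e3, e4]
  exact h χ hχ

lemma WRot.congr (hΩ : MeasurableSet Ω) {s s' : R2 → ℝ} {ζ' : R2 → R2} (h : WRot Ω ζ s)
    (h1 : ∀ᵐ p, p ∈ Ω → ζ p = ζ' p) (h2 : ∀ᵐ p, p ∈ Ω → s p = s' p) : WRot Ω ζ' s' := by
  intro χ hχ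
  have e1 := setIntegral_congr_ae (f := fun p => s' p * χ p) (g := fun p => s p * χ p) hΩ
    (by filter_upwards [h2] with p h hp; rw [h hp])
  have e2 := setIntegral_congr_ae (f := fun p => (ζ' p).1 * dz χ p - (ζ' p).2 * dr χ p)
    (g := fun p => (ζ p).1 * dz χ p - (ζ p).2 * dr χ p) hΩ
    (by filter_upwards [h1] with p h hp; rw [h hp])
  rw [e1, e2]
  exact h χ hχ

lemma WGrad.add {ψ' : R2 → ℝ} {G' : R2 → R2} (h : WGrad Ω ψ G) (h' : WGrad Ω ψ' G')
    (lψ : LocInt Ω ψ) (lG : LocInt Ω G) (lψ' : LocInt Ω ψ') (lG' : LocInt Ω G') : WGrad Ω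
    (fun p => ψ p + ψ' p) fun p => G p + G' p := by
  intro χ hχ
  obtain ⟨a1, a2⟩ := h χ hχ
  obtain ⟨b1, b2⟩ := h' χ hχ
  have i := fun (f : R2 → ℝ) (hf : LocInt Ω f) => hχ.intOn_mul hf.loc
  have j := fun (f : R2 → ℝ) (hf : LocInt Ω f) (e : R2) =>
    (hχ.fd_test e).intOn_mul hf.loc
  constructor
  · simp only [Prod.fst_add, add_mul]
    rw [integral_add (i _ lG.fst) (i _ lG'.fst), a1, b1]
    unfold dr
    rw [integral_add (j _ lψ _) (j _ lψ' _)]; ring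
  · simp only [Prod.snd_add, add_mul]
    rw [integral_add (i _ lG.snd) (i _ lG'.snd), a2, b2]
    unfold dz
    rw [integral_add (j _ lψ _) (j _ lψ' _)]; ring

lemma WGrad.const_smul (h : WGrad Ω ψ G) (c : ℝ) : WGrad Ω (fun p => c • ψ p) fun p => c • G p := by
  intro χ hχ
  obtain ⟨a1, a2⟩ := h χ hχ
  simp only [smul_fst, smul_snd, smul_eq_mul, mul_assoc]
  rw [integral_const_mul, integral_const_mul, integral_const_mul, integral_const_mul, a1, a2]
  constructor <;> ring

lemma WRot.add {s s' : R2 → ℝ} {ζ' : R2 → R2} (h : WRot Ω ζ s) (h' : WRot Ω ζ' s')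
    (lζ : LocInt Ω ζ) (ls : LocInt Ω s) (lζ' : LocInt Ω ζ') (ls' : LocInt Ω s') : WRot Ω
    (fun p => ζ p + ζ' p) fun p => s p + s' p := by
  intro χ hχ
  have a := h χ hχ
  have b := h' χ hχ
  have i := fun (f : R2 → ℝ) (hf : LocInt Ω f) => hχ.intOn_mul hf.loc
  have j := fun (f : R2 → ℝ) (hf : LocInt Ω f) (e : R2) =>
    (hχ.fd_test e).intOn_mul hf.loc
  simp only [add_mul]
  rw [integral_add (i _ ls) (i _ ls'), a, b]
  unfold dr dz
  have k := fun (ζ : R2 → R2) (l : LocInt Ω ζ) =>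
    (show IntegrableOn (fun p => (ζ p).1 * fderiv ℝ χ p (0, 1) - (ζ p).2 * fderiv ℝ χ p (1, 0)) Ω
      from (j _ l.fst _).sub (j _ l.snd _))
  rw [← integral_add (k _ lζ) (k _ lζ')]
  congr 1; ext p; simp; ring

lemma WRot.const_smul {s : R2 → ℝ} (h : WRot Ω ζ s) (c : ℝ) : WRot Ω (fun p => c • ζ p) fun p => c
    • s p := by
  intro χ hχ
  have a := h χ hχ
  simp only [smul_fst, smul_snd, smul_eq_mul, mul_assoc]
  rw [integral_const_mul, a, ← integral_const_mul]
  congr 1; ext p; ring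

section

variable [MeasurableSpace F] [BorelSpace F] [SecondCountableTopology F]

lemma LocInt.of_cont {f : R2 → F} (hf : Continuous f) : LocInt Ω f :=
  ⟨hf.measurable, hf.locallyIntegrable.locallyIntegrableOn Ω⟩

lemma LocInt.of_bounded {f : R2 → F}
    (hf : Measurable f) (hg : Continuous g) (h : ∀ p, ‖f p‖ ≤ ‖g p‖) : LocInt Ω f :=
  ⟨hf, (hg.locallyIntegrable.locallyIntegrableOn Ω).mono hf.aestronglyMeasurable
    (.of_forall h)⟩

lemma LocInt.zero : LocInt Ω fun _ : R2 => (0 : F) :=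
  LocInt.of_cont continuous_const

lemma LocInt.sum {ι : Type*} (S : Finset ι) {f : ι → R2 → F} (h : ∀ i ∈ S, LocInt Ω (f i)) :
    LocInt Ω fun p => ∑ i ∈ S, f i p := by
  classical
  induction S using Finset.induction_on with
  | empty => simpa using LocInt.zero
  | insert i S hi ih =>
    simp only [Finset.sum_insert hi]
    exact (h i (by simp)).add (ih fun j hj => h j (by simp [hj]))

end

lemma WGrad.sum {ι : Type*} (S : Finset ι) {ψ : ι → R2 → ℝ} {G : ι → R2 → R2}
    (h : ∀ i ∈ S, WGrad Ω (ψ i) (G i)) (l : ∀ i ∈ S, LocInt Ω (ψ i))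
    (l' : ∀ i ∈ S, LocInt Ω (G i)) : WGrad Ω (fun p => ∑ i ∈ S, ψ i p) fun p => ∑ i ∈ S, G i p := by
  classical
  induction S using Finset.induction_on with
  | empty => intro χ _; simp
  | insert i S hi ih =>
    simp only [Finset.sum_insert hi]
    have hj : ∀ j ∈ S, j ∈ insert i S := fun j hj => by simp [hj]
    exact (h i (by simp)).add (ih (fun j q => h j (hj j q)) (fun j q => l j (hj j q))
      fun j q => l' j (hj j q)) (l i (by simp)) (l' i (by simp))
      (LocInt.sum S fun j q => l j (hj j q)) (LocInt.sum S fun j q => l' j (hj j q))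

lemma WRot.sum {ι : Type*} (S : Finset ι) {ζ : ι → R2 → R2} {s : ι → R2 → ℝ}
    (h : ∀ i ∈ S, WRot Ω (ζ i) (s i)) (l : ∀ i ∈ S, LocInt Ω (ζ i)) (l' : ∀ i ∈ S, LocInt Ω (s i)) :
    WRot Ω (fun p => ∑ i ∈ S, ζ i p) fun p => ∑ i ∈ S, s i p := by
  classical
  induction S using Finset.induction_on with
  | empty => intro χ _; simp
  | insert i S hi ih =>
    simp only [Finset.sum_insert hi]
    have hj : ∀ j ∈ S, j ∈ insert i S := fun j hj => by simp [hj]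
    exact (h i (by simp)).add (ih (fun j q => h j (hj j q)) (fun j q => l j (hj j q))
      fun j q => l' j (hj j q)) (l i (by simp)) (l' i (by simp))
      (LocInt.sum S fun j q => l j (hj j q)) (LocInt.sum S fun j q => l' j (hj j q))

/-! ### Identities for barycentric coordinates -/

section bary

lemma IsTri.sum_lam (hs : IsTri s) (p : R2) : ∑ v ∈ s, lam s v p = 1 := hs.isBary.sum_one p

lemma IsTri.sum_lam_smul (hs : IsTri s) (p : R2) : ∑ v ∈ s, lam s v p • v = p :=
  hs.isBary.sum_smul p

lemma pdot_lamG (s : Finset R2) (v e : R2) : pdot (lamG s v) e = lam s v e - lam s v 0 := by simp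
    [lam_sub]

lemma IsTri.sum_lamG (hs : IsTri s) : ∑ v ∈ s, lamG s v = 0 := by
  have h : ∀ e, ∑ v ∈ s, pdot (lamG s v) e = 0 := by
    intro e
    simp only [pdot_lamG, sum_sub_distrib, hs.sum_lam, sub_self]
  ext
  · simpa [pdot, fst_sum] using h (1, 0)
  · simpa [pdot, snd_sum] using h (0, 1)

lemma IsTri.sum_pdot_smul (hs : IsTri s) (e : R2) : ∑ v ∈ s, pdot (lamG s v) e • v = e := by
  simp only [pdot_lamG, sub_smul, sum_sub_distrib, hs.sum_lam_smul, sub_zero]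

lemma sum_pdot_mul (s : Finset R2) (x : R2) (c : ℝ) (l : R2 → ℝ) : ∑ w ∈ s, (pdot x w + c) * l w =
    x.1 * ∑ w ∈ s, l w * w.1 + x.2 * ∑ w ∈ s, l w * w.2 + c * ∑ w ∈ s, l w := by
  simp only [mul_sum, ← sum_add_distrib, pdot]
  exact sum_congr rfl fun w _ => by ring

lemma IsTri.sum_affine_smul (hs : IsTri s) (x : R2) (c : ℝ) : ∑ w ∈ s, (pdot x w + c) • lamG s w =
    x := by
  have h1 := hs.sum_lamG
  have h2 := hs.sum_pdot_smul (1, 0)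
  have h3 := hs.sum_pdot_smul (0, 1)
  rw [Prod.ext_iff] at h1 h2 h3
  simp only [fst_sum, snd_sum, smul_fst, smul_snd, pdot, smul_eq_mul, mul_one,
    mul_zero, add_zero, zero_add, Prod.fst_zero, Prod.snd_zero] at h1 h2 h3
  ext
  · simp only [fst_sum, smul_fst, smul_eq_mul]
    rw [sum_pdot_mul, h1.1, h2.1, h2.2]; ring
  · simp only [snd_sum, smul_snd, smul_eq_mul]
    rw [sum_pdot_mul, h1.2, h3.1, h3.2]; ring

lemma IsTri.sum_affine (hs : IsTri s) (x : R2) (c : ℝ) (p : R2) : ∑ w ∈ s, (pdot x w + c) * lam s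
    w p = pdot x p + c := by
  have h2 := hs.sum_lam_smul p
  rw [Prod.ext_iff] at h2
  simp only [fst_sum, snd_sum, smul_fst, smul_snd, smul_eq_mul] at h2
  rw [sum_pdot_mul, hs.sum_lam, h2.1, h2.2, mul_one]; rfl

/-- The lowest order Nédélec field `(a₁ - b z, a₂ + b r)`. -/
def ndf (a : R2) (b : ℝ) (p : R2) : R2 := (a.1 - b * p.2, a.2 + b * p.1)

/-- The Whitney field of the edge from `v` to `w`. -/
def whit (s : Finset R2) (v w p : R2) : R2 :=
  lam s v p • lamG s w - lam s w p • lamG s v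

lemma whit_eq (s : Finset R2) (v w p : R2) : whit s v w p = ndf
    (lamB s v • lamG s w - lamB s w • lamG s v) (pdet (lamG s v) (lamG s w)) p := by
  ext <;> simp [whit, ndf, lam, pdet, pdot] <;> ring

lemma sum_ndf {ι : Type*} (S : Finset ι) (x : ι → ℝ) (a : ι → R2) (b : ι → ℝ) (p : R2) : ∑ i ∈ S,
    x i • ndf (a i) (b i) p = ndf (∑ i ∈ S, x i • a i) (∑ i ∈ S, x i * b i) p := by
  ext
  · simp only [ndf, fst_sum, smul_fst, smul_eq_mul, Finset.sum_mul,
      ← sum_sub_distrib]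
    exact sum_congr rfl fun i _ => by ring
  · simp only [ndf, snd_sum, smul_snd, smul_eq_mul, Finset.sum_mul,
      ← sum_add_distrib]
    exact sum_congr rfl fun i _ => by ring

lemma IsTri.sum_whit_ndf (hs : IsTri s) (a : R2) (b : ℝ) (p : R2) : ∑ v ∈ s, ∑ w ∈ s,
    (pdot (ndf a b v) (w - v) / 2) • whit s v w p = ndf a b p := by
  have inner : ∀ v, ∑ w ∈ s, pdot (ndf a b v) (w - v) • lamG s w = ndf a b v := by
    intro v
    refine Eq.trans ?_ (hs.sum_affine_smul (ndf a b v) (-pdot (ndf a b v) v))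
    refine sum_congr rfl fun w _ => ?_
    congr 1
    simp [pdot]; ring
  have anti : ∀ v w, pdot (ndf a b w) (v - w) = -pdot (ndf a b v) (w - v) := by
    intro v w
    simp [pdot, ndf]; ring
  have h1 : ∑ v ∈ s, ∑ w ∈ s, pdot (ndf a b v) (w - v) • (lam s v p • lamG s w) = ndf a b p := by
    have e : ∀ v, ∑ w ∈ s, pdot (ndf a b v) (w - v) • (lam s v p • lamG s w) =
        lam s v p • ndf a b v := by
      intro v
      conv_rhs => rw [← inner v, smul_sum]
      exact sum_congr rfl fun w _ => smul_comm _ _ _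
    rw [sum_congr rfl fun v _ => e v]
    have k1 := hs.sum_affine (0, -b) a.1 p
    have k2 := hs.sum_affine (b, 0) a.2 p
    ext
    · simp only [fst_sum, smul_fst, ndf, smul_eq_mul]
      rw [sum_congr rfl fun v _ => (by simp only [pdot]; ring :
        lam s v p * (a.1 - b * v.2) = (pdot (0, -b) v + a.1) * lam s v p), k1]
      simp only [pdot]; ring
    · simp only [snd_sum, smul_snd, ndf, smul_eq_mul]
      rw [sum_congr rfl fun v _ => (by simp only [pdot]; ring :
        lam s v p * (a.2 + b * v.1) = (pdot (b, 0) v + a.2) * lam s v p), k2]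
      simp only [pdot]; ring
  have h2 : ∑ v ∈ s, ∑ w ∈ s, pdot (ndf a b v) (w - v) • (lam s w p • lamG s v) = -ndf a b p := by
    rw [Finset.sum_comm, ← h1, ← Finset.sum_neg_distrib]
    refine sum_congr rfl fun v _ => ?_
    rw [← Finset.sum_neg_distrib]
    refine sum_congr rfl fun w _ => ?_
    rw [anti, neg_smul]
  have h3 : ∑ v ∈ s, ∑ w ∈ s, (pdot (ndf a b v) (w - v) / 2) • whit s v w p =
      (1 / 2 : ℝ) • (∑ v ∈ s, ∑ w ∈ s, pdot (ndf a b v) (w - v) • (lam s v p • lamG s w) -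
        ∑ v ∈ s, ∑ w ∈ s, pdot (ndf a b v) (w - v) • (lam s w p • lamG s v)) := by
    rw [← sum_sub_distrib, smul_sum]
    refine sum_congr rfl fun v _ => ?_
    rw [← sum_sub_distrib, smul_sum]
    refine sum_congr rfl fun w _ => ?_
    rw [← smul_sub, smul_smul]
    congr 1; ring
  rw [h3, h1, h2, sub_neg_eq_add, ← two_smul ℝ, smul_smul]
  norm_num

lemma pdet_sum {ι : Type*} (S : Finset ι) (x : R2) (c : ι → ℝ) (f : ι → R2) : ∑ i ∈ S, c i * pdet
    x (f i) = pdet x (∑ i ∈ S, c i • f i) := by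
  simp only [pdet, fst_sum, snd_sum, smul_fst, smul_snd, smul_eq_mul,
    mul_sum, ← sum_sub_distrib]
  exact sum_congr rfl fun i _ => by ring

lemma IsTri.sum_pdet (hs : IsTri s) (S : ℝ) : ∑ a ∈ s, ∑ b ∈ s, ∑ c ∈ s, S * pdet (b - a) (c - a)
    / 2 * (1 / 3 * pdet (lamG s b) (lamG s c)) = S := by
  have h1 : ∀ a b, ∑ c ∈ s, S * pdet (b - a) (c - a) / 2 * (1 / 3 * pdet (lamG s b) (lamG s c)) =
      S / 6 * pdot (lamG s b) (b - a) := by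
    intro a b
    have e : ∑ c ∈ s, pdet (b - a) (c - a) • lamG s c = (-(b - a).2, (b - a).1) := by
      rw [← hs.sum_affine_smul (-(b - a).2, (b - a).1) (-pdet (b - a) a)]
      refine sum_congr rfl fun c _ => ?_
      congr 1
      simp [pdot, pdet]; ring
    calc _ = S / 6 * ∑ c ∈ s, pdet (b - a) (c - a) * pdet (lamG s b) (lamG s c) := by
          rw [mul_sum]; exact sum_congr rfl fun c _ => by ring
      _ = _ := by
          rw [pdet_sum, e]; simp only [pdet, pdot]; ring
  have h2 : ∀ a, ∑ b ∈ s, pdot (lamG s b) (b - a) = 2 := by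
    intro a
    have k1 := hs.sum_affine_smul (1, 0) (-a.1)
    have k2 := hs.sum_affine_smul (0, 1) (-a.2)
    rw [Prod.ext_iff] at k1 k2
    simp only [fst_sum, snd_sum, smul_fst, smul_snd, pdot, smul_eq_mul] at k1 k2
    calc _ = ∑ b ∈ s, (1 * b.1 + 0 * b.2 + -a.1) * (lamG s b).1 +
          ∑ b ∈ s, (0 * b.1 + 1 * b.2 + -a.2) * (lamG s b).2 := by
          rw [← sum_add_distrib]
          exact sum_congr rfl fun b _ => by simp [pdot]; ring
      _ = 2 := by rw [k1.1, k2.2]; norm_num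
  simp only [h1, ← mul_sum, h2]
  rw [Finset.sum_const, hs.1, nsmul_eq_mul]
  push_cast; ring

lemma IsTri.sum_whit_grad (hs : IsTri s) (c : R2 → ℝ) (p : R2) : ∑ v ∈ s, ∑ w ∈ s,
    ((c w - c v) / 2) • whit s v w p = ∑ v ∈ s, c v • lamG s v := by
  have h0 := hs.sum_lam p
  have h1 := hs.sum_lamG
  have a1 : ∑ v ∈ s, ∑ w ∈ s, (c w * lam s v p) • lamG s w = ∑ v ∈ s, c v • lamG s v := by
    rw [Finset.sum_comm]
    refine sum_congr rfl fun w _ => ?_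
    rw [← Finset.sum_smul, ← mul_sum, h0, mul_one]
  have a2 : ∑ v ∈ s, ∑ w ∈ s, (c w * lam s w p) • lamG s v = 0 := by
    rw [Finset.sum_comm]
    simp only [← smul_sum, h1, smul_zero, Finset.sum_const_zero]
  have a3 : ∑ v ∈ s, ∑ w ∈ s, (c v * lam s v p) • lamG s w = 0 := by
    simp only [← smul_sum, h1, smul_zero, Finset.sum_const_zero]
  have a4 : ∑ v ∈ s, ∑ w ∈ s, (c v * lam s w p) • lamG s v = ∑ v ∈ s, c v • lamG s v := by
    refine sum_congr rfl fun v _ => ?_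
    rw [← Finset.sum_smul, ← mul_sum, h0, mul_one]
  have : ∑ v ∈ s, ∑ w ∈ s, ((c w - c v) / 2) • whit s v w p =
      (1 / 2 : ℝ) • (∑ v ∈ s, ∑ w ∈ s, (c w * lam s v p) • lamG s w -
        ∑ v ∈ s, ∑ w ∈ s, (c w * lam s w p) • lamG s v -
        ∑ v ∈ s, ∑ w ∈ s, (c v * lam s v p) • lamG s w +
        ∑ v ∈ s, ∑ w ∈ s, (c v * lam s w p) • lamG s v) := by
    simp only [← sum_sub_distrib, ← sum_add_distrib, smul_sum]
    refine sum_congr rfl fun v _ => sum_congr rfl fun w _ => ?_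
    unfold whit
    ext <;> simp <;> ring
  rw [this, a1, a2, a3, a4, sub_zero, sub_zero, ← two_smul ℝ, smul_smul]
  norm_num

lemma IsTri.sum_pdet_coc (hs : IsTri s) (d : R2 → R2 → ℝ) : ∑ a ∈ s, ∑ b ∈ s, ∑ c ∈ s,
    (d a b + d b c - d a c) * (1 / 3 * pdet (lamG s b) (lamG s c)) = ∑ b ∈ s, ∑ c ∈ s, d b c * pdet
    (lamG s b) (lamG s c) := by
  have h1 := hs.sum_lamG
  have a1 : ∑ a ∈ s, ∑ b ∈ s, ∑ c ∈ s, d a b * pdet (lamG s b) (lamG s c) = 0 := by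
    refine Finset.sum_eq_zero fun a _ => Finset.sum_eq_zero fun b _ => ?_
    rw [pdet_sum, ← smul_sum, h1]; simp [pdet]
  have a3 : ∑ a ∈ s, ∑ b ∈ s, ∑ c ∈ s, d a c * pdet (lamG s b) (lamG s c) = 0 := by
    refine Finset.sum_eq_zero fun a _ => ?_
    rw [Finset.sum_comm]
    refine Finset.sum_eq_zero fun c _ => ?_
    have : ∀ b, d a c * pdet (lamG s b) (lamG s c) = (-d a c) * pdet (lamG s c) (lamG s b) := by
      intro b; simp only [pdet]; ring
    simp only [this]
    rw [pdet_sum, ← smul_sum, h1]; simp [pdet]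
  have : ∑ a ∈ s, ∑ b ∈ s, ∑ c ∈ s, (d a b + d b c - d a c) *
      (1 / 3 * pdet (lamG s b) (lamG s c)) =
      1 / 3 * (∑ a ∈ s, ∑ b ∈ s, ∑ c ∈ s, d a b * pdet (lamG s b) (lamG s c) +
        ∑ a ∈ s, ∑ b ∈ s, ∑ c ∈ s, d b c * pdet (lamG s b) (lamG s c) -
        ∑ a ∈ s, ∑ b ∈ s, ∑ c ∈ s, d a c * pdet (lamG s b) (lamG s c)) := by
    simp only [← sum_sub_distrib, ← sum_add_distrib, mul_sum]
    exact sum_congr rfl fun a _ => sum_congr rfl fun b _ =>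
      sum_congr rfl fun c _ => by ring
  rw [this, a1, a3, Finset.sum_const, hs.1, nsmul_eq_mul]
  push_cast; ring

end bary

/-! ### Piecewise fields and interpolation -/

/-- The field given by `F s` in the interior of each triangle `s`. -/
def pw (Tr : Finset (Finset R2)) (F : Finset R2 → R2 → E) (p : R2) : E :=
  ∑ s ∈ Tr, (interior (hull s)).indicator (F s) p

/-- The affine interpolant of vertex values. -/
def loc0 (c : R2 → ℝ) (s : Finset R2) (p : R2) : ℝ := ∑ v ∈ s, c v * lam s v p

/-- The Whitney interpolant of edge values. -/
def loc1 (d : R2 → R2 → ℝ) (s : Finset R2) (p : R2) : R2 :=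
  ∑ v ∈ s, ∑ w ∈ s, (d v w / 2) • whit s v w p

/-- The constant interpolant of triangle values. -/
def loc2 (τ : R2 → R2 → R2 → ℝ) (s : Finset R2) (_p : R2) : ℝ :=
  ∑ a ∈ s, ∑ b ∈ s, ∑ c ∈ s, τ a b c * (1 / 3 * pdet (lamG s b) (lamG s c))

lemma cont_lam (s : Finset R2) (v : R2) : Continuous (lam s v) := by
  unfold lam pdot; fun_prop

lemma cont_loc0 (c : R2 → ℝ) (s : Finset R2) : Continuous (loc0 c s) := by
  have := cont_lam s
  unfold loc0; fun_prop

lemma cont_loc1 (d : R2 → R2 → ℝ) (s : Finset R2) : Continuous (loc1 d s) := by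
  have := cont_lam s
  unfold loc1 whit; fun_prop

lemma cont_loc2 (τ : R2 → R2 → R2 → ℝ) (s : Finset R2) : Continuous (loc2 τ s) :=
    continuous_const

lemma loc_pw [MeasurableSpace E] [BorelSpace E] [SecondCountableTopology E] {F : Finset R2 → R2 → E}
    (hF : ∀ s, Continuous (F s)) : LocInt Ω (pw Tr F) := by
  refine LocInt.sum Tr fun s _ => ?_
  refine LocInt.of_bounded (g := fun p => ‖F s p‖)
    ((hF s).measurable.indicator isOpen_interior.measurableSet) (hF s).norm fun p => ?_
  rw [norm_norm]
  exact norm_indicator_le_norm_self _ _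

lemma Geom.pw_eq (g : Geom Ω Tr φ C) (F : Finset R2 → R2 → E) : ∀ᵐ p : R2, ∀ s ∈ Tr, p ∈ hull s → p
    ∈ interior (hull s) ∧ pw Tr F p = F s p := by
  have h : ∀ᵐ p : R2, ∀ s ∈ Tr, p ∈ hull s → p ∈ interior (hull s) ∧ p ∈ Ω := by
    rw [eventually_all]
    exact fun s hs => g.ae_hull hs
  filter_upwards [h, g.ae_tri] with p h1 h2 s hs hp
  obtain ⟨hi, hΩ⟩ := h1 s hs hp
  obtain ⟨t, ht, hpt, huniq⟩ := h2 hΩ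
  obtain rfl := huniq s hs hp
  refine ⟨hi, ?_⟩
  unfold pw
  rw [Finset.sum_eq_single s, indicator_of_mem hi]
  · intro t ht hts
    exact indicator_of_notMem (fun h => hts (huniq t ht (interior_subset h))) _
  · exact fun h => absurd hs h

section

variable {μ : R2 → Measure R2}

lemma Geom.ae_pw (g : Geom Ω Tr φ C) {F : Finset R2 → R2 → E} {P : R2 → E → Prop} (h : ∀ s ∈ Tr, ∀ p
    ∈ interior (hull s), P p (F s p)) : ∀ᵐ p, p ∈ Ω → P p (pw Tr F p) := by
  filter_upwards [g.pw_eq F] with p h1 hp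
  obtain ⟨s, hs, hps⟩ := g.cover p hp
  obtain ⟨hi, e⟩ := h1 s hs hps
  rw [e]
  exact h s hs p hi

lemma Geom.pw_congr (g : Geom Ω Tr φ C) {F F' : Finset R2 → R2 → E} (h : ∀ s ∈ Tr, ∀ p ∈ interior
    (hull s), F s p = F' s p) : ∀ᵐ p, p ∈ Ω → pw Tr F p = pw Tr F' p := by
  filter_upwards [g.pw_eq F, g.pw_eq F'] with p h1 h2 hp
  obtain ⟨s, hs, hps⟩ := g.cover p hp
  obtain ⟨hi, e⟩ := h1 s hs hps
  rw [e, (h2 s hs hps).2, h s hs p hi]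

open Classical in
/-- The vertices of a triangulation. -/
def verts (Tr : Finset (Finset R2)) : Finset R2 := Tr.biUnion id

lemma sum_verts (hs : s ∈ Tr) {f : R2 → E} (h : ∀ v ∉ s, f v = 0) :
    ∑ v ∈ verts Tr, f v = ∑ v ∈ s, f v := by
  classical
  refine (Finset.sum_subset (fun v hv => ?_) fun v _ hv => h v hv).symm
  exact Finset.mem_biUnion.2 ⟨s, hs, hv⟩

lemma loc_smul_lgrad {h : R2 → ℝ} (hf : Continuous f) {L : NNReal} (hh : LipschitzWith L h) :
    LocInt Ω fun p => f p • lgrad h p := by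
  refine LocInt.of_bounded (g := fun p => f p * L)
    (hf.measurable.smul (meas_lgrad hh.continuous)) (by fun_prop) fun p => ?_
  rw [norm_smul, norm_mul]
  refine mul_le_mul_of_nonneg_left ((norm_lgrad_le hh p).trans ?_) (norm_nonneg _)
  simp

lemma meas_pdet {f h : R2 → R2} (hf : Measurable f) (hh : Measurable h) : Measurable fun
    p => pdet (f p) (h p) := by
  unfold pdet
  fun_prop

lemma loc_pdet_lgrad {h : R2 → ℝ} {L L' : NNReal} (hf : LipschitzWith L f)
    (hh : LipschitzWith L' h) : LocInt Ω fun p => pdet (lgrad f p) (lgrad h p) := by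
  refine LocInt.of_bounded (g := fun p => 2 * L * L')
    (meas_pdet (meas_lgrad hf.continuous) (meas_lgrad hh.continuous))
    (by fun_prop) fun p => ?_
  refine (abs_pdet_le _ _).trans ((?_ : _ ≤ 2 * (L : ℝ) * L').trans (le_abs_self _))
  have := norm_lgrad_le hf p
  have := norm_lgrad_le hh p
  gcongr

lemma Geom.wGrad_loc0 (hΩ : MeasurableSet Ω) (g : Geom Ω Tr φ C) (c : R2 → ℝ) : WGrad Ω
    (pw Tr (loc0 c)) (pw Tr fun s _ => ∑ v ∈ s, c v • lamG s v) := by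
  have key : WGrad Ω (fun p => ∑ v ∈ verts Tr, c v • φ v p)
      (fun p => ∑ v ∈ verts Tr, c v • lgrad (φ v) p) := by
    refine WGrad.sum _ (fun v _ => ?_) (fun v _ => ?_) fun v _ => ?_ <;>
      obtain ⟨L, hL⟩ := g.lip v
    · exact (wGrad_lgrad hL).const_smul _
    · exact (LocInt.of_cont hL.continuous).const_smul _
    · exact loc_smul_lgrad continuous_const hL
  have e := fun s hs p (hp : p ∈ hull s) (v : R2) => g.hat s hs v p hp
  refine key.congr hΩ ?_ ?_
  · refine g.ae_pw (P := fun p x => ∑ v ∈ verts Tr, c v • φ v p = x) fun s hs p hp => ?_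
    simp only [g.hat s hs _ p (interior_subset hp)]
    rw [sum_verts hs fun v hv => by rw [lam_of_nmem (g.isTri s hs) hv, smul_zero]]
    rfl
  · refine g.ae_pw (P := fun p x => ∑ v ∈ verts Tr, c v • lgrad (φ v) p = x)
      fun s hs p hp => ?_
    simp only [g.lgrad_hat hs _ hp]
    exact sum_verts hs fun v hv => by rw [(g.isTri s hs).isBary.grad_zero v hv, smul_zero]

lemma Geom.wRot_loc1 (hΩ : MeasurableSet Ω) (g : Geom Ω Tr φ C) (d : R2 → R2 → ℝ) : WRot Ω
    (pw Tr (loc1 d)) (pw Tr fun s _ => ∑ v ∈ s, ∑ w ∈ s, d v w * pdet (lamG s v) (lamG s w)) := by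
  have key : WRot Ω (fun p => ∑ v ∈ verts Tr, ∑ w ∈ verts Tr, (d v w / 2) •
        (φ v p • lgrad (φ w) p + (-1 : ℝ) • (φ w p • lgrad (φ v) p)))
      (fun p => ∑ v ∈ verts Tr, ∑ w ∈ verts Tr, (d v w / 2) •
        (pdet (lgrad (φ v) p) (lgrad (φ w) p) + (-1 : ℝ) • pdet (lgrad (φ w) p) (lgrad (φ v) p))) := by
    have l1 : ∀ v w, LocInt Ω fun p => (d v w / 2) •
        (φ v p • lgrad (φ w) p + (-1 : ℝ) • (φ w p • lgrad (φ v) p)) := by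
      intro v w
      obtain ⟨L, hL⟩ := g.lip v
      obtain ⟨L', hL'⟩ := g.lip w
      exact ((loc_smul_lgrad hL.continuous hL').add
        ((loc_smul_lgrad hL'.continuous hL).const_smul _)).const_smul _
    have l2 : ∀ v w, LocInt Ω fun p => (d v w / 2) • (pdet (lgrad (φ v) p) (lgrad (φ w) p) +
        (-1 : ℝ) • pdet (lgrad (φ w) p) (lgrad (φ v) p)) := by
      intro v w
      obtain ⟨L, hL⟩ := g.lip v
      obtain ⟨L', hL'⟩ := g.lip w
      exact ((loc_pdet_lgrad hL hL').add ((loc_pdet_lgrad hL' hL).const_smul _)).const_smul _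
    refine WRot.sum _ (fun v _ => WRot.sum _ (fun w _ => ?_) (fun w _ => l1 v w) fun w _ => l2 v w)
      (fun v _ => LocInt.sum _ fun w _ => l1 v w) fun v _ => LocInt.sum _ fun w _ => l2 v w
    obtain ⟨L, hL⟩ := g.lip v
    obtain ⟨L', hL'⟩ := g.lip w
    exact ((wRot_smul_lgrad hL hL').add ((wRot_smul_lgrad hL' hL).const_smul _)
      (loc_smul_lgrad hL.continuous hL') (loc_pdet_lgrad hL hL')
      ((loc_smul_lgrad hL'.continuous hL).const_smul _)
      ((loc_pdet_lgrad hL' hL).const_smul _)).const_smul _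
  refine key.congr hΩ ?_ ?_
  · refine g.ae_pw (P := fun p x => ∑ v ∈ verts Tr, ∑ w ∈ verts Tr, (d v w / 2) •
        (φ v p • lgrad (φ w) p + (-1 : ℝ) • (φ w p • lgrad (φ v) p)) = x) fun s hs p hp => ?_
    have hz := fun v (hv : v ∉ s) => (g.isTri s hs).isBary.grad_zero v hv
    have hl := fun v (hv : v ∉ s) => lam_of_nmem (g.isTri s hs) hv p
    simp only [g.hat s hs _ p (interior_subset hp), g.lgrad_hat hs _ hp]
    rw [sum_verts hs fun v hv => by simp [hz v hv, hl v hv]]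
    refine sum_congr rfl fun v _ => ?_
    rw [sum_verts hs fun w hw => by simp [hz w hw, hl w hw]]
    refine sum_congr rfl fun w _ => ?_
    rw [whit, neg_one_smul, ← sub_eq_add_neg]
  · refine g.ae_pw (P := fun p x => ∑ v ∈ verts Tr, ∑ w ∈ verts Tr, (d v w / 2) •
        (pdet (lgrad (φ v) p) (lgrad (φ w) p) +
          (-1 : ℝ) • pdet (lgrad (φ w) p) (lgrad (φ v) p)) = x) fun s hs p hp => ?_
    have hz := fun v (hv : v ∉ s) => (g.isTri s hs).isBary.grad_zero v hv
    simp only [g.lgrad_hat hs _ hp]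
    rw [sum_verts hs fun v hv => by simp [hz v hv, pdet]]
    refine sum_congr rfl fun v _ => ?_
    rw [sum_verts hs fun w hw => by simp [hz w hw, pdet]]
    refine sum_congr rfl fun w _ => ?_
    simp only [pdet, smul_eq_mul]; ring

/-- The quasi-interpolant by vertex averages. -/
def qi0 (Tr : Finset (Finset R2)) (μ : R2 → Measure R2) (f : R2 → ℝ) : R2 → ℝ :=
  pw Tr (loc0 fun v => avg0 (μ v) f)

/-- The quasi-interpolant by averaged edge integrals. -/
def qi1 (Tr : Finset (Finset R2)) (μ : R2 → Measure R2) (f : R2 → R2) : R2 → R2 :=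
  pw Tr (loc1 fun v w => avg1 (μ v) (μ w) f)

/-- The quasi-interpolant by averaged triangle integrals. -/
def qi2 (Tr : Finset (Finset R2)) (μ : R2 → Measure R2) (f : R2 → ℝ) : R2 → ℝ :=
  pw Tr (loc2 fun a b c => avg2 (μ a) (μ b) (μ c) f)

lemma Geom.wGrad_qi (hΩ : IsOpen Ω) (cv : Convex ℝ Ω) (g : Geom Ω Tr φ C)
    (hμ : ∀ s ∈ Tr, ∀ v ∈ s, Probe Ω (μ v)) (hψ : LocInt Ω ψ) (hG : LocInt Ω G) (h : WGrad Ω ψ G) :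
    WGrad Ω (qi0 Tr μ ψ) (qi1 Tr μ G) := by
  refine (g.wGrad_loc0 hΩ.measurableSet _).congr hΩ.measurableSet (.of_forall fun _ _ => rfl)
    (g.pw_congr fun s hs p _ => ?_)
  rw [← (g.isTri s hs).sum_whit_grad _ p]
  refine sum_congr rfl fun v hv => sum_congr rfl fun w hw => ?_
  rw [Probe.avg0_sub hΩ cv (hμ s hs v hv) (hμ s hs w hw) hψ hG h]

lemma Geom.wRot_qi (hΩ : IsOpen Ω) (cv : Convex ℝ Ω) (g : Geom Ω Tr φ C)
    (hμ : ∀ s ∈ Tr, ∀ v ∈ s, Probe Ω (μ v)) (hζ : LocInt Ω ζ) (hf : LocInt Ω f) (h : WRot Ω ζ f) :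
    WRot Ω (qi1 Tr μ ζ) (qi2 Tr μ f) := by
  refine (g.wRot_loc1 hΩ.measurableSet _).congr hΩ.measurableSet (.of_forall fun _ _ => rfl)
    (g.pw_congr fun s hs p _ => ?_)
  rw [← (g.isTri s hs).sum_pdet_coc, loc2]
  refine sum_congr rfl fun a ha => sum_congr rfl fun b hb =>
    sum_congr rfl fun c hc => ?_
  rw [Probe.avg1_coc hΩ cv (hμ s hs a ha) (hμ s hs b hb) (hμ s hs c hc) hζ hf h]

/-! ### Pointwise bounds -/

lemma IsTri.abs_loc0_le (hs : IsTri s) {c : R2 → ℝ} {m : ℝ} (h : ∀ v ∈ s, |c v| ≤ m)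
    (hp : p ∈ hull s) : |loc0 c s p| ≤ m := by
  calc |loc0 c s p| ≤ ∑ v ∈ s, |c v * lam s v p| := Finset.abs_sum_le_sum_abs _ _
    _ ≤ ∑ v ∈ s, m * lam s v p := by
        refine Finset.sum_le_sum fun v hv => ?_
        rw [abs_mul, abs_of_nonneg (hs.lam_nn hp v)]
        exact mul_le_mul_of_nonneg_right (h v hv) (hs.lam_nn hp v)
    _ = m := by rw [← mul_sum, hs.sum_lam, mul_one]

lemma Geom.norm_loc1_le (g : Geom Ω Tr φ C) (hs : s ∈ Tr) {d : R2 → R2 → ℝ} {m : ℝ} (h : ∀ v ∈ s, ∀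
    w ∈ s, |d v w| ≤ m) (hp : p ∈ hull s) : ‖loc1 d s p‖ ≤ 9 * C / dK s * m := by
  have ht := g.isTri s hs
  have hC := g.pos
  have hh := g.spos hs
  have hw : ∀ v w, ‖whit s v w p‖ ≤ 2 * (C / dK s) := by
    intro v w
    have hb : ∀ v w, ‖lam s v p • lamG s w‖ ≤ C / dK s := by
      intro v w
      rw [norm_smul, norm_eq_abs, abs_of_nonneg (ht.lam_nn hp v)]
      calc _ ≤ 1 * (C / dK s) := mul_le_mul (ht.lam_le_one hp v) (g.grad s hs w)
            (norm_nonneg _) zero_le_one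
        _ = _ := one_mul _
    have h1 := norm_sub_le (lam s v p • lamG s w) (lam s w p • lamG s v)
    have h2 := hb v w
    have h3 := hb w v
    unfold whit; linarith
  have h1 : ∀ v ∈ s, ∀ w ∈ s, ‖(d v w / 2) • whit s v w p‖ ≤ C / dK s * m := by
    intro v hv w hw'
    have hm := h v hv w hw'
    rw [norm_smul, norm_eq_abs, abs_div, abs_two]
    calc _ ≤ m / 2 * (2 * (C / dK s)) :=
          mul_le_mul (by linarith) (hw v w) (norm_nonneg _) (by linarith [abs_nonneg (d v w)])
      _ = _ := by ring
  calc ‖loc1 d s p‖ ≤ ∑ v ∈ s, ∑ w ∈ s, C / dK s * m :=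
        norm_sum_le_of_le _ fun v hv => norm_sum_le_of_le _ fun w hw => h1 v hv w hw
    _ = _ := by
        simp only [Finset.sum_const, ht.1, nsmul_eq_mul]; push_cast; ring

lemma Geom.abs_loc2_le (g : Geom Ω Tr φ C) (hs : s ∈ Tr) {τ : R2 → R2 → R2 → ℝ} {m : ℝ} (h : ∀ a ∈
    s, ∀ b ∈ s, ∀ c ∈ s, |τ a b c| ≤ m) (p : R2) : |loc2 τ s p| ≤ 18 * (C / dK s) ^ 2 * m := by
  have hC := g.pos
  have hh := g.spos hs
  have h1 : ∀ a ∈ s, ∀ b ∈ s, ∀ c ∈ s, ‖τ a b c * (1 / 3 * pdet (lamG s b) (lamG s c))‖ ≤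
      2 / 3 * (C / dK s) ^ 2 * m := by
    intro a ha b hb c hc
    have hm := h a ha b hb c hc
    have hd : |pdet (lamG s b) (lamG s c)| ≤ 2 * (C / dK s) * (C / dK s) :=
      (abs_pdet_le _ _).trans (by have := g.grad s hs b; have := g.grad s hs c; gcongr)
    rw [norm_eq_abs, abs_mul, abs_mul, abs_of_nonneg (by norm_num : (0 : ℝ) ≤ 1 / 3)]
    calc _ ≤ m * (1 / 3 * (2 * (C / dK s) * (C / dK s))) :=
          mul_le_mul hm (by linarith) (by positivity) ((abs_nonneg _).trans hm)
      _ = _ := by ring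
  calc |loc2 τ s p| ≤ ∑ a ∈ s, ∑ b ∈ s, ∑ c ∈ s, 2 / 3 * (C / dK s) ^ 2 * m :=
        norm_sum_le_of_le _ fun a ha => norm_sum_le_of_le _ fun b hb =>
          norm_sum_le_of_le _ fun c hc => h1 a ha b hb c hc
    _ = _ := by
        simp only [Finset.sum_const, (g.isTri s hs).1, nsmul_eq_mul]; push_cast; ring

lemma enorm_sq_le {x : E} {m y : ℝ} (hm : 0 ≤ m)
    (h : ‖x‖ ≤ m * |y|) : ‖x‖ₑ ^ 2 ≤ ofReal (m ^ 2) * ‖y‖ₑ ^ 2 := by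
  have h1 : ‖x‖ₑ ≤ ofReal m * ‖y‖ₑ := by
    rw [← ofReal_norm, ← ofReal_norm, ← ofReal_mul hm]
    exact ofReal_le_ofReal h
  rw [ofReal_pow hm, ← mul_pow]
  gcongr

/-! ### Boundedness of the quasi-interpolants -/

lemma Geom.wE_bound (g : Geom Ω Tr φ C) (hs : s ∈ Tr) {f' : R2 → E} {f : R2 → F} {m n K y : ℝ}
    (hm : 0 ≤ m)
    (h : ∀ᵐ p, p ∈ hull s → ‖f' p‖ ≤ m * |y|) (hy : ‖y‖ₑ ^ 2 * ofReal (dK s ^ 2 * rho s ^ α) ≤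
    ofReal n * (ofReal K * wE α f (patch Tr s))) : wE α f' (hull s) ≤ ofReal (4 * m ^ 2 * n) *
    ofReal K * wE α f (patch Tr s) := by
  refine (g.wE_hull_le hs (m := ofReal (m ^ 2) * ‖y‖ₑ ^ 2) ?_).trans ?_
  · filter_upwards [h] with p h hp using enorm_sq_le hm (h hp)
  · have e : ofReal (4 * dK s ^ 2 * rho s ^ α) =
        ofReal 4 * ofReal (dK s ^ 2 * rho s ^ α) := by
      rw [← ofReal_mul (by norm_num), mul_assoc]
    calc _ = ofReal (4 * m ^ 2) *
          (‖y‖ₑ ^ 2 * ofReal (dK s ^ 2 * rho s ^ α)) := by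
          rw [e, ofReal_mul (by norm_num : (0 : ℝ) ≤ 4)]; ring
      _ ≤ ofReal (4 * m ^ 2) * (ofReal n * (ofReal K * wE α f (patch Tr s))) :=
          mul_le_mul' le_rfl hy
      _ = _ := by rw [ofReal_mul (by positivity : 0 ≤ 4 * m ^ 2)]; ring

lemma Geom.wE_qi0_le (cv : Convex ℝ Ω) (g : Geom Ω Tr φ C) (ha : 0 < a)
    (hμ : ∀ s ∈ Tr, ∀ v ∈ s, Near Ω C A a s (μ v)) (α : ℕ) (hf : Measurable f) : wE α (qi0 Tr μ f)
    Ω ≤ ofReal (3 * C) * (ofReal (4 * 1 ^ 2 * 1) * ofReal (9 * A / a ^ α)) * wE α f Ω := by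
  refine g.wE_le_of_patch fun s hs => ?_
  have ht := g.isTri s hs
  obtain ⟨v, hv, hmax⟩ := s.exists_max_image (fun v => |avg0 (μ v) f|)
    (ht.nonempty)
  refine g.wE_bound hs zero_le_one (y := avg0 (μ v) f) ?_ ?_
  · filter_upwards [g.pw_eq (loc0 fun v => avg0 (μ v) f)] with p h hp
    rw [qi0, (h s hs hp).2, one_mul]
    exact ht.abs_loc0_le hmax hp
  · rw [ENNReal.ofReal_one, one_mul]
    exact (hμ s hs v hv).enorm_avg0_sq cv g hs ha α hf

lemma Geom.wE_qi1_le (cv : Convex ℝ Ω) (g : Geom Ω Tr φ C) (ha : 0 < a) (hμ : ∀ s ∈ Tr, ∀ v ∈ s,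
    Near Ω C A a s (μ v)) (α : ℕ) {f : R2 → R2} (hf : Measurable f) : wE α (qi1 Tr μ f) Ω ≤ ofReal
    (3 * C) * (ofReal (4 * (9 * C) ^ 2 * 36) * ofReal (9 * A / a ^ α)) * wE α f Ω := by
  refine g.wE_le_of_patch fun s hs => ?_
  have hh := g.spos hs
  have hC := g.pos
  have hne := (g.isTri s hs).nonempty
  obtain ⟨⟨v, w⟩, hv, hmax⟩ := (s ×ˢ s).exists_max_image (fun q => |avg1 (μ q.1) (μ q.2) f|)
    (hne.product hne)
  rw [Finset.mem_product] at hv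
  rw [show 4 * (9 * C) ^ 2 * 36 = 4 * (9 * C / dK s) ^ 2 * (36 * dK s ^ 2) by
    field_simp]
  refine g.wE_bound hs (by positivity) (y := avg1 (μ v) (μ w) f) ?_
    ((hμ s hs v hv.1).enorm_avg1_sq cv g hs ha (hμ s hs w hv.2) α hf)
  filter_upwards [g.pw_eq (loc1 fun v w => avg1 (μ v) (μ w) f)] with p h hp
  rw [qi1, (h s hs hp).2]
  exact g.norm_loc1_le hs (fun v hv w hw => hmax (v, w) (Finset.mk_mem_product hv hw)) hp

lemma Geom.wE_qi2_le (cv : Convex ℝ Ω) (g : Geom Ω Tr φ C) (ha : 0 < a) (hμ : ∀ s ∈ Tr, ∀ v ∈ s,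
    Near Ω C A a s (μ v)) (α : ℕ) (hf : Measurable f) : wE α (qi2 Tr μ f) Ω ≤ ofReal (3 * C) *
    (ofReal (4 * (18 * C ^ 2) ^ 2 * 324) * ofReal (9 * A / a ^ α)) * wE α f Ω := by
  refine g.wE_le_of_patch fun s hs => ?_
  have hh := g.spos hs
  have hC := g.pos
  have hne := (g.isTri s hs).nonempty
  obtain ⟨⟨v, w, x⟩, hv, hmax⟩ := (s ×ˢ s ×ˢ s).exists_max_image
    (fun q => |avg2 (μ q.1) (μ q.2.1) (μ q.2.2) f|) (hne.product (hne.product hne))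
  simp only [Finset.mem_product] at hv
  rw [show 4 * (18 * C ^ 2) ^ 2 * 324 = 4 * (18 * (C / dK s) ^ 2) ^ 2 * (324 * dK s ^ 4) by
    field_simp]
  refine g.wE_bound hs (by positivity) (y := avg2 (μ v) (μ w) (μ x) f) ?_
    ((hμ s hs v hv.1).enorm_avg2_sq cv g hs ha (hμ s hs w hv.2.1) (hμ s hs x hv.2.2) α hf)
  filter_upwards [g.pw_eq (loc2 fun a b c => avg2 (μ a) (μ b) (μ c) f)] with p h hp
  rw [qi2, (h s hs hp).2]
  exact g.abs_loc2_le hs (fun a ha b hb c hc => hmax (a, b, c)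
    (Finset.mk_mem_product ha (Finset.mk_mem_product hb hc))) p

end

/-! ### Uniqueness and locality of weak derivatives -/

lemma ae_eq_of_test (hU : IsOpen U) (hf : LocallyIntegrableOn f U) (hg : LocallyIntegrableOn g U) (h
    : ∀ χ, IsTest U χ → ∫ p in U, f p * χ p = ∫ p in U, g p * χ p) : ∀ᵐ p, p ∈ U → f p = g p := by
  have := hU.ae_eq_zero_of_integral_contDiff_smul_eq_zero (f := fun p => f p - g p) (μ := volume)
    (hf.sub hg) fun χ h1 h2 h3 => by
      have hχ : IsTest U χ := ⟨h1, h2, h3⟩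
      have e := h χ hχ
      rw [← sub_eq_zero, ← integral_sub (hχ.intOn_mul hf) (hχ.intOn_mul hg)] at e
      rw [← e, ← setIntegral_eq_integral_of_forall_compl_eq_zero (s := U)]
      · refine integral_congr_ae (.of_forall fun p => ?_)
        simp only [smul_eq_mul]; ring
      · intro p hp
        rw [image_eq_zero_of_notMem_tsupport fun h => hp (h3 h), zero_smul]
  filter_upwards [this] with p hp hpU
  linarith [hp hpU]

lemma IsTest.mono (h : U ⊆ Ω) (hχ : IsTest U χ) : IsTest Ω χ := ⟨hχ.1, hχ.2.1, hχ.2.2.trans h⟩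

lemma IsTest.setIntegral_eq (hΩ : MeasurableSet Ω) (hU : U ⊆ Ω) (hχ : IsTest U χ) (f : R2 → ℝ) : ∫
    p in Ω, f p * χ p = ∫ p in U, f p * χ p :=
  setIntegral_eq_of_subset_of_forall_sdiff_eq_zero hΩ hU fun p hp => by
    rw [image_eq_zero_of_notMem_tsupport fun h => hp.2 (hχ.2.2 h), mul_zero]

lemma WGrad.mono (hΩ : MeasurableSet Ω) (hU : U ⊆ Ω) (h : WGrad Ω ψ G) : WGrad U ψ G := fun χ
    hχ => by
  have e := h χ (hχ.mono hU)
  unfold dr dz at *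
  rwa [hχ.setIntegral_eq hΩ hU, hχ.setIntegral_eq hΩ hU, (hχ.fd_test _).setIntegral_eq hΩ hU,
    (hχ.fd_test _).setIntegral_eq hΩ hU] at e

lemma WRot.mono (hΩ : MeasurableSet Ω) (hU : U ⊆ Ω) {s : R2 → ℝ} (h : WRot Ω ζ s) : WRot U ζ s :=
    fun χ hχ => by
  have e := h χ (hχ.mono hU)
  rw [hχ.setIntegral_eq hΩ hU] at e
  rw [e]
  refine setIntegral_eq_of_subset_of_forall_sdiff_eq_zero hΩ hU fun p hp => ?_
  have h1 := fun e => image_eq_zero_of_notMem_tsupport fun h => hp.2 ((hχ.fd_test e).2.2 h)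
  have h2 := h1 (1, 0)
  have h3 := h1 (0, 1)
  unfold dr dz
  rw [h2, h3, mul_zero, mul_zero, sub_zero]

lemma LocInt.mono [MeasurableSpace F] (hU : U ⊆ Ω) {f : R2 → F}
    (h : LocInt Ω f) : LocInt U f := ⟨h.meas, h.loc.mono_set hU⟩

lemma WGrad.unique (hU : IsOpen U) {G' : R2 → R2} (h : WGrad U ψ G) (h' : WGrad U ψ G')
    (l : LocInt U G) (l' : LocInt U G') : ∀ᵐ p, p ∈ U → G p = G' p := by
  filter_upwards [ae_eq_of_test hU l.fst.loc l'.fst.loc fun χ hχ => by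
      rw [(h χ hχ).1, (h' χ hχ).1], ae_eq_of_test hU l.snd.loc l'.snd.loc fun χ hχ => by
      rw [(h χ hχ).2, (h' χ hχ).2]] with p h1 h2 hp
  exact Prod.ext (h1 hp) (h2 hp)

lemma WRot.unique (hU : IsOpen U) {s s' : R2 → ℝ} (h : WRot U ζ s) (h₂ : WRot U ζ s')
    (l : LocInt U s) (l' : LocInt U s') : ∀ᵐ p, p ∈ U → s p = s' p :=
  ae_eq_of_test hU l.loc l'.loc fun χ hχ => by rw [h χ hχ, h₂ χ hχ]

/-- The affine function with gradient `x` and value `c` at the origin. -/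
def aff (x : R2) (c : ℝ) (p : R2) : ℝ := pdot x p + c

lemma cont_aff (x : R2) (c : ℝ) : Continuous (aff x c) := by
  unfold aff pdot; fun_prop

lemma cont_ndf (a : R2) (b : ℝ) : Continuous (ndf a b) := by
  unfold ndf; fun_prop

lemma aff_sub (x : R2) (c : ℝ) (p q : R2) : aff x c p - aff x c q = pdot x (p - q) := by
  simp only [aff, pdot, fst_sub, snd_sub]; ring

lemma lip_aff (x : R2) (c : ℝ) : LipschitzWith (2 * ‖x‖₊) (aff x c) := by
  refine LipschitzWith.of_dist_le_mul fun p q => ?_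
  rw [Real.dist_eq, aff_sub, dist_eq_norm]
  simpa using abs_pdot_le x (p - q)

lemma lgrad_aff (x : R2) (c : ℝ) (p : R2) : lgrad (aff x c) p = x := by
  have key : ∀ e, lD (aff x c) p e = pdot x e := by
    intro e
    have h : HasLineDerivAt ℝ (aff x c) (pdot x e) p e := by
      unfold HasLineDerivAt
      have h1 : (fun t : ℝ => aff x c (p + t • e)) = fun t => aff x c p + t * pdot x e := by
        ext t; simp [aff, pdot]; ring
      rw [h1]
      simpa using ((hasDerivAt_id (0 : ℝ)).mul_const (pdot x e)).const_add (aff x c p)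
    exact h.lineDeriv
  unfold lgrad
  rw [key, key]
  simp [pdot]

lemma wGrad_aff (U : Set R2) (x : R2) (c : ℝ) : WGrad U (aff x c) fun _ => x := by
  have := wGrad_lgrad (Ω := U) (lip_aff x c)
  rwa [funext (lgrad_aff x c)] at this

lemma wRot_ndf (hU : MeasurableSet U) (a : R2) (b : ℝ) : WRot U (ndf a b) fun _ => 2 * b := by
  have h1 := wRot_smul_lgrad (Ω := U) (lip_aff (0, -b) a.1) (lip_aff (1, 0) 0)
  have h2 := wRot_smul_lgrad (Ω := U) (lip_aff (b, 0) a.2) (lip_aff (0, 1) 0)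
  have := h1.add h2 (loc_smul_lgrad (cont_aff _ _) (lip_aff _ _))
    (loc_pdet_lgrad (lip_aff _ _) (lip_aff _ _))
    (loc_smul_lgrad (cont_aff _ _) (lip_aff _ _))
    (loc_pdet_lgrad (lip_aff _ _) (lip_aff _ _))
  refine this.congr hU (.of_forall fun p _ => ?_) (.of_forall fun p _ => ?_)
  · simp only [lgrad_aff]
    ext <;> simp [aff, ndf, pdot] <;> ring
  · simp only [lgrad_aff, pdet]; ring

section

lemma Geom.grad_eq (hΩ : MeasurableSet Ω) (g : Geom Ω Tr φ C) (lG : LocInt Ω G) (h : WGrad Ω f G) {x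
    : Finset R2 → R2} {c : Finset R2 → ℝ} (hf : ∀ t ∈ Tr, ∀ᵐ p, p ∈ hull t → f p = aff (x t) (c t)
    p) : ∀ᵐ p : R2, ∀ t ∈ Tr, p ∈ hull t → G p = x t := by
  rw [eventually_all]
  intro t ht
  have hU := g.int_sub t ht
  have h1 := ((wGrad_aff (interior (hull t)) (x t) (c t)).congr isOpen_interior.measurableSet
    (ψ' := f) (G' := fun _ => x t)
    (by filter_upwards [hf t ht] with p hp hpt; rw [hp (interior_subset hpt)])
    (.of_forall fun _ _ => rfl)).unique isOpen_interior (h.mono hΩ hU)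
    (.of_cont continuous_const) (lG.mono hU)
  filter_upwards [h1, g.ae_hull ht] with p h1 h2 hp
  exact (h1 (h2 hp).1).symm

lemma Geom.rot_eq (hΩ : MeasurableSet Ω) (g : Geom Ω Tr φ C) (lf : LocInt Ω f) (h : WRot Ω ζ f) {a :
    Finset R2 → R2} {b : Finset R2 → ℝ} (hζ : ∀ t ∈ Tr, ∀ᵐ p, p ∈ hull t → ζ p = ndf (a t) (b t) p)
    : ∀ᵐ p : R2, ∀ t ∈ Tr, p ∈ hull t → f p = 2 * b t := by
  rw [eventually_all]
  intro t ht
  have hU := g.int_sub t ht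
  have h1 := ((wRot_ndf isOpen_interior.measurableSet (a t) (b t)).congr
    (Ω := interior (hull t)) isOpen_interior.measurableSet
    (ζ' := ζ) (s' := fun _ => 2 * b t)
    (by filter_upwards [hζ t ht] with p hp hpt; rw [hp (interior_subset hpt)])
    (.of_forall fun _ _ => rfl)).unique isOpen_interior (h.mono hΩ hU)
    (.of_cont continuous_const) (lf.mono hU)
  filter_upwards [h1, g.ae_hull ht] with p h1 h2 hp
  exact (h1 (h2 hp).1).symm

/-! ### Inverse estimates -/

lemma IsTri.aff_eq (hs : IsTri s) (x : R2) (c : ℝ) : aff x c = loc0 (aff x c) s := by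
  ext p
  exact (hs.sum_affine x c p).symm

lemma aff_third (x : R2) (c : ℝ) (u w p : R2) : aff x c ((1 / 3 : ℝ) • p + ((1 / 3 : ℝ) • w + (1 / 3
    : ℝ) • u)) = (aff x c w + aff x c u + aff x c p) / 3 := by
  simp [aff, pdot]; ring

lemma Geom.inv_aff (g : Geom Ω Tr φ C) (α : ℕ) (hs : s ∈ Tr) (x : R2) (c : ℝ) : ∃ m,
    0 ≤ m ∧ (∀ p ∈ hull s, |aff x c p| ≤ m) ∧ ‖x‖ ≤ 3 * C / dK s * m ∧ ‖m‖ₑ ^ 2 * ofReal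
    (dK s ^ 2 * rho s ^ α) ≤ ofReal (9 ^ (α + 3) * C) * wE α (aff x c) (hull s) := by
  have ht := g.isTri s hs
  have hne := ht.nonempty
  have hh := g.spos hs
  have hρ := g.rho_pos hs
  have hC := g.pos
  set f := aff x c with hf
  have hfc : Continuous f := cont_aff x c
  have hsup : ∀ m, (∀ v ∈ s, |f v| ≤ m) → ∀ p ∈ hull s, |f p| ≤ m := by
    intro m hm p hp
    rw [hf, ht.aff_eq x c]
    exact ht.abs_loc0_le hm hp
  obtain ⟨w, hw, hwmax⟩ := s.exists_max_image (fun v => v.1) hne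
  have hw3 : rho s / 3 ≤ w.1 := by
    have := Finset.sum_le_card_nsmul s (fun v : R2 => v.1) w.1 hwmax
    rw [ht.1, nsmul_eq_mul] at this
    push_cast at this
    unfold rho; linarith
  have hVpos := (ht.vol_pos (g.vol s hs)).2
  have hV0 : volume (hull s) ≠ 0 := fun h => by simp [measureReal_def, h] at hVpos
  have hVt := (vol_hull_lt_top s).ne
  set ν := unif (hull s) with hν
  have hprob : IsProbabilityMeasure ν := prob_unif hV0 hVt
  have hmem : ∀ᵐ p ∂ν, p ∈ hull s := ae_mem_unif (mset_hull s)
  obtain ⟨v, hv, hvmax⟩ := s.exists_max_image (fun v => |f v|) hne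
  have hin : Integrable f ν := by
    refine Integrable.of_bound hfc.measurable.aestronglyMeasurable |f v| ?_
    filter_upwards [hmem] with p hp using hsup _ hvmax p hp
  set γ := ∫ p, f p ∂ν with hγ
  set m : R2 → ℝ := fun u => (f w + f u + γ) / 3 with hm
  have hmean : ∀ u, m u = ∫ p, f ((1 / 3 : ℝ) • p + ((1 / 3 : ℝ) • w + (1 / 3 : ℝ) • u)) ∂ν := by
    intro u
    simp only [hf, aff_third]
    rw [integral_div, integral_add (integrable_const _) hin]
    simp [hm, hγ, hf]
  -- the square of each mean is controlled
  have hsq : ∀ u ∈ s, ‖m u‖ₑ ^ 2 * ofReal (dK s ^ 2 * rho s ^ α) ≤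
      ofReal (9 ^ (α + 1) * C) * wE α f (hull s) := by
    intro u hu
    set T : R2 → R2 := fun p => (1 / 3 : ℝ) • p + ((1 / 3 : ℝ) • w + (1 / 3 : ℝ) • u) with hT
    have hTc : Continuous T := by fun_prop
    set H : R2 → ENNReal := (hull s).indicator fun p => ‖f p‖ₑ ^ 2 * ofReal (p.1 ^ α)
      with hH
    have hHm : Measurable H := by
      refine Measurable.indicator ?_ (mset_hull s)
      exact (hfc.measurable.enorm.pow_const 2).mul (by fun_prop)
    have hHint : ∫⁻ p, H p = wE α f (hull s) := lintegral_indicator (mset_hull s) _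
    have h1 : ‖m u‖ₑ ^ 2 ≤ ∫⁻ p, ‖f (T p)‖ₑ ^ 2 ∂ν := by
      rw [hmean u]
      refine le_trans ?_ (lint_sq_le (by simp) (hfc.comp hTc).measurable.enorm.aemeasurable)
      gcongr
      exact enorm_integral_le_lintegral_enorm _
    have h2 : (∫⁻ p, ‖f (T p)‖ₑ ^ 2 ∂ν) * ofReal ((rho s / 9) ^ α) ≤ ∫⁻ p, H (T p) ∂ν := by
      have hm2 : Measurable fun p => ‖f (T p)‖ₑ ^ 2 := (hfc.comp hTc).measurable.enorm.pow_const 2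
      rw [← lintegral_mul_const _ hm2]
      refine lintegral_mono_ae ?_
      filter_upwards [hmem] with p hp
      have hTp : T p ∈ hull s := by
        have h3 := (convex_convexHull ℝ (s : Set R2)) (sub_hull hw)
          (sub_hull hu) (by norm_num : (0 : ℝ) ≤ 1 / 2) (by norm_num : (0 : ℝ) ≤ 1 / 2)
          (by norm_num)
        have := (convex_convexHull ℝ (s : Set R2)) hp h3 (by norm_num : (0 : ℝ) ≤ 1 / 3)
          (by norm_num : (0 : ℝ) ≤ 2 / 3) (by norm_num)
        rwa [smul_add, smul_smul, smul_smul,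
          show (2 / 3 : ℝ) * (1 / 2) = 1 / 3 by norm_num] at this
      rw [hH, indicator_of_mem hTp]
      gcongr
      have := (g.hull_fst hs hp).1
      have := g.fst_nonneg s hs u hu
      simp only [hT, Prod.fst_add, smul_fst, smul_eq_mul]; linarith
    have h3 : ∫⁻ p, H (T p) ∂ν ≤ (volume (hull s))⁻¹ * (9 * wE α f (hull s)) := by
      rw [← hHint]
      calc _ ≤ ∫⁻ p, H (T p) ∂((volume (hull s))⁻¹ • volume) := lintegral_mono' (unif_le _) le_rfl
        _ ≤ _ := by
          rw [lintegral_smul_measure, smul_eq_mul]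
          exact mul_le_mul' le_rfl (lint_comp_smul_add_le hHm le_rfl _)
    have h4 : ofReal (dK s ^ 2) * (volume (hull s))⁻¹ ≤ ofReal C := by
      rw [← div_eq_mul_inv]
      refine ENNReal.div_le_of_le_mul ?_
      rw [← ENNReal.ofReal_toReal hVt, ← ofReal_mul hC.le]
      exact ofReal_le_ofReal (g.vol s hs)
    have e : ofReal (dK s ^ 2 * rho s ^ α) = ofReal (9 ^ α) *
        ofReal (dK s ^ 2) * ofReal ((rho s / 9) ^ α) := by
      rw [← ofReal_mul (by positivity), ← ofReal_mul (by positivity)]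
      congr 1; rw [div_pow]; field_simp
    calc _ ≤ (∫⁻ p, ‖f (T p)‖ₑ ^ 2 ∂ν) * ofReal (dK s ^ 2 * rho s ^ α) :=
          mul_le_mul' h1 le_rfl
      _ = ofReal (9 ^ α) * ofReal (dK s ^ 2) *
          ((∫⁻ p, ‖f (T p)‖ₑ ^ 2 ∂ν) * ofReal ((rho s / 9) ^ α)) := by rw [e]; ring
      _ ≤ ofReal (9 ^ α) * ofReal (dK s ^ 2) *
          ((volume (hull s))⁻¹ * (9 * wE α f (hull s))) := mul_le_mul' le_rfl (h2.trans h3)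
      _ = ofReal (9 ^ α) * (ofReal (dK s ^ 2) * (volume (hull s))⁻¹) *
          (9 * wE α f (hull s)) := by ring
      _ ≤ ofReal (9 ^ α) * ofReal C * (9 * wE α f (hull s)) := by gcongr
      _ = _ := by
          rw [pow_succ, ofReal_mul (by positivity), ofReal_mul (by positivity),
            ofReal_ofNat]
          ring
  obtain ⟨u, hu, humax⟩ := s.exists_max_image (fun u => |m u|) hne
  have d1 : ∀ v ∈ s, |f v - f w| ≤ 6 * |m u| := by
    intro v hv
    have h1 := humax v hv
    have h2 := humax w hw
    have : f v - f w = 3 * (m v - m w) := by simp only [hm]; ring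
    rw [this, abs_mul, abs_of_pos (by norm_num : (0 : ℝ) < 3)]
    have := abs_sub (m v) (m w)
    linarith
  have d2 : |γ - f w| ≤ 6 * |m u| := by
    have e : γ - f w = ∫ p, (f p - f w) ∂ν := by
      rw [integral_sub hin (integrable_const _)]; simp [hγ]
    rw [e]
    have := norm_integral_le_of_norm_le_const (μ := ν) (C := 6 * |m u|)
      (f := fun p => f p - f w) ?_
    · simpa using this
    · filter_upwards [hmem] with p hp
      have e2 : f p - f w = loc0 (fun v => f v - f w) s p := by
        unfold loc0
        simp only [sub_mul, sum_sub_distrib, ← mul_sum, ht.sum_lam, mul_one]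
        exact congrArg (· - f w) (congrFun (ht.aff_eq x c) p)
      rw [e2]
      exact ht.abs_loc0_le d1 hp
  have d3 : |f w| ≤ 3 * |m u| := by
    have h2 := humax w hw
    have e : f w = m w - (γ - f w) / 3 := by simp only [hm]; ring
    have a1 := abs_le.1 h2
    have a2 := abs_le.1 d2
    rw [abs_le]
    constructor <;> linarith
  have d4 : |f v| ≤ 9 * |m u| := by
    have := abs_add_le (f v - f w) (f w)
    rw [sub_add_cancel] at this
    linarith [d1 v hv]
  refine ⟨|f v|, abs_nonneg _, hsup _ hvmax, ?_, ?_⟩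
  · have e := ht.sum_affine_smul x c
    rw [← e]
    calc _ ≤ ∑ u ∈ s, |f v| * (C / dK s) := by
          refine norm_sum_le_of_le _ fun u hu => ?_
          rw [norm_smul]
          exact mul_le_mul (hvmax u hu) (g.grad s hs u) (norm_nonneg _) (abs_nonneg _)
      _ = _ := by rw [Finset.sum_const, ht.1, nsmul_eq_mul]; push_cast; ring
  · have h1 : ‖|f v|‖ₑ ^ 2 ≤ ofReal (9 ^ 2) * ‖m u‖ₑ ^ 2 :=
      enorm_sq_le (by norm_num) (by simpa using d4)
    calc _ ≤ ofReal (9 ^ 2) * ‖m u‖ₑ ^ 2 * ofReal (dK s ^ 2 * rho s ^ α) :=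
          mul_le_mul' h1 le_rfl
      _ ≤ ofReal (9 ^ 2) * (ofReal (9 ^ (α + 1) * C) * wE α f (hull s)) := by
          rw [mul_assoc]; exact mul_le_mul' le_rfl (hsq u hu)
      _ = _ := by
          rw [← mul_assoc, ← ofReal_mul (by norm_num)]; congr 2; ring

lemma wE_mono_norm {f : R2 → E} {h : R2 → F} {S : Set R2} (hS : MeasurableSet S) (hfh : ∀ᵐ p, p ∈ S
    → ‖f p‖ ≤ ‖h p‖) : wE α f S ≤ wE α h S := by
  refine lintegral_mono_ae ((ae_restrict_iff' hS).2 ?_)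
  filter_upwards [hfh] with p hp hpS
  refine mul_le_mul' (pow_le_pow_left' ?_ 2) le_rfl
  exact enorm_le_iff_norm_le.2 (hp hpS)

lemma wE_mono_set {f : R2 → E} {S S' : Set R2} (h : S ⊆ S') :
    wE α f S ≤ wE α f S' := lintegral_mono_set h

lemma Geom.inv_ndf (g : Geom Ω Tr φ C) (α : ℕ) (hs : s ∈ Tr) (a : R2) (b : ℝ) : ∃ m,
    0 ≤ m ∧ (∀ p ∈ hull s, ‖ndf a b p‖ ≤ m) ∧ |b| ≤ 3 * C / dK s * m ∧ ‖m‖ₑ ^ 2 * ofReal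
    (dK s ^ 2 * rho s ^ α) ≤ ofReal (9 ^ (α + 3) * C) * wE α (ndf a b) (hull s) := by
  obtain ⟨m, m0, m1, m2, m3⟩ := g.inv_aff α hs (0, -b) a.1
  obtain ⟨n, n0, n1, n2, n3⟩ := g.inv_aff α hs (b, 0) a.2
  have hC := g.pos
  have hh := g.spos hs
  have e : ∀ p, ndf a b p = (aff (0, -b) a.1 p, aff (b, 0) a.2 p) := fun p => by
    ext <;> simp [ndf, aff, pdot] <;> ring
  have w1 : wE α (aff (0, -b) a.1) (hull s) ≤ wE α (ndf a b) (hull s) :=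
    wE_mono_norm (mset_hull s) (.of_forall fun p _ => by rw [e]; exact le_max_left _ _)
  have w2 : wE α (aff (b, 0) a.2) (hull s) ≤ wE α (ndf a b) (hull s) :=
    wE_mono_norm (mset_hull s) (.of_forall fun p _ => by rw [e]; exact le_max_right _ _)
  have hb : |b| = ‖((b, 0) : R2)‖ := by simp [norm_def]
  refine ⟨max m n, le_max_of_le_left m0, fun p hp => ?_, ?_, ?_⟩
  · rw [e]
    exact max_le ((m1 p hp).trans (le_max_left _ _)) ((n1 p hp).trans (le_max_right _ _))
  · rw [hb]
    exact n2.trans (by gcongr; exact le_max_right _ _)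
  · rcases max_choice m n with h | h <;> rw [h]
    · exact m3.trans (mul_le_mul' le_rfl w1)
    · exact n3.trans (mul_le_mul' le_rfl w2)

lemma Geom.wE_small (g : Geom Ω Tr φ C) {f : R2 → E} {f' : R2 → F} {m : Finset R2 → ℝ} {K B : ℝ}
    (hB : 0 ≤ B)
    (hm : ∀ t ∈ Tr, 0 ≤ m t) (hinv : ∀ t ∈ Tr, ‖m t‖ₑ ^ 2 * ofReal (dK t ^ 2 * rho t ^ α) ≤
    ofReal K * wE α f (hull t)) (h : ∀ s ∈ Tr, ∀ M, (∀ t ∈ nbs Tr s, m t ≤ M) → ∀ᵐ p, p ∈ hull s →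
    ‖f' p‖ ≤ B * M) : wE α f' Ω ≤ ofReal (3 * C) *
    (ofReal (4 * B ^ 2 * (C ^ 2 * (6 * C ^ 2) ^ α)) * ofReal K) * wE α f Ω := by
  refine g.wE_le_of_patch fun s hs => ?_
  have hC := g.pos
  obtain ⟨t, ht, hmax⟩ := (nbs Tr s).exists_max_image m ⟨s, g.self_mem_nbs hs⟩
  obtain ⟨htT, -⟩ := mem_nbs.1 ht
  have hst := nbs_symm hs ht
  refine g.wE_bound hs hB (y := m t) ?_ ?_
  · rw [abs_of_nonneg (hm t htT)]
    exact h s hs _ hmax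
  · have h1 := g.size_le_of_nbs htT hst
    have h2 := g.rho_le_of_nbs htT hst
    have p1 := g.spos hs
    have p2 := g.rho_pos hs
    calc _ ≤ ‖m t‖ₑ ^ 2 * (ofReal (C ^ 2 * (6 * C ^ 2) ^ α) *
          ofReal (dK t ^ 2 * rho t ^ α)) := by
          refine mul_le_mul' le_rfl ?_
          rw [← ofReal_mul (by positivity)]
          apply ofReal_le_ofReal
          calc _ ≤ (C * dK t) ^ 2 * (6 * C ^ 2 * rho t) ^ α := by gcongr
            _ = _ := by rw [mul_pow, mul_pow]; ring
      _ = ofReal (C ^ 2 * (6 * C ^ 2) ^ α) *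
          (‖m t‖ₑ ^ 2 * ofReal (dK t ^ 2 * rho t ^ α)) := by ring
      _ ≤ _ := by
          refine mul_le_mul' le_rfl ((hinv t htT).trans (mul_le_mul' le_rfl (wE_mono_set ?_)))
          exact fun p hp => mem_patch.2 ⟨t, ht, hp⟩

end

/-! ### The quasi-interpolants on finite element functions -/

lemma Probe.mono (h : U ⊆ Ω) (hμ : Probe U μ) : Probe Ω μ := by
  obtain ⟨S, h1, h2, h3⟩ := hμ.supp
  exact ⟨hμ.prob, hμ.dens, S, h1, h2.trans h, h3⟩

lemma IsTri.ex_probe (hs : IsTri s) (hε : 0 < ε) (hε1 : ε ≤ 1) (hv : v ∈ s) : ∃ μ, Probe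
    (interior (hull s)) μ ∧ ∀ᵐ x ∂μ, ‖x - v‖ ≤ ε * dK s := by
  have cv := convex_convexHull ℝ (s : Set R2)
  obtain ⟨c, hc⟩ := hs.interior_nonempty
  obtain ⟨r, hr, hB⟩ := Metric.nhds_basis_closedBall.mem_iff.1 (isOpen_interior.mem_nhds hc)
  have hvc : v ∈ closure (interior (hull s)) := by
    rw [cv.closure_interior_eq_closure_of_nonempty_interior hs.interior_nonempty]
    exact subset_closure (sub_hull hv)
  refine ⟨samp ε v c r, samp_probe isOpen_interior cv.interior hε hε1 hvc hr hB, ?_⟩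
  filter_upwards [ae_samp hε v c r] with x hx
  obtain ⟨y, hy, rfl⟩ := hx
  rw [add_sub_cancel_left, norm_smul, norm_eq_abs, abs_of_pos hε]
  gcongr
  exact norm_sub_le_diam (interior_subset (hB hy)) (sub_hull hv)

section

variable {μ : R2 → Measure R2}

lemma norm_sub_le_two {c x y : R2} (h : ‖x - c‖ ≤ a) (h' : ‖y - c‖ ≤ a) : ‖y - x‖ ≤ 2 * a := by
  have := norm_sub_le (y - c) (x - c)
  rw [sub_sub_sub_cancel_right] at this
  linarith

lemma abs_int_sub_le {X : Type*} [MeasurableSpace X] {κ : Measure X} [IsProbabilityMeasure κ] {F : X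
    → ℝ} (hF : Integrable F κ) {c B : ℝ} (h : ∀ᵐ x ∂κ, |F x - c| ≤ B) : |∫ x, F x ∂κ - c| ≤ B := by
  have := norm_integral_le_of_norm_le_const (f := fun x => F x - c) h
  rw [integral_sub hF (integrable_const _)] at this
  simpa using this

lemma Geom.hull_zone (g : Geom Ω Tr φ C) (hs : s ∈ Tr) : interior (hull s) ⊆ zone Ω C s :=
    fun p hp =>
  ⟨g.int_sub s hs hp, p, interior_subset hp, by simpa using diam_nn s⟩

lemma Geom.inv_size_le (g : Geom Ω Tr φ C) (hs : s ∈ Tr) (h : t ∈ nbs Tr s) : 3 * C /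
    dK t ≤ 3 * C ^ 2 / dK s := by
  have ht := (mem_nbs.1 h).1
  have h1 := g.size_le_of_nbs ht (nbs_symm hs h)
  have := g.spos hs
  have := g.spos ht
  have := g.pos
  rw [div_le_div_iff₀ (by positivity) (by positivity)]
  nlinarith

lemma Geom.wE_sub_qi0 (hΩ : IsOpen Ω) (cv : Convex ℝ Ω) (g : Geom Ω Tr φ C)
    (hε : 0 < ε) (hε1 : ε ≤ 1) (S : Samp Ω Tr C A a ε μ) (α : ℕ) (lf : LocInt Ω f)
    (lG : LocInt Ω G) (h : WGrad Ω f G) (hf : ∀ t ∈ Tr, ∃ x c, ∀ᵐ p, p ∈ hull t → f p = aff x c p) :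
    wE α (fun p => f p - qi0 Tr μ f p) Ω ≤ ofReal (3 * C) * (ofReal (4 * (18 * C ^ 2 * ε) ^ 2 * (C ^
    2 * (6 * C ^ 2) ^ α)) * ofReal (9 ^ (α + 3) * C)) * wE α f Ω := by
  classical
  choose! x c hf using hf
  have hG := g.grad_eq hΩ.measurableSet lG h hf
  have hC := g.pos
  choose! m m0 m1 m2 m3 using fun t ht => g.inv_aff α (s := t) ht (x t) (c t)
  refine g.wE_small (m := m) (by positivity) m0 (fun t ht => ?_) fun s hs M hM => ?_
  · refine (m3 t ht).trans (mul_le_mul' le_rfl (wE_mono_norm (mset_hull t) ?_))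
    filter_upwards [hf t ht] with p hp hpt
    rw [hp hpt]
  have hh := g.spos hs
  have ht := g.isTri s hs
  have hM0 : 0 ≤ M := (m0 s hs).trans (hM s (g.self_mem_nbs hs))
  have hx : ∀ t ∈ nbs Tr s, ‖x t‖ ≤ 3 * C ^ 2 / dK s * M := fun t ht =>
    (m2 t (mem_nbs.1 ht).1).trans (mul_le_mul (g.inv_size_le hs ht) (hM t ht)
      (m0 t (mem_nbs.1 ht).1) (by positivity))
  have hZ : ∀ᵐ p, p ∈ zone Ω C s → ‖G p‖ ≤ 3 * C ^ 2 / dK s * M := by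
    filter_upwards [hG] with p hp hpz
    obtain ⟨t, ht, hpt⟩ := mem_patch.1 (g.zone_sub hs hpz)
    rw [hp t (mem_nbs.1 ht).1 hpt]
    exact hx t ht
  have key : ∀ v ∈ s, |aff (x s) (c s) v - avg0 (μ v) f| ≤ 18 * C ^ 2 * ε * M := by
    intro v hv
    obtain ⟨κ, hκ, hκc⟩ := ht.ex_probe hε hε1 hv
    have hκp := hκ.prob
    have hμp := (S.probe s hs v hv).prob
    have b1 : |avg0 (μ v) f - avg0 κ f| ≤ 12 * C ^ 2 * ε * M := by
      rw [Probe.avg0_sub hΩ cv (hκ.mono (g.int_sub s hs)) (S.probe s hs v hv) lf lG h]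
      refine (Probe.abs_avg1_le (cvx_zone cv hC.le s) (hκ.mono (g.int_sub s hs))
        (S.probe s hs v hv) (hκ.ae_mem.mono fun p hp => g.hull_zone hs hp)
        (S.near s hs v hv).zone hZ (ℓ := 2 * (ε * dK s)) ?_).trans (le_of_eq ?_)
      · filter_upwards [ae_tm hκc (S.close s hs v hv) (S.close s hs v hv)] with X hX
        exact norm_sub_le_two hX.1 hX.2.1
      · field_simp; ring
    have b2 : |avg0 κ f - aff (x s) (c s) v| ≤ 6 * C ^ 2 * ε * M := by
      rw [hκ.avg0_congr (g := aff (x s) (c s)) (by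
        filter_upwards [hf s hs] with p hp hpi using hp (interior_subset hpi))]
      refine abs_int_sub_le (hκ.integrable (convex_convexHull ℝ _).interior
        (.of_cont (cont_aff (x s) (c s)))) ?_
      filter_upwards [hκc] with p hp
      rw [aff_sub]
      refine (abs_pdot_le _ _).trans ?_
      calc _ ≤ 2 * (3 * C ^ 2 / dK s * M) * (ε * dK s) := by
            have := hx s (g.self_mem_nbs hs); gcongr
        _ = _ := by field_simp; ring
    have := abs_sub_le (avg0 (μ v) f) (avg0 κ f) (aff (x s) (c s) v)
    rw [abs_sub_comm]
    linarith
  filter_upwards [hf s hs, g.pw_eq (loc0 fun v => avg0 (μ v) f)] with p h1 h2 hp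
  rw [qi0, (h2 s hs hp).2, h1 hp]
  have e : aff (x s) (c s) p - loc0 (fun v => avg0 (μ v) f) s p =
      loc0 (fun v => aff (x s) (c s) v - avg0 (μ v) f) s p := by
    rw [congrFun (ht.aff_eq (x s) (c s)) p]
    simp only [loc0, sub_mul, sum_sub_distrib]
  rw [e]
  exact ht.abs_loc0_le key hp

lemma seg_ndf (a : R2) (b : ℝ) (x y : R2) : seg (ndf a b) x y = pdot (ndf a b x) (y - x) := by
  have i : ∀ c d : ℝ, IntegrableOn (fun τ : ℝ => c + τ * d) I01 := fun c d =>
    (by fun_prop : Continuous fun τ : ℝ => c + τ * d).integrableOn_Icc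
  have e1 : ∀ τ : ℝ, (ndf a b (x + τ • (y - x))).1 = (ndf a b x).1 + τ * (-b * (y - x).2) := by
    intro τ; simp [ndf]; ring
  have e2 : ∀ τ : ℝ, (ndf a b (x + τ • (y - x))).2 = (ndf a b x).2 + τ * (b * (y - x).1) := by
    intro τ; simp [ndf]; ring
  have e3 : ∀ c d : ℝ, ∫ τ in I01, (c + τ * d) =
      c + d * ∫ τ in I01, τ := by
    intro c d
    rw [integral_add (by simp) (by simpa [IntegrableOn] using i 0 d), integral_mul_const]
    simp [mul_comm]
  unfold seg
  simp only [e1, e2, e3, pdot]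
  ring

lemma norm_ndf_sub_le (a : R2) (b : ℝ) (p q : R2) : ‖ndf a b p - ndf a b q‖ ≤ |b| * ‖p - q‖ := by
  have e : ndf a b p - ndf a b q = b • (-(p - q).2, (p - q).1) := by
    ext <;> simp [ndf] <;> ring
  rw [e, norm_smul, norm_eq_abs]
  refine mul_le_mul_of_nonneg_left (max_le ?_ ?_) (abs_nonneg b)
  · simpa only [norm_neg] using norm_snd_le (p - q)
  · exact norm_fst_le (p - q)

lemma Geom.wE_sub_qi1 (hΩ : IsOpen Ω) (cv : Convex ℝ Ω) (g : Geom Ω Tr φ C)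
    (hε : 0 < ε) (hε1 : ε ≤ 1) (S : Samp Ω Tr C A a ε μ) (α : ℕ) (lη : LocInt Ω η)
    (lf : LocInt Ω f) (h : WRot Ω η f) (hη : ∀ t ∈ Tr, ∃ x b, ∀ᵐ p, p ∈ hull t → η p = ndf x b p) :
    wE α (fun p => η p - qi1 Tr μ η p) Ω ≤ ofReal (3 * C) * (ofReal (4 * (1458 * C ^ 3 * ε) ^ 2 * (C
    ^ 2 * (6 * C ^ 2) ^ α)) * ofReal (9 ^ (α + 3) * C)) * wE α η Ω := by
  classical
  choose! x b hη using hη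
  have hf := g.rot_eq hΩ.measurableSet lf h hη
  have hC := g.pos
  choose! m m0 m1 m2 m3 using fun t ht => g.inv_ndf α (s := t) ht (x t) (b t)
  refine g.wE_small (m := m) (by positivity) m0 (fun t ht => ?_) fun s hs M hM => ?_
  · refine (m3 t ht).trans (mul_le_mul' le_rfl (wE_mono_norm (mset_hull t) ?_))
    filter_upwards [hη t ht] with p hp hpt
    rw [hp hpt]
  have hh := g.spos hs
  have ht := g.isTri s hs
  have hMs := hM s (g.self_mem_nbs hs)
  have hM0 : 0 ≤ M := (m0 s hs).trans hMs
  have hb : ∀ t ∈ nbs Tr s, |b t| ≤ 3 * C ^ 2 / dK s * M := fun t ht =>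
    (m2 t (mem_nbs.1 ht).1).trans (mul_le_mul (g.inv_size_le hs ht) (hM t ht)
      (m0 t (mem_nbs.1 ht).1) (by positivity))
  have hZf : ∀ᵐ p, p ∈ zone Ω C s → |f p| ≤ 6 * C ^ 2 / dK s * M := by
    filter_upwards [hf] with p hp hpz
    obtain ⟨t, ht, hpt⟩ := mem_patch.1 (g.zone_sub hs hpz)
    rw [hp t (mem_nbs.1 ht).1 hpt, abs_mul, abs_two]
    calc _ ≤ 2 * (3 * C ^ 2 / dK s * M) := by have := hb t ht; gcongr
      _ = _ := by ring
  have hη' : ∀ᵐ p : R2, ∀ t ∈ Tr, p ∈ hull t → η p = ndf (x t) (b t) p := by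
    rw [eventually_all]; exact hη
  have hZη : ∀ᵐ p, p ∈ zone Ω C s → ‖η p‖ ≤ M := by
    filter_upwards [hη'] with p hp hpz
    obtain ⟨t, ht, hpt⟩ := mem_patch.1 (g.zone_sub hs hpz)
    have htT := (mem_nbs.1 ht).1
    rw [hp t htT hpt]
    exact (m1 t htT p hpt).trans (hM t ht)
  have hZc := cvx_zone cv hC.le s
  choose! κ hκ hκc using fun v (hv : v ∈ s) => ht.ex_probe hε hε1 hv
  have pκ := fun v hv => (hκ v hv).mono (g.int_sub s hs)
  have zκ : ∀ v ∈ s, ∀ᵐ p ∂(κ v), p ∈ zone Ω C s := fun v hv =>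
    (hκ v hv).ae_mem.mono fun p hp => g.hull_zone hs hp
  have zμ := fun v hv => (S.near s hs v hv).zone
  set N := ndf (x s) (b s) with hN
  have pμ := S.probe s hs
  have cμ := S.close s hs
  have key : ∀ v ∈ s, ∀ w ∈ s, |pdot (N v) (w - v) - avg1 (μ v) (μ w) η| ≤
      162 * C ^ 2 * ε * dK s * M := by
    intro v hv w hw
    have i1 := (hκ v hv).prob; have i2 := (hκ w hw).prob
    have i3 := (pμ v hv).prob; have i4 := (pμ w hw).prob
    have near : ∀ u ∈ s, |avg1 (μ u) (κ u) η| ≤ 4 * ε * dK s * M := by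
      intro u hu
      have i1 := (hκ u hu).prob; have i3 := (pμ u hu).prob
      refine (Probe.abs_avg1_le hZc (pμ u hu) (pκ u hu) (zμ u hu) (zκ u hu) hZη
        (ℓ := 2 * (ε * dK s)) ?_).trans (le_of_eq (by ring))
      filter_upwards [ae_tm (cμ u hu) (hκc u hu) (hκc u hu)] with X hX
      exact norm_sub_le_two hX.1 hX.2.1
    have c1 := Probe.avg1_coc hΩ cv (pμ v hv) (pκ v hv) (pκ w hw) lη lf h
    have c2 := Probe.avg1_coc hΩ cv (pμ v hv) (pμ w hw) (pκ w hw) lη lf h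
    have fin : 6 * C ^ 2 / dK s * M * (12 * ε * dK s ^ 2) = 72 * C ^ 2 * ε * dK s * M := by
      field_simp; ring
    have t1 : |avg2 (μ v) (κ v) (κ w) f| ≤ 72 * C ^ 2 * ε * dK s * M := by
      refine (Probe.abs_avg2_le hZc (pμ v hv) (pκ v hv) (pκ w hw) (zμ v hv) (zκ v hv)
        (zκ w hw) hZf (D := 12 * ε * dK s ^ 2) ?_ (by positivity) (by positivity)).trans_eq fin
      filter_upwards [ae_tm (cμ v hv) (hκc v hv) (hκc w hw),
        ae_tm (zμ v hv) (zκ v hv) (zκ w hw)] with X hX hX'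
      have n2 := dist_le_of_zone g.one_le hX'.1 hX'.2.2
      have n3 := norm_sub_le_two hX.1 hX.2.1
      calc _ ≤ 2 * ‖X.2.1 - X.1‖ * ‖X.2.2 - X.1‖ := abs_pdet_le _ _
        _ ≤ 2 * (2 * (ε * dK s)) * (3 * dK s) := by gcongr
        _ = _ := by ring
    have t2 : |avg2 (μ v) (μ w) (κ w) f| ≤ 72 * C ^ 2 * ε * dK s * M := by
      refine (Probe.abs_avg2_le hZc (pμ v hv) (pμ w hw) (pκ w hw) (zμ v hv)
        (zμ w hw) (zκ w hw) hZf (D := 12 * ε * dK s ^ 2) ?_ (by positivity)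
        (by positivity)).trans_eq fin
      filter_upwards [ae_tm (cμ v hv) (cμ w hw) (hκc w hw),
        ae_tm (zμ v hv) (zμ w hw) (zκ w hw)] with X hX hX'
      have n2 := dist_le_of_zone g.one_le hX'.1 hX'.2.1
      have n3 := norm_sub_le_two hX.2.1 hX.2.2
      rw [show pdet (X.2.1 - X.1) (X.2.2 - X.1) = pdet (X.2.1 - X.1) (X.2.2 - X.2.1) by
        simp [pdet]; ring]
      calc _ ≤ 2 * ‖X.2.1 - X.1‖ * ‖X.2.2 - X.2.1‖ := abs_pdet_le _ _
        _ ≤ 2 * (3 * dK s) * (2 * (ε * dK s)) := by gcongr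
        _ = _ := by ring
    have t3 : |avg1 (κ v) (κ w) η - pdot (N v) (w - v)| ≤
        (6 * C ^ 2 + 4) * ε * dK s * M := by
      have hic := (convex_convexHull ℝ (s : Set R2)).interior
      rw [Probe.avg1_congr hic (hκ v hv) (hκ w hw) (g := N) (by
        filter_upwards [hη s hs] with p hp hpi using hp (interior_subset hpi))]
      obtain ⟨si, se⟩ := Probe.int_seg hic (hκ v hv) (hκ w hw)
        (LocInt.of_cont (cont_ndf _ _))
      rw [← se]
      refine abs_int_sub_le si ?_
      · filter_upwards [ae_pl (ν := κ w) (hκc v hv),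
          ae_pr (μ := κ v) (hκc w hw),
          ae_pl (ν := κ w) (hκ v hv).ae_mem,
          ae_pr (μ := κ v) (hκ w hw).ae_mem] with z z1 z2 z3 z4
        rw [seg_ndf]
        have e : pdot (N z.1) (z.2 - z.1) - pdot (N v) (w - v) =
            pdot (N z.1 - N v) (z.2 - z.1) +
              pdot (N v) ((z.2 - w) - (z.1 - v)) := by
          simp [pdot]; ring
        rw [e]
        have n1 : ‖z.2 - z.1‖ ≤ dK s :=
          norm_sub_le_diam (interior_subset z4) (interior_subset z3)
        have n2 : ‖N z.1 - N v‖ ≤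
            3 * C ^ 2 / dK s * M * (ε * dK s) :=
          (norm_ndf_sub_le _ _ _ _).trans
            (mul_le_mul (hb s (g.self_mem_nbs hs)) z1 (norm_nonneg _) (by positivity))
        have n3 : ‖(z.2 - w) - (z.1 - v)‖ ≤ 2 * (ε * dK s) := by
          have := norm_sub_le (z.2 - w) (z.1 - v); linarith
        have n4 : ‖N v‖ ≤ M := (m1 s hs v (sub_hull hv)).trans hMs
        calc _ ≤ 2 * ‖N z.1 - N v‖ * ‖z.2 - z.1‖ +
              2 * ‖N v‖ * ‖(z.2 - w) - (z.1 - v)‖ :=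
              (abs_add_le _ _).trans (add_le_add (abs_pdot_le _ _) (abs_pdot_le _ _))
          _ ≤ 2 * (3 * C ^ 2 / dK s * M * (ε * dK s)) * dK s +
              2 * M * (2 * (ε * dK s)) := by gcongr
          _ = _ := by field_simp; ring
    have e : pdot (N v) (w - v) - avg1 (μ v) (μ w) η =
        -(avg1 (κ v) (κ w) η - pdot (N v) (w - v)) - avg1 (μ v) (κ v) η +
          avg1 (μ w) (κ w) η + avg2 (μ v) (κ v) (κ w) f - avg2 (μ v) (μ w) (κ w) f := by
      linarith
    have hC1 : 1 ≤ C ^ 2 := one_le_pow₀ g.one_le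
    have last : (6 * C ^ 2 + 4) * ε * dK s * M + 4 * ε * dK s * M +
        4 * ε * dK s * M + 72 * C ^ 2 * ε * dK s * M + 72 * C ^ 2 * ε * dK s * M ≤
        162 * C ^ 2 * ε * dK s * M := by
      have : 0 ≤ ε * dK s * M := by positivity
      nlinarith
    rw [e, abs_le]
    have := abs_le.1 (near v hv); have := abs_le.1 (near w hw)
    have := abs_le.1 t1; have := abs_le.1 t2; have := abs_le.1 t3
    constructor <;> linarith
  filter_upwards [hη s hs, g.pw_eq (loc1 fun v w => avg1 (μ v) (μ w) η)] with p h1 h2 hp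
  rw [qi1, (h2 s hs hp).2, h1 hp]
  have e : N p - loc1 (fun v w => avg1 (μ v) (μ w) η) s p =
      loc1 (fun v w => pdot (N v) (w - v) - avg1 (μ v) (μ w) η) s p := by
    rw [hN, ← ht.sum_whit_ndf (x s) (b s) p]
    simp only [loc1, sub_div, sub_smul, sum_sub_distrib]
  rw [e]
  refine (g.norm_loc1_le hs key hp).trans (le_of_eq ?_)
  field_simp; ring

lemma full_uR : full.real Set.univ = 1 / 2 := by
  have h := int_stdT_fst (D := fun _ => 1) continuous_const
  have e : ∀ x ∈ I01, ∫ _y in Icc (0 : ℝ) (1 - x), (1 : ℝ) = 1 - x := by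
    intro x hx
    simp [hx.2]
  rw [setIntegral_congr_fun measurableSet_Icc e, integral_Icc_eq_integral_Ioc,
    ← intervalIntegral.integral_of_le zero_le_one] at h
  simp at h
  have e2 : ∫ x in (0 : ℝ)..1, (1 - x) = 1 / 2 := by
    rw [intervalIntegral.integral_sub (by simp) (by simp)]; norm_num
  rw [measureReal_restrict_apply_univ, h, e2]

lemma ex_inn_par {δ : ℝ} (hδ : 0 ≤ δ) : ∃ S : Set R2, MeasurableSet S ∧
    (∀ t ∈ S, δ ≤ t.1 ∧ δ ≤ t.2 ∧ δ ≤ 1 - t.1 - t.2) ∧ full.real Sᶜ ≤ 6 * δ := by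
  by_cases h : 3 * δ ≤ 1
  · set S := AffineMap.homothety ((1 / 3, 1 / 3) : R2) (1 - 3 * δ) '' stdT with hS
    have hc : IsCompact S := cpt_stdT.image
      (AffineMap.homothety_continuous ((1 / 3, 1 / 3) : R2) (1 - 3 * δ))
    have h1 : ∀ t ∈ S, δ ≤ t.1 ∧ δ ≤ t.2 ∧ δ ≤ 1 - t.1 - t.2 := by
      rintro _ ⟨t, ⟨ht1, ht2, ht3⟩, rfl⟩
      have e : AffineMap.homothety ((1 / 3, 1 / 3) : R2) (1 - 3 * δ) t =
          ((1 - 3 * δ) * t.1 + δ, (1 - 3 * δ) * t.2 + δ) := by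
        ext <;> simp [AffineMap.homothety_apply] <;> ring
      rw [e]
      have h4 : 0 ≤ 1 - 3 * δ := by linarith
      refine ⟨?_, ?_, ?_⟩
      · have := mul_nonneg h4 ht1; simp only; linarith
      · have := mul_nonneg h4 ht2; simp only; linarith
      · have := mul_le_mul_of_nonneg_left ht3 h4; simp only; nlinarith
    refine ⟨S, hc.measurableSet, h1, ?_⟩
    have hsub : S ⊆ stdT := fun t ht => by
      obtain ⟨a, b, c⟩ := h1 t ht
      exact ⟨by linarith, by linarith, by linarith⟩
    have hv : volume.real stdT = 1 / 2 := by
      rw [← full_uR, measureReal_restrict_apply_univ]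
    have h2 : full.real S = (1 - 3 * δ) ^ 2 / 2 := by
      rw [measureReal_restrict_apply hc.measurableSet, Set.inter_eq_left.2 hsub, measureReal_def,
        hS, Measure.addHaar_image_homothety, ENNReal.toReal_mul, ← measureReal_def, hv,
        rank_pl, ENNReal.toReal_ofReal (abs_nonneg _), abs_of_nonneg (by positivity)]
      ring
    rw [measureReal_compl hc.measurableSet, full_uR, h2]
    nlinarith
  · refine ⟨∅, MeasurableSet.empty, by simp, ?_⟩
    rw [Set.compl_empty, full_uR]; linarith

lemma bpt_mem_hull (hs : IsTri s) {u : R2} (hu : u ∈ s) (hv : v ∈ s) (hw : w ∈ s) (huv : u ≠ v)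
    (huw : u ≠ w) (hvw : v ≠ w) {δ : ℝ} {X : Tri3} (h1 : ∀ y, |lam s y X.1 - lam s y u| ≤ δ)
    (h2 : ∀ y, |lam s y X.2.1 - lam s y v| ≤ δ) (h3 : ∀ y, |lam s y X.2.2 - lam s y w| ≤ δ) {t : R2}
    (ht : t ∈ stdT) (hδ : δ ≤ t.1 ∧ δ ≤ t.2 ∧ δ ≤ 1 - t.1 - t.2) : bpt t X ∈ hull s := by
  classical
  have hset : s = {u, v, w} := by
    symm
    refine Finset.eq_of_subset_of_card_le (fun y hy => ?_) ?_
    · simp only [Finset.mem_insert, Finset.mem_singleton] at hy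
      rcases hy with rfl | rfl | rfl <;> assumption
    · rw [hs.1, Finset.card_eq_three.2 ⟨u, v, w, huv, huw, hvw, rfl⟩]
  have hlam : ∀ y ∈ s, ∀ z ∈ s, lam s y z = if y = z then 1 else 0 := hs.isBary.delta
  obtain ⟨t1, t2, t3⟩ := ht
  have e : ∀ y, lam s y (bpt t X) =
      (1 - t.1 - t.2) * lam s y X.1 + t.1 * lam s y X.2.1 + t.2 * lam s y X.2.2 := by
    intro y; simp [lam, bpt_eq, pdot]; ring
  have t0 : 0 ≤ 1 - t.1 - t.2 := by linarith
  have low : ∀ y, (1 - t.1 - t.2) * (lam s y u - δ) + t.1 * (lam s y v - δ) +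
      t.2 * (lam s y w - δ) ≤ lam s y (bpt t X) := by
    intro y
    rw [e]
    have a1 := (abs_le.1 (h1 y)).1; have a2 := (abs_le.1 (h2 y)).1; have a3 := (abs_le.1 (h3 y)).1
    gcongr <;> linarith
  rw [hs.mem_hull_iff]
  intro y hy
  have l := low y
  rw [hlam y hy u hu, hlam y hy v hv, hlam y hy w hw] at l
  have hy' := hy
  rw [hset] at hy'
  simp only [Finset.mem_insert, Finset.mem_singleton] at hy'
  rcases hy' with rfl | rfl | rfl
  · rw [if_pos rfl, if_neg huv, if_neg huw] at l; nlinarith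
  · rw [if_neg huv.symm, if_pos rfl, if_neg hvw] at l; nlinarith
  · rw [if_neg huw.symm, if_neg hvw.symm, if_pos rfl] at l; nlinarith

lemma abs_pdet_sub_le {u : R2} {X : Tri3} {e h : ℝ} (h1 : ‖X.1 - u‖ ≤ e) (h2 : ‖X.2.1 - v‖ ≤ e)
    (h3 : ‖X.2.2 - w‖ ≤ e) (h4 : ‖X.2.2 - X.1‖ ≤ 3 * h) (h5 : ‖v - u‖ ≤ h) : |pdet (X.2.1 - X.1)
    (X.2.2 - X.1) - pdet (v - u) (w - u)| ≤ 16 * e * h := by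
  have he : 0 ≤ e := (norm_nonneg _).trans h1
  have hh : 0 ≤ h := (norm_nonneg _).trans h5
  have i : pdet (X.2.1 - X.1) (X.2.2 - X.1) - pdet (v - u) (w - u) =
      pdet ((X.2.1 - v) - (X.1 - u)) (X.2.2 - X.1) + pdet (v - u) ((X.2.2 - w) - (X.1 - u)) := by
    simp [pdet]; ring
  have n1 : ‖(X.2.1 - v) - (X.1 - u)‖ ≤ 2 * e := (norm_sub_le _ _).trans (by linarith)
  have n2 : ‖(X.2.2 - w) - (X.1 - u)‖ ≤ 2 * e := (norm_sub_le _ _).trans (by linarith)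
  rw [i]
  calc _ ≤ 2 * ‖(X.2.1 - v) - (X.1 - u)‖ * ‖X.2.2 - X.1‖ +
        2 * ‖v - u‖ * ‖(X.2.2 - w) - (X.1 - u)‖ :=
        (abs_add_le _ _).trans (add_le_add (abs_pdet_le _ _) (abs_pdet_le _ _))
    _ ≤ 2 * (2 * e) * (3 * h) + 2 * h * (2 * e) := by gcongr
    _ = _ := by ring

lemma Geom.wE_sub_qi2 (cv : Convex ℝ Ω) (g : Geom Ω Tr φ C) (hε : 0 < ε) (S : Samp Ω Tr C A a ε μ)
    (α : ℕ) (lf : LocInt Ω f) (hf : ∀ t ∈ Tr, ∃ c, ∀ᵐ p, p ∈ hull t → f p = c) : wE α (fun p => f p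
    - qi2 Tr μ f p) Ω ≤ ofReal (3 * C) * (ofReal (4 * (1152 * C ^ 3 * ε) ^ 2 * (C ^ 2 * (6 * C ^ 2)
    ^ α)) * ofReal (9 ^ (α + 3) * C)) * wE α f Ω := by
  classical
  choose! c hf using hf
  have hC := g.pos
  have eaff : ∀ t p, aff 0 (c t) p = c t := fun t p => by simp [aff, pdot]
  choose! m m0 m1 m2 m3 using fun t ht => g.inv_aff α (s := t) ht 0 (c t)
  refine g.wE_small (m := m) (by positivity) m0 (fun t ht => ?_) fun s hs M hM => ?_
  · refine (m3 t ht).trans (mul_le_mul' le_rfl (wE_mono_norm (mset_hull t) ?_))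
    filter_upwards [hf t ht] with p hp hpt
    rw [hp hpt, eaff]
  have hh := g.spos hs
  have ht := g.isTri s hs
  have hcM : ∀ t ∈ nbs Tr s, |c t| ≤ M := by
    intro t ht
    have htT := (mem_nbs.1 ht).1
    obtain ⟨p, hp⟩ := (g.isTri t htT).interior_nonempty
    have := m1 t htT p (interior_subset hp)
    rw [eaff] at this
    exact this.trans (hM t ht)
  have hM0 : 0 ≤ M := (m0 s hs).trans (hM s (g.self_mem_nbs hs))
  have hf' : ∀ᵐ p : R2, ∀ t ∈ Tr, p ∈ hull t → f p = c t := by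
    rw [eventually_all]; exact hf
  have hZ : ∀ᵐ p, p ∈ zone Ω C s → |f p| ≤ M ∧ (p ∈ hull s → f p = c s) := by
    filter_upwards [hf'] with p hp hpz
    obtain ⟨t, ht, hpt⟩ := mem_patch.1 (g.zone_sub hs hpz)
    refine ⟨?_, hp s hs⟩
    rw [hp t (mem_nbs.1 ht).1 hpt]
    exact hcM t ht
  have hcs := hcM s (g.self_mem_nbs hs)
  have hZc := cvx_zone cv hC.le s
  obtain ⟨Q, hQm, hQ, hQv⟩ := ex_inn_par (δ := 2 * C * ε) (by positivity)
  have key : ∀ u ∈ s, ∀ v ∈ s, ∀ w ∈ s,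
      |c s * pdet (v - u) (w - u) / 2 - avg2 (μ u) (μ v) (μ w) f| ≤ 64 * C * ε * dK s ^ 2 * M := by
    intro u hu v hv w hw
    have i1 := (S.probe s hs u hu).prob; have i2 := (S.probe s hs v hv).prob
    have i3 := (S.probe s hs w hw).prob
    have hi := Probe.intble_avg2 cv (S.probe s hs u hu) (S.probe s hs v hv)
      (S.probe s hs w hw) lf
    set P := (tm (μ u) (μ v) (μ w)).prod full with hP
    have hPu : P.real Set.univ = 1 / 2 := by
      rw [hP, ← Set.univ_prod_univ, measureReal_prod_prod, full_uR]; simp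
    have e1 : avg2 (μ u) (μ v) (μ w) f - c s * pdet (v - u) (w - u) / 2 =
        ∫ q, (f (bpt q.2 q.1) * pdet (q.1.2.1 - q.1.1) (q.1.2.2 - q.1.1) -
          c s * pdet (v - u) (w - u)) ∂P := by
      rw [integral_sub hi (integrable_const _), integral_const, hPu, smul_eq_mul]
      unfold avg2; ring
    have hind : Integrable (Qᶜ.indicator fun _ : R2 => (1 : ℝ)) full :=
      (integrable_const _).indicator hQm.compl
    have hlam : ∀ y z z', ‖z - z'‖ ≤ ε * dK s → |lam s y z - lam s y z'| ≤ 2 * C * ε := by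
      intro y z z' hz
      rw [lam_sub]
      refine (abs_pdot_le _ _).trans ?_
      calc _ ≤ 2 * (C / dK s) * (ε * dK s) := by have := g.grad s hs y; gcongr
        _ = _ := by field_simp
    have hbound : ∀ᵐ q ∂P, ‖f (bpt q.2 q.1) * pdet (q.1.2.1 - q.1.1) (q.1.2.2 - q.1.1) -
        c s * pdet (v - u) (w - u)‖ ≤ 16 * ε * dK s ^ 2 * M +
          4 * dK s ^ 2 * M * Qᶜ.indicator (fun _ => (1 : ℝ)) q.2 := by
      filter_upwards [(S.probe s hs u hu).ae_bpt_mem_of_cvx hZc (S.probe s hs v hv)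
        (S.probe s hs w hw) (S.near s hs u hu).zone (S.near s hs v hv).zone (S.near s hs w hw).zone
        ae_full hZ, ae_pl (ν := full)
          (ae_tm (S.close s hs u hu) (S.close s hs v hv) (S.close s hs w hw)),
        ae_pl (ν := full) (ae_tm (S.near s hs u hu).zone (S.near s hs v hv).zone
          (S.near s hs w hw).zone), ae_pr (μ := tm (μ u) (μ v) (μ w)) ae_full]
        with q q1 q2 q3 q4
      have d1 : ‖v - u‖ ≤ dK s :=
        norm_sub_le_diam (sub_hull hv) (sub_hull hu)
      have d2 : ‖w - u‖ ≤ dK s :=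
        norm_sub_le_diam (sub_hull hw) (sub_hull hu)
      have p1 := abs_pdet_sub_le q2.1 q2.2.1 q2.2.2 (dist_le_of_zone g.one_le q3.1 q3.2.2) d1
      have p2 : |f (bpt q.2 q.1) - c s| * |pdet (v - u) (w - u)| ≤
          4 * dK s ^ 2 * M * Qᶜ.indicator (fun _ => (1 : ℝ)) q.2 := by
        have hind0 : 0 ≤ Qᶜ.indicator (fun _ => (1 : ℝ)) q.2 :=
          Set.indicator_nonneg (fun _ _ => zero_le_one) _
        by_cases hd : pdet (v - u) (w - u) = 0
        · rw [hd, abs_zero, mul_zero]; positivity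
        by_cases hq : q.2 ∈ Q
        · have : bpt q.2 q.1 ∈ hull s := by
            refine bpt_mem_hull ht hu hv hw ?_ ?_ ?_ (fun y => hlam y _ _ q2.1)
              (fun y => hlam y _ _ q2.2.1) (fun y => hlam y _ _ q2.2.2) q4 (hQ _ hq) <;>
            · rintro rfl; exact hd (by simp [pdet] <;> ring)
          rw [q1.2 this, sub_self, abs_zero, zero_mul]; positivity
        · rw [indicator_of_mem (show q.2 ∈ Qᶜ from hq), mul_one]
          have a1 : |f (bpt q.2 q.1) - c s| ≤ 2 * M :=
            (abs_sub _ _).trans (by linarith [q1.1])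
          have a2 : |pdet (v - u) (w - u)| ≤ 2 * dK s * dK s :=
            (abs_pdet_le _ _).trans (by gcongr)
          calc _ ≤ 2 * M * (2 * dK s * dK s) := by gcongr
            _ = _ := by ring
      have e : f (bpt q.2 q.1) * pdet (q.1.2.1 - q.1.1) (q.1.2.2 - q.1.1) -
          c s * pdet (v - u) (w - u) =
          f (bpt q.2 q.1) * (pdet (q.1.2.1 - q.1.1) (q.1.2.2 - q.1.1) - pdet (v - u) (w - u)) +
            (f (bpt q.2 q.1) - c s) * pdet (v - u) (w - u) := by ring
      rw [norm_eq_abs, e]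
      refine (abs_add_le _ _).trans ?_
      rw [abs_mul, abs_mul (_ - _)]
      refine add_le_add ?_ p2
      calc _ ≤ M * (16 * (ε * dK s) * dK s) := mul_le_mul q1.1 p1 (abs_nonneg _) hM0
        _ = _ := by ring
    rw [abs_sub_comm, e1]
    have hi2 : Integrable (fun q : Tri3 × R2 => Qᶜ.indicator (fun _ => (1 : ℝ)) q.2) P :=
      hind.comp_snd _
    refine (norm_integral_le_of_norm_le ((integrable_const _).add (hi2.const_mul _)) hbound).trans ?_
    simp only [Pi.add_apply]
    rw [integral_add (integrable_const _) (hi2.const_mul _), integral_const, hPu, integral_const_mul,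
      integral_fun_snd (fun t => Qᶜ.indicator (fun _ => (1 : ℝ)) t), integral_indicator hQm.compl]
    simp only [smul_eq_mul, integral_const, mul_one, measureReal_restrict_apply_univ]
    have hC1 := g.one_le
    have : 0 ≤ dK s ^ 2 * M := by positivity
    simp only [probReal_univ, one_mul]
    calc _ ≤ 1 / 2 * (16 * ε * dK s ^ 2 * M) +
          4 * dK s ^ 2 * M * (6 * (2 * C * ε)) := by gcongr
      _ ≤ _ := by nlinarith [mul_nonneg this hε.le, mul_nonneg (mul_nonneg this hε.le)
                    (sub_nonneg.2 hC1)]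
  filter_upwards [hf s hs, g.pw_eq (loc2 fun u v w => avg2 (μ u) (μ v) (μ w) f)] with p h1 h2 hp
  rw [qi2, (h2 s hs hp).2, h1 hp]
  have e : c s - loc2 (fun u v w => avg2 (μ u) (μ v) (μ w) f) s p =
      loc2 (fun u v w => c s * pdet (v - u) (w - u) / 2 - avg2 (μ u) (μ v) (μ w) f) s p := by
    conv_lhs => rw [← ht.sum_pdet (c s)]
    simp only [loc2, sub_mul, sum_sub_distrib]
  rw [e]
  refine (g.abs_loc2_le hs key p).trans (le_of_eq ?_)
  field_simp; ring

end

lemma IsMeridianDomain.meas (h : IsMeridianDomain Ω) : MeasurableSet Ω := h.isOpen.measurableSet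

variable [D : Fact (IsMeridianDomain Ω)] [Fk : Fact (1 ≤ |k|)]

lemma k0 : (k : ℝ) ≠ 0 := by
  have := Fk.1
  rintro h; simp_all

/-! ### Multiplication of weak derivatives by smooth functions of `r` -/

/-- `a` is a smooth function of `r` on `Ω`, with derivative `b`. -/
structure RadMul (Ω : Set R2) (a b : R2 → ℝ) : Prop where
  isOpen : IsOpen Ω
  smooth : ContDiffOn ℝ ∞ a Ω
  smooth' : ContDiffOn ℝ ∞ b Ω
  deriv : ∀ p ∈ Ω, HasFDerivAt a (b p • ContinuousLinearMap.fst ℝ ℝ ℝ) p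
  meas : Measurable a
  meas' : Measurable b

section radial

variable {a b : R2 → ℝ}

lemma IsTest.mul (hΩ : IsOpen Ω) (ha : ContDiffOn ℝ ∞ a Ω) (hχ : IsTest Ω χ) : IsTest Ω fun p => a
    p * χ p := by
  refine ⟨contDiff_iff_contDiffAt.2 fun p => ?_, hχ.2.1.mul_left,
    (tsupport_mul_subset_right (f := a) (g := χ)).trans hχ.2.2⟩
  by_cases hp : p ∈ tsupport χ
  · exact (ha.contDiffAt (hΩ.mem_nhds (hχ.2.2 hp))).mul hχ.1.contDiffAt
  · refine (contDiffAt_const (c := (0 : ℝ))).congr_of_eventuallyEq ?_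
    filter_upwards [notMem_tsupport_iff_eventuallyEq.1 hp] with q hq
    rw [hq]; simp

lemma IsTest.intOn_mul_dr (hf : LocallyIntegrableOn f Ω) (hχ : IsTest Ω χ) : IntegrableOn
    (fun p => f p * dr χ p) Ω := (hχ.fd_test _).intOn_mul hf

lemma IsTest.intOn_mul_dz (hf : LocallyIntegrableOn f Ω) (hχ : IsTest Ω χ) : IntegrableOn
    (fun p => f p * dz χ p) Ω := (hχ.fd_test _).intOn_mul hf

lemma RadMul.fderiv (h : RadMul Ω a b) (hχ : IsTest Ω χ) (hp : p ∈ Ω) : dr (fun p => a p * χ p)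
    p = a p * dr χ p + b p * χ p ∧ dz (fun p => a p * χ p) p = a p * dz χ p := by
  have e := ((h.deriv p hp).mul (hχ.1.differentiable (by simp) p).hasFDerivAt).fderiv
  unfold dr dz
  change (_root_.fderiv ℝ (a * χ) p) (1, 0) = _ ∧ (_root_.fderiv ℝ (a * χ) p) (0, 1) = _
  rw [e]
  simp; ring

lemma RadMul.locInt [MeasurableSpace F]
    [BorelSpace F] [SecondCountableTopology F] (ha : ContinuousOn a Ω) (ma : Measurable a)
    (hΩ : IsOpen Ω) {f : R2 → F} (hf : LocInt Ω f) : LocInt Ω fun p => a p • f p :=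
  ⟨ma.smul hf.meas, hf.loc.continuousOn_smul hΩ.isLocallyClosed ha⟩

lemma WGrad.mul (h : WGrad Ω ψ G) (m : RadMul Ω a b) (lψ : LocInt Ω ψ) (lG : LocInt Ω G) : WGrad Ω
    (fun p => a p * ψ p) fun p => a p • G p + (b p * ψ p, 0) := by
  intro χ hχ
  have ta := hχ.mul m.isOpen m.smooth
  have tb := hχ.mul m.isOpen m.smooth'
  obtain ⟨h1, h2⟩ := h _ ta
  have hm := m.isOpen.measurableSet
  constructor
  · have e : ∀ p, (a p • G p + (b p * ψ p, 0)).1 * χ p = (G p).1 * (a p * χ p) + ψ p * (b p * χ p) := by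
      intro p; simp; ring
    simp only [e]
    rw [integral_add (ta.intOn_mul lG.fst.loc) (tb.intOn_mul lψ.loc), h1, neg_add_eq_sub,
      ← integral_sub (tb.intOn_mul lψ.loc) (ta.intOn_mul_dr lψ.loc),
      ← integral_neg]
    refine setIntegral_congr_fun hm fun p hp => ?_
    rw [(m.fderiv hχ hp).1]; ring
  · have e : ∀ p, (a p • G p + (b p * ψ p, 0)).2 * χ p = (G p).2 * (a p * χ p) := by
      intro p; simp; ring
    simp only [e]
    rw [h2]
    congr 1
    refine setIntegral_congr_fun hm fun p hp => ?_
    rw [(m.fderiv hχ hp).2]; ring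

lemma WRot.mul (h : WRot Ω ζ f) (m : RadMul Ω a b) (lζ : LocInt Ω ζ) (lf : LocInt Ω f) : WRot Ω
    (fun p => a p • ζ p) fun p => a p * f p + b p * (ζ p).2 := by
  intro χ hχ
  have ta := hχ.mul m.isOpen m.smooth
  have tb := hχ.mul m.isOpen m.smooth'
  have h1 := h _ ta
  have i : IntegrableOn (fun p => (ζ p).1 * dz (fun p => a p * χ p) p -
      (ζ p).2 * dr (fun p => a p * χ p) p) Ω :=
    (ta.intOn_mul_dz lζ.fst.loc).sub (ta.intOn_mul_dr lζ.snd.loc)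
  have e : ∀ p, (a p * f p + b p * (ζ p).2) * χ p = f p * (a p * χ p) + (ζ p).2 * (b p * χ p) := by
    intro p; ring
  simp only [e]
  rw [integral_add (ta.intOn_mul lf.loc) (tb.intOn_mul lζ.snd.loc), h1,
    ← integral_add i (tb.intOn_mul lζ.snd.loc)]
  refine setIntegral_congr_fun m.isOpen.measurableSet fun p hp => ?_
  rw [(m.fderiv hχ hp).1, (m.fderiv hχ hp).2]; simp; ring

lemma radMul_fst : RadMul Ω (fun p => p.1) fun _ => 1 where
  isOpen := D.1.isOpen
  smooth := contDiff_fst.contDiffOn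
  smooth' := contDiffOn_const
  deriv p _ := by simpa using hasFDerivAt_fst (𝕜 := ℝ) (p := p)
  meas := measurable_fst
  meas' := measurable_const

lemma radMul_inv : RadMul Ω (fun p => p.1⁻¹) fun p =>
    -(p.1 ^ 2)⁻¹ where
  isOpen := D.1.isOpen
  smooth := contDiff_fst.contDiffOn.inv fun p hp => (D.1.pos p hp).ne'
  smooth' := ((contDiff_fst.pow 2).contDiffOn.inv fun p hp => (pow_pos (D.1.pos p hp) 2).ne').neg
  deriv p hp := by
    have := (hasDerivAt_inv (D.1.pos p hp).ne').comp_hasFDerivAt p (hasFDerivAt_fst (𝕜 := ℝ) (p := p))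
    simpa only [Function.comp_def] using! this
  meas := measurable_fst.inv
  meas' := (measurable_fst.pow_const 2).inv.neg

end radial

/-! ### The changes of variables -/

/-- The field `((k u_r + u_θ)/r, k u_z/r)`. -/
def etaOf (k : ℤ) (U : R2 → Vec) (p : R2) : R2 :=
  (((k : ℝ) * U p 0 + U p 1) / p.1, (k : ℝ) * U p 2 / p.1)

/-- The field `(w_z, -w_r)`. -/
def zetaOf (W : R2 → Vec) (p : R2) : R2 := (W p 2, -W p 0)

/-- The function `(w_r - k w_θ)/r`. -/
def rotOf (k : ℤ) (W : R2 → Vec) (p : R2) : ℝ := (W p 0 - (k : ℝ) * W p 1) / p.1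

/-- The field `U` with `U_θ = u` and `etaOf k U = η`. -/
def mkB (k : ℤ) (u : R2 → ℝ) (η : R2 → R2) (p : R2) : Vec :=
  !₂[(p.1 * (η p).1 - u p) / k, u p, p.1 * (η p).2 / k]

/-- The field `W` with `zetaOf W = ζ` and `rotOf k W = s`. -/
def mkC (k : ℤ) (ζ : R2 → R2) (s : R2 → ℝ) (p : R2) : Vec :=
  !₂[-(ζ p).2, (-(ζ p).2 - p.1 * s p) / k, (ζ p).1]

section change

lemma etaOf_mkB (hp : 0 < p.1) (u : R2 → ℝ) (η : R2 → R2) : etaOf k (mkB k u η) p = η p := by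
  have := k0 (k := k)
  ext <;> simp [etaOf, mkB] <;> field_simp <;> ring

lemma mkB_etaOf (hp : 0 < p.1) (U : R2 → Vec) : mkB k (fun p => U p 1) (etaOf k U) p = U p := by
  have := k0 (k := k)
  ext i
  fin_cases i <;> simp [etaOf, mkB] <;> field_simp <;> ring

lemma rotOf_mkC (hp : 0 < p.1) (ζ : R2 → R2) (s : R2 → ℝ) : rotOf k (mkC k ζ s) p = s p := by
  have := k0 (k := k)
  simp [rotOf, mkC]; field_simp; ring

lemma mkC_rotOf (hp : 0 < p.1) (W : R2 → Vec) : mkC k (zetaOf W) (rotOf k W) p = W p := by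
  have := k0 (k := k)
  ext i
  fin_cases i <;> simp [zetaOf, rotOf, mkC] <;> field_simp <;> ring

end change

/-! ### The operators of the Fourier mode in the new variables -/

section transform

variable {u : R2 → ℝ} {U W : R2 → Vec}

lemma LocInt.prodMk {h : R2 → ℝ} (hf : LocInt Ω f) (hh : LocInt Ω h) : LocInt Ω fun p =>
    (f p, h p) := by
  have h1 : LocInt Ω fun p => f p • ((1, 0) : R2) + h p • ((0, 1) : R2) := by
    refine LocInt.add ⟨hf.meas.smul_const _, ?_⟩ ⟨hh.meas.smul_const _, ?_⟩
    · refine hf.loc.mono (hf.meas.smul_const _).aestronglyMeasurable (.of_forall fun p => ?_)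
      rw [norm_smul]; simp [norm_def]
    · refine hh.loc.mono (hh.meas.smul_const _).aestronglyMeasurable (.of_forall fun p => ?_)
      rw [norm_smul]; simp [norm_def]
  simpa using h1

lemma LocInt.neg [MeasurableSpace F]
    [BorelSpace F] [SecondCountableTopology F] {f : R2 → F} (hf : LocInt Ω f) : LocInt Ω fun p => -f
    p := by simpa using hf.const_smul (-1)

lemma LocInt.div_fst (hf : LocInt Ω f) : LocInt Ω fun p => f p / p.1 := by
  have m := radMul_inv (Ω := Ω)
  simpa [div_eq_inv_mul] using RadMul.locInt m.smooth.continuousOn m.meas D.1.isOpen hf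

lemma loc_etaOf (k : ℤ) (lU : ∀ i, LocInt Ω fun p => U p i) : LocInt Ω (etaOf k U) :=
  (((((lU 0).const_smul (k : ℝ))).add (lU 1)).div_fst).prodMk
    (((lU 2).const_smul (k : ℝ)).div_fst)

lemma loc_zetaOf (lW : ∀ i, LocInt Ω fun p => W p i) : LocInt Ω (zetaOf W) :=
  (lW 2).prodMk (lW 0).neg

lemma loc_rotOf (k : ℤ) (lW : ∀ i, LocInt Ω fun p => W p i) : LocInt Ω (rotOf k W) := by
  have := ((lW 0).add ((lW 1).const_smul (-(k : ℝ)))).div_fst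
  refine ⟨?_, ?_⟩
  · exact (show (fun p => (W p 0 + -(k : ℝ) • W p 1) / p.1) = rotOf k W by
      funext p; simp [rotOf, sub_eq_add_neg]) ▸ this.meas
  · exact (show (fun p => (W p 0 + -(k : ℝ) • W p 1) / p.1) = rotOf k W by
      funext p; simp [rotOf, sub_eq_add_neg]) ▸ this.loc

lemma isGrad_iff (lu : LocInt Ω u) (lU : ∀ i, LocInt Ω fun p => U p i) : IsGrad Ω k u U ↔ (∀ᵐ p, p ∈
    Ω → U p 1 = -(k * (u p / p.1))) ∧ WGrad Ω (fun p => u p / p.1) fun p => (k : ℝ)⁻¹ • etaOf k U p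
    := by
  have hk' := k0 (k := k)
  have hm := D.1.meas
  have lψ := lu.div_fst
  have lη := loc_etaOf k lU
  have e1 : IsGrad Ω k u U ↔ (∀ᵐ p, p ∈ Ω → U p 1 = -(k * (u p / p.1))) ∧
      WGrad Ω u fun p => (U p 0, U p 2) := by
    have c1 : ∀ p : R2, ∀ y : ℝ, -((k : ℝ) / p.1 * u p * y) = -(k * (u p / p.1)) * y := by
      intro p y; ring
    constructor
    · intro h
      refine ⟨ae_eq_of_test D.1.isOpen (lU 1).loc ?_ fun χ hχ => ?_, fun χ hχ => ?_⟩
      · simpa using (lψ.const_smul (-(k : ℝ))).loc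
      · simpa only [c1] using (h χ hχ).2.1
      · have := h χ hχ
        simp only [integral_neg] at this
        exact ⟨this.1, this.2.2⟩
    · rintro ⟨h1, h2⟩ χ hχ
      simp only [c1, integral_neg]
      refine ⟨(h2 χ hχ).1, ?_, (h2 χ hχ).2⟩
      refine setIntegral_congr_ae hm ?_
      filter_upwards [h1] with p hp hpΩ
      rw [hp hpΩ]
  rw [e1]
  refine and_congr_right fun h1 => ⟨fun h => ?_, fun h => ?_⟩
  · refine (h.mul (radMul_inv) lu ((lU 0).prodMk (lU 2))).congr hm
      (.of_forall fun p _ => by simp [div_eq_inv_mul]) ?_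
    filter_upwards [h1] with p hp hpΩ
    have := D.1.pos p hpΩ
    ext <;> simp [etaOf, hp hpΩ] <;> field_simp <;> ring
  · refine (h.mul (radMul_fst) lψ (lη.const_smul _)).congr hm ?_ ?_
    · refine .of_forall fun p hpΩ => ?_
      have := D.1.pos p hpΩ
      field_simp
    · filter_upwards [h1] with p hp hpΩ
      have := D.1.pos p hpΩ
      ext <;> simp [etaOf, hp hpΩ] <;> field_simp <;> ring

lemma isCurl_iff (lU : ∀ i, LocInt Ω fun p => U p i) (lW : ∀ i, LocInt Ω fun p => W p i) : IsCurl Ω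
    k U W ↔ WGrad Ω (fun p => U p 1) (fun p => zetaOf W p + (-1 : ℝ) • etaOf k U p) ∧ WRot Ω (etaOf
    k U) (rotOf k W) := by
  have hk' := k0 (k := k)
  have hm := D.1.meas
  have lη := loc_etaOf k lU
  have lζ := loc_zetaOf lW
  have ls := loc_rotOf k lW
  have e1 : IsCurl Ω k U W ↔ WGrad Ω (fun p => U p 1) (fun p => zetaOf W p + (-1 : ℝ) • etaOf k U p) ∧
      WRot Ω (fun p => (U p 0, U p 2)) fun p => -W p 1 := by
    unfold IsCurl WGrad WRot
    rw [← forall_and, ]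
    refine forall_congr' fun χ => ?_
    rw [← imp_and]
    refine imp_congr_right fun hχ => ?_
    have i : ∀ f : R2 → ℝ, LocInt Ω f → IntegrableOn (fun p => f p * χ p) Ω :=
      fun f hf => hχ.intOn_mul hf.loc
    have a1 : ∀ p, (zetaOf W p + (-1 : ℝ) • etaOf k U p).1 * χ p =
        W p 2 * χ p - (etaOf k U p).1 * χ p := by intro p; simp [zetaOf]; ring
    have a2 : ∀ p, (zetaOf W p + (-1 : ℝ) • etaOf k U p).2 * χ p =
        -(W p 0 * χ p + (etaOf k U p).2 * χ p) := by intro p; simp [zetaOf]; ring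
    have a3 : ∀ p, -((k : ℝ) / p.1 * U p 2 * χ p) + U p 1 * dz χ p =
        U p 1 * dz χ p - (etaOf k U p).2 * χ p := by intro p; simp [etaOf]; ring
    have a4 : ∀ p, -(U p 0 * dz χ p) + U p 2 * dr χ p = -(U p 0 * dz χ p - U p 2 * dr χ p) := by
      intro p; ring
    have a5 : ∀ p, ((k : ℝ) * U p 0 + U p 1) / p.1 * χ p - U p 1 * dr χ p =
        (etaOf k U p).1 * χ p - U p 1 * dr χ p := fun p => rfl
    have a6 : ∀ p, -W p 1 * χ p = -(W p 1 * χ p) := by intro p; ring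
    simp only [a1, a2, a3, a4, a5, a6, integral_neg]
    rw [integral_sub (i _ (lW 2)) (i _ lη.fst), integral_add (i _ (lW 0)) (i _ lη.snd),
      integral_sub (hχ.intOn_mul_dz (lU 1).loc) (i _ lη.snd),
      integral_sub (i _ lη.fst) (hχ.intOn_mul_dr (lU 1).loc)]
    constructor
    · rintro ⟨b1, b2, b3⟩
      exact ⟨⟨by linarith, by linarith⟩, by linarith⟩
    · rintro ⟨⟨b1, b2⟩, b3⟩
      exact ⟨by linarith, by linarith, by linarith⟩
  rw [e1]
  refine and_congr_right fun h1 => ?_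
  have l0 : LocInt Ω fun p => (U p 0, U p 2) := (lU 0).prodMk (lU 2)
  have lu : LocInt Ω fun p => (U p 1, (0 : ℝ)) := (lU 1).prodMk LocInt.zero
  have lt : LocInt Ω fun p => W p 0 + (etaOf k U p).2 := (lW 0).add lη.snd
  have r1 : WRot Ω (fun p => (U p 1, (0 : ℝ))) fun p => W p 0 + (etaOf k U p).2 := by
    intro χ hχ
    have := (h1 χ hχ).2
    have a2 : ∀ p, (zetaOf W p + (-1 : ℝ) • etaOf k U p).2 * χ p =
        -((W p 0 + (etaOf k U p).2) * χ p) := by intro p; simp [zetaOf]; ring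
    simp only [a2, integral_neg] at this
    simp only [zero_mul, sub_zero]
    linarith
  constructor
  · intro h
    have := ((h.const_smul (k : ℝ)).add r1 (l0.const_smul _) ((lW 1).neg.const_smul _) lu lt).mul
      (radMul_inv) ((l0.const_smul _).add lu) (((lW 1).neg.const_smul _).add lt)
    refine this.congr hm (.of_forall fun p hp => ?_) (.of_forall fun p hp => ?_)
    · have := D.1.pos p hp
      ext <;> simp [etaOf] <;> field_simp
    · have := D.1.pos p hp
      simp [rotOf, etaOf]; field_simp; ring
  · intro h
    have h2 := (h.mul (radMul_fst) lη ls).add (r1.const_smul (-1))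
      (RadMul.locInt (radMul_fst).smooth.continuousOn measurable_fst D.1.isOpen lη)
      ((RadMul.locInt (radMul_fst).smooth.continuousOn measurable_fst D.1.isOpen ls).add
        (lη.snd.const_smul 1)) (lu.const_smul _) (lt.const_smul _)
    refine (h2.const_smul (k : ℝ)⁻¹).congr hm (.of_forall fun p hp => ?_) (.of_forall fun p hp => ?_)
    · have := D.1.pos p hp
      ext <;> simp [etaOf] <;> field_simp <;> ring
    · have := D.1.pos p hp
      simp [rotOf, etaOf]; field_simp; ring

lemma isDiv_iff (lW : ∀ i, LocInt Ω fun p => W p i) (lg : LocInt Ω g) : IsDiv Ω k W g ↔ WRot Ω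
    (zetaOf W) fun p => rotOf k W p + (-1 : ℝ) • g p := by
  have ls := loc_rotOf k lW
  unfold IsDiv WRot
  refine forall_congr' fun χ => imp_congr_right fun hχ => ?_
  have i : ∀ f : R2 → ℝ, LocInt Ω f → IntegrableOn (fun p => f p * χ p) Ω :=
    fun f hf => hχ.intOn_mul hf.loc
  have i2 : IntegrableOn (fun p => (zetaOf W p).1 * dz χ p - (zetaOf W p).2 * dr χ p) Ω :=
    (hχ.intOn_mul_dz (loc_zetaOf lW).fst.loc).sub
      (hχ.intOn_mul_dr (loc_zetaOf lW).snd.loc)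
  have a1 : ∀ p, -(W p 0 * dr χ p) + (W p 0 - (k : ℝ) * W p 1) / p.1 * χ p - W p 2 * dz χ p =
      rotOf k W p * χ p - ((zetaOf W p).1 * dz χ p - (zetaOf W p).2 * dr χ p) := by
    intro p; simp [zetaOf, rotOf]; ring
  have a2 : ∀ p, (rotOf k W p + (-1 : ℝ) • g p) * χ p = rotOf k W p * χ p - g p * χ p := by
    intro p; simp; ring
  simp only [a1, a2]
  rw [integral_sub (i _ ls) i2, integral_sub (i _ ls) (i _ lg)]
  constructor <;> intro h <;> linarith

end transform

/-! ### Weighted `L²` spaces -/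

section lp

lemma ae_w_iff (α : ℤ) {P : R2 → Prop} : (∀ᵐ p ∂(wMeasure Ω α), P p) ↔ ∀ᵐ p, p ∈ Ω → P p := by
  have hm : Measurable fun p : R2 => ofReal (p.1 ^ α) := by fun_prop
  rw [wMeasure, ae_withDensity_iff hm, ae_restrict_iff' D.1.meas]
  refine Filter.eventually_congr (.of_forall fun p => forall_congr' fun hp => ?_)
  have : ofReal (p.1 ^ α) ≠ 0 := by simpa using zpow_pos (D.1.pos p hp) α
  simp [this]

lemma eLpNorm_sq {f : R2 → V} (hf : AEStronglyMeasurable f (wm Ω)) : eLpNorm f 2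
    (wm Ω) ^ 2 = wE 1 f Ω := by
  have h := eLpNorm_nnreal_pow_eq_lintegral (p := 2) (f := f) (μ := wm Ω) (by norm_num)
  norm_num at h
  rw [h]
  have hm : Measurable fun p : R2 => ofReal (p.1 ^ (1 : ℤ)) := by fun_prop
  have hc : wm Ω ≪ volume.restrict Ω := withDensity_absolutelyContinuous _ _
  have hc' : volume.restrict Ω ≪ wm Ω := by
    intro s hs
    have := (ae_w_iff 1).1 (measure_eq_zero_iff_ae_notMem.1 hs)
    exact measure_eq_zero_iff_ae_notMem.2 ((ae_restrict_iff' D.1.meas).2 this)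
  rw [wMeasure, lintegral_withDensity_eq_lintegral_mul₀ hm.aemeasurable
    ((hf.mono_ac hc').enorm.pow_const 2), wE]
  refine lintegral_congr fun p => ?_
  simp [mul_comm]

lemma enorm_sq_lp (u : Lp V 2 (wm Ω)) : ‖u‖ₑ ^ 2 = wE 1 u Ω := by
  rw [Lp.enorm_def, eLpNorm_sq (Lp.aestronglyMeasurable u)]

lemma ex_lp {F : R2 → V} (hF : AEStronglyMeasurable F (wm Ω)) (hE : wE 1 F Ω < ⊤) : ∃ u : Lp V 2 (wm
    Ω), ∀ᵐ p, p ∈ Ω → u p = F p := by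
  have : MemLp F 2 (wm Ω) := by
    refine ⟨hF, ?_⟩
    rw [← eLpNorm_sq hF] at hE
    by_contra h
    rw [not_lt, top_le_iff] at h
    rw [h] at hE
    simp at hE
  exact ⟨this.toLp F, (ae_w_iff 1).1 this.coeFn_toLp⟩

lemma wE_congr {f h : R2 → V} (e : ∀ᵐ p, p ∈ Ω → f p = h p) : wE α f Ω = wE α h Ω :=
  setLIntegral_congr_fun_ae D.1.meas (by filter_upwards [e] with p hp hpΩ; rw [hp hpΩ])

lemma norm_le_of_wE {u : Lp V 2 (wm Ω)} {v : Lp W 2 (wm Ω)} {K : ℝ} (hK : 0 ≤ K) (h : wE 1 u Ω ≤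
    ofReal (K ^ 2) * wE 1 v Ω) : ‖u‖ ≤ K * ‖v‖ := by
  rw [← enorm_sq_lp, ← enorm_sq_lp, ofReal_pow hK, ← mul_pow,
    ENNReal.pow_le_pow_left_iff two_ne_zero, ← ofReal_norm, ← ofReal_norm,
    ← ofReal_mul hK] at h
  exact (ENNReal.ofReal_le_ofReal_iff (by positivity)).1 h

lemma ex_clm (F : (R2 → V) → R2 → V) {K : ℝ} (hK : 0 ≤ K) (hm : ∀ u : Lp V 2 (wm Ω),
    AEStronglyMeasurable (F u) (wm Ω)) (hb : ∀ u : Lp V 2 (wm Ω), wE 1 (F u) Ω ≤ ofReal (K ^ 2) * wE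
    1 u Ω) (hlin : ∀ (u v : Lp V 2 (wm Ω)) (c d : ℝ), ∀ᵐ p, p ∈ Ω → F (c • u + d • v : Lp V 2 (wm
    Ω)) p = c • F u p + d • F v p) : ∃ M : Lp V 2 (wm Ω) →L[ℝ] Lp V 2 (wm Ω), ‖M‖ ≤ K ∧ ∀ u, ∀ᵐ p, p
    ∈ Ω → M u p = F u p := by
  have hfin : ∀ u : Lp V 2 (wm Ω), wE 1 (F u) Ω < ⊤ := fun u =>
    (hb u).trans_lt (ENNReal.mul_lt_top ENNReal.ofReal_lt_top
      (by rw [← enorm_sq_lp]; finiteness))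
  choose L hL using fun u => ex_lp (hm u) (hfin u)
  have ext : ∀ u v : Lp V 2 (wm Ω), (∀ᵐ p, p ∈ Ω → u p = v p) → u = v :=
    fun u v h => Lp.ext ((ae_w_iff 1).2 h)
  have comb : ∀ u v (c d : ℝ), L (c • u + d • v) = c • L u + d • L v := by
    intro u v c d
    refine ext _ _ ?_
    filter_upwards [hL (c • u + d • v), hL u, hL v, hlin u v c d,
      (ae_w_iff 1).1 (Lp.coeFn_add (c • L u) (d • L v)),
      (ae_w_iff 1).1 (Lp.coeFn_smul c (L u)),
      (ae_w_iff 1).1 (Lp.coeFn_smul d (L v))] with p h1 h2 h3 h4 h5 h6 h7 hp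
    rw [h1 hp, h4 hp, h5 hp, Pi.add_apply, h6 hp, h7 hp, Pi.smul_apply, Pi.smul_apply, h2 hp, h3 hp]
  let M : Lp V 2 (wm Ω) →ₗ[ℝ] Lp V 2 (wm Ω) :=
    { toFun := L
      map_add' := fun u v => by simpa using comb u v 1 1
      map_smul' := fun c u => by simpa using comb u u c 0 }
  have hMb : ∀ u, ‖M u‖ ≤ K * ‖u‖ := fun u => by
    refine norm_le_of_wE hK ?_
    change wE 1 (L u) Ω ≤ _
    rw [wE_congr (hL u)]
    exact hb u
  exact ⟨M.mkContinuous K hMb, M.mkContinuous_norm_le hK hMb, hL⟩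

lemma loc_of_wE [MeasurableSpace V] [BorelSpace V] [SecondCountableTopology V] {f : R2 → V}
    (hf : Measurable f) (h : wE α f Ω < ⊤) : LocInt Ω f := by
  refine ⟨hf, (locallyIntegrableOn_iff D.1.isOpen.isLocallyClosed).2 fun K hK hKc => ?_⟩
  rcases K.eq_empty_or_nonempty with rfl | hne
  · exact integrableOn_empty
  obtain ⟨q, hq, hmin⟩ := hKc.exists_isMinOn hne (continuous_fst.continuousOn (s := K))
  have hq0 := D.1.pos q (hK hq)
  have hfin : IsFiniteMeasure (volume.restrict K) := isFiniteMeasure_restrict.2 hKc.measure_lt_top.ne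
  refine MemLp.integrable (q := 2) (by norm_num) ⟨hf.aestronglyMeasurable, ?_⟩
  have e := eLpNorm_nnreal_pow_eq_lintegral (p := 2) (f := f) (μ := volume.restrict K) (by norm_num)
  norm_num at e
  have hlt : ∫⁻ p in K, ‖f p‖ₑ ^ 2 < ⊤ := by
    have h1 : (∫⁻ p in K, ‖f p‖ₑ ^ 2) * ofReal (q.1 ^ α) ≤ wE α f Ω := by
      rw [← lintegral_mul_const _ (hf.enorm.pow_const 2)]
      refine (lintegral_mono_ae ((ae_restrict_iff' hKc.measurableSet).2
        (.of_forall fun p hp => ?_))).trans (lintegral_mono_set hK)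
      have : q.1 ≤ p.1 := hmin hp
      exact mul_le_mul' le_rfl (ofReal_le_ofReal (by gcongr))
    have h2 : ofReal (q.1 ^ α) ≠ 0 := by simpa using pow_pos hq0 α
    by_contra hn
    rw [not_lt, top_le_iff] at hn
    rw [hn, ENNReal.top_mul h2] at h1
    exact absurd h (not_lt.2 h1)
  rw [← e] at hlt
  by_contra hn
  rw [not_lt, top_le_iff] at hn
  rw [hn] at hlt
  simp at hlt

lemma loc_lp (u : L2r Ω) : LocInt Ω u :=
  loc_of_wE (α := 1) (Lp.stronglyMeasurable u).measurable
    (by rw [← enorm_sq_lp]; finiteness)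

lemma loc_lpVec (U : L2rVec Ω) (i : Fin 3) : LocInt Ω fun p => U p i := by
  have hm : Measurable fun p => U p i :=
    ((EuclideanSpace.proj (𝕜 := ℝ) i).continuous.measurable).comp (Lp.stronglyMeasurable U).measurable
  refine loc_of_wE (α := 1) hm (lt_of_le_of_lt (wE_mono_norm (h := U) D.1.meas
    (.of_forall fun p _ => ?_)) (by rw [← enorm_sq_lp]; finiteness))
  exact PiLp.norm_apply_le (U p) i

lemma wE_le_mul {f : R2 → V} {h : R2 → W} {K : ℝ} (hK : 0 ≤ K)
    (e : ∀ p ∈ Ω, ‖f p‖ ≤ K * ‖h p‖) : wE α f Ω ≤ ofReal (K ^ 2) * wE α h Ω := by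
  unfold wE
  rw [← lintegral_const_mul' _ _ ofReal_ne_top]
  refine setLIntegral_mono' D.1.meas fun p hp => ?_
  rw [← mul_assoc]
  refine mul_le_mul' ?_ le_rfl
  have := enorm_sq_le (y := ‖h p‖) hK (by simpa using e p hp)
  simpa using this

lemma wE_le_scale {f : R2 → V} {h : R2 → W} {K : ℝ} (hK : 0 ≤ K)
    (e : ∀ p ∈ Ω, p.1 * ‖f p‖ ≤ K * ‖h p‖) : wE 3 f Ω ≤
    ofReal (K ^ 2) * wE 1 h Ω := by
  refine le_trans (le_of_eq ?_) (wE_le_mul (f := fun p => p.1 • f p) hK fun p hp => ?_)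
  · refine setLIntegral_congr_fun D.1.meas fun p hp => ?_
    have := (D.1.pos p hp).le
    rw [enorm_smul, mul_pow, ← ofReal_norm p.1, norm_of_nonneg this, ← ofReal_pow this,
      mul_comm (ofReal _), mul_assoc, ← ofReal_mul (by positivity)]
    ring_nf
  · rw [norm_smul, norm_of_nonneg (D.1.pos p hp).le]
    exact e p hp

lemma wE_le_add {U : R2 → V} {f : R2 → W} {X : Type*} [NormedAddCommGroup X] [NormedSpace ℝ X] {h :
    R2 → X} {K : ℝ} (hK : 0 ≤ K) (hf : AEMeasurable (fun p => ‖f p‖ₑ) (volume.restrict Ω)) (e : ∀ᵐ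
    p, p ∈ Ω → ‖U p‖ ≤ K * (‖f p‖ + p.1 * ‖h p‖)) : wE 1 U Ω ≤ ofReal (2 * K ^ 2) * (wE 1 f Ω + wE 3
    h Ω) := by
  have hm : AEMeasurable (fun p => ‖f p‖ₑ ^ 2 * ofReal (p.1 ^ 1)) (volume.restrict Ω) :=
    (hf.pow_const 2).mul (by fun_prop)
  unfold wE
  rw [← lintegral_add_left' hm, ← lintegral_const_mul' _ _ ofReal_ne_top]
  refine lintegral_mono_ae ((ae_restrict_iff' D.1.meas).2 ?_)
  filter_upwards [e] with p hp hpΩ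
  have h0 := (D.1.pos p hpΩ).le
  have h1 := hp hpΩ
  simp only [← ofReal_norm]
  rw [← ofReal_pow (norm_nonneg _), ← ofReal_pow (norm_nonneg _),
    ← ofReal_pow (norm_nonneg _), ← ofReal_mul (by positivity),
    ← ofReal_mul (by positivity), ← ofReal_mul (by positivity),
    ← ofReal_add (by positivity) (by positivity), ← ofReal_mul (by positivity)]
  refine ofReal_le_ofReal ?_
  have h2 : ‖U p‖ ^ 2 ≤ (K * (‖f p‖ + p.1 * ‖h p‖)) ^ 2 := by gcongr
  have h3 : (K * (‖f p‖ + p.1 * ‖h p‖)) ^ 2 ≤ 2 * K ^ 2 * (‖f p‖ ^ 2 + p.1 ^ 2 * ‖h p‖ ^ 2) := by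
    nlinarith [mul_nonneg (sq_nonneg K) (sq_nonneg (‖f p‖ - p.1 * ‖h p‖))]
  calc _ ≤ 2 * K ^ 2 * (‖f p‖ ^ 2 + p.1 ^ 2 * ‖h p‖ ^ 2) * p.1 ^ 1 := by
        have := h2.trans h3; gcongr
    _ = _ := by ring

end lp

/-! ### Linearity and uniform bounds of the quasi-interpolants -/

section qi

variable {μ : R2 → Measure R2}

lemma pw_comb {F G H : Finset R2 → R2 → E} {c d : ℝ} (h : ∀ s ∈ Tr, ∀ p, F s p = c • G s p + d • H s
    p) (p : R2) : pw Tr F p = c • pw Tr G p + d • pw Tr H p := by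
  unfold pw
  rw [smul_sum, smul_sum, ← sum_add_distrib]
  refine sum_congr rfl fun s hs => ?_
  by_cases hp : p ∈ interior (hull s)
  · simp only [indicator_of_mem hp, h s hs]
  · simp only [indicator_of_notMem hp, smul_zero, add_zero]

lemma qi0_comb (hμ : ∀ s ∈ Tr, ∀ v ∈ s, Probe Ω (μ v)) {F h : R2 → ℝ}
    (lf : LocInt Ω f) (lh : LocInt Ω h) {c d : ℝ} (e : ∀ᵐ p, p ∈ Ω → F p = c • f p + d • h p)
    (p : R2) : qi0 Tr μ F p = c • qi0 Tr μ f p + d • qi0 Tr μ h p := by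
  refine pw_comb (fun s hs p => ?_) p
  simp only [loc0, smul_eq_mul, mul_sum, ← sum_add_distrib]
  refine sum_congr rfl fun v hv => ?_
  have P := hμ s hs v hv
  rw [P.avg0_congr e, P.avg0_add D.1.cvx (lf.const_smul c) (lh.const_smul d), avg0_smul, avg0_smul]
  ring

lemma qi1_comb (hμ : ∀ s ∈ Tr, ∀ v ∈ s, Probe Ω (μ v)) {F f h : R2 → R2}
    (lf : LocInt Ω f) (lh : LocInt Ω h) {c d : ℝ} (e : ∀ᵐ p, p ∈ Ω → F p = c • f p + d • h p)
    (p : R2) : qi1 Tr μ F p = c • qi1 Tr μ f p + d • qi1 Tr μ h p := by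
  refine pw_comb (fun s hs p => ?_) p
  simp only [loc1, smul_sum, ← sum_add_distrib]
  refine sum_congr rfl fun v hv => sum_congr rfl fun w hw => ?_
  have P := hμ s hs v hv
  have Q := hμ s hs w hw
  rw [P.avg1_congr D.1.cvx Q e, P.avg1_add D.1.cvx Q (lf.const_smul c) (lh.const_smul d), avg1_smul,
    avg1_smul, smul_smul, smul_smul, ← add_smul]
  congr 1; ring

lemma qi2_comb (hμ : ∀ s ∈ Tr, ∀ v ∈ s, Probe Ω (μ v)) {F h : R2 → ℝ}
    (lf : LocInt Ω f) (lh : LocInt Ω h) {c d : ℝ} (e : ∀ᵐ p, p ∈ Ω → F p = c • f p + d • h p)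
    (p : R2) : qi2 Tr μ F p = c • qi2 Tr μ f p + d • qi2 Tr μ h p := by
  refine pw_comb (fun s hs p => ?_) p
  simp only [loc2, smul_eq_mul, mul_sum, ← sum_add_distrib]
  refine sum_congr rfl fun a ha => sum_congr rfl fun b hb =>
    sum_congr rfl fun x hx => ?_
  have P := hμ s hs a ha
  have Q := hμ s hs b hb
  have R := hμ s hs x hx
  rw [P.avg2_congr D.1.cvx Q R e, P.avg2_add D.1.cvx Q R (lf.const_smul c) (lh.const_smul d), avg2_smul,
    avg2_smul]
  ring

/-- The quasi-interpolants are bounded by `K` with weight `r ^ α`, and `κ`-close to the identity on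
finite element functions. -/
structure QIBound (Ω : Set R2) (Tr : Finset (Finset R2)) (μ : R2 → Measure R2)
    (α : ℕ) (K κ : ℝ) : Prop where
  b0 : ∀ f, Measurable f → wE α (qi0 Tr μ f) Ω ≤ ofReal K * wE α f Ω
  b1 : ∀ f, Measurable f → wE α (qi1 Tr μ f) Ω ≤ ofReal K * wE α f Ω
  b2 : ∀ f, Measurable f → wE α (qi2 Tr μ f) Ω ≤ ofReal K * wE α f Ω
  s0 : ∀ f G, LocInt Ω f → LocInt Ω G → WGrad Ω f G →
    (∀ t ∈ Tr, ∃ x c, ∀ᵐ p, p ∈ hull t → f p = aff x c p) →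
    wE α (fun p => f p - qi0 Tr μ f p) Ω ≤ ofReal κ * wE α f Ω
  s1 : ∀ η f, LocInt Ω η → LocInt Ω f → WRot Ω η f →
    (∀ t ∈ Tr, ∃ x b, ∀ᵐ p, p ∈ hull t → η p = ndf x b p) →
    wE α (fun p => η p - qi1 Tr μ η p) Ω ≤ ofReal κ * wE α η Ω
  s2 : ∀ f, LocInt Ω f → (∀ t ∈ Tr, ∃ c, ∀ᵐ p, p ∈ hull t → f p = c) →
    wE α (fun p => f p - qi2 Tr μ f p) Ω ≤ ofReal κ * wE α f Ω

lemma ex_qiBound (hb : IsBounded Ω) (C : ℝ) {κ : ℝ}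
    (hκ : 0 < κ) : ∃ K, 0 ≤ K ∧ ∀ (Tr : Finset (Finset R2)) (φ : R2 → R2 → ℝ), Geom Ω Tr φ C → ∃
    μ, (∀ s ∈ Tr, ∀ v ∈ s, Probe Ω (μ v)) ∧ QIBound Ω Tr μ 1 K κ ∧ QIBound Ω Tr μ 3 K κ := by
  by_cases hC : 1 ≤ C
  swap
  · exact ⟨0, le_rfl, fun Tr φ g => absurd g.one_le hC⟩
  have hC0 : 0 < C := by linarith
  set N : ℕ → ℝ := fun α => 3 * C * (4 * (1458 * C ^ 3) ^ 2 * (C ^ 2 * (6 * C ^ 2) ^ α) *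
    (9 ^ (α + 3) * C)) with hN
  have hN0 : ∀ α, 0 < N α := fun α => by simp only [hN]; positivity
  obtain ⟨ε, hε, hε1, hεN⟩ : ∃ ε : ℝ, 0 < ε ∧ ε ≤ 1 ∧ (N 1 + N 3) * ε ^ 2 ≤ κ := by
    have h0 : 0 < N 1 + N 3 := add_pos (hN0 1) (hN0 3)
    refine ⟨min 1 (κ / (N 1 + N 3)), by positivity, min_le_left _ _, ?_⟩
    have h1 : min 1 (κ / (N 1 + N 3)) ≤ 1 := min_le_left _ _
    have h2 : min 1 (κ / (N 1 + N 3)) ≤ κ / (N 1 + N 3) := min_le_right _ _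
    have h3 : 0 < min 1 (κ / (N 1 + N 3)) := by positivity
    calc _ ≤ (N 1 + N 3) * (κ / (N 1 + N 3)) := by
          refine mul_le_mul_of_nonneg_left ?_ h0.le
          nlinarith
      _ = κ := by field_simp
  obtain ⟨A, a, ha, hS⟩ := ex_samp D.1 hb C hε hε1
  set B : ℕ → ℝ := fun α => 3 * C * (4 * (18 * C ^ 2) ^ 2 * 324 * |9 * A / a ^ α|) with hB
  have hB0 : ∀ α, 0 ≤ B α := fun α => by simp only [hB]; positivity
  refine ⟨B 1 + B 3, add_nonneg (hB0 1) (hB0 3), fun Tr φ g => ?_⟩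
  obtain ⟨μ, S⟩ := hS Tr φ g
  have small : ∀ α, N α ≤ N 1 + N 3 → ∀ n : ℝ, 0 ≤ n → n ≤ 1458 * C ^ 3 →
      ofReal (3 * C) * (ofReal (4 * (n * ε) ^ 2 * (C ^ 2 * (6 * C ^ 2) ^ α)) *
        ofReal (9 ^ (α + 3) * C)) ≤ ofReal κ := by
    intro α hα n hn0 hn
    rw [← ofReal_mul (by positivity), ← ofReal_mul (by positivity)]
    refine ofReal_le_ofReal (le_trans ?_ hεN)
    calc _ ≤ 3 * C * (4 * (1458 * C ^ 3 * ε) ^ 2 * (C ^ 2 * (6 * C ^ 2) ^ α) *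
          (9 ^ (α + 3) * C)) := by gcongr
      _ = N α * ε ^ 2 := by simp only [hN]; ring
      _ ≤ _ := by gcongr
  have bdd : ∀ α, B α ≤ B 1 + B 3 → ∀ n : ℝ, 0 ≤ n → n ≤ 4 * (18 * C ^ 2) ^ 2 * 324 →
      ofReal (3 * C) * (ofReal n * ofReal (9 * A / a ^ α)) ≤
        ofReal (B 1 + B 3) := by
    intro α hα n hn0 hn
    calc _ ≤ ofReal (3 * C) * (ofReal n * ofReal |9 * A / a ^ α|) := by
          gcongr; exact le_abs_self _
      _ ≤ _ := by
          rw [← ofReal_mul hn0, ← ofReal_mul (by positivity)]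
          refine ofReal_le_ofReal (le_trans ?_ hα)
          simp only [hB]; gcongr
  have h2C : C ^ 2 ≤ C ^ 3 := by nlinarith [sq_nonneg C]
  have h1C : 1 ≤ C ^ 3 := one_le_pow₀ hC
  have h4C : C ^ 2 ≤ C ^ 4 := pow_le_pow_right₀ hC (by norm_num)
  have h5C : 1 ≤ C ^ 2 := one_le_pow₀ hC
  have build : ∀ α, N α ≤ N 1 + N 3 → B α ≤ B 1 + B 3 → QIBound Ω Tr μ α (B 1 + B 3) κ := by
    intro α hα hα'
    refine ⟨fun f hf => ?_, fun f hf => ?_, fun f hf => ?_, fun f G lf lG h hp => ?_,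
      fun η f lη lf h hp => ?_, fun f lf hp => ?_⟩
    · exact (g.wE_qi0_le D.1.cvx ha S.near α hf).trans
        (mul_le_mul' (bdd α hα' _ (by norm_num) (by nlinarith)) le_rfl)
    · exact (g.wE_qi1_le D.1.cvx ha S.near α hf).trans
        (mul_le_mul' (bdd α hα' _ (by positivity) (by nlinarith)) le_rfl)
    · exact (g.wE_qi2_le D.1.cvx ha S.near α hf).trans
        (mul_le_mul' (bdd α hα' _ (by positivity) le_rfl) le_rfl)
    · exact (g.wE_sub_qi0 D.1.isOpen D.1.cvx hε hε1 S α lf lG h hp).trans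
        (mul_le_mul' (small α hα _ (by positivity) (by nlinarith)) le_rfl)
    · exact (g.wE_sub_qi1 D.1.isOpen D.1.cvx hε hε1 S α lη lf h hp).trans
        (mul_le_mul' (small α hα _ (by positivity) le_rfl) le_rfl)
    · exact (g.wE_sub_qi2 D.1.cvx hε S α lf hp).trans
        (mul_le_mul' (small α hα _ (by positivity) (by nlinarith)) le_rfl)
  exact ⟨μ, S.probe, build 1 (by linarith [hN0 3]) (by linarith [hB0 3]),
    build 3 (by linarith [hN0 1]) (by linarith [hB0 1])⟩

end qi

/-! ### Projections from operators close to the identity -/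

section packs

/-- `P = (M|_V)⁻¹ M` is a projection onto `V`. -/
structure InvProj (V : Submodule ℝ E) (M P : E →L[ℝ] E) : Prop where
  mem : ∀ u, M u ∈ V
  proj : IsProjOnto P (V : Set E)
  map : ∀ u, M (P u) = M u
  inj : ∀ v ∈ V, M v = 0 → v = 0
  surj : ∀ v ∈ V, ∃ v' ∈ V, M v' = v

lemma InvProj.comm {V : Submodule ℝ E} {W : Submodule ℝ F} {M P : E →L[ℝ] E} {N Q : F →L[ℝ] F}
    (hP : InvProj V M P) (hQ : InvProj W N Q) {R : Submodule ℝ (E × F)}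
    (hV : ∀ v ∈ V, ∃ w, (v, w) ∈ R) (h0 : ∀ w, (0, w) ∈ R → w = 0)
    (hR : ∀ x ∈ R, (M x.1, N x.2) ∈ R) {u : E} {w : F} (h : (u, w) ∈ R) : (P u, Q w) ∈ R := by
  obtain ⟨a, ha, e⟩ := hP.surj (P u) (hP.proj.1 u)
  obtain ⟨b, hb⟩ := hV a ha
  have h1 : (P u, N b) ∈ R := e ▸ hR _ hb
  have h2 := R.sub_mem (hR _ h1) (hR _ h)
  simp only [hP.map, Prod.mk_sub_mk, sub_self] at h2
  have h3 : N (N b) = N w := sub_eq_zero.1 (h0 _ h2)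
  have h4 := hQ.inj (N b - Q w) (W.sub_mem (hQ.mem b) (hQ.proj.1 w)) (by
    rw [map_sub, hQ.map, h3, sub_self])
  rwa [sub_eq_zero.1 h4] at h1

end packs

section ops

lemma lp_ae_comb (u v : Lp V 2 (wm Ω))
    (c d : ℝ) : ∀ᵐ p, p ∈ Ω → (c • u + d • v : Lp V 2 (wm Ω)) p = c • u p + d • v p := by
  filter_upwards [(ae_w_iff 1).1 (Lp.coeFn_add (c • u) (d • v)),
    (ae_w_iff 1).1 (Lp.coeFn_smul c u),
    (ae_w_iff 1).1 (Lp.coeFn_smul d v)] with p h5 h6 h7 hp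
  rw [h5 hp, Pi.add_apply, h6 hp, h7 hp, Pi.smul_apply, Pi.smul_apply]

lemma ex_lp_of_bd (hb : IsBounded Ω) {F : R2 → V} (hF : AEStronglyMeasurable F (wm Ω)) (hB : ∃ B, ∀
    p ∈ Ω, ‖F p‖ ≤ B) : ∃ u : Lp V 2 (wm Ω), ∀ᵐ p, p ∈ Ω → u p = F p := by
  obtain ⟨B, hB⟩ := hB
  obtain ⟨R, hR⟩ := hb.exists_norm_le
  refine ex_lp hF (lt_of_le_of_lt (setLIntegral_mono' D.1.meas
    (g := fun _ => ofReal B ^ 2 * ofReal R) fun p hp => ?_) ?_)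
  · rw [pow_one]
    refine mul_le_mul' (pow_le_pow_left' ?_ 2) (ofReal_le_ofReal ?_)
    · rw [← ofReal_norm]; exact ofReal_le_ofReal (hB p hp)
    · exact (le_abs_self _).trans ((norm_fst_le p).trans (hR p hp))
  · rw [setLIntegral_const]
    exact ENNReal.mul_lt_top (by finiteness) hb.measure_lt_top

/-- Combinations of the functions `e i` on every triangle. -/
def pwSub (Ω : Set R2) (Tr : Finset (Finset R2)) {n : ℕ} (e : Fin n → R2 → V) :
    Submodule ℝ (Lp V 2 (wm Ω)) where
  carrier := {u | ∀ s ∈ Tr, ∃ a : Fin n → ℝ, ∀ᵐ p ∂(wm Ω), p ∈ hull s →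
    u p = ∑ i, a i • e i p}
  zero_mem' s _ := ⟨0, by
    filter_upwards [Lp.coeFn_zero V 2 (wm Ω)] with p hp _
    rw [hp]; simp⟩
  add_mem' := by
    intro u v hu hv s hs
    obtain ⟨a, ha⟩ := hu s hs
    obtain ⟨b, hb⟩ := hv s hs
    refine ⟨a + b, ?_⟩
    filter_upwards [ha, hb, Lp.coeFn_add u v] with p h1 h2 h3 hp
    rw [h3, Pi.add_apply, h1 hp, h2 hp]
    simp [add_smul, sum_add_distrib]
  smul_mem' := by
    intro c u hu s hs
    obtain ⟨a, ha⟩ := hu s hs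
    refine ⟨c • a, ?_⟩
    filter_upwards [ha, Lp.coeFn_smul c u] with p h1 h3 hp
    rw [h3, Pi.smul_apply, h1 hp]
    simp [mul_smul, smul_sum]

lemma lp_ae_sum {ι : Type*} (S : Finset ι) (c : ι → ℝ) (f : ι → Lp V 2 (wm Ω)) : ∀ᵐ p, p ∈ Ω → (∑ i
    ∈ S, c i • f i : Lp V 2 (wm Ω)) p = ∑ i ∈ S, c i • f i p := by
  classical
  induction S using Finset.induction_on with
  | empty => simpa using (ae_w_iff 1).1 (Lp.coeFn_zero V 2 (wm Ω))
  | insert i S hi ih =>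
    rw [Finset.sum_insert hi]
    filter_upwards [ih, lp_ae_comb (f i) (∑ i ∈ S, c i • f i) (c i) 1] with p h1 h2 hp
    rw [one_smul] at h2
    rw [h2 hp, Finset.sum_insert hi, h1 hp, one_smul]

lemma pwSub_fin (hb : IsBounded Ω) (g : Geom Ω Tr φ C) {n : ℕ} {e : Fin n → R2 → V} (he : ∀ i,
    Continuous (e i)) : FiniteDimensional ℝ (pwSub Ω Tr e) := by
  classical
  have hex : ∀ x : Finset R2 × Fin n, ∃ u : Lp V 2 (wm Ω), ∀ᵐ p, p ∈ Ω →
      u p = (interior (hull x.1)).indicator (e x.2) p := fun x => by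
    refine ex_lp_of_bd hb
      ((he x.2).aestronglyMeasurable.indicator isOpen_interior.measurableSet) ?_
    obtain ⟨B, hB⟩ := (cpt_hull x.1).exists_bound_of_continuousOn (he x.2).continuousOn
    refine ⟨max B 0, fun p _ => ?_⟩
    by_cases hp : p ∈ interior (hull x.1)
    · rw [indicator_of_mem hp]
      exact (hB p (interior_subset hp)).trans (le_max_left _ _)
    · rw [indicator_of_notMem hp, norm_zero]
      exact le_max_right _ _
  choose b hb using hex
  have hle : pwSub Ω Tr e ≤ Submodule.span ℝ
      ((Tr ×ˢ (Finset.univ : Finset (Fin n))).image b : Set (Lp V 2 (wm Ω))) := by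
    intro u hu
    choose! a ha using hu
    have key : u = ∑ x ∈ Tr ×ˢ (Finset.univ : Finset (Fin n)), a x.1 x.2 • b x := by
      refine Lp.ext ((ae_w_iff 1).2 ?_)
      have h1 : ∀ᵐ p : R2, ∀ s ∈ Tr, p ∈ Ω → p ∈ hull s → u p = ∑ i, a s i • e i p := by
        rw [eventually_all]
        exact fun s hs => (ae_w_iff 1).1 (ha s hs)
      have h2 : ∀ᵐ p : R2, ∀ x ∈ Tr ×ˢ (Finset.univ : Finset (Fin n)), p ∈ Ω →
          b x p = (interior (hull x.1)).indicator (e x.2) p := by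
        rw [eventually_all]
        exact fun x _ => hb x
      filter_upwards [h1, h2, lp_ae_sum (Tr ×ˢ (Finset.univ : Finset (Fin n)))
        (fun x => a x.1 x.2) b, g.ae_tri] with p h1 h2 h3 h4 hp
      obtain ⟨s, hs, hps, huniq⟩ := h4 hp
      rw [h3 hp, Finset.sum_product, Finset.sum_eq_single_of_mem s hs, h1 s hs hp
        (interior_subset hps)]
      · refine sum_congr rfl fun i _ => ?_
        rw [h2 (s, i) (by simp [hs]) hp, indicator_of_mem hps]
      · intro t ht hts
        refine Finset.sum_eq_zero fun i _ => ?_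
        rw [h2 (t, i) (by simp [ht]) hp, indicator_of_notMem, smul_zero]
        exact fun h => hts (huniq t ht (interior_subset h))
    rw [key]
    exact Submodule.sum_mem _ fun x hx => Submodule.smul_mem _ _
      (Submodule.subset_span (Finset.mem_coe.2 (Finset.mem_image_of_mem b hx)))
  have := FiniteDimensional.span_finset ℝ ((Tr ×ˢ (Finset.univ : Finset (Fin n))).image b)
  exact Submodule.finiteDimensional_of_le hle

lemma ex_invProj (F : (R2 → V) → R2 → V) {K : ℝ} (hK : 0 ≤ K) (hm : ∀ u : Lp V 2 (wm Ω),
    AEStronglyMeasurable (F u) (wm Ω)) (hb : ∀ u : Lp V 2 (wm Ω), wE 1 (F u) Ω ≤ ofReal K * wE 1 u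
    Ω) (hlin : ∀ (u v : Lp V 2 (wm Ω)) (c d : ℝ), ∀ᵐ p, p ∈ Ω → F (c • u + d • v : Lp V 2 (wm Ω)) p
    = c • F u p + d • F v p) (S : Submodule ℝ (Lp V 2 (wm Ω))) (hS : FiniteDimensional ℝ S) (hmem :
    ∀ u v : Lp V 2 (wm Ω), (∀ᵐ p, p ∈ Ω → v p = F u p) → v ∈ S) (hnear : ∀ u ∈ S, wE 1 (fun p => u p
    - F u p) Ω ≤ ofReal (1 / 4) * wE 1 u Ω) : ∃ M P : Lp V 2 (wm Ω) →L[ℝ] Lp V 2 (wm Ω), InvProj S M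
    P ∧ ‖P‖ ≤ 2 * Real.sqrt K ∧ ∀ u, ∀ᵐ p, p ∈ Ω → M u p = F u p := by
  obtain ⟨M, hMK, hM⟩ := ex_clm F (Real.sqrt_nonneg K) hm
    (fun u => by rw [Real.sq_sqrt hK]; exact hb u) hlin
  have hMS : ∀ u, M u ∈ S := fun u => hmem u _ (hM u)
  have hfin : FiniteDimensional ℝ (LinearMap.range M.toLinearMap) := by
    refine Submodule.finiteDimensional_of_le (S₂ := S) ?_
    rintro _ ⟨u, rfl⟩
    exact hMS u
  have hn : ∀ v ∈ S, ‖M.toLinearMap v - v‖ ≤ (1 / 2) * ‖v‖ := by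
    intro v hv
    rw [norm_sub_rev]
    refine norm_le_of_wE (by norm_num) ?_
    have e : ∀ᵐ p, p ∈ Ω → (v - M v : Lp V 2 (wm Ω)) p = v p - F v p := by
      filter_upwards [(ae_w_iff 1).1 (Lp.coeFn_sub v (M v)), hM v] with p a1 a2 hp
      rw [a1 hp, Pi.sub_apply, a2 hp]
    refine (wE_congr e).trans_le ((hnear v hv).trans_eq ?_)
    norm_num
  obtain ⟨P, h1, h2, h3, h4, h5⟩ := ex_proj_of_near_id S M.toLinearMap hfin hMS
    (C := Real.sqrt K) (fun u => M.le_of_opNorm_le hMK u) hn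
  refine ⟨M, P, ⟨hMS, h1, h3, h4, h5⟩, ?_, hM⟩
  rwa [max_eq_left (Real.sqrt_nonneg K)] at h2

end ops

/-! ### The relations defined by `grad`, `curl` and `div` -/

section relations

lemma ex_subm {P : E → Prop} (h0 : P 0)
    (h : ∀ x y (c d : ℝ), P x → P y → P (c • x + d • y)) : ∃ R : Submodule ℝ E, ∀ x, x ∈ R ↔ P x :=
  ⟨{ carrier := {x | P x}
     zero_mem' := h0
     add_mem' := fun {x y} hx hy => by simpa using h x y 1 1 hx hy
     smul_mem' := fun c x hx => by simpa using h x x c 0 hx hx }, fun _ => Iff.rfl⟩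

lemma lpVec_eq_zero {U : L2rVec Ω} (h : ∀ i χ, IsTest Ω χ → ∫ p in Ω, U p i * χ p = 0) : U = 0 := by
  have h1 : ∀ i, ∀ᵐ p, p ∈ Ω → U p i = 0 := fun i =>
    ae_eq_of_test D.1.isOpen (loc_lpVec U i).loc LocInt.zero.loc fun χ hχ => by
      simpa using h i χ hχ
  refine Lp.ext ((ae_w_iff 1).2 ?_)
  filter_upwards [ae_all_iff.2 h1, (ae_w_iff 1).1
    (Lp.coeFn_zero Vec 2 (wm Ω))] with p h1 h2 hp
  rw [h2 hp]
  ext i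
  exact h1 i hp

lemma lp_zero_ae {u : Lp V 2 (wm Ω)} (hu : u = 0) : ∀ᵐ p : R2 ∂(volume.restrict Ω), u p = 0 := by
  subst hu
  exact (ae_restrict_iff' D.1.meas).2
    ((ae_w_iff 1).1 (Lp.coeFn_zero V 2 (wm Ω)))

lemma isGrad_zero_iff {u : L2r Ω} (hu : u = 0)
    {U : L2rVec Ω} : IsGrad Ω k u U ↔ ∀ i χ, IsTest Ω χ → ∫ p in Ω, U p i * χ p = 0 := by
  have e : ∀ f : R2 → ℝ, ∫ p in Ω, -(u p * f p) = 0 := fun f =>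
    integral_eq_zero_of_ae (by filter_upwards [lp_zero_ae hu] with p hp; simp [hp])
  have e' : ∀ χ : R2 → ℝ, ∫ p in Ω, -((k : ℝ) / p.1 * u p * χ p) = 0 := fun χ =>
    integral_eq_zero_of_ae (by filter_upwards [lp_zero_ae hu] with p hp; simp [hp])
  simp only [IsGrad, e, e', Fin.forall_fin_succ, IsEmpty.forall_iff, and_true, ← forall_and]
  rfl

lemma isCurl_zero_iff {u : L2rVec Ω} (hu : u = 0)
    {W : L2rVec Ω} : IsCurl Ω k u W ↔ ∀ i χ, IsTest Ω χ → ∫ p in Ω, W p i * χ p = 0 := by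
  have e : ∀ χ : R2 → ℝ, (∫ p in Ω, (-((k : ℝ) / p.1 * u p 2 * χ p) +
      u p 1 * dz χ p)) = 0 ∧
      (∫ p in Ω, (-(u p 0 * dz χ p) + u p 2 * dr χ p)) = 0 ∧
      (∫ p in Ω, (((k : ℝ) * u p 0 + u p 1) / p.1 * χ p -
        u p 1 * dr χ p)) = 0 := fun χ => by
    refine ⟨?_, ?_, ?_⟩ <;> refine integral_eq_zero_of_ae ?_ <;>
      filter_upwards [lp_zero_ae hu] with p hp <;> simp [hp]
  simp only [IsCurl, (e _).1, (e _).2.1, (e _).2.2, Fin.forall_fin_succ, IsEmpty.forall_iff, and_true,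
    ← forall_and]
  rfl

lemma isDiv_zero_iff {u : L2rVec Ω} (hu : u = 0)
    {g : L2r Ω} : IsDiv Ω k u g ↔ ∀ χ, IsTest Ω χ → ∫ p in Ω, g p * χ p = 0 := by
  have e : ∀ χ : R2 → ℝ, ∫ p in Ω, (-(u p 0 * dr χ p) + (u p 0 -
      (k : ℝ) * u p 1) / p.1 * χ p - u p 2 * dz χ p) = 0 := fun χ => by
    refine integral_eq_zero_of_ae ?_
    filter_upwards [lp_zero_ae hu] with p hp
    simp [hp]
  simp only [IsDiv, e]

lemma ex_gradRel : ∃ R : Submodule ℝ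
    (L2r Ω × L2rVec Ω), (∀ x, x ∈ R ↔ IsGrad Ω k x.1 x.2) ∧ ∀ w, (0, w) ∈ R → w = 0 := by
  refine (ex_subm (P := fun x : L2r Ω × L2rVec Ω => IsGrad Ω k x.1 x.2) ?_ ?_).imp
    fun R hR => ⟨hR, fun w hw =>
      lpVec_eq_zero ((isGrad_zero_iff rfl).1 ((hR _).1 hw))⟩
  · refine (isGrad_zero_iff rfl).2 fun i χ _ => integral_eq_zero_of_ae ?_
    filter_upwards [lp_zero_ae (V := Vec) rfl] with p hp
    change (0 : L2rVec Ω) p i * χ p = 0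
    rw [hp]; simp
  · rintro ⟨u, G⟩ ⟨v, H⟩ c d h1 h2
    change IsGrad Ω k (c • u + d • v : L2r Ω) (c • G + d • H : L2rVec Ω)
    have lu := fun u : L2r Ω => loc_lp u
    have lU := fun u : L2rVec Ω => loc_lpVec u
    have lη := fun u : L2rVec Ω => (loc_etaOf k (lU u)).const_smul (k : ℝ)⁻¹
    obtain ⟨a1, b1⟩ := (isGrad_iff (lu u) (lU G)).1 h1
    obtain ⟨a2, b2⟩ := (isGrad_iff (lu v) (lU H)).1 h2
    refine (isGrad_iff (lu _) (lU _)).2 ⟨?_, ((b1.const_smul c).add (b2.const_smul d)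
      (((lu u).div_fst).const_smul c) ((lη G).const_smul c)
      (((lu v).div_fst).const_smul d) ((lη H).const_smul d)).congr D.1.meas ?_ ?_⟩
    · filter_upwards [a1, a2, lp_ae_comb u v c d, lp_ae_comb G H c d]
        with p h1 h2 h3 h4 hp
      rw [h3 hp, h4 hp]
      simp [h1 hp, h2 hp]; ring
    · filter_upwards [lp_ae_comb u v c d] with p h3 hp
      rw [h3 hp]; simp; ring
    · filter_upwards [lp_ae_comb G H c d] with p h3 hp
      unfold etaOf
      rw [h3 hp]; ext <;> simp <;> ring

lemma ex_curlRel : ∃ R : Submodule ℝ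
    (L2rVec Ω × L2rVec Ω), (∀ x, x ∈ R ↔ IsCurl Ω k x.1 x.2) ∧ ∀ w, (0, w) ∈ R → w = 0 := by
  refine (ex_subm (P := fun x : L2rVec Ω × L2rVec Ω => IsCurl Ω k x.1 x.2) ?_ ?_).imp
    fun R hR => ⟨hR, fun w hw =>
      lpVec_eq_zero ((isCurl_zero_iff rfl).1 ((hR _).1 hw))⟩
  · refine (isCurl_zero_iff rfl).2 fun i χ _ => integral_eq_zero_of_ae ?_
    filter_upwards [lp_zero_ae (V := Vec) rfl] with p hp
    change (0 : L2rVec Ω) p i * χ p = 0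
    rw [hp]; simp
  · rintro ⟨u, G⟩ ⟨v, H⟩ c d h1 h2
    change IsCurl Ω k (c • u + d • v : L2rVec Ω) (c • G + d • H : L2rVec Ω)
    have lU := fun u : L2rVec Ω => loc_lpVec u
    have lη := fun u : L2rVec Ω => loc_etaOf k (lU u)
    have lζ := fun u : L2rVec Ω => loc_zetaOf (lU u)
    have ls := fun u : L2rVec Ω => loc_rotOf k (lU u)
    have ld := fun u v : L2rVec Ω => (lζ u).add ((lη v).const_smul (-1))
    obtain ⟨a1, b1⟩ := (isCurl_iff (lU u) (lU G)).1 h1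
    obtain ⟨a2, b2⟩ := (isCurl_iff (lU v) (lU H)).1 h2
    refine (isCurl_iff (lU _) (lU _)).2 ⟨((a1.const_smul c).add (a2.const_smul d)
      ((lU u 1).const_smul c) ((ld G u).const_smul c) ((lU v 1).const_smul d)
      ((ld H v).const_smul d)).congr D.1.meas ?_ ?_,
      ((b1.const_smul c).add (b2.const_smul d) ((lη u).const_smul c) ((ls G).const_smul c)
      ((lη v).const_smul d) ((ls H).const_smul d)).congr D.1.meas ?_ ?_⟩
    · filter_upwards [lp_ae_comb u v c d] with p h3 hp
      rw [h3 hp]; simp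
    · filter_upwards [lp_ae_comb u v c d, lp_ae_comb G H c d] with p h3 h4 hp
      unfold etaOf zetaOf
      rw [h3 hp, h4 hp]; ext <;> simp <;> ring
    · filter_upwards [lp_ae_comb u v c d] with p h3 hp
      unfold etaOf
      rw [h3 hp]; ext <;> simp <;> ring
    · filter_upwards [lp_ae_comb G H c d] with p h3 hp
      unfold rotOf
      rw [h3 hp]; simp; ring

lemma ex_divRel : ∃ R : Submodule ℝ
    (L2rVec Ω × L2r Ω), (∀ x, x ∈ R ↔ IsDiv Ω k x.1 x.2) ∧ ∀ w, (0, w) ∈ R → w = 0 := by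
  refine (ex_subm (P := fun x : L2rVec Ω × L2r Ω => IsDiv Ω k x.1 x.2) ?_ ?_).imp
    fun R hR => ⟨hR, fun w hw => Lp.ext ((ae_w_iff 1).2 ?_)⟩
  · refine (isDiv_zero_iff rfl).2 fun χ _ => integral_eq_zero_of_ae ?_
    filter_upwards [lp_zero_ae (V := ℝ) rfl] with p hp
    change (0 : L2r Ω) p * χ p = 0
    rw [hp]; simp
  · rintro ⟨u, G⟩ ⟨v, H⟩ c d h1 h2
    change IsDiv Ω k (c • u + d • v : L2rVec Ω) (c • G + d • H : L2r Ω)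
    have lu := fun u : L2r Ω => loc_lp u
    have lU := fun u : L2rVec Ω => loc_lpVec u
    have lζ := fun u : L2rVec Ω => loc_zetaOf (lU u)
    have ls := fun u : L2rVec Ω => loc_rotOf k (lU u)
    have ld := fun (u : L2rVec Ω) (v : L2r Ω) => (ls u).add ((lu v).const_smul (-1))
    have b1 := (isDiv_iff (lU u) (lu G)).1 h1
    have b2 := (isDiv_iff (lU v) (lu H)).1 h2
    refine (isDiv_iff (lU _) (lu _)).2
      (((b1.const_smul c).add (b2.const_smul d) ((lζ u).const_smul c) ((ld u G).const_smul c)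
      ((lζ v).const_smul d) ((ld v H).const_smul d)).congr D.1.meas ?_ ?_)
    · filter_upwards [lp_ae_comb u v c d] with p h3 hp
      unfold zetaOf
      rw [h3 hp]; ext <;> simp <;> ring
    · filter_upwards [lp_ae_comb u v c d, lp_ae_comb G H c d] with p h3 h4 hp
      unfold rotOf
      rw [h3 hp, h4 hp]; simp; ring
  · filter_upwards [ae_eq_of_test D.1.isOpen (loc_lp w).loc LocInt.zero.loc fun χ hχ => by
      simpa using (isDiv_zero_iff rfl).1 ((hR _).1 hw) χ hχ, (ae_w_iff 1).1
      (Lp.coeFn_zero ℝ 2 (wm Ω))] with p h1 h2 hp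
    rw [h1 hp, h2 hp, Pi.zero_apply]

lemma isGrad_of {u : L2r Ω} {G : L2rVec Ω}
    {γ : R2 → R2} (hu : ∀ᵐ p, p ∈ Ω → u p = p.1 * ψ p) (hG : ∀ᵐ p, p ∈ Ω → G p = mkB k (fun p => -(k
    * ψ p)) (fun p => (k : ℝ) • γ p) p) (h : WGrad Ω ψ γ) : IsGrad Ω k u G := by
  have hk' := k0 (k := k)
  refine (isGrad_iff (loc_lp u) (loc_lpVec G)).2
    ⟨?_, h.congr D.1.meas ?_ ?_⟩
  · filter_upwards [hu, hG] with p h1 h2 hp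
    have := D.1.pos p hp
    rw [h1 hp, h2 hp]
    simp [mkB, mul_div_cancel_left₀ _ this.ne']
  · filter_upwards [hu] with p h1 hp
    have := D.1.pos p hp
    rw [h1 hp]; field_simp
  · filter_upwards [hG] with p h2 hp
    have := etaOf_mkB (k := k) (D.1.pos p hp) (fun p => -(k * ψ p)) (fun p => (k : ℝ) • γ p)
    unfold etaOf at this ⊢
    rw [h2 hp, this, smul_smul, inv_mul_cancel₀ hk', one_smul]

lemma isCurl_of {U W : L2rVec Ω}
    {u s : R2 → ℝ} (hU : ∀ᵐ p, p ∈ Ω → U p = mkB k u η p) (hW : ∀ᵐ p, p ∈ Ω → W p = mkC k ζ s p)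
    (h1 : WGrad Ω u fun p => ζ p + (-1 : ℝ) • η p) (h2 : WRot Ω η s) : IsCurl Ω k U W := by
  have hη : ∀ᵐ p, p ∈ Ω → η p = etaOf k U p := by
    filter_upwards [hU] with p h2 hp
    have := etaOf_mkB (k := k) (D.1.pos p hp) u η
    unfold etaOf at this ⊢
    rw [h2 hp, this]
  refine (isCurl_iff (loc_lpVec U) (loc_lpVec W)).2
    ⟨h1.congr D.1.meas ?_ ?_, h2.congr D.1.meas hη ?_⟩
  · filter_upwards [hU] with p h2 hp
    rw [h2 hp]; simp [mkB]
  · filter_upwards [hη, hW] with p h1 h2 hp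
    rw [h1 hp]; unfold zetaOf; rw [h2 hp]; simp [mkC]
  · filter_upwards [hW] with p h2 hp
    have := rotOf_mkC (k := k) (D.1.pos p hp) ζ s
    unfold rotOf at this ⊢
    rw [h2 hp, this]

lemma isDiv_of {W : L2rVec Ω} {G : L2r Ω} {s : R2 → ℝ} (hW : ∀ᵐ p, p ∈ Ω → W p = mkC k ζ s p) (hG :
    ∀ᵐ p, p ∈ Ω → G p = g p) (h : WRot Ω ζ fun p => s p + (-1 : ℝ) • g p) : IsDiv Ω k W G := by
  refine (isDiv_iff (loc_lpVec W) (loc_lp G)).2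
    (h.congr D.1.meas ?_ ?_)
  · filter_upwards [hW] with p h2 hp
    unfold zetaOf; rw [h2 hp]; simp [mkC]
  · filter_upwards [hW, hG] with p h2 h3 hp
    have := rotOf_mkC (k := k) (D.1.pos p hp) ζ s
    unfold rotOf at this ⊢
    rw [h2 hp, h3 hp, this]

end relations

/-! ### Norms in the new variables -/

section norms

lemma norm_vec_le (x : Vec) : ‖x‖ ≤ |x 0| + |x 1| + |x 2| := by
  rw [EuclideanSpace.norm_eq, Fin.sum_univ_three]
  refine Real.sqrt_le_iff.2 ⟨by positivity, ?_⟩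
  simp only [norm_eq_abs]
  nlinarith [mul_nonneg (abs_nonneg (x 0)) (abs_nonneg (x 1)),
    mul_nonneg (abs_nonneg (x 0)) (abs_nonneg (x 2)), mul_nonneg (abs_nonneg (x 1)) (abs_nonneg (x 2))]

lemma one_le_abs_cast : 1 ≤ |(k : ℝ)| := by exact_mod_cast Fk.1

lemma abs_div_le (x : ℝ) : |x / k| ≤ |x| := by
  rw [abs_div]
  exact div_le_self (abs_nonneg _) (one_le_abs_cast)

lemma norm_mkB_le (u : R2 → ℝ) (η : R2 → R2) (hp : 0 < p.1) : ‖mkB k u η p‖ ≤ 3 *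
    (‖u p‖ + p.1 * ‖η p‖) := by
  refine (norm_vec_le _).trans ?_
  have h1 := norm_fst_le (η p)
  have h2 := norm_snd_le (η p)
  have a1 := (abs_div_le (k := k) (p.1 * (η p).1 - u p)).trans (abs_sub _ _)
  have a2 := abs_div_le (k := k) (p.1 * (η p).2)
  rw [abs_mul, abs_of_pos hp] at a1 a2
  simp only [norm_eq_abs] at *
  have b1 := mul_le_mul_of_nonneg_left h1 hp.le
  have b2 := mul_le_mul_of_nonneg_left h2 hp.le
  have := mul_nonneg hp.le (norm_nonneg (η p))
  have := abs_nonneg (u p)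
  simp only [mkB, PiLp.toLp_apply, Matrix.cons_val]
  linarith

lemma norm_mkC_le (ζ : R2 → R2) (s : R2 → ℝ) (hp : 0 < p.1) : ‖mkC k ζ s p‖ ≤ 3 *
    (‖ζ p‖ + p.1 * ‖s p‖) := by
  refine (norm_vec_le _).trans ?_
  have h1 := norm_fst_le (ζ p)
  have h2 := norm_snd_le (ζ p)
  have a1 := (abs_div_le (k := k) (-(ζ p).2 - p.1 * s p)).trans (abs_sub _ _)
  rw [abs_neg, abs_mul, abs_of_pos hp] at a1
  have := mul_nonneg hp.le (norm_nonneg (s p))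
  simp only [norm_eq_abs] at *
  simp only [mkC, PiLp.toLp_apply, Matrix.cons_val, abs_neg]
  linarith

lemma meas_mkB {u : R2 → ℝ} (hu : Measurable u) (hη : Measurable η) : Measurable (mkB k u η) := by
  refine (PiLp.continuous_toLp 2 _).measurable.comp (measurable_pi_iff.2 fun i => ?_)
  fin_cases i
  · exact ((measurable_fst.mul hη.fst).sub hu).div_const _
  · exact hu
  · exact (measurable_fst.mul hη.snd).div_const _

lemma meas_mkC {s : R2 → ℝ} (hζ : Measurable ζ) (hs : Measurable s) : Measurable (mkC k ζ s) := by
  refine (PiLp.continuous_toLp 2 _).measurable.comp (measurable_pi_iff.2 fun i => ?_)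
  fin_cases i
  · exact hζ.snd.neg
  · exact (hζ.snd.neg.sub (measurable_fst.mul hs)).div_const _
  · exact hζ.fst

lemma mkB_comb {u u₁ u₂ : R2 → ℝ} {η₁ η₂ : R2 → R2} {c d : ℝ} (hu : u p = c • u₁ p + d • u₂ p)
    (hη : η p = c • η₁ p + d • η₂ p) : mkB k u η p = c • mkB k u₁ η₁ p + d • mkB k u₂ η₂ p := by
  ext i
  fin_cases i <;> simp [mkB, hu, hη] <;> ring

lemma mkC_comb {s s₁ s₂ : R2 → ℝ} {ζ₁ ζ₂ : R2 → R2} {c d : ℝ} (hζ : ζ p = c • ζ₁ p + d • ζ₂ p)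
    (hs : s p = c • s₁ p + d • s₂ p) : mkC k ζ s p = c • mkC k ζ₁ s₁ p + d • mkC k ζ₂ s₂ p := by
  ext i
  fin_cases i <;> simp [mkC, hs, hζ] <;> ring

/-- The constant of the change of variables. -/
def cvC (k : ℤ) : ℝ := 18 * (1 + (|(k : ℝ)| + 1) ^ 2)

lemma cvConst_pos (k : ℤ) : 0 < cvC k := by unfold cvC; positivity

lemma wE_comp_le {X : Type*} [NormedAddCommGroup X] [NormedSpace ℝ X] [MeasurableSpace W]
    [BorelSpace W] {U U' : R2 → V} {f f' : R2 → W} {h h' : R2 → X}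
    {κ : ℝ} (hκ : 0 ≤ κ) (hf : Measurable f) (e : ∀ᵐ p, p ∈ Ω → ‖U p‖ ≤ 3 * (‖f p‖ + p.1 * ‖h p‖))
    (e1 : ∀ p ∈ Ω, ‖f' p‖ ≤ ‖U' p‖) (e2 : ∀ p ∈ Ω, p.1 * ‖h' p‖ ≤ (|(k : ℝ)| + 1) * ‖U' p‖)
    (b1 : wE 1 f Ω ≤ ofReal κ * wE 1 f' Ω) (b2 : wE 3 h Ω ≤ ofReal κ * wE 3 h' Ω) : wE 1 U Ω ≤
    ofReal (cvC k * κ) * wE 1 U' Ω := by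
  have c1 := wE_mono_norm (α := 1) D.1.meas (.of_forall e1)
  have c2 := wE_le_scale (by positivity) e2
  calc wE 1 U Ω ≤ ofReal (2 * 3 ^ 2) * (wE 1 f Ω + wE 3 h Ω) :=
        wE_le_add (by norm_num) hf.enorm.aemeasurable e
    _ ≤ ofReal (2 * 3 ^ 2) * (ofReal κ * wE 1 U' Ω + ofReal κ *
        (ofReal ((|(k : ℝ)| + 1) ^ 2) * wE 1 U' Ω)) :=
        mul_le_mul' le_rfl (add_le_add (b1.trans (mul_le_mul' le_rfl c1))
          (b2.trans (mul_le_mul' le_rfl c2)))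
    _ = _ := by
        rw [← mul_assoc (ofReal κ), ← ofReal_mul hκ, ← add_mul,
          ← ofReal_add hκ (by positivity), ← mul_assoc, ← ofReal_mul (by norm_num)]
        congr 2
        unfold cvC; ring

lemma norm_etaOf_le (k : ℤ) (U : R2 → Vec) (hp : 0 < p.1) : p.1 * ‖etaOf k U p‖ ≤
    (|(k : ℝ)| + 1) * ‖U p‖ := by
  have h : ∀ i, |U p i| ≤ ‖U p‖ := fun i => by simpa using PiLp.norm_apply_le (U p) i
  have h0 := norm_nonneg (U p)
  rw [← abs_of_pos hp, ← norm_eq_abs, ← norm_smul, norm_def]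
  have c1 : p.1 * (((k : ℝ) * U p 0 + U p 1) / p.1) = (k : ℝ) * U p 0 + U p 1 := by field_simp
  have c2 : p.1 * ((k : ℝ) * U p 2 / p.1) = (k : ℝ) * U p 2 := by field_simp
  simp only [etaOf, Prod.smul_mk, smul_eq_mul, c1, c2, norm_eq_abs]
  refine max_le ((abs_add_le _ _).trans ?_) ?_
  · rw [abs_mul]; nlinarith [h 0, h 1, abs_nonneg (k : ℝ)]
  · rw [abs_mul]; nlinarith [h 2, abs_nonneg (k : ℝ)]

lemma norm_zetaOf_le (W : R2 → Vec) (p : R2) : ‖zetaOf W p‖ ≤ ‖W p‖ := by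
  have h : ∀ i, |W p i| ≤ ‖W p‖ := fun i => by simpa using PiLp.norm_apply_le (W p) i
  rw [norm_def]
  exact max_le (h 2) (by simpa [zetaOf] using h 0)

lemma norm_rotOf_le (k : ℤ) (W : R2 → Vec) (hp : 0 < p.1) : p.1 * ‖rotOf k W p‖ ≤
    (|(k : ℝ)| + 1) * ‖W p‖ := by
  have h : ∀ i, |W p i| ≤ ‖W p‖ := fun i => by simpa using PiLp.norm_apply_le (W p) i
  rw [← abs_of_pos hp, ← norm_eq_abs, ← norm_smul]
  have c1 : p.1 * ((W p 0 - (k : ℝ) * W p 1) / p.1) = W p 0 - (k : ℝ) * W p 1 := by field_simp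
  simp only [rotOf, smul_eq_mul, c1, norm_eq_abs]
  refine (abs_sub _ _).trans ?_
  rw [abs_mul]; nlinarith [h 0, h 1, abs_nonneg (k : ℝ)]

end norms

/-! ### The local polynomial spaces -/

section poly

lemma loc0_eq_aff (c : R2 → ℝ) (s : Finset R2) : ∃ x b, ∀ p, loc0 c s p = aff x b p := by
  refine ⟨∑ v ∈ s, c v • lamG s v, ∑ v ∈ s, c v * lamB s v, fun p => ?_⟩
  simp only [loc0, lam, aff, pdot, fst_sum, snd_sum, smul_fst, smul_snd,
    smul_eq_mul, Finset.sum_mul, ← sum_add_distrib]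
  exact sum_congr rfl fun v _ => by ring

lemma loc1_eq_ndf (d : R2 → R2 → ℝ) (s : Finset R2) : ∃ x b, ∀ p, loc1 d s p = ndf x b p := by
  refine ⟨∑ i ∈ s ×ˢ s, (d i.1 i.2 / 2) • (lamB s i.1 • lamG s i.2 - lamB s i.2 • lamG s i.1),
    ∑ i ∈ s ×ˢ s, d i.1 i.2 / 2 * pdet (lamG s i.1) (lamG s i.2), fun p => ?_⟩
  rw [← sum_ndf, Finset.sum_product]
  simp only [loc1, whit_eq]

lemma sum_polyA (a : Fin 3 → ℝ) (p : R2) : ∑ i, a i • polyA (Pi.single i 1) p = polyA a p := by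
  simp [polyA, Fin.sum_univ_three]; ring

lemma sum_polyB (a : Fin 6 → ℝ) (p : R2) : ∑ i, a i • polyB k (Pi.single i 1) p = polyB k a p := by
  ext i
  fin_cases i <;> simp [polyB, Fin.sum_univ_six, Pi.single_apply] <;> ring

lemma sum_polyC (a : Fin 4 → ℝ) (p : R2) : ∑ i, a i • polyC k (Pi.single i 1) p = polyC k a p := by
  ext i
  fin_cases i <;> simp [polyC, Fin.sum_univ_four, Pi.single_apply] <;> ring

lemma cont_vec {f : R2 → Vec} (h : ∀ i, Continuous fun p => f p i) : Continuous f :=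
  (PiLp.continuous_toLp 2 _).comp (continuous_pi h)

lemma cont_polyB (a : Fin 6 → ℝ) : Continuous (polyB k a) :=
  cont_vec fun i => by fin_cases i <;> simp [polyB] <;> fun_prop

lemma cont_polyC (a : Fin 4 → ℝ) : Continuous (polyC k a) :=
  cont_vec fun i => by fin_cases i <;> simp [polyC] <;> fun_prop

lemma mul_aff_eq (x : R2) (c : ℝ) (p : R2) : p.1 * aff x c p = polyA ![c, x.1, x.2] p := by
  simp [polyA, aff, pdot]; ring

lemma mkB_aff_ndf {u : R2 → ℝ} {x y : R2} {c b : ℝ} (hu : u p = aff x c p) (hη : η p = ndf y b p) :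
    mkB k u η p = polyB k ![-c / k, x.1, -x.2 / k, (y.1 - x.1) / k, y.2 / k, b / k] p := by
  have := k0 (k := k)
  ext i
  fin_cases i <;> simp [mkB, polyB, hu, hη, aff, ndf, pdot] <;> field_simp <;> ring

lemma polyB_theta (a : Fin 6 → ℝ) (p : R2) : polyB k a p 1 = aff (a 1, -k * a 2) (-k * a 0) p := by
  simp [polyB, aff, pdot]; ring

lemma etaOf_polyB {U : R2 → Vec} (hp : 0 < p.1) {a : Fin 6 → ℝ} (h : U p = polyB k a p) : etaOf k
    U p = ndf (k * a 3 + a 1, k * a 4) (k * a 5) p := by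
  unfold etaOf
  rw [h]
  ext <;> simp [polyB, ndf] <;> field_simp <;> ring

lemma mkC_ndf {s : R2 → ℝ} {y : R2} {b S : ℝ} (hζ : ζ p = ndf y b p) (hs : s p = S) :
    mkC k ζ s p = polyC k ![-y.2 / k, -b, -(b + S) / k, y.1] p := by
  have := k0 (k := k)
  ext i
  fin_cases i <;> simp [mkC, polyC, hζ, hs, ndf] <;> field_simp <;> ring

lemma zetaOf_polyC {U : R2 → Vec} {a : Fin 4 → ℝ} (h : U p = polyC k a p) : zetaOf U p = ndf
    (a 3, -k * a 0) (-a 1) p := by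
  unfold zetaOf
  rw [h]
  ext <;> simp [polyC, ndf] <;> ring

lemma rotOf_polyC {U : R2 → Vec} (hp : 0 < p.1) {a : Fin 4 → ℝ} (h : U p = polyC k a p) : rotOf k
    U p = a 1 - k * a 2 := by
  unfold rotOf
  rw [h]
  simp [polyC]; field_simp; ring

lemma ex_bd_pw {F : Finset R2 → R2 → E}
    (hF : ∀ s, Continuous (F s)) : ∃ B, ∀ p, ‖pw Tr F p‖ ≤ B := by
  have : ∀ s, ∃ B, ∀ p, ‖(interior (hull s)).indicator (F s) p‖ ≤ B := fun s => by
    obtain ⟨B, hB⟩ := (cpt_hull s).exists_bound_of_continuousOn (hF s).continuousOn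
    refine ⟨max B 0, fun p => ?_⟩
    by_cases hp : p ∈ interior (hull s)
    · rw [indicator_of_mem hp]
      exact (hB p (interior_subset hp)).trans (le_max_left _ _)
    · rw [indicator_of_notMem hp, norm_zero]
      exact le_max_right _ _
  choose B hB using this
  exact ⟨∑ s ∈ Tr, B s, fun p => norm_sum_le_of_le _ fun s _ => hB s p⟩

lemma pwSub_ae (g : Geom Ω Tr φ C) {n : ℕ} {e : Fin n → R2 → V}
    {u : Lp V 2 (wm Ω)} (hu : u ∈ pwSub Ω Tr e) (hs : s ∈ Tr) : ∃ a : Fin n → ℝ, ∀ᵐ p, p ∈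
    hull s → 0 < p.1 ∧ u p = ∑ i, a i • e i p := by
  obtain ⟨a, ha⟩ := hu s hs
  refine ⟨a, ?_⟩
  filter_upwards [(ae_w_iff 1).1 ha, g.ae_hull hs] with p h1 h2 hp
  exact ⟨D.1.pos p (h2 hp).2, h1 (h2 hp).2 hp⟩

lemma mem_pwSub {n : ℕ} {e : Fin n → R2 → V} {u : Lp V 2 (wm Ω)} {F : R2 → V}
    (hu : ∀ᵐ p, p ∈ Ω → u p = F p) (h : ∀ s ∈ Tr, ∃ a : Fin n → ℝ, ∀ᵐ p, p ∈ hull s → F p = ∑ i, a i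
    • e i p) : u ∈ pwSub Ω Tr e := fun s hs => by
  obtain ⟨a, ha⟩ := h s hs
  refine ⟨a, (ae_w_iff 1).2 ?_⟩
  filter_upwards [ha, hu] with p h1 h2 hp hps
  rw [h2 hp, h1 hps]

end poly

/-! ### Existence of bounded commuting projections -/

section main

variable {μ : R2 → Measure R2}

/-- The quasi-interpolation operator into `A_h`. -/
def opA (Tr : Finset (Finset R2)) (μ : R2 → Measure R2) (u : R2 → ℝ) (p : R2) : ℝ :=
  p.1 * qi0 Tr μ (fun p => u p / p.1) p

/-- The quasi-interpolation operator into `B_h`. -/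
def opB (k : ℤ) (Tr : Finset (Finset R2)) (μ : R2 → Measure R2) (U : R2 → Vec) : R2 → Vec :=
  mkB k (qi0 Tr μ fun p => U p 1) (qi1 Tr μ (etaOf k U))

/-- The quasi-interpolation operator into `C_h`. -/
def opC (k : ℤ) (Tr : Finset (Finset R2)) (μ : R2 → Measure R2) (W : R2 → Vec) : R2 → Vec :=
  mkC k (qi1 Tr μ (zetaOf W)) (qi2 Tr μ (rotOf k W))

lemma meas_qi0 (f : R2 → ℝ) : Measurable (qi0 Tr μ f) :=
  (loc_pw (Ω := Set.univ) fun s => cont_loc0 _ s).meas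

lemma meas_qi1 (f : R2 → R2) : Measurable (qi1 Tr μ f) :=
  (loc_pw (Ω := Set.univ) fun s => cont_loc1 _ s).meas

lemma meas_qi2 (f : R2 → ℝ) : Measurable (qi2 Tr μ f) :=
  (loc_pw (Ω := Set.univ) fun s => cont_loc2 _ s).meas

lemma ex_lp_mkB (hb : IsBounded Ω) {u : R2 → ℝ} (hu : Measurable u) (hη : Measurable η) {B B' : ℝ}
    (bu : ∀ p, ‖u p‖ ≤ B) (bη : ∀ p, ‖η p‖ ≤ B') : ∃ U : L2rVec Ω, ∀ᵐ p, p ∈ Ω → U p = mkB k u η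
    p := by
  obtain ⟨ρ, hρ⟩ := hb.exists_norm_le
  refine ex_lp_of_bd hb (meas_mkB hu hη).aestronglyMeasurable
    ⟨3 * (B + ρ * B'), fun p hp => (norm_mkB_le _ _ (D.1.pos p hp)).trans ?_⟩
  have h1 : p.1 ≤ ρ := (le_abs_self _).trans ((norm_fst_le p).trans (hρ p hp))
  have h2 := (D.1.pos p hp).le.trans h1
  have h3 := bu p
  have h4 := bη p
  gcongr

lemma ex_lp_mkC (hb : IsBounded Ω) {s : R2 → ℝ} (hζ : Measurable ζ) (hs : Measurable s) {B B' : ℝ}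
    (bζ : ∀ p, ‖ζ p‖ ≤ B) (bs : ∀ p, ‖s p‖ ≤ B') : ∃ W : L2rVec Ω, ∀ᵐ p, p ∈ Ω → W p = mkC k ζ s
    p := by
  obtain ⟨ρ, hρ⟩ := hb.exists_norm_le
  refine ex_lp_of_bd hb (meas_mkC hζ hs).aestronglyMeasurable
    ⟨3 * (B + ρ * B'), fun p hp => (norm_mkC_le _ _ (D.1.pos p hp)).trans ?_⟩
  have h1 : p.1 ≤ ρ := (le_abs_self _).trans ((norm_fst_le p).trans (hρ p hp))
  have h2 := (D.1.pos p hp).le.trans h1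
  have h3 := bζ p
  have h4 := bs p
  gcongr

/-- The finite element functions with conformity relation `R`. -/
def conf (Tr : Finset (Finset R2)) {n : ℕ} (e : Fin n → R2 → V)
    (R : Submodule ℝ (Lp V 2 (wm Ω) × F)) : Submodule ℝ (Lp V 2 (wm Ω)) :=
  pwSub Ω Tr e ⊓ R.map (LinearMap.fst ℝ _ _)

lemma mem_conf {n : ℕ} {e : Fin n → R2 → V} {R : Submodule ℝ (Lp V 2 (wm Ω) × F)} {u : Lp V 2 (wm
    Ω)} : u ∈ conf Tr e R ↔ u ∈ pwSub Ω Tr e ∧ ∃ w, (u, w) ∈ R := by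
  rw [conf, Submodule.mem_inf]
  refine and_congr_right fun _ => ?_
  constructor
  · rintro ⟨⟨v, w⟩, h, rfl⟩
    exact ⟨w, h⟩
  · rintro ⟨w, h⟩
    exact ⟨(u, w), h, rfl⟩

lemma conf_fin (hb : IsBounded Ω) (g : Geom Ω Tr φ C) {n : ℕ} {e : Fin n → R2 → V}
    (he : ∀ i, Continuous (e i)) (R : Submodule ℝ (Lp V 2 (wm Ω) × F)) : FiniteDimensional ℝ
    (conf Tr e R) := by
  have := pwSub_fin hb g he
  exact Submodule.finiteDimensional_of_le (S₂ := pwSub Ω Tr e) inf_le_left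

lemma ex_invProjA (hb : IsBounded Ω) (g : Geom Ω Tr φ C) (hμ : ∀ s ∈ Tr, ∀ v ∈ s, Probe Ω (μ v)) {K
    κ : ℝ} (hK : 0 ≤ K) (hκ : 0 ≤ κ) (hκ' : cvC k * κ ≤ 1 / 4) (q : QIBound Ω Tr μ 3 K κ) {R :
    Submodule ℝ (L2r Ω × L2rVec Ω)} (hR : ∀ x, x ∈ R ↔ IsGrad Ω k x.1 x.2) : ∃ M P : L2r Ω →L[ℝ] L2r
    Ω, InvProj (conf Tr (fun i : Fin 3 => polyA (Pi.single i 1)) R) M P ∧ ‖P‖ ≤ 2 * Real.sqrt (cvC k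
    * K) ∧ ∀ u, ∀ᵐ p, p ∈ Ω → M u p = opA Tr μ u p := by
  have hm := D.1.meas
  have lu := fun u : L2r Ω => loc_lp u
  have lψ := fun u : L2r Ω => (lu u).div_fst
  have hA : ∀ u : L2r Ω, Measurable (opA Tr μ u) := fun u => measurable_fst.mul (meas_qi0 _)
  have bound : ∀ (u : L2r Ω) (f h : R2 → ℝ) (κ : ℝ), 0 ≤ κ →
      (∀ᵐ p, p ∈ Ω → f p = p.1 * h p) →
      wE 3 h Ω ≤ ofReal κ * wE 3 (fun p => u p / p.1) Ω →
      wE 1 f Ω ≤ ofReal (cvC k * κ) * wE 1 u Ω := by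
    intro u f h κ hκ e b
    refine wE_comp_le (f := fun _ => (0 : ℝ)) (f' := fun _ => (0 : ℝ)) hκ measurable_const
      ?_ (fun p _ => by simp) (fun p hp => ?_) (by simp [wE]) b
    · filter_upwards [e] with p h1 hp
      have := D.1.pos p hp
      rw [h1 hp, norm_mul, norm_of_nonneg this.le, norm_zero, zero_add]
      nlinarith [mul_nonneg this.le (norm_nonneg (h p))]
    · have := D.1.pos p hp
      rw [norm_div, norm_of_nonneg this.le, mul_div_cancel₀ _ this.ne']
      nlinarith [mul_nonneg (abs_nonneg (k : ℝ)) (norm_nonneg (u p))]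
  refine ex_invProj (opA Tr μ) (mul_nonneg (cvConst_pos k).le hK)
    (fun u => (hA u).aestronglyMeasurable)
    (fun u => bound u _ _ K hK (.of_forall fun p _ => rfl) (q.b0 _ (lψ u).meas))
    (fun u v c d => ?_) _ (conf_fin hb g (fun i => by unfold polyA; fun_prop) R)
    (fun u v hv => ?_) fun u hu => ?_
  · refine .of_forall fun p _ => ?_
    unfold opA
    rw [qi0_comb hμ (lψ u) (lψ v) (F := fun p => (c • u + d • v : L2r Ω) p / p.1) (c := c)
      (d := d)]
    · simp only [smul_eq_mul]; ring
    · filter_upwards [lp_ae_comb u v c d] with p h hp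
      rw [h hp]; simp only [smul_eq_mul]; ring
  · rw [mem_conf]
    constructor
    · refine mem_pwSub hv fun s hs => ?_
      obtain ⟨x, b, h⟩ := loc0_eq_aff (fun v => avg0 (μ v) fun p => u p / p.1) s
      refine ⟨![b, x.1, x.2], ?_⟩
      filter_upwards [g.pw_eq (loc0 fun v => avg0 (μ v) fun p => u p / p.1)] with p h1 hp
      rw [sum_polyA, ← mul_aff_eq, ← h p, opA, qi0, (h1 s hs hp).2]
    · set c : R2 → ℝ := fun v => avg0 (μ v) fun p => u p / p.1
      have h := g.wGrad_loc0 hm c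
      have l1 : LocInt Ω (pw Tr fun s (_ : R2) => ∑ v ∈ s, c v • lamG s v) :=
        loc_pw fun s => continuous_const
      obtain ⟨B, hB⟩ := ex_bd_pw (Tr := Tr) fun s => cont_loc0 c s
      obtain ⟨B', hB'⟩ := ex_bd_pw (Tr := Tr) (F := fun s (_ : R2) =>
        ∑ v ∈ s, c v • lamG s v) fun s => continuous_const
      obtain ⟨G, hG⟩ := ex_lp_mkB (k := k) hb
        (u := fun p => -(k * qi0 Tr μ (fun p => u p / p.1) p))
        (η := fun p => (k : ℝ) • pw Tr (fun s (_ : R2) => ∑ v ∈ s, c v • lamG s v) p)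
        ((meas_qi0 _).const_mul _).neg (l1.const_smul _).meas (B := |(k : ℝ)| * B)
        (B' := |(k : ℝ)| * B') (fun p => by
          rw [norm_neg, norm_mul, norm_eq_abs]
          exact mul_le_mul_of_nonneg_left (hB p) (abs_nonneg _)) (fun p => by
          rw [norm_smul, norm_eq_abs]
          exact mul_le_mul_of_nonneg_left (hB' p) (abs_nonneg _))
      exact ⟨G, (hR _).2 (isGrad_of hv hG h)⟩
  · obtain ⟨h1, G, h2⟩ := mem_conf.1 hu
    have h3 := ((isGrad_iff (lu u) (loc_lpVec G)).1 ((hR _).1 h2)).2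
    have h4 := q.s0 _ _ (lψ u) ((loc_etaOf k (loc_lpVec G)).const_smul _) h3
      fun s hs => by
        obtain ⟨a, ha⟩ := pwSub_ae g h1 hs
        refine ⟨(a 1, a 2), a 0, ?_⟩
        filter_upwards [ha] with p h hp
        obtain ⟨hp0, h⟩ := h hp
        rw [h, sum_polyA]
        simp only [polyA, aff, pdot]; field_simp; ring
    refine (bound u _ _ κ hκ (.of_forall fun p hp => ?_) h4).trans
      (mul_le_mul' (ofReal_le_ofReal hκ') le_rfl)
    have := D.1.pos p hp
    simp only [opA]; field_simp

lemma mem_confB (hb : IsBounded Ω) (g : Geom Ω Tr φ C) {R : Submodule ℝ (L2rVec Ω × L2rVec Ω)}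
    (hR : ∀ x, x ∈ R ↔ IsCurl Ω k x.1 x.2) {c : R2 → ℝ} {d : R2 → R2 → ℝ} {V : L2rVec Ω}
    (hv : ∀ᵐ p, p ∈ Ω → V p = mkB k (pw Tr (loc0 c)) (pw Tr (loc1 d)) p) : V ∈ conf Tr
    (fun i : Fin 6 => polyB k (Pi.single i 1)) R := by
  have hm := D.1.meas
  rw [mem_conf]
  constructor
  · refine mem_pwSub hv fun s hs => ?_
    obtain ⟨x, b, h⟩ := loc0_eq_aff c s
    obtain ⟨y, b', h'⟩ := loc1_eq_ndf d s
    refine ⟨![-b / k, x.1, -x.2 / k, (y.1 - x.1) / k, y.2 / k, b' / k], ?_⟩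
    filter_upwards [g.pw_eq (loc0 c), g.pw_eq (loc1 d)] with p h1 h2 hp
    rw [sum_polyB]
    exact mkB_aff_ndf ((h1 s hs hp).2.trans (h p)) ((h2 s hs hp).2.trans (h' p))
  · have h1 := g.wGrad_loc0 hm c
    have h2 := g.wRot_loc1 hm d
    have l1 : LocInt Ω (pw Tr fun s (_ : R2) => ∑ v ∈ s, c v • lamG s v) :=
      loc_pw fun s => continuous_const
    have l2 : LocInt Ω (pw Tr fun s (_ : R2) =>
      ∑ v ∈ s, ∑ w ∈ s, d v w * pdet (lamG s v) (lamG s w)) := loc_pw fun s => continuous_const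
    obtain ⟨B1, hB1⟩ := ex_bd_pw (Tr := Tr) (F := fun s (_ : R2) =>
      ∑ v ∈ s, c v • lamG s v) fun s => continuous_const
    obtain ⟨B2, hB2⟩ := ex_bd_pw (Tr := Tr) fun s => cont_loc1 d s
    obtain ⟨B3, hB3⟩ := ex_bd_pw (Tr := Tr) (F := fun s (_ : R2) =>
      ∑ v ∈ s, ∑ w ∈ s, d v w * pdet (lamG s v) (lamG s w)) fun s => continuous_const
    obtain ⟨G, hG⟩ := ex_lp_mkC (k := k) hb
      (ζ := fun p => pw Tr (fun s (_ : R2) => ∑ v ∈ s, c v • lamG s v) p +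
        pw Tr (loc1 d) p) (l1.meas.add (loc_pw (Ω := Ω) fun s => cont_loc1 d s).meas) l2.meas
      (fun p => norm_add_le_of_le (hB1 p) (hB2 p)) hB3
    exact ⟨G, (hR _).2 (isCurl_of hv hG (h1.congr hm (.of_forall fun _ _ => rfl)
      (.of_forall fun p _ => by simp)) h2)⟩

lemma ex_invProjB (hb : IsBounded Ω) (g : Geom Ω Tr φ C) (hμ : ∀ s ∈ Tr, ∀ v ∈ s, Probe Ω (μ v)) {K
    κ : ℝ} (hK : 0 ≤ K) (hκ : 0 ≤ κ) (hκ' : cvC k * κ ≤ 1 / 4) (q1 : QIBound Ω Tr μ 1 K κ) (q3 :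
    QIBound Ω Tr μ 3 K κ) {R : Submodule ℝ (L2rVec Ω × L2rVec Ω)} (hR : ∀ x, x ∈ R ↔ IsCurl Ω k x.1
    x.2) : ∃ M P : L2rVec Ω →L[ℝ] L2rVec Ω, InvProj (conf Tr (fun i : Fin 6 => polyB k (Pi.single i
    1)) R) M P ∧ ‖P‖ ≤ 2 * Real.sqrt (cvC k * K) ∧ ∀ u, ∀ᵐ p, p ∈ Ω → M u p = opB k Tr μ u p := by
  have hm := D.1.meas
  have lU := fun u : L2rVec Ω => loc_lpVec u
  have lη := fun u : L2rVec Ω => loc_etaOf k (lU u)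
  have bound : ∀ (U : L2rVec Ω) (f : R2 → ℝ) (h : R2 → R2) (V : R2 → Vec) (κ : ℝ), 0 ≤ κ →
      Measurable f → (∀ p ∈ Ω, V p = mkB k f h p) →
      wE 1 f Ω ≤ ofReal κ * wE 1 (fun p => U p 1) Ω →
      wE 3 h Ω ≤ ofReal κ * wE 3 (etaOf k U) Ω →
      wE 1 V Ω ≤ ofReal (cvC k * κ) * wE 1 U Ω := by
    intro U f h V κ hκ hf e b1 b2
    refine wE_comp_le hκ hf (.of_forall fun p hp => ?_)
      (fun p _ => PiLp.norm_apply_le (U p) 1) (fun p hp => norm_etaOf_le k U (D.1.pos p hp)) b1 b2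
    rw [e p hp]; exact norm_mkB_le f h (D.1.pos p hp)
  refine ex_invProj (opB k Tr μ) (mul_nonneg (cvConst_pos k).le hK)
    (fun u => (meas_mkB (meas_qi0 _) (meas_qi1 _)).aestronglyMeasurable)
    (fun u => bound u _ _ _ K hK (meas_qi0 _) (fun p _ => rfl) (q1.b0 _ (lU u 1).meas)
      (q3.b1 _ (lη u).meas))
    (fun u v c d => ?_) _ (conf_fin hb g (fun i => cont_polyB _) R)
    (fun u v hv => ?_) fun u hu => ?_
  · refine .of_forall fun p _ => mkB_comb (qi0_comb hμ (lU u 1) (lU v 1) ?_ p)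
      (qi1_comb hμ (lη u) (lη v) ?_ p)
    · filter_upwards [lp_ae_comb u v c d] with p h hp
      rw [h hp]; simp
    · filter_upwards [lp_ae_comb u v c d] with p h hp
      unfold etaOf
      rw [h hp]; ext <;> simp <;> ring
  · exact mem_confB hb g hR hv
  · obtain ⟨h1, G, h2⟩ := mem_conf.1 hu
    obtain ⟨h3, h4⟩ := (isCurl_iff (lU u) (lU G)).1 ((hR _).1 h2)
    have h5 := q1.s0 _ _ (lU u 1) ((loc_zetaOf (lU G)).add ((lη u).const_smul _)) h3
      fun s hs => by
        obtain ⟨a, ha⟩ := pwSub_ae g h1 hs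
        refine ⟨(a 1, -k * a 2), -k * a 0, ?_⟩
        filter_upwards [ha] with p h hp
        rw [(h hp).2, sum_polyB, polyB_theta]
    have h6 := q3.s1 _ _ (lη u) (loc_rotOf k (lU G)) h4
      fun s hs => by
        obtain ⟨a, ha⟩ := pwSub_ae g h1 hs
        refine ⟨(k * a 3 + a 1, k * a 4), k * a 5, ?_⟩
        filter_upwards [ha] with p h hp
        exact etaOf_polyB (h hp).1 ((h hp).2.trans (sum_polyB _ _))
    refine (bound u _ _ _ κ hκ ((lU u 1).meas.sub (meas_qi0 _)) (fun p hp => ?_) h5 h6).trans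
      (mul_le_mul' (ofReal_le_ofReal hκ') le_rfl)
    rw [mkB_comb (c := 1) (d := -1) (u₁ := fun p => u p 1) (u₂ := qi0 Tr μ fun p => u p 1)
      (η₁ := etaOf k u) (η₂ := qi1 Tr μ (etaOf k u)) (by simp [sub_eq_add_neg])
      (by simp [sub_eq_add_neg]), mkB_etaOf (D.1.pos p hp)]
    simp [opB, sub_eq_add_neg]

lemma ex_invProjC (hb : IsBounded Ω) (g : Geom Ω Tr φ C) (hμ : ∀ s ∈ Tr, ∀ v ∈ s, Probe Ω (μ v)) {K
    κ : ℝ} (hK : 0 ≤ K) (hκ : 0 ≤ κ) (hκ' : cvC k * κ ≤ 1 / 4) (q1 : QIBound Ω Tr μ 1 K κ) (q3 :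
    QIBound Ω Tr μ 3 K κ) {R : Submodule ℝ (L2rVec Ω × L2r Ω)} (hR : ∀ x, x ∈ R ↔ IsDiv Ω k x.1 x.2)
    : ∃ M P : L2rVec Ω →L[ℝ] L2rVec Ω, InvProj (conf Tr (fun i : Fin 4 => polyC k (Pi.single i 1))
    R) M P ∧ ‖P‖ ≤ 2 * Real.sqrt (cvC k * K) ∧ ∀ u, ∀ᵐ p, p ∈ Ω → M u p = opC k Tr μ u p := by
  have hm := D.1.meas
  have lU := fun u : L2rVec Ω => loc_lpVec u
  have lζ := fun u : L2rVec Ω => loc_zetaOf (lU u)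
  have ls := fun u : L2rVec Ω => loc_rotOf k (lU u)
  have bound : ∀ (U : L2rVec Ω) (f : R2 → R2) (h : R2 → ℝ) (V : R2 → Vec) (κ : ℝ), 0 ≤ κ →
      Measurable f → (∀ p ∈ Ω, V p = mkC k f h p) →
      wE 1 f Ω ≤ ofReal κ * wE 1 (zetaOf U) Ω →
      wE 3 h Ω ≤ ofReal κ * wE 3 (rotOf k U) Ω →
      wE 1 V Ω ≤ ofReal (cvC k * κ) * wE 1 U Ω := by
    intro U f h V κ hκ hf e b1 b2
    refine wE_comp_le hκ hf (.of_forall fun p hp => ?_)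
      (fun p _ => norm_zetaOf_le U p) (fun p hp => norm_rotOf_le k U (D.1.pos p hp)) b1 b2
    rw [e p hp]; exact norm_mkC_le f h (D.1.pos p hp)
  refine ex_invProj (opC k Tr μ) (mul_nonneg (cvConst_pos k).le hK)
    (fun u => (meas_mkC (meas_qi1 _) (meas_qi2 _)).aestronglyMeasurable)
    (fun u => bound u _ _ _ K hK (meas_qi1 _) (fun p _ => rfl) (q1.b1 _ (lζ u).meas)
      (q3.b2 _ (ls u).meas))
    (fun u v c d => ?_) _ (conf_fin hb g (fun i => cont_polyC _) R)
    (fun u v hv => ?_) fun u hu => ?_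
  · refine .of_forall fun p _ => mkC_comb (qi1_comb hμ (lζ u) (lζ v) ?_ p)
      (qi2_comb hμ (ls u) (ls v) ?_ p)
    · filter_upwards [lp_ae_comb u v c d] with p h hp
      unfold zetaOf
      rw [h hp]; ext <;> simp; ring
    · filter_upwards [lp_ae_comb u v c d] with p h hp
      unfold rotOf
      rw [h hp]; simp; ring
  · rw [mem_conf]
    set d : R2 → R2 → ℝ := fun v w => avg1 (μ v) (μ w) (zetaOf u)
    set τ : R2 → R2 → R2 → ℝ := fun x y z => avg2 (μ x) (μ y) (μ z) (rotOf k u)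
    constructor
    · refine mem_pwSub hv fun s hs => ?_
      obtain ⟨y, b', h'⟩ := loc1_eq_ndf d s
      refine ⟨![-y.2 / k, -b', -(b' + loc2 τ s 0) / k, y.1], ?_⟩
      filter_upwards [g.pw_eq (loc1 d), g.pw_eq (loc2 τ)] with p h1 h2 hp
      rw [sum_polyC]
      exact mkC_ndf ((h1 s hs hp).2.trans (h' p)) (h2 s hs hp).2
    · have h2 := g.wRot_loc1 hm d
      have l2 : LocInt Ω (pw Tr fun s (_ : R2) =>
        ∑ v ∈ s, ∑ w ∈ s, d v w * pdet (lamG s v) (lamG s w)) := loc_pw fun s => continuous_const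
      obtain ⟨B2, hB2⟩ := ex_bd_pw (Tr := Tr) fun s => cont_loc2 τ s
      obtain ⟨B3, hB3⟩ := ex_bd_pw (Tr := Tr) (F := fun s (_ : R2) =>
        ∑ v ∈ s, ∑ w ∈ s, d v w * pdet (lamG s v) (lamG s w)) fun s => continuous_const
      obtain ⟨G, hG⟩ := ex_lp_of_bd hb
        (F := fun p => qi2 Tr μ (rotOf k u) p -
          pw Tr (fun s (_ : R2) => ∑ v ∈ s, ∑ w ∈ s, d v w * pdet (lamG s v) (lamG s w)) p)
        ((meas_qi2 _).sub l2.meas).aestronglyMeasurable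
        ⟨B2 + B3, fun p hp => norm_sub_le_of_le (hB2 p) (hB3 p)⟩
      exact ⟨G, (hR _).2 (isDiv_of hv hG (h2.congr hm (.of_forall fun _ _ => rfl)
        (.of_forall fun p _ => by simp)))⟩
  · obtain ⟨h1, G, h2⟩ := mem_conf.1 hu
    have h3 := (isDiv_iff (lU u) (loc_lp G)).1 ((hR _).1 h2)
    have h5 := q1.s1 _ _ (lζ u) ((ls u).add ((loc_lp G).const_smul _)) h3
      fun s hs => by
        obtain ⟨a, ha⟩ := pwSub_ae g h1 hs
        refine ⟨(a 3, -k * a 0), -a 1, ?_⟩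
        filter_upwards [ha] with p h hp
        exact zetaOf_polyC ((h hp).2.trans (sum_polyC _ _))
    have h6 := q3.s2 _ (ls u) fun s hs => by
        obtain ⟨a, ha⟩ := pwSub_ae g h1 hs
        refine ⟨a 1 - k * a 2, ?_⟩
        filter_upwards [ha] with p h hp
        exact rotOf_polyC (h hp).1 ((h hp).2.trans (sum_polyC _ _))
    refine (bound u _ _ _ κ hκ ((lζ u).meas.sub (meas_qi1 _)) (fun p hp => ?_) h5 h6).trans
      (mul_le_mul' (ofReal_le_ofReal hκ') le_rfl)
    rw [mkC_comb (c := 1) (d := -1) (ζ₁ := zetaOf u) (ζ₂ := qi1 Tr μ (zetaOf u))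
      (s₁ := rotOf k u) (s₂ := qi2 Tr μ (rotOf k u)) (by simp [sub_eq_add_neg])
      (by simp [sub_eq_add_neg]), mkC_rotOf (D.1.pos p hp)]
    simp [opC, sub_eq_add_neg]

lemma ex_invProjD (hb : IsBounded Ω) (g : Geom Ω Tr φ C) (hμ : ∀ s ∈ Tr, ∀ v ∈ s, Probe Ω (μ v)) {K
    κ : ℝ} (hK : 0 ≤ K) (hκ' : κ ≤ 1 / 4) (q1 : QIBound Ω Tr μ 1 K κ) : ∃ M P : L2r Ω →L[ℝ] L2r Ω,
    InvProj (pwSub Ω Tr fun (_ : Fin 1) _ => (1 : ℝ)) M P ∧ ‖P‖ ≤ 2 * Real.sqrt K ∧ ∀ u, ∀ᵐ p, p ∈ Ω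
    → M u p = qi2 Tr μ u p := by
  have lu := fun u : L2r Ω => loc_lp u
  refine ex_invProj (qi2 Tr μ) hK (fun u => (meas_qi2 _).aestronglyMeasurable)
    (fun u => q1.b2 _ (lu u).meas)
    (fun u v c d => .of_forall fun p _ => qi2_comb hμ (lu u) (lu v)
      (lp_ae_comb u v c d) p) _ (pwSub_fin hb g fun _ => continuous_const)
    (fun u v hv => ?_) fun u hu => ?_
  · refine mem_pwSub hv fun s hs => ?_
    refine ⟨fun _ => loc2 (fun x y z => avg2 (μ x) (μ y) (μ z) u) s 0, ?_⟩
    filter_upwards [g.pw_eq (loc2 fun x y z => avg2 (μ x) (μ y) (μ z) u)] with p h2 hp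
    rw [qi2, (h2 s hs hp).2]
    simp [loc2]
  · refine (q1.s2 _ (lu u) fun s hs => ?_).trans
      (mul_le_mul' (ofReal_le_ofReal hκ') le_rfl)
    obtain ⟨a, ha⟩ := pwSub_ae g hu hs
    refine ⟨a 0, ?_⟩
    filter_upwards [ha] with p h hp
    simpa using (h hp).2

end main

section comm

variable {μ : R2 → Measure R2}

lemma isGrad_op (g : Geom Ω Tr φ C) (hμ : ∀ s ∈ Tr, ∀ v ∈ s, Probe Ω (μ v)) {u u' : L2r Ω} {G G' :
    L2rVec Ω} (h : IsGrad Ω k u G) (hu : ∀ᵐ p, p ∈ Ω → u' p = opA Tr μ u p) (hG : ∀ᵐ p, p ∈ Ω → G' p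
    = opB k Tr μ G p) : IsGrad Ω k u' G' := by
  have hk' := k0 (k := k)
  have lu := (loc_lp u).div_fst
  have lU := loc_lpVec G
  have lη := (loc_etaOf k lU).const_smul (k : ℝ)⁻¹
  obtain ⟨a, b⟩ := (isGrad_iff (loc_lp u) lU).1 h
  refine isGrad_of hu ?_ (g.wGrad_qi D.1.isOpen D.1.cvx hμ lu lη b)
  filter_upwards [hG] with p h hp
  have e0 := qi0_comb (Tr := Tr) hμ (F := fun p => G p 1) (c := -k) (d := 0) lu lu
    (by filter_upwards [a] with p h hp; rw [h hp]; simp) p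
  have e1 := qi1_comb (Tr := Tr) hμ (F := etaOf k G) (c := k) (d := 0) lη lη
    (.of_forall fun p _ => by simp [smul_smul, hk']) p
  rw [h hp, opB, mkB, mkB, e0, e1]
  simp

lemma isCurl_op (g : Geom Ω Tr φ C) (hμ : ∀ s ∈ Tr, ∀ v ∈ s, Probe Ω (μ v)) {U U' W W' : L2rVec Ω}
    (h : IsCurl Ω k U W) (hU : ∀ᵐ p, p ∈ Ω → U' p = opB k Tr μ U p) (hW : ∀ᵐ p, p ∈ Ω → W' p = opC k
    Tr μ W p) : IsCurl Ω k U' W' := by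
  have lU := loc_lpVec U
  have lW := loc_lpVec W
  have lη := loc_etaOf k lU
  have lζ := loc_zetaOf lW
  obtain ⟨a, b⟩ := (isCurl_iff lU lW).1 h
  refine isCurl_of hU hW ((g.wGrad_qi D.1.isOpen D.1.cvx hμ (lU 1)
    (lζ.add (lη.const_smul (-1))) a).congr D.1.meas (.of_forall fun _ _ => rfl)
    (.of_forall fun p _ => ?_)) (g.wRot_qi D.1.isOpen D.1.cvx hμ lη (loc_rotOf k lW) b)
  rw [qi1_comb hμ lζ lη (c := 1) (d := -1) (.of_forall fun p _ => by simp), one_smul]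

lemma isDiv_op (g : Geom Ω Tr φ C) (hμ : ∀ s ∈ Tr, ∀ v ∈ s, Probe Ω (μ v)) {W W' : L2rVec Ω} {f f' :
    L2r Ω} (h : IsDiv Ω k W f) (hW : ∀ᵐ p, p ∈ Ω → W' p = opC k Tr μ W p) (hf : ∀ᵐ p, p ∈ Ω → f' p =
    qi2 Tr μ f p) : IsDiv Ω k W' f' := by
  have lf := loc_lp f
  have lW := loc_lpVec W
  have ls := loc_rotOf k lW
  have b := (isDiv_iff lW lf).1 h
  refine isDiv_of hW hf ((g.wRot_qi D.1.isOpen D.1.cvx hμ (loc_zetaOf lW)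
    (ls.add (lf.const_smul (-1))) b).congr D.1.meas (.of_forall fun _ _ => rfl)
    (.of_forall fun p _ => ?_))
  rw [qi2_comb hμ ls lf (c := 1) (d := -1) (.of_forall fun p _ => by simp), one_smul]

lemma coe_confA {T : Mesh Ω} {R : Submodule ℝ (L2r Ω × L2rVec Ω)} (hR : ∀ x, x ∈ R ↔ IsGrad Ω k x.1
    x.2) : (conf T.tris (fun i : Fin 3 => polyA (Pi.single i 1)) R : Set (L2r Ω)) = spaceA k T := by
  ext u
  rw [SetLike.mem_coe, mem_conf, and_comm]
  refine and_congr (exists_congr fun w => hR _) ?_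
  change (∀ s ∈ T.tris, ∃ a : Fin 3 → ℝ, _) ↔ _
  simp only [sum_polyA, mem_tris]

lemma coe_confB {T : Mesh Ω} {R : Submodule ℝ (L2rVec Ω × L2rVec Ω)}
    (hR : ∀ x, x ∈ R ↔ IsCurl Ω k x.1 x.2) : (conf T.tris (fun i : Fin 6 => polyB k (Pi.single i
    1)) R : Set (L2rVec Ω)) = spaceB k T := by
  ext u
  rw [SetLike.mem_coe, mem_conf, and_comm]
  refine and_congr (exists_congr fun w => hR _) ?_
  change (∀ s ∈ T.tris, ∃ a : Fin 6 → ℝ, _) ↔ _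
  simp only [sum_polyB, mem_tris]

lemma coe_confC {T : Mesh Ω} {R : Submodule ℝ (L2rVec Ω × L2r Ω)}
    (hR : ∀ x, x ∈ R ↔ IsDiv Ω k x.1 x.2) : (conf T.tris (fun i : Fin 4 => polyC k (Pi.single i
    1)) R : Set (L2rVec Ω)) = spaceC k T := by
  ext u
  rw [SetLike.mem_coe, mem_conf, and_comm]
  refine and_congr (exists_congr fun w => hR _) ?_
  change (∀ s ∈ T.tris, ∃ a : Fin 4 → ℝ, _) ↔ _
  simp only [sum_polyC, mem_tris]

lemma coe_pwSub_one {T : Mesh Ω} : (pwSub Ω T.tris (fun (_ : Fin 1) _ => (1 : ℝ)) : Set (L2r Ω)) =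
    spaceD T := by
  ext u
  change (∀ s ∈ T.tris, ∃ a : Fin 1 → ℝ, _) ↔ ∀ s ∈ T.triangles, ∃ d : ℝ, _
  simp only [mem_tris, Finset.univ_unique, Finset.sum_singleton, smul_eq_mul, mul_one]
  refine forall₂_congr fun s _ => ⟨?_, ?_⟩
  · rintro ⟨a, ha⟩
    exact ⟨a default, ha⟩
  · rintro ⟨d, hd⟩
    exact ⟨fun _ => d, hd⟩

lemma exists_commutingProj {Ω : Set R2} {k : ℤ} (hΩ : IsMeridianDomain Ω) (hk : 1 ≤ |k|)
    (σ : ℝ) : ∃ M : ℝ, ∀ T : Mesh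
    Ω, T.ShapeRegular σ → ∃ (Pg : L2r Ω →L[ℝ] L2r Ω) (Pc Pd : L2rVec Ω →L[ℝ] L2rVec Ω)
    (Po : L2r Ω →L[ℝ] L2r Ω), IsCommutingProj k T M Pg Pc Pd Po := by
  haveI : Fact _ := ⟨hΩ⟩
  haveI : Fact _ := ⟨hk⟩
  by_cases hb : IsBounded Ω
  swap
  · exact ⟨0, fun T => absurd T.isBounded hb⟩
  have hc := cvConst_pos k
  have hc1 : 1 ≤ cvC k := by
    unfold cvC; nlinarith [sq_nonneg (|(k : ℝ)| + 1)]
  set κ : ℝ := 1 / (4 * cvC k) with hκ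
  have hκ0 : 0 < κ := by positivity
  have hκ1 : cvC k * κ ≤ 1 / 4 := by rw [hκ]; field_simp; norm_num
  have hκ2 : κ ≤ 1 / 4 := (le_mul_of_one_le_left hκ0.le hc1).trans hκ1
  obtain ⟨C, hC⟩ := ex_geom hΩ σ
  obtain ⟨K, hK, hq⟩ := ex_qiBound hb C hκ0
  refine ⟨2 * Real.sqrt (cvC k * K), fun T hT => ?_⟩
  obtain ⟨φ, g⟩ := hC T hT
  obtain ⟨μ, hμ, q1, q3⟩ := hq _ _ g
  obtain ⟨Rg, hRg, uRg⟩ := ex_gradRel (Ω := Ω) (k := k)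
  obtain ⟨Rc, hRc, uRc⟩ := ex_curlRel (Ω := Ω) (k := k)
  obtain ⟨Rd, hRd, uRd⟩ := ex_divRel (Ω := Ω) (k := k)
  obtain ⟨Mg, Pg, ig, ng, eg⟩ := ex_invProjA hb g hμ hK hκ0.le hκ1 q3 hRg
  obtain ⟨Mc, Pc, ic, nc, ec⟩ := ex_invProjB hb g hμ hK hκ0.le hκ1 q1 q3 hRc
  obtain ⟨Md, Pd, id, nd, ed⟩ := ex_invProjC hb g hμ hK hκ0.le hκ1 q1 q3 hRd
  obtain ⟨Mo, Po, io, no, eo⟩ := ex_invProjD hb g hμ hK hκ2 q1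
  refine ⟨Pg, Pc, Pd, Po, coe_confA hRg ▸ ig.proj, coe_confB hRc ▸ ic.proj, coe_confC hRd ▸ id.proj,
    coe_pwSub_one (Ω := Ω) ▸ io.proj, fun u w h => ?_, fun u w h => ?_, fun u w h => ?_, ng, nc, nd,
    no.trans ?_⟩
  · exact (hRg _).1 (ig.comm ic (fun v hv => (mem_conf.1 hv).2) uRg (fun x hx => (hRg _).2
      (isGrad_op g hμ ((hRg _).1 hx) (eg _) (ec _))) ((hRg (u, w)).2 h))
  · exact (hRc _).1 (ic.comm id (fun v hv => (mem_conf.1 hv).2) uRc (fun x hx => (hRc _).2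
      (isCurl_op g hμ ((hRc _).1 hx) (ec _) (ed _))) ((hRc (u, w)).2 h))
  · exact (hRd _).1 (id.comm io (fun v hv => (mem_conf.1 hv).2) uRd (fun x hx => (hRd _).2
      (isDiv_op g hμ ((hRd _).1 hx) (ed _) (eo _))) ((hRd (u, w)).2 h))
  · have := le_mul_of_one_le_left hK hc1
    gcongr

end comm

/-! ### A weighted Poincaré inequality -/

section poincare

lemma enorm_seg_sq_le (hG : Measurable G) {x y : R2} {ℓ : ℝ} (h : ‖y - x‖ ≤ ℓ) : ‖seg G x y‖ₑ ^
    2 ≤ ofReal (4 * ℓ ^ 2) * ∫⁻ t in I01, ‖G (x + t • (y - x))‖ₑ ^ 2 := by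
  have hℓ : 0 ≤ ℓ := (norm_nonneg _).trans h
  have hm : Measurable fun t : ℝ => G (x + t • (y - x)) := hG.comp (by fun_prop)
  have key : ∀ (c : ℝ) (f : ℝ → ℝ), |c| ≤ ℓ → (∀ t, ‖f t‖ ≤ ‖G (x + t • (y - x))‖) →
      ‖c * ∫ t in I01, f t‖ₑ ≤ ofReal ℓ *
        ∫⁻ t in I01, ‖G (x + t • (y - x))‖ₑ := by
    intro c f hc hf
    rw [enorm_mul]
    refine mul_le_mul' ?_ ((enorm_integral_le_lintegral_enorm _).trans (lintegral_mono fun t =>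
      enorm_le_iff_norm_le.2 (hf t)))
    rw [← ofReal_norm]
    exact ofReal_le_ofReal hc
  have h1 : ‖seg G x y‖ₑ ≤ ofReal (2 * ℓ) *
      ∫⁻ t in I01, ‖G (x + t • (y - x))‖ₑ := by
    refine (enorm_add_le _ _).trans ((add_le_add (key _ _ ((norm_fst_le _).trans h)
      fun t => norm_fst_le _) (key _ _ ((norm_snd_le _).trans h) fun t => norm_snd_le _)).trans_eq ?_)
    rw [ofReal_mul (by norm_num), ofReal_ofNat]; ring
  calc _ ≤ (ofReal (2 * ℓ) * ∫⁻ t in I01, ‖G (x + t • (y - x))‖ₑ) ^ 2 := by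
        gcongr
    _ ≤ _ := by
        rw [mul_pow, ← ofReal_pow (by positivity)]
        refine mul_le_mul' (le_of_eq (by ring_nf)) (lint_sq_le (by simp) hm.enorm.aemeasurable)

lemma Near.lint_seg_le (g : Geom Ω Tr φ C) (hs : s ∈ Tr)
    (ha : 0 < a) (n : Near Ω C A a s μ) (α : ℕ) {F : R2 → ENNReal} (hF : Measurable F) {t : ℝ}
    (ht : t ∈ I01) : ∫⁻ p in hull s, ∫⁻ y, F (p + t • (y - p)) * ofReal (p.1 ^ α) ∂μ ≤
    ofReal (9 * 2 ^ α + 36 * |A| * (2 / a) ^ α) * ∫⁻ p in patch Tr s, F p * ofReal (p.1 ^ α) := by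
  have := n.prob
  have hd := g.spos hs
  have hρ := g.rho_pos hs
  have hsm := mset_hull s
  set f' : R2 → ENNReal := (patch Tr s).indicator fun p => F p * ofReal (p.1 ^ α) with hf'
  have hm : Measurable f' := Measurable.indicator (by fun_prop) (mset_patch Tr s)
  rw [← lintegral_indicator (mset_patch Tr s), ← hf']
  have hmm : Measurable fun z : R2 × R2 => f' (z.1 + t • (z.2 - z.1)) :=
    hm.comp (by fun_prop)
  have key : ∀ m : ℝ, (∀ p y : R2, 0 ≤ p.1 → p.1 ≤ rho s → a * rho s ≤ y.1 →
      p.1 ≤ m * (p + t • (y - p)).1) → 0 ≤ m →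
      ∫⁻ p in hull s, ∫⁻ y, F (p + t • (y - p)) * ofReal (p.1 ^ α) ∂μ ≤
      ∫⁻ p in hull s, ∫⁻ y, ofReal (m ^ α) * f' (p + t • (y - p)) ∂μ := by
    intro m h hm0
    refine lintegral_mono_ae ((ae_restrict_iff' hsm).2 ?_)
    filter_upwards [g.ae_hull hs] with p hp hps
    refine lintegral_mono_ae ?_
    filter_upwards [n.zone, n.rad] with y hy1 hy2
    have hpz := g.hull_zone hs (hp hps).1
    have hq := (cvx_zone D.1.cvx g.pos.le s).add_smul_sub_mem hpz hy1 ht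
    have h0 := g.hull_fst hs hps
    rw [hf', indicator_of_mem (g.zone_sub hs hq), mul_comm (ofReal (m ^ α)), mul_assoc]
    refine mul_le_mul' le_rfl ?_
    have := h p y h0.1 h0.2 hy2
    have := h0.1
    rw [mul_comm, ← ofReal_mul (by positivity), ← mul_pow]
    exact ofReal_le_ofReal (by gcongr)
  rcases le_total t (1 / 2) with h2 | h2
  · refine (key 2 (fun p y h0 _ hy => ?_) (by norm_num)).trans ?_
    · have : 0 ≤ y.1 := (by positivity : 0 ≤ a * rho s).trans hy
      simp only [Prod.fst_add, smul_fst, fst_sub, smul_eq_mul]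
      nlinarith [ht.1]
    · rw [lintegral_lintegral_swap (hmm.const_mul _).aemeasurable]
      calc _ ≤ ∫⁻ y, ofReal (2 ^ α) * (9 * ∫⁻ p, f' p) ∂μ := by
            refine lintegral_mono fun y => ?_
            rw [lintegral_const_mul' _ _ ofReal_ne_top]
            refine mul_le_mul' le_rfl ((setLIntegral_le_lintegral _ _).trans ?_)
            refine le_trans (le_of_eq ?_) (lint_comp_smul_add_le hm (t := 1 - t)
              (by linarith) (t • y))
            refine lintegral_congr fun p => ?_
            congr 1; ext <;> simp <;> ring
        _ = ofReal (9 * 2 ^ α) * ∫⁻ p, f' p := by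
            rw [lintegral_const, measure_univ, mul_one, ofReal_mul (by norm_num),
              ofReal_ofNat]; ring
        _ ≤ _ := mul_le_mul' (ofReal_le_ofReal (le_add_of_nonneg_right (by positivity))) le_rfl
  · refine (key (2 / a) (fun p y h0 h1 hy => ?_) (by positivity)).trans ?_
    · have h3 : rho s / 2 * a ≤ (p + t • (y - p)).1 := by
        simp only [Prod.fst_add, smul_fst, fst_sub, smul_eq_mul]
        nlinarith [ht.2, mul_nonneg ha.le hρ.le]
      calc p.1 ≤ 2 / a * (rho s / 2 * a) := by rw [show 2 / a * (rho s / 2 * a) = rho s by field_simp]; exact h1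
        _ ≤ _ := by gcongr
    · calc _ ≤ ∫⁻ p in hull s, ofReal ((2 / a) ^ α) *
            (ofReal (A / dK s ^ 2) * (9 * ∫⁻ p, f' p)) := by
            refine lintegral_mono fun p => ?_
            rw [lintegral_const_mul' _ _ ofReal_ne_top]
            refine mul_le_mul' le_rfl ((lintegral_mono' n.dens le_rfl).trans ?_)
            rw [lintegral_smul_measure]
            refine mul_le_mul' le_rfl (le_trans (le_of_eq ?_) (lint_comp_smul_add_le hm (t := t)
              (by linarith) ((1 - t) • p)))
            refine lintegral_congr fun y => ?_
            congr 1; ext <;> simp <;> ring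
        _ ≤ ofReal ((2 / a) ^ α) * (ofReal (|A| / dK s ^ 2) *
            (9 * ∫⁻ p, f' p)) * ofReal (4 * dK s ^ 2) := by
            rw [setLIntegral_const]
            gcongr
            · exact le_abs_self A
            · exact g.vol_hull_le hs
        _ = ofReal (36 * |A| * (2 / a) ^ α) * ∫⁻ p, f' p := by
            have : ofReal (36 * |A| * (2 / a) ^ α) = ofReal ((2 / a) ^ α) *
                (ofReal (|A| / dK s ^ 2) * 9) * ofReal (4 * dK s ^ 2) := by
              rw [← ofReal_ofNat 9, ← ofReal_mul (by positivity),
                ← ofReal_mul (by positivity), ← ofReal_mul (by positivity)]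
              congr 1; field_simp; ring
            rw [this]; ring
        _ ≤ _ := mul_le_mul' (ofReal_le_ofReal (le_add_of_nonneg_left (by positivity))) le_rfl

lemma lint_rotate {X Y Z : Type*} [MeasurableSpace X] [MeasurableSpace Y] [MeasurableSpace Z]
    {μ : Measure X} {ν : Measure Y} {τ : Measure Z} [SFinite μ] [SFinite ν] [SFinite τ]
    {F : (X × Y) × Z → ENNReal} (hF : Measurable F) : ∫⁻ x, ∫⁻ y, ∫⁻ t, F ((x, y), t) ∂τ ∂ν ∂μ = ∫⁻
    t, ∫⁻ x, ∫⁻ y, F ((x, y), t) ∂ν ∂μ ∂τ := by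
  rw [← lintegral_prod (fun z : X × Y => ∫⁻ t, F (z, t) ∂τ) hF.lintegral_prod_right'.aemeasurable,
    lintegral_lintegral_swap (f := fun z t => F (z, t)) hF.aemeasurable]
  exact lintegral_congr fun t => lintegral_prod (fun z => F (z, t))
    (hF.comp measurable_prodMk_right).aemeasurable

lemma Near.poincare (g : Geom Ω Tr φ C) (hs : s ∈ Tr)
    (ha : 0 < a) (n : Near Ω C A a s μ) (P : Probe Ω μ) (α : ℕ) (lf : LocInt Ω f) (lG : LocInt Ω G)
    (h : WGrad Ω f G) : wE α (fun p => f p - avg0 μ f) (hull s) ≤ ofReal (4 * (3 * dK s) ^ 2) *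
    (ofReal (9 * 2 ^ α + 36 * |A| * (2 / a) ^ α) * wE α G (patch Tr s)) := by
  have := n.prob
  have hac : (volume : Measure R2).prod (μ.prod μ) ≪ (volume : Measure Tri3) :=
    Measure.AbsolutelyContinuous.rfl.prod (P.ac.prod P.ac)
  have h1 := Measure.ae_ae_of_ae_prod (hac.ae_le (ae_sub_eq_seg_triple D.1.isOpen D.1.cvx lf lG h))
  have hF : Measurable fun p => ‖G p‖ₑ ^ 2 := lG.meas.enorm.pow_const 2
  set T : Measure ℝ := volume.restrict I01
  have hm : Measurable fun q : (R2 × R2) × ℝ =>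
      ‖G (q.1.1 + q.2 • (q.1.2 - q.1.1))‖ₑ ^ 2 * ofReal (q.1.1.1 ^ α) :=
    (hF.comp (by fun_prop)).mul (by fun_prop)
  have b1 : wE α (fun p => f p - avg0 μ f) (hull s) ≤ ∫⁻ p in hull s,
      ofReal (4 * (3 * dK s) ^ 2) * ∫⁻ y, ∫⁻ t, ‖G (p + t • (y - p))‖ₑ ^ 2 *
        ofReal (p.1 ^ α) ∂T ∂μ := by
    refine lintegral_mono_ae ((ae_restrict_iff' (mset_hull s)).2 ?_)
    filter_upwards [h1, g.ae_hull hs] with p hp1 hp2 hps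
    have hpΩ := (hp2 hps).2
    have hpz := g.hull_zone hs (hp2 hps).1
    have e1 : ∀ᵐ y ∂μ, f y - f p - seg G p y = 0 := by
      filter_upwards [Measure.ae_ae_of_ae_prod hp1, P.ae_mem] with y hy hyΩ
      obtain ⟨w, hw, hwΩ⟩ := (hy.and P.ae_mem).exists
      exact hw ⟨hpΩ, hyΩ, hwΩ⟩
    have e2 : f p - avg0 μ f = ∫ y, (f p - f y) ∂μ := by
      rw [integral_sub (integrable_const _) (P.integrable D.1.cvx lf)]; simp [avg0]
    have e3 : ‖f p - avg0 μ f‖ₑ ^ 2 ≤ ∫⁻ y, ‖seg G p y‖ₑ ^ 2 ∂μ := by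
      rw [e2]
      refine (pow_le_pow_left' (enorm_integral_le_lintegral_enorm _) 2).trans
        ((lint_sq_le (by simp) (measurable_const.sub lf.meas).enorm.aemeasurable).trans_eq
        (lintegral_congr_ae ?_))
      filter_upwards [e1] with y hy
      rw [Pi.sub_apply, enorm_sub_rev, show f y - f p = seg G p y by linarith]
    rw [← lintegral_const_mul' _ _ ofReal_ne_top]
    refine (mul_le_mul' e3 le_rfl).trans ?_
    rw [← lintegral_mul_const' _ _ ofReal_ne_top]
    refine lintegral_mono_ae ?_
    filter_upwards [n.zone] with y hy
    rw [lintegral_mul_const' _ _ ofReal_ne_top, ← mul_assoc]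
    exact mul_le_mul' (enorm_seg_sq_le lG.meas (dist_le_of_zone g.one_le hpz hy)) le_rfl
  refine b1.trans ?_
  rw [lintegral_const_mul' _ _ ofReal_ne_top]
  refine mul_le_mul' le_rfl ?_
  have b2 : ∫⁻ p in hull s, ∫⁻ y, ∫⁻ t, ‖G (p + t • (y - p))‖ₑ ^ 2 * ofReal (p.1 ^ α) ∂T ∂μ =
      ∫⁻ t, (∫⁻ p in hull s, ∫⁻ y, ‖G (p + t • (y - p))‖ₑ ^ 2 * ofReal (p.1 ^ α) ∂μ) ∂T := lint_rotate hm
  rw [b2]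
  calc _ ≤ ∫⁻ _, ofReal (9 * 2 ^ α + 36 * |A| * (2 / a) ^ α) * wE α G (patch Tr s) ∂T :=
        lintegral_mono_ae ((ae_restrict_iff' measurableSet_Icc).2 (.of_forall fun t ht =>
          n.lint_seg_le g hs ha α hF ht))
    _ = _ := by simp [T]

end poincare

/-! ### Approximation by interpolation of local averages -/

section approx

variable {μ : R2 → Measure R2}

lemma wE_le_sum {ι : Type*} (S : Finset ι) {f : R2 → E} {h : ι → R2 → F} {B : Set R2} (hB :
    MeasurableSet B) {m : ℝ} (hm : 0 ≤ m) (hh : ∀ i ∈ S, Measurable fun p => ‖h i p‖ₑ) (e : ∀ᵐ p, p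
    ∈ B → ∃ i ∈ S, ‖f p‖ ≤ m * ‖h i p‖) : wE α f B ≤ ofReal (m ^ 2) * ∑ i ∈ S, wE α (h i) B := by
  unfold wE
  rw [← lintegral_finsetSum (f := fun i p => ‖h i p‖ₑ ^ 2 * ofReal (p.1 ^ α)) S fun i hi =>
      ((hh i hi).pow_const 2).mul (by fun_prop),
    ← lintegral_const_mul' _ _ ofReal_ne_top]
  refine lintegral_mono_ae ((ae_restrict_iff' hB).2 ?_)
  filter_upwards [e] with p hp hpB
  obtain ⟨i, hi, h1⟩ := hp hpB
  refine le_trans ?_ (mul_le_mul' le_rfl (Finset.single_le_sum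
    (f := fun i => ‖h i p‖ₑ ^ 2 * ofReal (p.1 ^ α)) (fun _ _ => zero_le) hi))
  rw [← mul_assoc]
  refine mul_le_mul' ?_ le_rfl
  rw [← ofReal_norm, ← ofReal_norm, ofReal_pow hm, ← mul_pow, ← ofReal_mul hm]
  exact pow_le_pow_left' (ofReal_le_ofReal h1) 2

lemma wE_prod_le {f : R2 → E} {h : R2 → F} {B : Set R2} (hf : Measurable fun p => ‖f p‖ₑ) : wE α
    (fun p => (f p, h p)) B ≤ wE α f B + wE α h B := by
  unfold wE
  rw [← lintegral_add_left (f := fun p => ‖f p‖ₑ ^ 2 * ofReal (p.1 ^ α))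
    ((hf.pow_const 2).mul (by fun_prop))]
  refine lintegral_mono fun p => ?_
  rw [← add_mul]
  refine mul_le_mul' ?_ le_rfl
  rw [show ‖(f p, h p)‖ₑ = max ‖f p‖ₑ ‖h p‖ₑ from rfl]
  rcases max_choice ‖f p‖ₑ ‖h p‖ₑ with h | h <;> rw [h]
  · exact le_add_right le_rfl
  · exact le_add_left le_rfl

/-- The constant of the local Poincaré inequality. -/
def poinC (A a : ℝ) (α : ℕ) : ℝ := 9 * 2 ^ α + 36 * |A| * (2 / a) ^ α

lemma poin_nn (ha : 0 < a) (α : ℕ) : 0 ≤ poinC A a α := by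
  unfold poinC; positivity

lemma Samp.sum_poin (g : Geom Ω Tr φ C) (ha : 0 < a) (S : Samp Ω Tr C A a ε μ) {H : ℝ} (hH : ∀ s ∈
    Tr, dK s ≤ H) (α : ℕ) (lf : LocInt Ω f) (lG : LocInt Ω G) (h : WGrad Ω f G) (hs : s ∈ Tr) : ∑ v
    ∈ s, wE α (fun p => f p - avg0 (μ v) f) (hull s) ≤ ofReal (108 * H ^ 2 * poinC A a α) * wE α G
    (patch Tr s) := by
  have hh := g.spos hs
  have h1 := hH s hs
  refine (Finset.sum_le_card_nsmul s _ _ fun v hv => ((S.near s hs v hv).poincare g hs ha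
    (S.probe s hs v hv) α lf lG h)).trans ?_
  rw [(g.isTri s hs).1, nsmul_eq_mul, ← mul_assoc, ← mul_assoc, Nat.cast_ofNat,
    ← ofReal_ofNat 3, ← ofReal_mul (by norm_num), ← ofReal_mul (by positivity)]
  refine mul_le_mul' (ofReal_le_ofReal (mul_le_mul_of_nonneg_right ?_
    (poin_nn ha α))) le_rfl
  nlinarith

lemma Samp.wE_sub_loc0 (g : Geom Ω Tr φ C) (ha : 0 < a) (S : Samp Ω Tr C A a ε μ) {H : ℝ} (hH : ∀ s
    ∈ Tr, dK s ≤ H) (α : ℕ) (lf : LocInt Ω f) (lG : LocInt Ω G) (h : WGrad Ω f G) : wE α (fun p => f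
    p - pw Tr (loc0 fun v => avg0 (μ v) f) p) Ω ≤ ofReal (3 * C) * ofReal (108 * H ^ 2 * poinC A a
    α) * wE α G Ω := by
  refine g.wE_le_of_patch fun s hs => ?_
  refine le_trans ?_ (S.sum_poin g ha hH α lf lG h hs)
  have ht := g.isTri s hs
  have hne := ht.nonempty
  have := wE_le_sum s (α := α) (f := fun p => f p - pw Tr (loc0 fun v => avg0 (μ v) f) p)
    (h := fun v p => f p - avg0 (μ v) f) (mset_hull s) zero_le_one
    (fun v _ => (lf.meas.sub_const _).enorm) (by
      filter_upwards [g.pw_eq (loc0 fun v => avg0 (μ v) f)] with p hp hps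
      obtain ⟨v, hv, hmax⟩ := s.exists_max_image (fun v => |f p - avg0 (μ v) f|) hne
      refine ⟨v, hv, ?_⟩
      have e : f p - loc0 (fun v => avg0 (μ v) f) s p = loc0 (fun v => f p - avg0 (μ v) f) s p := by
        simp only [loc0, sub_mul, sum_sub_distrib, ← mul_sum, ht.sum_lam, mul_one]
      rw [(hp s hs hps).2, e, one_mul]
      exact ht.abs_loc0_le hmax hps)
  simpa using this

lemma Samp.wE_sub_loc1 (g : Geom Ω Tr φ C) (ha : 0 < a) (S : Samp Ω Tr C A a ε μ) {H : ℝ} (hH : ∀ s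
    ∈ Tr, dK s ≤ H) (α : ℕ) {f₁ f₂ : R2 → ℝ} {G₁ G₂ : R2 → R2} (lf₁ : LocInt Ω f₁) (lf₂ : LocInt Ω
    f₂) (lG₁ : LocInt Ω G₁) (lG₂ : LocInt Ω G₂) (h₁ : WGrad Ω f₁ G₁) (h₂ : WGrad Ω f₂ G₂) : wE α
    (fun p => (f₁ p, f₂ p) - pw Tr (loc1 fun v w => pdot (avg0 (μ v) f₁, avg0 (μ v) f₂) (w - v)) p)
    Ω ≤ ofReal (3 * C) * (ofReal ((36 * C) ^ 2) * ofReal (108 * H ^ 2 * poinC A a α)) * wE α (fun p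
    => (G₁ p, G₂ p)) Ω := by
  refine g.wE_le_of_patch fun s hs => ?_
  have ht := g.isTri s hs
  have hC := g.pos
  have hh := g.spos hs
  have hne := ht.nonempty
  set c : R2 → R2 := fun v => (avg0 (μ v) f₁, avg0 (μ v) f₂)
  have hm : ∀ v, Measurable fun p => f₁ p - avg0 (μ v) f₁ := fun v => lf₁.meas.sub_const _
  have hm' : ∀ v, Measurable fun p => f₂ p - avg0 (μ v) f₂ := fun v => lf₂.meas.sub_const _
  refine (wE_le_sum s (h := fun v p => (f₁ p - avg0 (μ v) f₁, f₂ p - avg0 (μ v) f₂))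
    (m := 18 * C) (mset_hull s) (by positivity)
    (fun v _ => ((hm v).prodMk (hm' v)).enorm) ?_).trans ?_
  · filter_upwards [g.pw_eq (loc1 fun v w => pdot (c v) (w - v))] with p hp hps
    obtain ⟨v, hv, hmax⟩ := s.exists_max_image (fun v => ‖(f₁ p, f₂ p) - c v‖) hne
    refine ⟨v, hv, ?_⟩
    have e : (f₁ p, f₂ p) - loc1 (fun v w => pdot (c v) (w - v)) s p =
        loc1 (fun v w => pdot ((f₁ p, f₂ p) - c v) (w - v)) s p := by
      have := ht.sum_whit_ndf (f₁ p, f₂ p) 0 p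
      simp only [ndf, zero_mul, sub_zero, add_zero] at this
      refine (congrArg (· - loc1 (fun v w => pdot (c v) (w - v)) s p) this.symm).trans ?_
      rw [loc1, loc1, ← sum_sub_distrib]
      refine sum_congr rfl fun v _ => ?_
      rw [← sum_sub_distrib]
      refine sum_congr rfl fun w _ => ?_
      rw [← sub_smul]
      congr 1
      simp [pdot]; ring
    rw [(hp s hs hps).2, e]
    refine (g.norm_loc1_le hs (m := 2 * ‖(f₁ p, f₂ p) - c v‖ * dK s) (fun x hx y hy =>
      (abs_pdot_le _ _).trans ?_) hps).trans_eq (by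
        change _ = 18 * C * ‖(f₁ p, f₂ p) - c v‖
        field_simp; ring)
    have h1 := hmax x hx
    have h2 := norm_sub_le_diam (s := s) (sub_hull hy) (sub_hull hx)
    gcongr
  · have h3 : ∑ v ∈ s, wE α (fun p => (f₁ p - avg0 (μ v) f₁, f₂ p - avg0 (μ v) f₂)) (hull s) ≤
        2 * (ofReal (108 * H ^ 2 * poinC A a α) *
          wE α (fun p => (G₁ p, G₂ p)) (patch Tr s)) := by
      refine (Finset.sum_le_sum fun v _ => wE_prod_le (hm v).enorm).trans ?_
      rw [sum_add_distrib, two_mul]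
      refine add_le_add ((S.sum_poin g ha hH α lf₁ lG₁ h₁ hs).trans ?_)
        ((S.sum_poin g ha hH α lf₂ lG₂ h₂ hs).trans ?_)
      · exact mul_le_mul' le_rfl (wE_mono_norm (mset_patch Tr s)
          (.of_forall fun p _ => norm_fst_le (G₁ p, G₂ p)))
      · exact mul_le_mul' le_rfl (wE_mono_norm (mset_patch Tr s)
          (.of_forall fun p _ => norm_snd_le (G₁ p, G₂ p)))
    refine (mul_le_mul' le_rfl h3).trans ?_
    rw [← mul_assoc, ← mul_assoc]
    refine mul_le_mul' (mul_le_mul' ?_ le_rfl) le_rfl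
    rw [← ofReal_ofNat 2, ← ofReal_mul (by positivity)]
    exact ofReal_le_ofReal (by nlinarith [sq_nonneg C])

end approx

/-! ### Weighted norms and weak derivatives -/

section norms

lemma sq_wNorm (α : ℤ) (hf : MemLp f 2 (wMeasure Ω α)) :
    ∫⁻ p in Ω, ‖f p‖ₑ ^ 2 * ofReal (p.1 ^ α) = ofReal (wNorm Ω α f ^ 2) := by
  have h1 : Integrable (fun p => p.1 ^ α * f p ^ 2) (volume.restrict Ω) := by
    have h := hf.integrable_sq
    rw [wMeasure, integrable_withDensity_iff_integrable_smul' (by fun_prop) (by simp)] at h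
    refine h.congr ((ae_restrict_iff' D.1.meas).2 (.of_forall fun p hp => ?_))
    simp only [smul_eq_mul]
    rw [ENNReal.toReal_ofReal (zpow_pos (D.1.pos p hp) α).le]
  have h2 : 0 ≤ᵐ[volume.restrict Ω] fun p => f p ^ 2 * p.1 ^ α :=
    (ae_restrict_iff' D.1.meas).2 (.of_forall fun p hp =>
      mul_nonneg (sq_nonneg _) (zpow_pos (D.1.pos p hp) α).le)
  rw [wNorm, Real.sq_sqrt (integral_nonneg_of_ae h2), ofReal_integral_eq_lintegral_ofReal
    (h1.congr (.of_forall fun p => mul_comm _ _)) h2]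
  refine lintegral_congr fun p => ?_
  rw [ofReal_mul (sq_nonneg _), ← ofReal_norm, ← ofReal_pow (norm_nonneg _),
    norm_eq_abs, sq_abs]

lemma ex_wD {e : R2} (h : ∃ g, IsWeakDeriv Ω e f g ∧ MemLp g 2 (wm Ω)) : ∃ u : L2r Ω, (∀ χ, IsTest Ω
    χ → ∫ p in Ω, u p * χ p = -∫ p in Ω, f p * fderiv ℝ χ p e) ∧ wE 1 u Ω = ofReal (wNorm Ω 1
    (weakDeriv Ω e f) ^ 2) := by
  obtain ⟨g, hg, mg⟩ := h
  have hd : IsWeakDeriv Ω e f (weakDeriv Ω e f) := by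
    have hex : ∃ g, IsWeakDeriv Ω e f g := ⟨g, hg⟩
    rw [weakDeriv, dif_pos hex]
    exact hex.choose_spec
  have e1 := ae_eq_of_test D.1.isOpen hg.2.1 hd.2.1 fun χ hχ => (hg.2.2 χ hχ).trans (hd.2.2 χ hχ).symm
  have md : MemLp (weakDeriv Ω e f) 2 (wm Ω) :=
    (memLp_congr_ae ((ae_w_iff 1).2 e1)).1 mg
  have e2 := (ae_w_iff 1).1 md.coeFn_toLp
  refine ⟨md.toLp, fun χ hχ => ?_, ?_⟩
  · rw [← hd.2.2 χ hχ]
    exact setIntegral_congr_ae D.1.meas (by filter_upwards [e2] with p h hp; rw [h hp])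
  · rw [wE_congr e2, ← sq_wNorm 1 md]
    simp [wE]

lemma MemH1.ex_grad (h : MemH1 Ω f) : ∃ G : R2 → R2,
    LocInt Ω G ∧ WGrad Ω f G ∧ wE 1 G Ω ≤ ofReal (h1Seminorm Ω f ^ 2) := by
  obtain ⟨u, hu, nu⟩ := ex_wD h.2.1
  obtain ⟨w, hw, nw⟩ := ex_wD h.2.2
  have lu := loc_lp u
  refine ⟨fun p => (u p, w p), lu.prodMk (loc_lp w), fun χ hχ => ⟨hu χ hχ, hw χ hχ⟩,
    (wE_prod_le lu.meas.enorm).trans_eq ?_⟩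
  rw [nu, nw, ← ofReal_add (by positivity) (by positivity), h1Seminorm,
    Real.sq_sqrt (by positivity)]

lemma IsWeakDeriv.comb {e : R2} {f' g' : R2 → ℝ} (h : IsWeakDeriv Ω e f f') (h' : IsWeakDeriv Ω e g
    g') (c d : ℝ) : IsWeakDeriv Ω e (fun p => c * f p + d * g p) fun p => c * f' p + d * g' p := by
  have hl : ∀ {f g : R2 → ℝ}, LocallyIntegrableOn f Ω → LocallyIntegrableOn g Ω →
      LocallyIntegrableOn (fun p => c * f p + d * g p) Ω := fun hf hg => (hf.smul c).add (hg.smul d)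
  have hi : ∀ {f g χ : R2 → ℝ}, LocallyIntegrableOn f Ω → LocallyIntegrableOn g Ω →
      IsTest Ω χ → ∫ p in Ω, (c * f p + d * g p) * χ p =
        c * (∫ p in Ω, f p * χ p) + d * ∫ p in Ω, g p * χ p := fun hf hg hχ => by
    simp only [add_mul, mul_assoc]
    rw [integral_add ((hχ.intOn_mul hf).const_mul c) ((hχ.intOn_mul hg).const_mul d),
      integral_const_mul, integral_const_mul]
  refine ⟨hl h.1 h'.1, hl h.2.1 h'.2.1, fun χ hχ => ?_⟩
  rw [hi h.2.1 h'.2.1 hχ, hi h.1 h'.1 (hχ.fd_test e), h.2.2 χ hχ, h'.2.2 χ hχ]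
  ring

lemma MemH1.comb (hf : MemH1 Ω f) (hg : MemH1 Ω g) (c d : ℝ) : MemH1 Ω fun p => c * f p + d * g
    p := by
  have hm : ∀ {f g : R2 → ℝ}, MemLp f 2 (wm Ω) → MemLp g 2 (wm Ω) →
      MemLp (fun p => c * f p + d * g p) 2 (wm Ω) := fun hf hg =>
    (hf.const_mul c).add (hg.const_mul d)
  obtain ⟨h0, ⟨f₁, h1, m1⟩, f₂, h2, m2⟩ := hf
  obtain ⟨h0', ⟨g₁, h1', m1'⟩, g₂, h2', m2'⟩ := hg
  exact ⟨hm h0 h0', ⟨_, h1.comb h1' c d, hm m1 m1'⟩, _, h2.comb h2' c d, hm m2 m2'⟩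

lemma MemH1.ex_grad_div {y : R2 → ℝ}
    (ly : LocInt Ω y) (h : MemH1 Ω y) (hy : MemLp y 2 (wMeasure Ω (-1))) : ∃ G : R2 → R2, LocInt Ω
    G ∧ WGrad Ω (fun p => y p / p.1) G ∧ wE 3 G Ω ≤ ofReal (2 * h1TildeNorm Ω y ^ 2) := by
  obtain ⟨G, lG, hG, nG⟩ := h.ex_grad
  have hr := radMul_inv (Ω := Ω)
  refine ⟨fun p => p.1⁻¹ • G p + (-(p.1 ^ 2)⁻¹ * y p, 0), ?_,
    (hG.mul hr ly lG).congr D.1.meas (.of_forall fun p _ => by rw [div_eq_inv_mul])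
      (.of_forall fun _ _ => rfl), ?_⟩
  · refine (RadMul.locInt (a := fun p => p.1⁻¹) ?_ (by fun_prop) D.1.isOpen lG).add (LocInt.prodMk
      (RadMul.locInt (a := fun p => -(p.1 ^ 2)⁻¹) ?_ (by fun_prop) D.1.isOpen ly)
      (LocInt.of_cont continuous_const))
    · exact continuousOn_fst.inv₀ fun p hp => (D.1.pos p hp).ne'
    · exact ((continuousOn_fst.pow 2).inv₀ fun p hp => (pow_pos (D.1.pos p hp) 2).ne').neg
  · have hm : Measurable fun p => ‖G p‖ₑ ^ 2 * ofReal (p.1 ^ 1) :=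
      (lG.meas.enorm.pow_const 2).mul (by fun_prop)
    calc _ ≤ ∫⁻ p in Ω, 2 * (‖G p‖ₑ ^ 2 * ofReal (p.1 ^ 1) +
          ‖y p‖ₑ ^ 2 * ofReal (p.1 ^ (-1 : ℤ))) := by
          refine lintegral_mono_ae ((ae_restrict_iff' D.1.meas).2 (.of_forall fun p hp => ?_))
          have h0 := D.1.pos p hp
          have h1 : ‖p.1⁻¹ • G p + (-(p.1 ^ 2)⁻¹ * y p, (0 : ℝ))‖ ≤
              p.1⁻¹ * ‖G p‖ + (p.1 ^ 2)⁻¹ * ‖y p‖ := by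
            refine norm_add_le_of_le ?_ ?_
            · rw [norm_smul, norm_of_nonneg (by positivity)]
            · rw [Prod.norm_mk, norm_mul, norm_neg, norm_of_nonneg (by positivity), norm_zero,
                max_eq_left (by positivity)]
          simp only [← ofReal_norm]
          rw [← ofReal_ofNat 2, ← ofReal_pow (norm_nonneg _),
            ← ofReal_pow (norm_nonneg _), ← ofReal_pow (norm_nonneg _),
            ← ofReal_mul (by positivity), ← ofReal_mul (by positivity),
            ← ofReal_mul (by positivity), ← ofReal_add (by positivity) (by positivity),
            ← ofReal_mul (by norm_num)]
          refine ofReal_le_ofReal ?_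
          calc _ ≤ (p.1⁻¹ * ‖G p‖ + (p.1 ^ 2)⁻¹ * ‖y p‖) ^ 2 * p.1 ^ 3 := by gcongr
            _ ≤ 2 * ((p.1⁻¹ * ‖G p‖) ^ 2 + ((p.1 ^ 2)⁻¹ * ‖y p‖) ^ 2) * p.1 ^ 3 := by
                gcongr; exact add_sq_le
            _ = _ := by rw [zpow_neg_one]; field_simp
      _ = 2 * (wE 1 G Ω + ofReal (wNorm Ω (-1) y ^ 2)) := by
          rw [lintegral_const_mul' _ _ (by simp), lintegral_add_left hm, sq_wNorm (-1) hy]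
          rfl
      _ ≤ _ := by
          rw [ofReal_mul zero_le_two, ofReal_ofNat]
          refine mul_le_mul' le_rfl ((add_le_add nG le_rfl).trans ?_)
          rw [← ofReal_add (by positivity) (by positivity), h1TildeNorm,
            Real.sq_sqrt (by positivity)]
          exact ofReal_le_ofReal (by nlinarith [sq_nonneg (wNorm Ω 1 y)])

end norms

section estimate

lemma Mesh.diam_le_size (T : Mesh Ω) (hs : s ∈ T.triangles) : dK s ≤ T.size :=
  le_csSup ((T.finite.subset fun _ h => h.1).image _).bddAbove ⟨s, hs, rfl⟩

lemma Mesh.size_nn (T : Mesh Ω) : 0 ≤ T.size :=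
  Real.sSup_nonneg (by rintro _ ⟨s, -, rfl⟩; exact diam_nn s)

lemma ex_B_apx (hb : IsBounded Ω)
    (σ : ℝ) : ∃ K : ℝ, 0 ≤ K ∧ ∀ T : Mesh Ω, T.ShapeRegular σ → ∀ v : L2rVec Ω, MemH1Diamond Ω k v →
    ∃ w ∈ spaceB k T, ‖v - w‖ ≤ K * T.size * (h1Seminorm Ω (fun p => v p 1) + h1TildeNorm Ω (fun p
    => (k : ℝ) * v p 2) + h1TildeNorm Ω (fun p => (k : ℝ) * v p 0 + v p 1)) := by
  obtain ⟨C, hC⟩ := ex_geom D.1 σ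
  obtain ⟨A, a, ha, hS⟩ := ex_samp D.1 hb C zero_lt_one le_rfl
  set K₁ : ℝ := 3 * |C| * (108 * poinC A a 1)
  set K₃ : ℝ := 3 * |C| * ((36 * C) ^ 2 * (108 * poinC A a 3)) * 2
  have p1 := poin_nn (A := A) ha 1
  have p3 := poin_nn (A := A) ha 3
  have hK₁ : 0 ≤ K₁ := by positivity
  have hK₃ : 0 ≤ K₃ := by positivity
  refine ⟨Real.sqrt (18 * (K₁ + K₃)), Real.sqrt_nonneg _, fun T hT v hv => ?_⟩
  obtain ⟨φ, g⟩ := hC T hT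
  obtain ⟨μ, S⟩ := hS _ _ g
  have hH : ∀ s ∈ T.tris, dK s ≤ T.size := fun s hs => T.diam_le_size (mem_tris.1 hs)
  have hC0 := g.pos
  have lv := loc_lpVec v
  have ly₁ : LocInt Ω fun p => (k : ℝ) * v p 0 + v p 1 := ((lv 0).const_smul (k : ℝ)).add (lv 1)
  have ly₂ : LocInt Ω fun p => (k : ℝ) * v p 2 := (lv 2).const_smul (k : ℝ)
  have my₁ : MemH1 Ω fun p => (k : ℝ) * v p 0 + v p 1 := by
    simpa using (hv.1 0).comb (hv.1 1) k 1
  have my₂ : MemH1 Ω fun p => (k : ℝ) * v p 2 := by simpa using (hv.1 2).comb (hv.1 2) k 0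
  obtain ⟨G, lG, hG, nG⟩ := (hv.1 1).ex_grad
  obtain ⟨G₁, lG₁, hG₁, nG₁⟩ := my₁.ex_grad_div ly₁ hv.2.2
  obtain ⟨G₂, lG₂, hG₂, nG₂⟩ := my₂.ex_grad_div ly₂ hv.2.1
  have a1 := S.wE_sub_loc0 g ha hH 1 (lv 1) lG hG
  have a3 := S.wE_sub_loc1 g ha hH 3 (ly₁.div_fst) (ly₂.div_fst) lG₁ lG₂
    hG₁ hG₂
  set c : R2 → ℝ := fun x => avg0 (μ x) fun p => v p 1
  set d : R2 → R2 → ℝ := fun x w => pdot (avg0 (μ x) fun p => ((k : ℝ) * v p 0 + v p 1) / p.1,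
    avg0 (μ x) fun p => (k : ℝ) * v p 2 / p.1) (w - x)
  have lc : LocInt Ω (pw T.tris (loc0 c)) := loc_pw fun s => cont_loc0 c s
  have ld : LocInt Ω (pw T.tris (loc1 d)) := loc_pw fun s => cont_loc1 d s
  obtain ⟨B, hB⟩ := ex_bd_pw (Tr := T.tris) fun s => cont_loc0 c s
  obtain ⟨B', hB'⟩ := ex_bd_pw (Tr := T.tris) fun s => cont_loc1 d s
  obtain ⟨w, hw⟩ := ex_lp_mkB (k := k) hb lc.meas ld.meas hB hB'
  obtain ⟨R, hR, -⟩ := ex_curlRel (Ω := Ω) (k := k)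
  refine ⟨w, coe_confB hR ▸ mem_confB hb g hR hw, ?_⟩
  set s := h1Seminorm Ω fun p => v p 1
  set t₁ := h1TildeNorm Ω fun p => (k : ℝ) * v p 0 + v p 1
  set t₂ := h1TildeNorm Ω fun p => (k : ℝ) * v p 2
  have hs : 0 ≤ s := Real.sqrt_nonneg _
  have ht₁ : 0 ≤ t₁ := Real.sqrt_nonneg _
  have ht₂ : 0 ≤ t₂ := Real.sqrt_nonneg _
  have hh := T.size_nn
  have b1 : wE 1 (fun p => v p 1 - pw T.tris (loc0 c) p) Ω ≤
      ofReal (K₁ * T.size ^ 2 * s ^ 2) := by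
    refine (a1.trans (mul_le_mul' le_rfl nG)).trans_eq ?_
    rw [← ofReal_mul (by positivity), ← ofReal_mul (by positivity)]
    congr 1
    simp only [K₁, abs_of_pos hC0]; ring
  have b3 : wE 3 (fun p => etaOf k v p - pw T.tris (loc1 d) p) Ω ≤
      ofReal (K₃ * T.size ^ 2 * (t₁ ^ 2 + t₂ ^ 2)) := by
    refine (a3.trans (mul_le_mul' le_rfl ((wE_prod_le lG₁.meas.enorm).trans
      (add_le_add nG₁ nG₂)))).trans_eq ?_
    rw [← ofReal_add (by positivity) (by positivity), ← ofReal_mul (by positivity),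
      ← ofReal_mul (by positivity), ← ofReal_mul (by positivity)]
    congr 1
    simp only [K₃, abs_of_pos hC0]; ring
  have b : wE 1 (v - w : L2rVec Ω) Ω ≤ ofReal (2 * 3 ^ 2) *
      (wE 1 (fun p => v p 1 - pw T.tris (loc0 c) p) Ω +
        wE 3 (fun p => etaOf k v p - pw T.tris (loc1 d) p) Ω) := by
    refine wE_le_add (by norm_num) ((lv 1).meas.sub lc.meas).enorm.aemeasurable ?_
    filter_upwards [lp_ae_comb v w 1 (-1), hw] with p h1 h2 hp
    have h3 := h1 hp
    simp only [one_smul, neg_smul, ← sub_eq_add_neg] at h3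
    rw [h3, h2 hp, ← mkB_etaOf (k := k) (D.1.pos p hp) v]
    refine le_of_eq_of_le ?_ (norm_mkB_le (k := k) (fun p => v p 1 - pw T.tris (loc0 c) p)
      (fun p => etaOf k v p - pw T.tris (loc1 d) p) (D.1.pos p hp))
    rw [mkB_comb (c := 1) (d := -1) (u := fun p => v p 1 - pw T.tris (loc0 c) p)
      (η := fun p => etaOf k v p - pw T.tris (loc1 d) p) (u₁ := fun p => v p 1) (u₂ := pw T.tris (loc0 c))
      (η₁ := etaOf k v) (η₂ := pw T.tris (loc1 d)) (by simp [sub_eq_add_neg])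
      (by simp [sub_eq_add_neg])]
    simp [sub_eq_add_neg]
  have e := b.trans (mul_le_mul' le_rfl (add_le_add b1 b3))
  rw [← enorm_sq_lp, ← ofReal_add (by positivity) (by positivity),
    ← ofReal_mul (by norm_num), ← ofReal_norm, ← ofReal_pow (norm_nonneg _),
    ENNReal.ofReal_le_ofReal_iff (by positivity)] at e
  refine abs_le_of_sq_le_sq' (e.trans ?_) (by positivity) |>.2
  rw [mul_pow, mul_pow, Real.sq_sqrt (by positivity)]
  have q1 : s ^ 2 ≤ (s + t₂ + t₁) ^ 2 := by gcongr; linarith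
  have q3 : t₁ ^ 2 + t₂ ^ 2 ≤ (s + t₂ + t₁) ^ 2 := by nlinarith [mul_nonneg ht₁ ht₂]
  calc _ = 18 * T.size ^ 2 * (K₁ * s ^ 2 + K₃ * (t₁ ^ 2 + t₂ ^ 2)) := by ring
    _ ≤ 18 * T.size ^ 2 * (K₁ * (s + t₂ + t₁) ^ 2 + K₃ * (s + t₂ + t₁) ^ 2) := by gcongr
    _ = _ := by ring

lemma commutingProj_error {Ω : Set R2} {k : ℤ} (hΩ : IsMeridianDomain Ω) (hk : 1 ≤ |k|)
    (σ M : ℝ) : ∃ C : ℝ, ∀ T : Mesh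
    Ω, T.ShapeRegular σ → ∀ (Pg : L2r Ω →L[ℝ] L2r Ω) (Pc Pd : L2rVec Ω →L[ℝ] L2rVec Ω)
    (Po : L2r Ω →L[ℝ] L2r Ω), IsCommutingProj k T M Pg Pc Pd Po → ∀ v : L2rVec Ω, MemH1Diamond Ω k
    v → ‖v - Pc v‖ ≤ C * T.size * (h1Seminorm Ω (fun p => v p 1) + h1TildeNorm Ω (fun p => (k : ℝ) *
    v p 2) + h1TildeNorm Ω (fun p => (k : ℝ) * v p 0 + v p 1)) := by
  haveI : Fact _ := ⟨hΩ⟩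
  haveI : Fact _ := ⟨hk⟩
  by_cases hb : IsBounded Ω
  swap
  · exact ⟨0, fun T => absurd T.isBounded hb⟩
  obtain ⟨K, hK, h⟩ := ex_B_apx (k := k) hb σ
  refine ⟨(1 + M) * K, fun T hT Pg Pc Pd Po hP v hv => ?_⟩
  obtain ⟨w, hw, e⟩ := h T hT v hv
  have hM : 0 ≤ M := (norm_nonneg Pc).trans hP.norm_c
  calc ‖v - Pc v‖ = ‖(v - w) - Pc (v - w)‖ := by
        rw [map_sub, hP.proj_c.2 w hw]; congr 1; abel
    _ ≤ ‖v - w‖ + M * ‖v - w‖ := norm_sub_le_of_le le_rfl (Pc.le_of_opNorm_le hP.norm_c _)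
    _ = (1 + M) * ‖v - w‖ := by ring
    _ ≤ (1 + M) * _ := mul_le_mul_of_nonneg_left e (by linarith)
    _ = _ := by ring

end estimate

end AxiFEM
end

theorem theorem3p3 (Ω : Set (ℝ × ℝ)) (hΩ : AxiFEM.IsMeridianDomain Ω) (k : ℤ) (hk : 1 ≤ |k|)
    (σ : ℝ) :
    (∃ M : ℝ, ∀ T : AxiFEM.Mesh Ω, T.ShapeRegular σ →
      ∃ (Pg : AxiFEM.L2r Ω →L[ℝ] AxiFEM.L2r Ω) (Pc Pd : AxiFEM.L2rVec Ω →L[ℝ] AxiFEM.L2rVec Ω)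
        (Po : AxiFEM.L2r Ω →L[ℝ] AxiFEM.L2r Ω), AxiFEM.IsCommutingProj k T M Pg Pc Pd Po) ∧
    ∀ M : ℝ, ∃ C : ℝ, ∀ T : AxiFEM.Mesh Ω, T.ShapeRegular σ →
      ∀ (Pg : AxiFEM.L2r Ω →L[ℝ] AxiFEM.L2r Ω) (Pc Pd : AxiFEM.L2rVec Ω →L[ℝ] AxiFEM.L2rVec Ω)
        (Po : AxiFEM.L2r Ω →L[ℝ] AxiFEM.L2r Ω), AxiFEM.IsCommutingProj k T M Pg Pc Pd Po →
      ∀ v : AxiFEM.L2rVec Ω, AxiFEM.MemH1Diamond Ω k v →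
        ‖v - Pc v‖ ≤ C * T.size *
          (AxiFEM.h1Seminorm Ω (fun p => v p 1)
            + AxiFEM.h1TildeNorm Ω (fun p => (k : ℝ) * v p 2)
            + AxiFEM.h1TildeNorm Ω (fun p => (k : ℝ) * v p 0 + v p 1)) := by
  exact ⟨AxiFEM.exists_commutingProj hΩ hk σ, AxiFEM.commutingProj_error hΩ hk σ⟩
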